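/- **Conventions.** All 2-categories and 2-functors are strict; composites are written in the usual order, and $w\in\{\text{strict},\text{pseudo},\text{lax},\text{colax}\}$. A *$w$-cell* $p\Rightarrow_w q$ is an identity ($w$ strict), an invertible 2-cell ($w$ pseudo), a 2-cell $p\Rightarrow q$ ($w$ lax), or a 2-cell $q\Rightarrow p$ ($w$ colax). Finite powers are 2-categorical (universal for 1-cells and 2-cells). A *Lawvere 2-theory* is a 2-category $\mathbb T$ whose objects are the natural numbers, with an identity-on-objects functor $\theta:\mathbf F^{op}\to\mathbb T$, where $\mathbf F$ is the category of the finite sets $\{0,\dots,n-1\}$ and functions, such that the images of the $n$ functions $1\to n$ exhibit $n$ as the $n$-th power of $1$. A 1-cell is *inert* if it is in the image of $\theta$. Via the lexicographic bijection $m\times k\cong m\cdot k$, the object $m\cdot k$ is the power of $m$ rows of length $k$ and of $k$ columns of length $m$; for a cell $\beta:k\to l$ let $m\cdot\beta:m\cdot k\to m\cdot l$ apply $\beta$ to every row, and for a cell $\alpha:m\to n$ let $\alpha\cdot k:m\cdot k\to n\cdot k$ apply $\alpha$ to every column. An *$\mathcal F$-sketch* is a 2-category with a class of *tight* 1-cells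 containing identities and closed under composition, and a class of *specified* finite power cones (families $P\to X$ indexed by a finite set) with tight legs; a map of $\mathcal F$-sketches is a 2-functor preserving tight 1-cells and specified cones. A Lawvere 2-theory is an $\mathcal F$-sketch: tight means inert, and the specified cones are all power cones with inert legs such that a 1-cell into the vertex is inert as soon as its components are. The *semi-strict Gray tensor product* $\mathcal A\otimes_{s,w}\mathcal B$ has as objects the pairs $(a,b)$; its 1-cells and 2-cells are generated by those of $\mathcal A$ and $\mathcal B$ in each variable, functorially, and by $w$-cells $\Sigma_{f,g}:(f,1)(1,g)\Rightarrow_w(1,g)(f,1)$, which are compatible with composition in $f$ and in $g$, natural with respect to 2-cells in either variable, and identities if $f$ or $g$ is tight. Its tight 1-cells are generated by $(f,1)$ and $(1,g)$ with $f,g$ tight, and its specified cones are those of either factor with the other variable fixed. A *$w$-commutativity* on an $\mathcal F$-sketch $\mathcal S$ is a pseudomonoid structure $\mu:\mathcal S\otimes_{s,w}\mathcal S\to\mathcal S$, $u:1\to\mathcal S$ (that is, an object $u$), with associator and unitors satisfying the pentagon and triangle axioms; 2-cells between maps of $\mathcal F$-sketches are 2-natural transformations with tight components, and invertible means that the inverse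 also is one. A *magmal $w$-commutativity* consists of $\mu$, $u$ and the unitors only. Isomorphisms of (magmal) $w$-commutativities are those over $\mathrm{id}_{\mathcal S}$: pairs of invertible 2-cells $\mu\cong\mu'$, $u\cong u'$ compatible with the unitors (and associators). For $w$ strict or pseudo, a *symmetry* on a $w$-commutativity is a symmetric braiding on the pseudomonoid with respect to the exchange $\mathcal S\otimes_{s,w}\mathcal S\cong\mathcal S\otimes_{s,w}\mathcal S$, which exchanges the variables and sends $\Sigma_{f,g}$ to $\Sigma_{g,f}^{-1}$. A *coherent system of $w$-cells* on $\mathbb T$ is a family of $w$-cells, for all 1-cells $\alpha:m\to n$ and $\beta:k\to l$ of $\mathbb T$, $$\sigma_{\alpha\beta}:\ (\alpha\cdot l)\circ(m\cdot\beta)\ \Rightarrow_w\ (n\cdot\beta)\circ(\alpha\cdot k),$$ which are identities if $\alpha$ or $\beta$ is inert, are compatible with composition in $\alpha$ and in $\beta$ (the cell of a composite is the pasting of the two cells), and are natural with respect to 2-cells $\alpha\Rightarrow\alpha'$ and $\beta\Rightarrow\beta'$. For $w$ strict or pseudo it is *symmetric* if each $\sigma_{\alpha\beta}$ is inverse to the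 cell obtained from $\sigma_{\beta\alpha}$ by conjugation with the transpositions $m\cdot k\cong k\cdot m$ and $n\cdot l\cong l\cdot n$. For a 2-category $\mathcal C$ with chosen finite powers, $\mathsf{Mod}_w(\mathbb T,\mathcal C)$ is the 2-category whose objects are the 2-functors $\mathcal X:\mathbb T\to\mathcal C$ with $\mathcal X(n)=X^n$ the chosen power of $X=\mathcal X(1)$, and with inert 1-cells sent to the canonical maps between chosen powers; whose 1-cells are the $w$-natural transformations with component $f^n:X^n\to Y^n$ at $n$ (for some $f:X\to Y$), with structure $w$-cells $\mathcal Y(\alpha)f^m\Rightarrow_w f^n\mathcal X(\alpha)$ that are identities for $\alpha$ inert; and whose 2-cells are the modifications with component $c^n$ at $n$, for some 2-cell $c$ of $\mathcal C$. It has chosen finite powers created by evaluation at $1$, denoted $U_{\mathcal C}:\mathsf{Mod}_w(\mathbb T,\mathcal C)\to\mathcal C$, and it is functorial in $\mathcal C$ with respect to 2-functors preserving finite powers (up to isomorphism). A *simultaneous section* is a family of 2-functors $$L_{\mathcal C}:\mathsf{Mod}_w(\mathbb T,\mathcal C)\to\mathsf{Mod}_w(\mathbb T,\mathsf{Mod}_w(\mathbb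 T,\mathcal C)),$$ natural in $\mathcal C$, with $(U_{\mathcal C})_*\circ L_{\mathcal C}=\mathrm{id}$ and $U_{\mathsf{Mod}_w(\mathbb T,\mathcal C)}\circ L_{\mathcal C}=\mathrm{id}$. **Theorem.** Let $\mathbb T$ be a Lawvere 2-theory and $w\in\{\text{strict},\text{pseudo},\text{lax},\text{colax}\}$. The following are in bijection: 1. $w$-commutativities on $\mathbb T$, up to isomorphism over $\mathrm{id}_{\mathbb T}$; 2. magmal $w$-commutativities on $\mathbb T$, up to isomorphism over $\mathrm{id}_{\mathbb T}$; 3. coherent systems $(\sigma_{\alpha\beta})$ of $w$-cells on $\mathbb T$; 4. simultaneous sections of the two forgetful transformations $(U_-)_*,\,U_{\mathsf{Mod}_w(\mathbb T,-)}:\mathsf{Mod}_w(\mathbb T,\mathsf{Mod}_w(\mathbb T,-))\to\mathsf{Mod}_w(\mathbb T,-)$, natural in the target. The map from 1 to 2 forgets the associator. The map from 2 to 3 sends $(\mu,u)$ to the system $\sigma$ for which there are inert isomorphisms $m\cdot n\cong\mu(m,n)$ that identify the actions of $\mu$ on cells in one variable with $\alpha\mapsto\alpha\cdot n$ and $\beta\mapsto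 m\cdot\beta$, and $\mu(\Sigma_{\alpha\beta})$ with $\sigma_{\alpha\beta}$; every coherent system arises in this way from a $w$-commutativity with $u=1$ and $\mu(m,n)=m\cdot n$. The map from 3 to 4 sends $\sigma$ to the section $L$ such that, for every model $\mathcal X$ and all $\alpha,\beta$, the structure cell at $\alpha$ of the $w$-homomorphism $L(\mathcal X)(\beta):\mathcal X^k\to\mathcal X^l$ is $\mathcal X(\sigma_{\alpha\beta})$, up to the canonical isomorphisms $(X^k)^m\cong X^{m\cdot k}$ and $(X^l)^n\cong X^{n\cdot l}$. Moreover, if $w$ is strict or pseudo, a $w$-commutativity on $\mathbb T$ admits at most one symmetry, and it admits one if and only if the corresponding coherent system is symmetric. -/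

import Mathlib

open CategoryTheory

namespace TwoDim

universe u v w u₁ v₁ w₁ u₂ v₂ w₂ u₃ v₃ w₃

/-- Strict 2-categories. The 2-cells from `X` to `Y` are bundled: each cell has a source and a
target 1-cell, so that all the laws of a strict 2-category are plain equations. The operations are
the identity cells, vertical composition `vc` (of cells with matching boundary) and horizontal
composition `hc`, written in diagrammatic order. -/
class TwoCat (C : Type u) extends Category.{v} C where
  Cell : C → C → Type w
  src : ∀ {X Y : C}, Cell X Y → (X ⟶ Y)
  tgt : ∀ {X Y : C}, Cell X Y → (X ⟶ Y)
  one : ∀ {X Y : C}, (X ⟶ Y) → Cell X Y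
  vc : ∀ {X Y : C} (a b : Cell X Y), tgt a = src b → Cell X Y
  hc : ∀ {X Y Z : C}, Cell X Y → Cell Y Z → Cell X Z
  src_one : ∀ {X Y : C} (f : X ⟶ Y), src (one f) = f
  tgt_one : ∀ {X Y : C} (f : X ⟶ Y), tgt (one f) = f
  src_vc : ∀ {X Y : C} (a b : Cell X Y) (h : tgt a = src b), src (vc a b h) = src a
  tgt_vc : ∀ {X Y : C} (a b : Cell X Y) (h : tgt a = src b), tgt (vc a b h) = tgt b
  src_hc : ∀ {X Y Z : C} (a : Cell X Y) (b : Cell Y Z), src (hc a b) = src a ≫ src b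
  tgt_hc : ∀ {X Y Z : C} (a : Cell X Y) (b : Cell Y Z), tgt (hc a b) = tgt a ≫ tgt b
  one_vc : ∀ {X Y : C} (a : Cell X Y), vc (one (src a)) a (tgt_one _) = a
  vc_one : ∀ {X Y : C} (a : Cell X Y), vc a (one (tgt a)) (src_one _).symm = a
  vc_assoc : ∀ {X Y : C} (a b c : Cell X Y) (h : tgt a = src b) (k : tgt b = src c),
    vc (vc a b h) c ((tgt_vc a b h).trans k) = vc a (vc b c k) (h.trans (src_vc b c k).symm)
  one_comp : ∀ {X Y Z : C} (f : X ⟶ Y) (g : Y ⟶ Z), one (f ≫ g) = hc (one f) (one g)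
  id_hc : ∀ {X Y : C} (a : Cell X Y), hc (one (𝟙 X)) a = a
  hc_id : ∀ {X Y : C} (a : Cell X Y), hc a (one (𝟙 Y)) = a
  hc_assoc : ∀ {W X Y Z : C} (a : Cell W X) (b : Cell X Y) (c : Cell Y Z),
    hc (hc a b) c = hc a (hc b c)
  interchange : ∀ {X Y Z : C} (a a' : Cell X Y) (b b' : Cell Y Z)
    (h : tgt a = src a') (k : tgt b = src b'),
    hc (vc a a' h) (vc b b' k) =
      vc (hc a b) (hc a' b') (by rw [tgt_hc, src_hc, h, k])

open TwoCat

attribute [simp] src_one tgt_one src_vc tgt_vc src_hc tgt_hc one_vc vc_one id_hc hc_id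

/-- Strict 2-functors. -/
@[ext]
structure TwoFunctor (C : Type u₁) [TwoCat.{u₁, v₁, w₁} C] (D : Type u₂) [TwoCat.{u₂, v₂, w₂} D]
    extends C ⥤ D where
  mapCell : ∀ {X Y : C}, Cell X Y → Cell (obj X) (obj Y)
  src_mapCell : ∀ {X Y : C} (a : Cell X Y), src (mapCell a) = map (src a)
  tgt_mapCell : ∀ {X Y : C} (a : Cell X Y), tgt (mapCell a) = map (tgt a)
  mapCell_one : ∀ {X Y : C} (f : X ⟶ Y), mapCell (one f) = one (map f)
  mapCell_vc : ∀ {X Y : C} (a b : Cell X Y) (h : tgt a = src b),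
    mapCell (vc a b h) = vc (mapCell a) (mapCell b) (by rw [src_mapCell, tgt_mapCell, h])
  mapCell_hc : ∀ {X Y Z : C} (a : Cell X Y) (b : Cell Y Z),
    mapCell (hc a b) = hc (mapCell a) (mapCell b)

attribute [simp] TwoFunctor.src_mapCell TwoFunctor.tgt_mapCell

namespace TwoFunctor

variable {C : Type u₁} [TwoCat.{u₁, v₁, w₁} C] {D : Type u₂} [TwoCat.{u₂, v₂, w₂} D]
  {E : Type u₃} [TwoCat.{u₃, v₃, w₃} E]

variable (C) in
/-- The identity 2-functor. -/
def id : TwoFunctor C C where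
  toFunctor := 𝟭 C
  mapCell a := a
  src_mapCell _ := rfl
  tgt_mapCell _ := rfl
  mapCell_one _ := rfl
  mapCell_vc _ _ _ := rfl
  mapCell_hc _ _ := rfl

/-- Composition of 2-functors, in diagrammatic order. -/
def comp (F : TwoFunctor C D) (G : TwoFunctor D E) : TwoFunctor C E where
  toFunctor := F.toFunctor ⋙ G.toFunctor
  mapCell a := G.mapCell (F.mapCell a)
  src_mapCell a := by simp
  tgt_mapCell a := by simp
  mapCell_one f := by simp [mapCell_one]
  mapCell_vc a b h := by simp [mapCell_vc]
  mapCell_hc a b := by simp [mapCell_hc]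

end TwoFunctor

/-- The four weaknesses of homomorphisms and of Gray tensor products. -/
inductive Weakness
  | strict
  | pseudo
  | lax
  | colax

section

variable {C : Type u} [TwoCat.{u, v, w} C]

/-- An invertible 2-cell. -/
def IsInvertible {X Y : C} (a : Cell X Y) : Prop :=
  ∃ (b : Cell X Y) (h : tgt a = src b) (k : tgt b = src a),
    vc a b h = one (src a) ∧ vc b a k = one (src b)

/-- The 2-cell `b` is inverse to `a`. -/
def IsInverse {X Y : C} (a b : Cell X Y) : Prop :=
  ∃ (h : tgt a = src b) (k : tgt b = src a),
    vc a b h = one (src a) ∧ vc b a k = one (src b)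

/-- `x`, or `y` if the weakness is `colax`. -/
def pick {α : Sort*} : Weakness → α → α → α
  | .strict, x, _ => x
  | .pseudo, x, _ => x
  | .lax, x, _ => x
  | .colax, _, y => y

/-- The source of a cell, or its target if the weakness is `colax`. -/
def osrc (z : Weakness) {X Y : C} (a : Cell X Y) : X ⟶ Y := pick z (src a) (tgt a)

/-- The target of a cell, or its source if the weakness is `colax`. -/
def otgt (z : Weakness) {X Y : C} (a : Cell X Y) : X ⟶ Y := pick z (tgt a) (src a)

/-- Vertical composition from `osrc` to `otgt`, that is, in reverse order if the weakness is
`colax`. -/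
def ovc : ∀ (z : Weakness) {X Y : C} (a b : Cell X Y), otgt z a = osrc z b → Cell X Y
  | .strict, _, _, a, b, h => vc a b h
  | .pseudo, _, _, a, b, h => vc a b h
  | .lax, _, _, a, b, h => vc a b h
  | .colax, _, _, a, b, h => vc b a h.symm

/-- `z`-cells: identities, invertible cells, or arbitrary cells (for `colax`, to be read in the
reverse direction). -/
def IsWCell : Weakness → ∀ {X Y : C}, Cell X Y → Prop
  | .strict, _, _, a => a = one (src a)
  | .pseudo, _, _, a => IsInvertible a
  | .lax, _, _, _ => True
  | .colax, _, _, _ => True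

section lemmas

variable (z : Weakness) {W X Y Z : C}

@[simp] theorem osrc_one (f : X ⟶ Y) : osrc z (one f) = f := by cases z <;> simp [osrc, pick]
@[simp] theorem otgt_one (f : X ⟶ Y) : otgt z (one f) = f := by cases z <;> simp [otgt, pick]
@[simp] theorem osrc_hc (a : Cell X Y) (b : Cell Y Z) :
    osrc z (hc a b) = osrc z a ≫ osrc z b := by cases z <;> simp [osrc, pick]
@[simp] theorem otgt_hc (a : Cell X Y) (b : Cell Y Z) :
    otgt z (hc a b) = otgt z a ≫ otgt z b := by cases z <;> simp [otgt, pick]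
@[simp] theorem osrc_ovc (a b : Cell X Y) (h : otgt z a = osrc z b) :
    osrc z (ovc z a b h) = osrc z a := by
  cases z
  · exact src_vc _ _ _
  · exact src_vc _ _ _
  · exact src_vc _ _ _
  · exact tgt_vc _ _ _
@[simp] theorem otgt_ovc (a b : Cell X Y) (h : otgt z a = osrc z b) :
    otgt z (ovc z a b h) = otgt z b := by
  cases z
  · exact tgt_vc _ _ _
  · exact tgt_vc _ _ _
  · exact tgt_vc _ _ _
  · exact src_vc _ _ _

theorem one_ovc (a : Cell X Y) {f : X ⟶ Y} (h : otgt z (one f) = osrc z a) :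
    ovc z (one f) a h = a := by
  rw [otgt_one] at h; subst h
  cases z <;> simp [ovc, osrc, pick]

theorem ovc_one (a : Cell X Y) {f : X ⟶ Y} (h : otgt z a = osrc z (one f)) :
    ovc z a (one f) h = a := by
  rw [osrc_one] at h; subst h
  cases z <;> simp [ovc, otgt, pick]

theorem ovc_assoc (a b c : Cell X Y) (h : otgt z a = osrc z b) (k : otgt z b = osrc z c) :
    ovc z (ovc z a b h) c ((otgt_ovc z a b h).trans k) =
      ovc z a (ovc z b c k) (h.trans (osrc_ovc z b c k).symm) := by
  cases z
  · exact vc_assoc a b c h k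
  · exact vc_assoc a b c h k
  · exact vc_assoc a b c h k
  · exact (vc_assoc c b a k.symm h.symm).symm

theorem ointerchange (a a' : Cell X Y) (b b' : Cell Y Z)
    (h : otgt z a = osrc z a') (k : otgt z b = osrc z b') :
    hc (ovc z a a' h) (ovc z b b' k) =
      ovc z (hc a b) (hc a' b') (by rw [otgt_hc, osrc_hc, h, k]) := by
  cases z
  · exact interchange a a' b b' h k
  · exact interchange a a' b b' h k
  · exact interchange a a' b b' h k
  · exact interchange a' a b' b h.symm k.symm

theorem ovc_congr {a a' b b' : Cell X Y} (h : otgt z a = osrc z b) (ha : a = a') (hb : b = b') :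
    ovc z a b h = ovc z a' b' (by rw [← ha, ← hb, h]) := by subst ha hb; rfl

theorem hc_slide (a : Cell X Y) (b : Cell Y Z) :
    ovc z (hc (one (osrc z a)) b) (hc a (one (otgt z b))) (by simp) = hc a b := by
  rw [← ointerchange z (one (osrc z a)) a b (one (otgt z b)) (by simp) (by simp), one_ovc, ovc_one]

theorem hc_slide' (a : Cell X Y) (b : Cell Y Z) :
    ovc z (hc a (one (osrc z b))) (hc (one (otgt z a)) b) (by simp) = hc a b := by
  rw [← ointerchange z a (one (otgt z a)) (one (osrc z b)) b (by simp) (by simp), one_ovc, ovc_one]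

theorem hc_ovc (f : W ⟶ X) (a b : Cell X Y) (h : otgt z a = osrc z b) :
    hc (one f) (ovc z a b h) = ovc z (hc (one f) a) (hc (one f) b) (by simp [h]) := by
  rw [← ointerchange z (one f) (one f) a b (by simp) h, one_ovc]

theorem ovc_hc (a b : Cell X Y) (f : Y ⟶ Z) (h : otgt z a = osrc z b) :
    hc (ovc z a b h) (one f) = ovc z (hc a (one f)) (hc b (one f)) (by simp [h]) := by
  rw [← ointerchange z a b (one f) (one f) h (by simp), one_ovc]

/-- Four composable cells may be rebracketed around a new factorisation of the middle pair. -/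
theorem ovc_four {a b c d b' c' : Cell X Y} (h₁ : otgt z a = osrc z b) (h₂ : otgt z c = osrc z d)
    (h₃ : otgt z b = osrc z c) (h₃' : otgt z b' = osrc z c')
    (e : ovc z b c h₃ = ovc z b' c' h₃') :
    ovc z (ovc z a b h₁) (ovc z c d h₂) (by simp [h₃]) =
      ovc z (ovc z a b' (by
          rw [h₁, ← osrc_ovc z b c h₃, e, osrc_ovc])) (ovc z c' d (by
          rw [← h₂, ← otgt_ovc z b c h₃, e, otgt_ovc])) (by simp [h₃']) := by
  have k₁ : otgt z a = osrc z b' := by rw [h₁, ← osrc_ovc z b c h₃, e, osrc_ovc]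
  have k₂ : otgt z c' = osrc z d := by rw [← h₂, ← otgt_ovc z b c h₃, e, otgt_ovc]
  rw [ovc_assoc z a b (ovc z c d h₂) h₁ (by simp [h₃]), ovc_assoc z a b' (ovc z c' d k₂) k₁ (by simp [h₃'])]
  refine ovc_congr z _ rfl ?_
  rw [← ovc_assoc z b c d h₃ h₂, ← ovc_assoc z b' c' d h₃' k₂]
  exact ovc_congr z _ e rfl

theorem isWCell_one (f : X ⟶ Y) : IsWCell z (one f) := by
  cases z
  · simp [IsWCell]
  · refine ⟨one f, by simp, by simp, ?_, ?_⟩ <;> simpa using one_vc (one f)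
  · trivial
  · trivial

theorem isInvertible_hc {a : Cell X Y} {b : Cell Y Z} (ha : IsInvertible a) (hb : IsInvertible b) :
    IsInvertible (hc a b) := by
  obtain ⟨a', h, k, e₁, e₂⟩ := ha
  obtain ⟨b', h', k', e₁', e₂'⟩ := hb
  refine ⟨hc a' b', by simp [h, h'], by simp [k, k'], ?_, ?_⟩
  · rw [← interchange a a' b b' h h', e₁, e₁', src_hc, one_comp]
  · rw [← interchange a' a b' b k k', e₂, e₂', src_hc, one_comp]

theorem isInvertible_vc {a b : Cell X Y} (h : tgt a = src b) (ha : IsInvertible a)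
    (hb : IsInvertible b) : IsInvertible (vc a b h) := by
  obtain ⟨a', h₁, k₁, e₁, e₁'⟩ := ha
  obtain ⟨b', h₂, k₂, e₂, e₂'⟩ := hb
  have hh : tgt b' = src a' := by rw [k₂, ← h, h₁]
  refine ⟨vc b' a' hh, by simp [h₂], by simp [k₁], ?_, ?_⟩
  · have := ovc_four Weakness.lax (a := a) (b := b) (c := b') (d := a')
      (b' := one (src b)) (c' := one (src b)) h hh h₂ (by simp) (by
        refine e₂.trans ?_
        exact (one_ovc .lax _ _).symm)
    refine this.trans ?_
    rw [src_vc, ← e₁]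
    exact ovc_congr .lax _ (ovc_one .lax _ _) (one_ovc .lax _ _)
  · have := ovc_four Weakness.lax (a := b') (b := a') (c := a) (d := b)
      (b' := one (src a')) (c' := one (src a')) hh h k₁ (by simp) (by
        refine e₁'.trans ?_
        exact (one_ovc .lax _ _).symm)
    refine this.trans ?_
    rw [src_vc, ← e₂']
    exact ovc_congr .lax _ (ovc_one .lax _ _) (one_ovc .lax _ _)

theorem isWCell_hc {a : Cell X Y} {b : Cell Y Z} (ha : IsWCell z a) (hb : IsWCell z b) :
    IsWCell z (hc a b) := by
  cases z
  · simp only [IsWCell] at ha hb ⊢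
    rw [src_hc, one_comp, ← ha, ← hb]
  · exact isInvertible_hc ha hb
  · trivial
  · trivial

theorem isWCell_ovc {a b : Cell X Y} (h : otgt z a = osrc z b) (ha : IsWCell z a)
    (hb : IsWCell z b) : IsWCell z (ovc z a b h) := by
  cases z
  · simp only [IsWCell] at ha hb ⊢
    have e : src a = src b := by rw [← tgt_one (src a), ← ha]; exact h
    have : ovc .strict a b h = a := by
      have hb' : b = one (tgt a) := by rw [hb]; congr 1; exact h.symm
      subst hb'
      exact vc_one a
    rw [this, ← ha]
  · exact isInvertible_vc h ha hb
  · trivial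
  · trivial

end lemmas


/-! ### Finite powers -/

/-- The cone `π` exhibits `P` as the `n`-th power of `X`, for 1-cells and for 2-cells. -/
def IsPower {n : ℕ} {P X : C} (π : Fin n → (P ⟶ X)) : Prop :=
  ∀ Z : C, Function.Bijective (fun (f : Z ⟶ P) (i : Fin n) => f ≫ π i) ∧
    Function.Bijective (fun (s : Cell Z P) (i : Fin n) => hc s (one (π i)))

namespace IsPower

variable {n : ℕ} {P X Z : C} {π : Fin n → (P ⟶ X)}

/-- The 1-cell into a power with given components. -/
noncomputable def lift (hπ : IsPower π) (f : Fin n → (Z ⟶ X)) : Z ⟶ P := ((hπ Z).1.2 f).choose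

/-- The 2-cell into a power with given components. -/
noncomputable def liftCell (hπ : IsPower π) (s : Fin n → Cell Z X) : Cell Z P := ((hπ Z).2.2 s).choose

theorem lift_fac (hπ : IsPower π) (f : Fin n → (Z ⟶ X)) (i : Fin n) : hπ.lift f ≫ π i = f i :=
  congrFun ((hπ Z).1.2 f).choose_spec i

theorem liftCell_fac (hπ : IsPower π) (s : Fin n → Cell Z X) (i : Fin n) :
    hc (hπ.liftCell s) (one (π i)) = s i :=
  congrFun ((hπ Z).2.2 s).choose_spec i

theorem hom_ext (hπ : IsPower π) {f g : Z ⟶ P} (h : ∀ i, f ≫ π i = g ≫ π i) : f = g :=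
  (hπ Z).1.1 (funext h)

theorem cell_ext (hπ : IsPower π) {s t : Cell Z P} (h : ∀ i, hc s (one (π i)) = hc t (one (π i))) : s = t :=
  (hπ Z).2.1 (funext h)

end IsPower

theorem IsPower.comp_lift {n : ℕ} {P X Y Z : C} {π : Fin n → (P ⟶ X)} (hπ : IsPower π)
    (g : Y ⟶ Z) (f : Fin n → (Z ⟶ X)) : g ≫ hπ.lift f = hπ.lift (fun i => g ≫ f i) :=
  hπ.hom_ext fun i => by simp [lift_fac]

theorem IsPower.osrc_liftCell {n : ℕ} {P X Z : C} {π : Fin n → (P ⟶ X)} (hπ : IsPower π)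
    (z : Weakness) (s : Fin n → Cell Z X) :
    osrc z (hπ.liftCell s) = hπ.lift fun i => osrc z (s i) :=
  hπ.hom_ext fun i => by
    have := congrArg (osrc z) (hπ.liftCell_fac s i)
    simpa [lift_fac] using this

theorem IsPower.otgt_liftCell {n : ℕ} {P X Z : C} {π : Fin n → (P ⟶ X)} (hπ : IsPower π)
    (z : Weakness) (s : Fin n → Cell Z X) :
    otgt z (hπ.liftCell s) = hπ.lift fun i => otgt z (s i) :=
  hπ.hom_ext fun i => by
    have := congrArg (otgt z) (hπ.liftCell_fac s i)
    simpa [lift_fac] using this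

theorem hc_vc_one {X Y Z : C} {a b : Cell X Y} (h : tgt a = src b) (f : Y ⟶ Z) :
    hc (vc a b h) (one f) = vc (hc a (one f)) (hc b (one f)) (by simp [h]) :=
  ovc_hc .lax a b f h

theorem IsPower.isWCell {n : ℕ} {P X Z : C} {π : Fin n → (P ⟶ X)} (hπ : IsPower π)
    (z : Weakness) (a : Cell Z P) (h : ∀ i, IsWCell z (hc a (one (π i)))) : IsWCell z a := by
  cases z
  · refine hπ.cell_ext fun i => ?_
    have := h i
    simp only [IsWCell] at this
    rw [this, ← one_comp]
    simp
  · choose b hb kb e₁ e₂ using h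
    have s : src (hπ.liftCell b) = tgt a := hπ.hom_ext fun i => by
      have := congrArg src (hπ.liftCell_fac b i)
      simp only [src_hc, src_one] at this
      rw [this, ← hb i]
      simp
    have t : tgt (hπ.liftCell b) = src a := hπ.hom_ext fun i => by
      have := congrArg tgt (hπ.liftCell_fac b i)
      simp only [tgt_hc, tgt_one] at this
      rw [this, kb i]
      simp
    refine ⟨hπ.liftCell b, s.symm, t, hπ.cell_ext fun i => ?_, hπ.cell_ext fun i => ?_⟩
    · rw [hc_vc_one]
      refine (ovc_congr .lax _ rfl (hπ.liftCell_fac b i)).trans ((e₁ i).trans ?_)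
      rw [src_hc, one_comp, src_one]
    · rw [hc_vc_one]
      refine (ovc_congr .lax _ (hπ.liftCell_fac b i) rfl).trans ((e₂ i).trans ?_)
      rw [← hb i, s, ← one_comp]; simp
  · trivial
  · trivial

end

/-- A choice of finite powers. -/
class ChosenPowers (C : Type u) [TwoCat.{u, v, w} C] where
  pow : C → ℕ → C
  proj : ∀ (X : C) (n : ℕ), Fin n → (pow X n ⟶ X)
  isPower : ∀ (X : C) (n : ℕ), IsPower (proj X n)

open ChosenPowers

section

variable {C : Type u} [TwoCat.{u, v, w} C] [ChosenPowers C]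

/-- The canonical map of powers induced by a function of finite sets. -/
noncomputable def reindex (X : C) {m n : ℕ} (φ : Fin n → Fin m) : pow X m ⟶ pow X n :=
  (isPower X n).lift fun i => proj X m (φ i)

/-- The `n`-th power of a 1-cell. -/
noncomputable def powMap (n : ℕ) {X Y : C} (f : X ⟶ Y) : pow X n ⟶ pow Y n :=
  (isPower Y n).lift fun i => proj X n i ≫ f

/-- The `n`-th power of a 2-cell. -/
noncomputable def powCell (n : ℕ) {X Y : C} (s : Cell X Y) : Cell (pow X n) (pow Y n) :=
  (isPower Y n).liftCell fun i => hc (one (proj X n i)) s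

variable {X Y Z : C} (n : ℕ)

@[simp] theorem reindex_proj {m n : ℕ} (φ : Fin n → Fin m) (i : Fin n) :
    reindex X φ ≫ proj X n i = proj X m (φ i) := IsPower.lift_fac _ _ _

@[simp] theorem powMap_proj (f : X ⟶ Y) (i : Fin n) :
    powMap n f ≫ proj Y n i = proj X n i ≫ f := IsPower.lift_fac _ _ _

@[simp] theorem powCell_proj (s : Cell X Y) (i : Fin n) :
    hc (powCell n s) (one (proj Y n i)) = hc (one (proj X n i)) s := IsPower.liftCell_fac _ _ _

@[simp] theorem reindex_proj_comp {m n : ℕ} (φ : Fin n → Fin m) (i : Fin n) (f : X ⟶ Z) :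
    reindex X φ ≫ proj X n i ≫ f = proj X m (φ i) ≫ f := by
  rw [← Category.assoc, reindex_proj]

@[simp] theorem powMap_proj_comp (f : X ⟶ Y) (i : Fin n) (g : Y ⟶ Z) :
    powMap n f ≫ proj Y n i ≫ g = proj X n i ≫ f ≫ g := by
  rw [← Category.assoc, powMap_proj, Category.assoc]

theorem pow_hom_ext {f g : Z ⟶ pow X n} (h : ∀ i, f ≫ proj X n i = g ≫ proj X n i) : f = g :=
  (isPower X n).hom_ext h

theorem pow_cell_ext {s t : Cell Z (pow X n)}
    (h : ∀ i, hc s (one (proj X n i)) = hc t (one (proj X n i))) : s = t :=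
  (isPower X n).cell_ext h

@[simp] theorem powMap_id : powMap n (𝟙 X) = 𝟙 _ := pow_hom_ext n fun i => by simp

theorem powMap_comp (f : X ⟶ Y) (g : Y ⟶ Z) : powMap n (f ≫ g) = powMap n f ≫ powMap n g :=
  pow_hom_ext n fun i => by simp

theorem powMap_reindex {m n : ℕ} (f : X ⟶ Y) (φ : Fin n → Fin m) :
    powMap m f ≫ reindex Y φ = reindex X φ ≫ powMap n f :=
  pow_hom_ext n fun i => by simp

@[simp] theorem osrc_powCell (z : Weakness) (s : Cell X Y) :
    osrc z (powCell n s) = powMap n (osrc z s) :=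
  pow_hom_ext n fun i => by
    have := congrArg (osrc z) (powCell_proj n s i)
    simp only [osrc_hc, osrc_one] at this
    rw [this, powMap_proj]

@[simp] theorem otgt_powCell (z : Weakness) (s : Cell X Y) :
    otgt z (powCell n s) = powMap n (otgt z s) :=
  pow_hom_ext n fun i => by
    have := congrArg (otgt z) (powCell_proj n s i)
    simp only [otgt_hc, otgt_one] at this
    rw [this, powMap_proj]

theorem powCell_one (f : X ⟶ Y) : powCell n (one f) = one (powMap n f) :=
  pow_cell_ext n fun i => by rw [powCell_proj, ← one_comp, ← one_comp, powMap_proj]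

theorem powCell_hc (s : Cell X Y) (t : Cell Y Z) :
    powCell n (hc s t) = hc (powCell n s) (powCell n t) :=
  pow_cell_ext n fun i => by
    rw [powCell_proj, hc_assoc, powCell_proj, ← hc_assoc, ← hc_assoc, powCell_proj]

theorem powCell_ovc (z : Weakness) (s t : Cell X Y) (h : otgt z s = osrc z t) :
    powCell n (ovc z s t h) = ovc z (powCell n s) (powCell n t) (by simp [h]) :=
  pow_cell_ext n fun i => by
    rw [powCell_proj, ovc_hc, hc_ovc]
    exact ovc_congr z _ (powCell_proj n s i).symm (powCell_proj n t i).symm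

/-- Powers of a power cone form a power cone. -/
theorem IsPower.powMap {k : ℕ} {P : C} {π : Fin k → (P ⟶ X)} (hπ : IsPower π) :
    IsPower (fun i => TwoDim.powMap n (π i)) := by
  intro Z
  refine ⟨⟨fun f g h => ?_, fun f => ?_⟩, ⟨fun s t h => ?_, fun s => ?_⟩⟩
  · refine pow_hom_ext n fun j => hπ.hom_ext fun i => ?_
    have := congrArg (· ≫ proj X n j) (congrFun h i)
    simpa using this
  · refine ⟨(isPower P n).lift fun j => hπ.lift fun i => f i ≫ proj X n j, funext fun i => ?_⟩
    refine pow_hom_ext n fun j => ?_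
    simp only [Category.assoc, powMap_proj]
    rw [← Category.assoc, IsPower.lift_fac, IsPower.lift_fac]
  · refine pow_cell_ext n fun j => hπ.cell_ext fun i => ?_
    have := congrArg (fun c => hc c (one (proj X n j))) (congrFun h i)
    simp only [hc_assoc, ← one_comp, powMap_proj] at this ⊢
    exact this
  · refine ⟨(isPower P n).liftCell fun j => hπ.liftCell fun i => hc (s i) (one (proj X n j)),
      funext fun i => ?_⟩
    refine pow_cell_ext n fun j => ?_
    simp only [hc_assoc, ← one_comp, powMap_proj]
    rw [one_comp, ← hc_assoc, IsPower.liftCell_fac, IsPower.liftCell_fac]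

end


section strictBicategory

open Bicategory

/-- The 2-cells of a bicategory, each together with its source and target. -/
structure BicatCell {B : Type u} [Bicategory.{w, v} B] (X Y : B) where
  src : X ⟶ Y
  tgt : X ⟶ Y
  hom : src ⟶ tgt

namespace BicatCell

variable {B : Type u} [Bicategory.{w, v} B]

theorem eq_of {X Y : B} {f g f' g' : X ⟶ Y} (s : f ⟶ g) (s' : f' ⟶ g') (h : f = f') (k : g = g')
    (e : s ≫ eqToHom k = eqToHom h ≫ s') : (⟨f, g, s⟩ : BicatCell X Y) = ⟨f', g', s'⟩ := by
  subst h k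
  simp only [eqToHom_refl, Category.comp_id, Category.id_comp] at e
  rw [e]

/-- A strict bicategory is a strict 2-category. -/
@[reducible] def ofStrict [Strict B] : TwoCat.{u, v, max v w} B where
  toCategory := StrictBicategory.category B
  Cell X Y := BicatCell X Y
  src := BicatCell.src
  tgt := BicatCell.tgt
  one f := ⟨f, f, 𝟙 f⟩
  vc a b h := ⟨a.src, b.tgt, a.hom ≫ eqToHom h ≫ b.hom⟩
  hc a b := ⟨a.src ≫ b.src, a.tgt ≫ b.tgt, a.hom ▷ b.src ≫ a.tgt ◁ b.hom⟩
  src_one _ := rfl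
  tgt_one _ := rfl
  src_vc _ _ _ := rfl
  tgt_vc _ _ _ := rfl
  src_hc _ _ := rfl
  tgt_hc _ _ := rfl
  one_vc a := by simp
  vc_one a := by simp
  vc_assoc a b c h k := by simp
  one_comp f g := by simp
  id_hc := by
    rintro X Y ⟨f, g, s⟩
    refine eq_of _ _ (Strict.id_comp f) (Strict.id_comp g) ?_
    simp [Strict.leftUnitor_eqToIso, id_whiskerLeft]
  hc_id := by
    rintro X Y ⟨f, g, s⟩
    refine eq_of _ _ (Strict.comp_id f) (Strict.comp_id g) ?_
    simp [Strict.rightUnitor_eqToIso, whiskerRight_id]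
  hc_assoc := by
    rintro W X Y Z ⟨f, f', s⟩ ⟨g, g', t⟩ ⟨h, h', r⟩
    refine eq_of _ _ (Strict.assoc f g h) (Strict.assoc f' g' h') ?_
    simp [Strict.associator_eqToIso]
  interchange := by
    rintro X Y Z ⟨f, f', s⟩ ⟨_, f'', s'⟩ ⟨g, g', t⟩ ⟨_, g'', t'⟩ h k
    dsimp only at h k
    subst h k
    refine eq_of _ _ rfl rfl ?_
    simp [whisker_exchange_assoc]

end BicatCell

end strictBicategory


/-! ### Lawvere 2-theories -/

/-- The objects of a Lawvere 2-theory: the natural numbers. -/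
structure Arity : Type where
  card : ℕ

/-- A (discrete) Lawvere 2-theory: a strict 2-category whose objects are the natural numbers,
with an identity-on-objects functor `θ` from the opposite of the category of finite sets
`Fin n` and functions, which preserves finite powers: `n` is the `n`-th power of `1`. -/
structure LawvereTwoTheory where
  twoCat : TwoCat.{0, v, w} Arity
  θ : ∀ {m n : ℕ}, (Fin n → Fin m) → (Arity.mk m ⟶ Arity.mk n)
  θ_id : ∀ n : ℕ, θ (fun i : Fin n => i) = 𝟙 (Arity.mk n)
  θ_comp : ∀ {l m n : ℕ} (φ : Fin m → Fin l) (ψ : Fin n → Fin m),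
    θ (fun i => φ (ψ i)) = θ φ ≫ θ ψ
  isPower : ∀ n : ℕ, IsPower fun i : Fin n => θ fun _ : Fin 1 => i

namespace LawvereTwoTheory

/-- The type of objects of `T`. -/
def Ob (_ : LawvereTwoTheory.{v, w}) : Type := Arity

variable (T : LawvereTwoTheory.{v, w})

instance : TwoCat.{0, v, w} T.Ob := T.twoCat

/-- The natural number `n` as an object of `T`. -/
def ob (n : ℕ) : T.Ob := Arity.mk n

/-- The image in `T` of a function between finite sets. -/
def inert {m n : ℕ} (φ : Fin n → Fin m) : T.ob m ⟶ T.ob n := T.θ φ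

/-- The `i`-th projection `n ⟶ 1`. -/
def pr (n : ℕ) (i : Fin n) : T.ob n ⟶ T.ob 1 := T.inert fun _ => i

theorem isPower_pr (n : ℕ) : IsPower (T.pr n) := T.isPower n

/-- The power `m · k` as `m` rows of length `k`: the projection to the `i`-th row. -/
def row (m k : ℕ) (i : Fin m) : T.ob (m * k) ⟶ T.ob k := T.inert fun j => finProdFinEquiv (i, j)

/-- The power `m · k` as `k` columns of length `m`: the projection to the `j`-th column. -/
def col (m k : ℕ) (j : Fin k) : T.ob (m * k) ⟶ T.ob m := T.inert fun i => finProdFinEquiv (i, j)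

/-- The transposition `m · k ⟶ k · m`. -/
def transpose (m k : ℕ) : T.ob (m * k) ⟶ T.ob (k * m) :=
  T.inert fun t => finProdFinEquiv ((finProdFinEquiv.symm t).2, (finProdFinEquiv.symm t).1)

variable {T}

/-- `m · α`: the operation `α`, applied to each of `m` rows. -/
noncomputable def rowMap (m : ℕ) {k l : ℕ} (α : T.ob k ⟶ T.ob l) :
    T.ob (m * k) ⟶ T.ob (m * l) :=
  (T.isPower_pr (m * l)).lift fun t =>
    T.row m k (finProdFinEquiv.symm t).1 ≫ α ≫ T.pr l (finProdFinEquiv.symm t).2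

/-- `α · k`: the operation `α`, applied to each of `k` columns. -/
noncomputable def colMap {m n : ℕ} (α : T.ob m ⟶ T.ob n) (k : ℕ) :
    T.ob (m * k) ⟶ T.ob (n * k) :=
  (T.isPower_pr (n * k)).lift fun t =>
    T.col m k (finProdFinEquiv.symm t).2 ≫ α ≫ T.pr n (finProdFinEquiv.symm t).1

/-- `m · s` for a 2-cell `s`. -/
noncomputable def rowCell (m : ℕ) {k l : ℕ} (s : Cell (T.ob k) (T.ob l)) :
    Cell (T.ob (m * k)) (T.ob (m * l)) :=
  (T.isPower_pr (m * l)).liftCell fun t =>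
    hc (one (T.row m k (finProdFinEquiv.symm t).1))
      (hc s (one (T.pr l (finProdFinEquiv.symm t).2)))

/-- `s · k` for a 2-cell `s`. -/
noncomputable def colCell {m n : ℕ} (s : Cell (T.ob m) (T.ob n)) (k : ℕ) :
    Cell (T.ob (m * k)) (T.ob (n * k)) :=
  (T.isPower_pr (n * k)).liftCell fun t =>
    hc (one (T.col m k (finProdFinEquiv.symm t).2))
      (hc s (one (T.pr n (finProdFinEquiv.symm t).1)))

end LawvereTwoTheory

/-- A coherent system of `z`-cells `σ α β` filling the interchange squares with sides
`m · β`, `α · l` and `α · k`, `n · β`.  The cells are identities when `α` or `β` comes from a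
function of finite sets, and are compatible with composition and with 2-cells in either variable. -/
@[ext]
structure CoherentSystem (z : Weakness) (T : LawvereTwoTheory.{v, w}) where
  σ : ∀ {m n k l : ℕ} (_ : T.ob m ⟶ T.ob n) (_ : T.ob k ⟶ T.ob l),
    Cell (T.ob (m * k)) (T.ob (n * l))
  osrc_σ : ∀ {m n k l : ℕ} (α : T.ob m ⟶ T.ob n) (β : T.ob k ⟶ T.ob l),
    osrc z (σ α β) = T.rowMap m β ≫ T.colMap α l
  otgt_σ : ∀ {m n k l : ℕ} (α : T.ob m ⟶ T.ob n) (β : T.ob k ⟶ T.ob l),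
    otgt z (σ α β) = T.colMap α k ≫ T.rowMap n β
  isWCell : ∀ {m n k l : ℕ} (α : T.ob m ⟶ T.ob n) (β : T.ob k ⟶ T.ob l), IsWCell z (σ α β)
  inert_left : ∀ {m n k l : ℕ} (φ : Fin n → Fin m) (β : T.ob k ⟶ T.ob l),
    σ (T.inert φ) β = one (osrc z (σ (T.inert φ) β))
  inert_right : ∀ {m n k l : ℕ} (α : T.ob m ⟶ T.ob n) (φ : Fin l → Fin k),
    σ α (T.inert φ) = one (osrc z (σ α (T.inert φ)))
  comp_right : ∀ {m n k l r : ℕ} (α : T.ob m ⟶ T.ob n) (β : T.ob k ⟶ T.ob l)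
    (γ : T.ob l ⟶ T.ob r), ∃ h, σ α (β ≫ γ) =
      ovc z (hc (one (T.rowMap m β)) (σ α γ)) (hc (σ α β) (one (T.rowMap n γ))) h
  comp_left : ∀ {m n r k l : ℕ} (α : T.ob m ⟶ T.ob n) (γ : T.ob n ⟶ T.ob r)
    (β : T.ob k ⟶ T.ob l), ∃ h, σ (α ≫ γ) β =
      ovc z (hc (σ α β) (one (T.colMap γ l))) (hc (one (T.colMap α k)) (σ γ β)) h
  nat_right : ∀ {m n k l : ℕ} (α : T.ob m ⟶ T.ob n) (s : Cell (T.ob k) (T.ob l)), ∃ h h',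
    ovc z (hc (T.rowCell m s) (one (T.colMap α l))) (σ α (otgt z s)) h =
      ovc z (σ α (osrc z s)) (hc (one (T.colMap α k)) (T.rowCell n s)) h'
  nat_left : ∀ {m n k l : ℕ} (s : Cell (T.ob m) (T.ob n)) (β : T.ob k ⟶ T.ob l), ∃ h h',
    ovc z (hc (one (T.rowMap m β)) (T.colCell s l)) (σ (otgt z s) β) h =
      ovc z (σ (osrc z s) β) (hc (T.colCell s k) (one (T.rowMap n β))) h'


/-! ### Models -/

section models

variable (z : Weakness) (T : LawvereTwoTheory.{v₁, w₁}) (C : Type u) [TwoCat.{u, v, w} C]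
  [ChosenPowers C]

/-- A model of `T` in `C`: a 2-functor `T → C` sending `n` to the chosen power `base ^ n`, and
sending the images of functions of finite sets to the canonical maps between chosen powers.
(The weakness `z` does not matter for the models, only for their homomorphisms.) -/
@[ext]
structure Model (z : Weakness) (T : LawvereTwoTheory.{v₁, w₁}) (C : Type u) [TwoCat.{u, v, w} C]
    [ChosenPowers C] where
  base : C
  map : ∀ {m n : ℕ}, (T.ob m ⟶ T.ob n) → (pow base m ⟶ pow base n)
  mapCell : ∀ {m n : ℕ}, Cell (T.ob m) (T.ob n) → Cell (pow base m) (pow base n)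
  map_inert : ∀ {m n : ℕ} (φ : Fin n → Fin m), map (T.inert φ) = reindex base φ
  map_comp : ∀ {l m n : ℕ} (α : T.ob l ⟶ T.ob m) (β : T.ob m ⟶ T.ob n),
    map (α ≫ β) = map α ≫ map β
  src_mapCell : ∀ {m n : ℕ} (s : Cell (T.ob m) (T.ob n)), src (mapCell s) = map (src s)
  tgt_mapCell : ∀ {m n : ℕ} (s : Cell (T.ob m) (T.ob n)), tgt (mapCell s) = map (tgt s)
  mapCell_one : ∀ {m n : ℕ} (α : T.ob m ⟶ T.ob n), mapCell (one α) = one (map α)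
  mapCell_vc : ∀ {m n : ℕ} (s t : Cell (T.ob m) (T.ob n)) (h : tgt s = src t),
    mapCell (vc s t h) = vc (mapCell s) (mapCell t) (by rw [src_mapCell, tgt_mapCell, h])
  mapCell_hc : ∀ {l m n : ℕ} (s : Cell (T.ob l) (T.ob m)) (t : Cell (T.ob m) (T.ob n)),
    mapCell (hc s t) = hc (mapCell s) (mapCell t)

variable {z T C}

namespace Model

@[simp] theorem osrc_mapCell (X : Model z T C) (z' : Weakness) {m n : ℕ}
    (s : Cell (T.ob m) (T.ob n)) : osrc z' (X.mapCell s) = X.map (osrc z' s) := by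
  cases z' <;> first | exact X.src_mapCell s | exact X.tgt_mapCell s

@[simp] theorem otgt_mapCell (X : Model z T C) (z' : Weakness) {m n : ℕ}
    (s : Cell (T.ob m) (T.ob n)) : otgt z' (X.mapCell s) = X.map (otgt z' s) := by
  cases z' <;> first | exact X.src_mapCell s | exact X.tgt_mapCell s

/-- A `z`-homomorphism of models: a `z`-natural transformation whose component at `n` is the
`n`-th power of the component `base`, with cells
`base ^ m ≫ Y α ⇒ X α ≫ base ^ n` (reversed if `z` is `colax`)
that are identities when `α` comes from a function of finite sets. -/
@[ext]
structure Hom (X Y : Model z T C) where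
  base : X.base ⟶ Y.base
  cell : ∀ {m n : ℕ}, (T.ob m ⟶ T.ob n) → Cell (pow X.base m) (pow Y.base n)
  osrc_cell : ∀ {m n : ℕ} (α : T.ob m ⟶ T.ob n), osrc z (cell α) = powMap m base ≫ Y.map α
  otgt_cell : ∀ {m n : ℕ} (α : T.ob m ⟶ T.ob n), otgt z (cell α) = X.map α ≫ powMap n base
  isWCell : ∀ {m n : ℕ} (α : T.ob m ⟶ T.ob n), IsWCell z (cell α)
  cell_inert : ∀ {m n : ℕ} (φ : Fin n → Fin m),
    cell (T.inert φ) = one (osrc z (cell (T.inert φ)))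
  cell_comp : ∀ {l m n : ℕ} (α : T.ob l ⟶ T.ob m) (β : T.ob m ⟶ T.ob n), ∃ h,
    cell (α ≫ β) = ovc z (hc (cell α) (one (Y.map β))) (hc (one (X.map α)) (cell β)) h
  cell_nat : ∀ {m n : ℕ} (s : Cell (T.ob m) (T.ob n)), ∃ h h',
    ovc z (hc (one (powMap m base)) (Y.mapCell s)) (cell (otgt z s)) h =
      ovc z (cell (osrc z s)) (hc (X.mapCell s) (one (powMap n base))) h'

/-- The modification axiom for a family of cells `c ^ n` from `f` to `g` (oriented according
to `z`). -/
def IsModif {X Y : Model z T C} (f g : Hom X Y) (c : Cell X.base Y.base) : Prop :=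
  ∀ (m n : ℕ) (α : T.ob m ⟶ T.ob n), ∃ h h',
    ovc z (hc (powCell m c) (one (Y.map α))) (g.cell α) h =
      ovc z (f.cell α) (hc (one (X.map α)) (powCell n c)) h'

/-- A modification between `z`-homomorphisms of models, with component `cell ^ n` at `n`. -/
@[ext]
structure Modif (X Y : Model z T C) where
  src : Hom X Y
  tgt : Hom X Y
  cell : Cell X.base Y.base
  src_cell : TwoCat.src cell = src.base
  tgt_cell : TwoCat.tgt cell = tgt.base
  isModif : IsModif (pick z src tgt) (pick z tgt src) cell

attribute [simp] Hom.osrc_cell Hom.otgt_cell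

theorem ovc_of_id {D : Type u} [TwoCat.{u, v, w} D] {X Y : D} {a b : Cell X Y}
    (h : otgt z a = osrc z b) (ha : a = one (osrc z a)) (hb : b = one (osrc z b)) :
    ovc z a b h = one (osrc z (ovc z a b h)) := by
  rw [osrc_ovc, ← ha]
  rw [ha, otgt_one] at h
  rw [ovc_congr z _ rfl (hb.trans (congrArg one h.symm))]
  exact ovc_one z _ _

theorem hc_of_id {D : Type u} [TwoCat.{u, v, w} D] {X Y Z : D} {a : Cell X Y} {b : Cell Y Z}
    (ha : a = one (osrc z a)) (hb : b = one (osrc z b)) : hc a b = one (osrc z (hc a b)) := by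
  rw [osrc_hc, one_comp, ← ha, ← hb]

/-- The identity homomorphism. -/
noncomputable def Hom.id (X : Model z T C) : Hom X X where
  base := 𝟙 _
  cell α := one (X.map α)
  osrc_cell α := by simp
  otgt_cell α := by simp
  isWCell α := isWCell_one z _
  cell_inert φ := by simp
  cell_comp α β := ⟨by simp, by
    rw [X.map_comp]
    refine Eq.trans ?_ (ovc_congr z ?_ (one_comp _ _) (one_comp _ _))
    · rw [ovc_one]
    · simp⟩
  cell_nat s := by
    refine ⟨by simp, by simp, ?_⟩
    rw [ovc_one, one_ovc]; simp

/-- The composite of two homomorphisms. -/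
noncomputable def Hom.comp {X Y Z : Model z T C} (f : Hom X Y) (g : Hom Y Z) : Hom X Z where
  base := f.base ≫ g.base
  cell {m n} α := ovc z (hc (one (powMap m f.base)) (g.cell α))
    (hc (f.cell α) (one (powMap n g.base))) (by simp)
  osrc_cell α := by simp [powMap_comp]
  otgt_cell α := by simp [powMap_comp]
  isWCell α := isWCell_ovc z _ (isWCell_hc z (isWCell_one z _) (g.isWCell α))
    (isWCell_hc z (f.isWCell α) (isWCell_one z _))
  cell_inert {m n} φ := ovc_of_id _ (hc_of_id (by simp) (g.cell_inert φ))
    (hc_of_id (f.cell_inert φ) (by simp))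
  cell_comp {l m n} α β := by
    obtain ⟨hf, ef⟩ := f.cell_comp α β
    obtain ⟨hg, eg⟩ := g.cell_comp α β
    refine ⟨by simp, ?_⟩
    have k₁ := congrArg (hc (one (powMap l f.base))) eg
    have k₂ := congrArg (fun c => hc c (one (powMap n g.base))) ef
    beta_reduce at k₂
    rw [hc_ovc] at k₁
    rw [ovc_hc] at k₂
    refine (ovc_congr z _ k₁ k₂).trans ?_
    have q₁ : osrc z (f.cell α) = powMap l f.base ≫ Y.map α := f.osrc_cell α
    have q₂ : otgt z (f.cell α) = X.map α ≫ powMap m f.base := f.otgt_cell α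
    have q₃ : osrc z (g.cell β) = powMap m g.base ≫ Z.map β := g.osrc_cell β
    have q₄ : otgt z (g.cell β) = Y.map β ≫ powMap n g.base := g.otgt_cell β
    have mid : ovc z (hc (one (powMap l f.base)) (hc (one (Y.map α)) (g.cell β)))
        (hc (hc (f.cell α) (one (Y.map β))) (one (powMap n g.base))) (by simp) =
        ovc z (hc (hc (f.cell α) (one (powMap m g.base))) (one (Z.map β)))
          (hc (one (X.map α)) (hc (one (powMap m f.base)) (g.cell β))) (by simp) := by
      refine (ovc_congr z _ ?_ ?_).trans ((hc_slide z (f.cell α) (g.cell β)).trans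
        ((hc_slide' z (f.cell α) (g.cell β)).symm.trans (ovc_congr z _ ?_ ?_)))
      · rw [q₁, one_comp, hc_assoc]
      · rw [q₄, one_comp, hc_assoc]
      · rw [q₃, one_comp, hc_assoc]
      · rw [q₂, one_comp, hc_assoc]
    refine (ovc_four z _ _ _ _ mid).trans ?_
    refine ovc_congr z _ ?_ ?_
    · rw [ovc_hc]
      exact ovc_congr z _ (hc_assoc _ _ _).symm rfl
    · rw [hc_ovc]
      exact ovc_congr z _ rfl (hc_assoc _ _ _)
  cell_nat {m n} s := by
    obtain ⟨h₁, h₁', ef⟩ := f.cell_nat s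
    obtain ⟨h₂, h₂', eg⟩ := g.cell_nat s
    refine ⟨by simp [powMap_comp], by simp [powMap_comp], ?_⟩
    have k₁ := congrArg (hc (one (powMap m f.base))) eg
    have k₂ := congrArg (fun c => hc c (one (powMap n g.base))) ef
    beta_reduce at k₂
    rw [hc_ovc, hc_ovc] at k₁
    rw [ovc_hc, ovc_hc] at k₂
    refine (ovc_congr z _ (b := _) (b' := _) (a' := hc (one (powMap m f.base))
      (hc (one (powMap m g.base)) (Z.mapCell s))) ?_ rfl).trans ?_
    · rw [powMap_comp, one_comp, hc_assoc]
    rw [← ovc_assoc z _ _ _ (by simp) (by simp)]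
    refine (ovc_congr z _ k₁ rfl).trans ?_
    rw [ovc_assoc z _ _ _ (by simp) (by simp)]
    refine (ovc_congr z _ rfl ((ovc_congr z _ (hc_assoc _ _ _).symm rfl).trans k₂)).trans ?_
    rw [← ovc_assoc z _ _ _ (by simp) (by simp)]
    refine ovc_congr z _ rfl ?_
    rw [powMap_comp, one_comp, hc_assoc]

theorem Hom.id_comp {X Y : Model z T C} (f : Hom X Y) : (Hom.id X).comp f = f := by
  refine Hom.ext (Category.id_comp _) ?_
  funext m n α
  refine (ovc_congr z _ (?_ : _ = f.cell α) (?_ : _ = one (X.map α ≫ powMap n f.base))).trans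
    (ovc_one z _ _)
  · simp [Hom.id]
  · rw [one_comp]; rfl

theorem Hom.comp_id {X Y : Model z T C} (f : Hom X Y) : f.comp (Hom.id Y) = f := by
  refine Hom.ext (Category.comp_id _) ?_
  funext m n α
  refine (ovc_congr z _ (?_ : _ = one (powMap m f.base ≫ Y.map α)) (?_ : _ = f.cell α)).trans
    (one_ovc z _ _)
  · rw [one_comp]; rfl
  · simp [Hom.id]

theorem Hom.assoc {W X Y Z : Model z T C} (f : Hom W X) (g : Hom X Y) (k : Hom Y Z) :
    (f.comp g).comp k = f.comp (g.comp k) := by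
  refine Hom.ext (Category.assoc _ _ _) ?_
  funext m n α
  dsimp only [Hom.comp]
  refine (ovc_congr z _ (?_ : _ = hc (one (powMap m f.base)) (hc (one (powMap m g.base))
    (k.cell α))) (ovc_hc z _ _ _ _)).trans ?_
  · rw [powMap_comp, one_comp, hc_assoc]
  refine Eq.trans ?_ (ovc_congr z (by simp) (hc_ovc z _ _ _ (by simp)).symm (?_ : hc (hc (f.cell α)
    (one (powMap n g.base))) (one (powMap n k.base)) = _))
  · refine Eq.trans (ovc_congr z _ rfl (ovc_congr z _ (hc_assoc _ _ _) rfl)) ?_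
    rw [← ovc_assoc z _ _ _ (by simp) (by simp)]
  · rw [hc_assoc, ← one_comp, ← powMap_comp]

noncomputable instance : Category (Model z T C) where
  Hom := Hom
  id := Hom.id
  comp := Hom.comp
  id_comp := Hom.id_comp
  comp_id := Hom.comp_id
  assoc := Hom.assoc

theorem isModif_one {X Y : Model z T C} (f : X ⟶ Y) : IsModif f f (one (Hom.base f)) := by
  intro m n α
  refine ⟨by simp, by simp, ?_⟩
  refine Eq.trans (b := Hom.cell f α) ?_ (Eq.symm ?_)
  · refine (ovc_congr z _ (?_ : _ = one (powMap m (Hom.base f) ≫ Y.map α)) rfl).trans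
      (one_ovc z _ _)
    rw [one_comp, powCell_one]
  · refine (ovc_congr z _ rfl (?_ : _ = one (X.map α ≫ powMap n (Hom.base f)))).trans
      (ovc_one z _ _)
    rw [one_comp, powCell_one]

theorem isModif_ovc {X Y : Model z T C} {f g k : X ⟶ Y} {a b : Cell X.base Y.base}
    (ha : IsModif f g a) (hb : IsModif g k b) (h : otgt z a = osrc z b) :
    IsModif f k (ovc z a b h) := by
  intro m n α
  obtain ⟨h₁, h₁', e₁⟩ := ha m n α
  obtain ⟨h₂, h₂', e₂⟩ := hb m n α
  have p₁ := powCell_ovc m z a b h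
  have p₂ := powCell_ovc n z a b h
  have k₁ : otgt z (hc (powCell m (ovc z a b h)) (one (Y.map α))) =
      osrc z (Hom.cell k α) := by
    rw [← h₂]; simp
  have k₂ : otgt z (Hom.cell f α) =
      osrc z (hc (one (X.map α)) (powCell n (ovc z a b h))) := by
    rw [h₁']; simp
  refine ⟨k₁, k₂, ?_⟩
  have q₁ := (congrArg (fun c => hc c (one (Y.map α))) p₁).trans (ovc_hc z _ _ _ (by simp [h]))
  have q₂ := (congrArg (hc (one (X.map α))) p₂).trans (hc_ovc z _ _ _ (by simp [h]))
  refine (ovc_congr z _ q₁ rfl).trans (Eq.trans ?_ (ovc_congr z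
    (by rw [← q₂]; exact k₂) rfl q₂.symm))
  rw [ovc_assoc z _ _ _ (by simp [h]) h₂]
  refine (ovc_congr z _ rfl e₂).trans ?_
  rw [← ovc_assoc z _ _ _ h₁ h₂']
  refine (ovc_congr z _ e₁ rfl).trans ?_
  rw [ovc_assoc z _ _ _ h₁' (by simp [h])]

theorem isModif_whiskerRight {X Y Z : Model z T C} {f g : X ⟶ Y} {a : Cell X.base Y.base}
    (ha : IsModif f g a) (hf : osrc z a = Hom.base f) (hg : otgt z a = Hom.base g) (k : Y ⟶ Z) :
    IsModif (f ≫ k) (g ≫ k) (hc a (one (Hom.base k))) := by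
  intro m n α
  obtain ⟨h₁, h₁', e₁⟩ := ha m n α
  have b₁ : ∀ r, powCell r (hc a (one (Hom.base k))) =
      hc (powCell r a) (one (powMap r (Hom.base k))) := fun r => by rw [powCell_hc, powCell_one]
  have c₁ := Hom.osrc_cell k α
  have c₂ := Hom.otgt_cell k α
  have s₁ : hc (powCell m (hc a (one (Hom.base k)))) (one (Z.map α)) =
      hc (powCell m a) (one (osrc z (Hom.cell k α))) := by
    rw [b₁, hc_assoc, ← one_comp, c₁]
  have s₂ : hc (one (X.map α)) (powCell n (hc a (one (Hom.base k)))) =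
      hc (hc (one (X.map α)) (powCell n a)) (one (powMap n (Hom.base k))) := by
    rw [b₁, hc_assoc]
  have key := congrArg (fun c => hc c (one (powMap n (Hom.base k)))) e₁
  beta_reduce at key
  rw [ovc_hc, ovc_hc] at key
  have mid : ovc z (hc (powCell m a) (one (osrc z (Hom.cell k α))))
      (hc (one (powMap m (Hom.base g))) (Hom.cell k α)) (by simp [hg]) =
      ovc z (hc (one (powMap m (Hom.base f))) (Hom.cell k α))
        (hc (hc (powCell m a) (one (Y.map α))) (one (powMap n (Hom.base k)))) (by simp [hf]) := by
    refine (ovc_congr z _ rfl ?_).trans ((hc_slide' z (powCell m a) (Hom.cell k α)).trans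
      ((hc_slide z (powCell m a) (Hom.cell k α)).symm.trans (ovc_congr z _ ?_ ?_)))
    · rw [otgt_powCell, hg]
    · rw [osrc_powCell, hf]
    · rw [c₂, one_comp, hc_assoc]
  have g₁ : otgt z (hc (powCell m (hc a (one (Hom.base k)))) (one (Z.map α))) =
      osrc z (Hom.cell (g ≫ k) α) := by
    rw [Hom.osrc_cell]
    change _ = powMap m (Hom.base g ≫ Hom.base k) ≫ _
    simp [hg]
  have g₂ : otgt z (Hom.cell (f ≫ k) α) =
      osrc z (hc (one (X.map α)) (powCell n (hc a (one (Hom.base k))))) := by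
    rw [Hom.otgt_cell]
    change _ ≫ powMap n (Hom.base f ≫ Hom.base k) = _
    simp [hf]
  refine ⟨g₁, g₂, ?_⟩
  refine (ovc_congr z g₁ s₁ rfl).trans (Eq.trans ?_ (ovc_congr z
    (by rw [← s₂]; exact g₂) rfl s₂.symm))
  refine (ovc_assoc z _ _ _ (by simp [hg]) (by simp)).symm.trans ?_
  refine (ovc_congr z _ mid rfl).trans ?_
  rw [ovc_assoc z _ _ _ (by simp [hf]) (by simp [hg])]
  refine (ovc_congr z _ rfl key).trans ?_
  exact (ovc_assoc z _ _ _ (by simp) (by simp [hf])).symm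

theorem isModif_whiskerLeft {X Y Z : Model z T C} {f g : Y ⟶ Z} {a : Cell Y.base Z.base}
    (k : X ⟶ Y) (ha : IsModif f g a) (hf : osrc z a = Hom.base f) (hg : otgt z a = Hom.base g) :
    IsModif (k ≫ f) (k ≫ g) (hc (one (Hom.base k)) a) := by
  intro m n α
  obtain ⟨h₁, h₁', e₁⟩ := ha m n α
  have b₁ : ∀ r, powCell r (hc (one (Hom.base k)) a) =
      hc (one (powMap r (Hom.base k))) (powCell r a) := fun r => by rw [powCell_hc, powCell_one]
  have c₁ := Hom.osrc_cell k α
  have c₂ := Hom.otgt_cell k α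
  have s₁ : hc (powCell m (hc (one (Hom.base k)) a)) (one (Z.map α)) =
      hc (one (powMap m (Hom.base k))) (hc (powCell m a) (one (Z.map α))) := by
    rw [b₁, hc_assoc]
  have s₂ : hc (one (X.map α)) (powCell n (hc (one (Hom.base k)) a)) =
      hc (one (otgt z (Hom.cell k α))) (powCell n a) := by
    rw [b₁, ← hc_assoc, ← one_comp, c₂]
  have key := congrArg (hc (one (powMap m (Hom.base k)))) e₁
  rw [hc_ovc, hc_ovc] at key
  have mid : ovc z (hc (one (powMap m (Hom.base k))) (hc (one (Y.map α)) (powCell n a)))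
      (hc (Hom.cell k α) (one (powMap n (Hom.base g)))) (by simp [hg]) =
      ovc z (hc (Hom.cell k α) (one (powMap n (Hom.base f))))
        (hc (one (otgt z (Hom.cell k α))) (powCell n a)) (by simp [hf]) := by
    refine (ovc_congr z _ ?_ ?_).trans ((hc_slide z (Hom.cell k α) (powCell n a)).trans
      ((hc_slide' z (Hom.cell k α) (powCell n a)).symm.trans (ovc_congr z _ ?_ rfl)))
    · rw [c₁, one_comp, hc_assoc]
    · rw [otgt_powCell, hg]
    · rw [osrc_powCell, hf]
  have g₁ : otgt z (hc (powCell m (hc (one (Hom.base k)) a)) (one (Z.map α))) =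
      osrc z (Hom.cell (k ≫ g) α) := by
    rw [Hom.osrc_cell]
    change _ = powMap m (Hom.base k ≫ Hom.base g) ≫ _
    simp [hg]
  have g₂ : otgt z (Hom.cell (k ≫ f) α) =
      osrc z (hc (one (X.map α)) (powCell n (hc (one (Hom.base k)) a))) := by
    rw [Hom.otgt_cell]
    change _ ≫ powMap n (Hom.base k ≫ Hom.base f) = _
    simp [hf]
  refine ⟨g₁, g₂, ?_⟩
  refine (ovc_congr z g₁ s₁ rfl).trans (Eq.trans ?_ (ovc_congr z
    (by rw [← s₂]; exact g₂) rfl s₂.symm))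
  refine (ovc_assoc z _ _ _ (by simp [hg]) (by simp)).symm.trans ?_
  refine (ovc_congr z _ key rfl).trans ?_
  rw [ovc_assoc z _ _ _ (by simp [hf]) (by simp [hg])]
  refine (ovc_congr z _ rfl mid).trans ?_
  exact (ovc_assoc z _ _ _ (by simp) (by simp [hf])).symm

theorem isModif_hc {X Y Z : Model z T C} {f g : X ⟶ Y} {f' g' : Y ⟶ Z}
    {a : Cell X.base Y.base} {b : Cell Y.base Z.base} (ha : IsModif f g a) (hb : IsModif f' g' b)
    (hf : osrc z a = Hom.base f) (hg : otgt z a = Hom.base g)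
    (hf' : osrc z b = Hom.base f') (hg' : otgt z b = Hom.base g') :
    IsModif (f ≫ f') (g ≫ g') (hc a b) := by
  rw [← hc_slide' z a b]
  refine isModif_ovc (g := g ≫ f') ?_ ?_ _
  · rw [hf']
    exact isModif_whiskerRight ha hf hg f'
  · rw [hg]
    exact isModif_whiskerLeft g hb hf' hg'

/-- Models, `z`-homomorphisms and modifications. -/
noncomputable instance : TwoCat (Model z T C) where
  Cell := Modif
  src a := a.src
  tgt a := a.tgt
  one f := ⟨f, f, one (Hom.base f), src_one _, tgt_one _, by
    cases z <;> exact isModif_one f⟩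
  vc a b h := ⟨a.src, b.tgt, vc a.cell b.cell (by rw [a.tgt_cell, b.src_cell, h]),
    by rw [src_vc, a.src_cell], by rw [tgt_vc, b.tgt_cell], by
    obtain ⟨p, q, a, ha, ha', ma⟩ := a
    obtain ⟨q', r, b, hb, hb', mb⟩ := b
    obtain rfl : q = q' := h
    have e : tgt a = src b := by rw [ha', hb]
    cases z
    · exact isModif_ovc (z := .strict) (f := p) (g := q) (k := r) ma mb e
    · exact isModif_ovc (z := .pseudo) (f := p) (g := q) (k := r) ma mb e
    · exact isModif_ovc (z := .lax) (f := p) (g := q) (k := r) ma mb e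
    · exact isModif_ovc (z := .colax) (f := r) (g := q) (k := p) mb ma e.symm⟩
  hc a b := ⟨a.src.comp b.src, a.tgt.comp b.tgt, hc a.cell b.cell,
    by rw [src_hc, a.src_cell, b.src_cell]; rfl, by rw [tgt_hc, a.tgt_cell, b.tgt_cell]; rfl, by
    obtain ⟨p, q, a, ha, ha', ma⟩ := a
    obtain ⟨p', q', b, hb, hb', mb⟩ := b
    cases z
    · exact isModif_hc (z := .strict) (f := p) (g := q) (f' := p') (g' := q') ma mb ha ha' hb hb'
    · exact isModif_hc (z := .pseudo) (f := p) (g := q) (f' := p') (g' := q') ma mb ha ha' hb hb'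
    · exact isModif_hc (z := .lax) (f := p) (g := q) (f' := p') (g' := q') ma mb ha ha' hb hb'
    · exact isModif_hc (z := .colax) (f := q) (g := p) (f' := q') (g' := p') ma mb ha' ha hb' hb⟩
  src_one _ := rfl
  tgt_one _ := rfl
  src_vc _ _ _ := rfl
  tgt_vc _ _ _ := rfl
  src_hc _ _ := rfl
  tgt_hc _ _ := rfl
  one_vc a := Modif.ext rfl rfl (by
    refine (ovc_congr .lax _ (congrArg one a.src_cell.symm) rfl).trans (one_vc _))
  vc_one a := Modif.ext rfl rfl (by
    refine (ovc_congr .lax _ rfl (congrArg one a.tgt_cell.symm)).trans (vc_one _))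
  vc_assoc _ _ _ _ _ := Modif.ext rfl rfl (vc_assoc _ _ _ _ _)
  one_comp _ _ := Modif.ext rfl rfl (one_comp _ _)
  id_hc a := Modif.ext (Hom.id_comp _) (Hom.id_comp _) (id_hc _)
  hc_id a := Modif.ext (Hom.comp_id _) (Hom.comp_id _) (hc_id _)
  hc_assoc _ _ _ := Modif.ext (Hom.assoc _ _ _) (Hom.assoc _ _ _) (hc_assoc _ _ _)
  interchange _ _ _ _ _ _ := Modif.ext rfl rfl (interchange _ _ _ _ _ _)

end Model

end models


section

variable {z : Weakness} {T : LawvereTwoTheory.{v₁, w₁}} {C : Type u} [TwoCat.{u, v, w} C]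
  [ChosenPowers C]

namespace Model

/-- The power `X ^ k` of a model, given on `α` by `(X α) ^ k` up to the canonical isomorphisms
`(c ^ k) ^ m ≅ (c ^ m) ^ k`. -/
noncomputable def power (X : Model z T C) (k : ℕ) : Model z T C where
  base := pow X.base k
  map {m n} α := ((isPower X.base k).powMap n).lift fun i => powMap m (proj X.base k i) ≫ X.map α
  mapCell {m n} s :=
    ((isPower X.base k).powMap n).liftCell fun i =>
      hc (one (powMap m (proj X.base k i))) (X.mapCell s)
  map_inert φ := ((isPower X.base k).powMap _).hom_ext fun i => by
    rw [IsPower.lift_fac, X.map_inert, powMap_reindex]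
  map_comp {l m n} α β := ((isPower X.base k).powMap _).hom_ext fun i => by
    rw [IsPower.lift_fac, Category.assoc, IsPower.lift_fac, ← Category.assoc, IsPower.lift_fac,
      Category.assoc, X.map_comp]
  src_mapCell s := (IsPower.osrc_liftCell _ .lax _).trans (by simp; rfl)
  tgt_mapCell s := (IsPower.otgt_liftCell _ .lax _).trans (by simp; rfl)
  mapCell_one α := ((isPower X.base k).powMap _).cell_ext fun i => by
    rw [IsPower.liftCell_fac, X.mapCell_one, ← one_comp, ← one_comp, IsPower.lift_fac]
  mapCell_vc s t h := ((isPower X.base k).powMap _).cell_ext fun i => by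
    rw [IsPower.liftCell_fac, hc_vc_one]
    refine Eq.trans ?_ (ovc_congr .lax (?_ : otgt .lax (hc (one (powMap _ (proj X.base k i)))
      (X.mapCell s)) = osrc .lax (hc (one (powMap _ (proj X.base k i))) (X.mapCell t)))
      (IsPower.liftCell_fac ((isPower X.base k).powMap _)
        (fun i => hc (one (powMap _ (proj X.base k i))) (X.mapCell s)) i).symm
      (IsPower.liftCell_fac ((isPower X.base k).powMap _)
        (fun i => hc (one (powMap _ (proj X.base k i))) (X.mapCell t)) i).symm)
    · rw [X.mapCell_vc]
      exact hc_ovc .lax _ _ _ _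
  mapCell_hc s t := ((isPower X.base k).powMap _).cell_ext fun i => by
    rw [IsPower.liftCell_fac, hc_assoc, IsPower.liftCell_fac, ← hc_assoc, IsPower.liftCell_fac,
      hc_assoc, X.mapCell_hc]

/-- The strict homomorphism with a given base. -/
noncomputable def strictHom {X Y : Model z T C} (p : X.base ⟶ Y.base)
    (h : ∀ {m n : ℕ} (α : T.ob m ⟶ T.ob n), X.map α ≫ powMap n p = powMap m p ≫ Y.map α)
    (h' : ∀ {m n : ℕ} (s : Cell (T.ob m) (T.ob n)),
      hc (X.mapCell s) (one (powMap n p)) = hc (one (powMap m p)) (Y.mapCell s)) : X ⟶ Y :=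
  { base := p
    cell := fun {m n} α => one (powMap m p ≫ Y.map α)
    osrc_cell := by simp
    otgt_cell := fun α => by rw [otgt_one, h]
    isWCell := fun α => isWCell_one z _
    cell_inert := by simp
    cell_comp := fun {l m n} α β => by
      have e' : hc (one (X.map α)) (one (powMap m p ≫ Y.map β)) =
          one (powMap l p ≫ Y.map (α ≫ β)) := by
        rw [← one_comp, ← Category.assoc, h, Category.assoc, Y.map_comp]
      have e'' : hc (one (powMap l p ≫ Y.map α)) (one (Y.map β)) =
          one (powMap l p ≫ Y.map (α ≫ β)) := by
        rw [← one_comp, Category.assoc, Y.map_comp]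
      refine ⟨by rw [e', e'']; simp, ?_⟩
      exact Eq.symm ((ovc_congr z _ e'' e').trans (one_ovc z _ _))
    cell_nat := fun {m n} s => by
      refine ⟨by simp, by rw [h']; simp, ?_⟩
      rw [ovc_one]
      exact (h' s).symm.trans (one_ovc z _ _).symm }

/-- The `i`-th projection `X ^ k ⟶ X`, a strict homomorphism. -/
noncomputable def powerProj (X : Model z T C) (k : ℕ) (i : Fin k) : X.power k ⟶ X :=
  strictHom (X := X.power k) (proj X.base k i)
    (fun {_ n} _ => IsPower.lift_fac ((isPower X.base k).powMap n) _ i)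
    (fun {_ n} _ => IsPower.liftCell_fac ((isPower X.base k).powMap n) _ i)

/-- A homomorphism all of whose cells are identities. -/
def IsStrict {X Y : Model z T C} (p : X ⟶ Y) : Prop :=
  ∀ (m n : ℕ) (α : T.ob m ⟶ T.ob n), Hom.cell p α = one (osrc z (Hom.cell p α))

theorem IsStrict.map_comp {X Y : Model z T C} {p : X ⟶ Y} (hp : IsStrict p) {m n : ℕ}
    (α : T.ob m ⟶ T.ob n) :
    X.map α ≫ powMap n (Hom.base p) = powMap m (Hom.base p) ≫ Y.map α := by
  rw [← Hom.otgt_cell, ← Hom.osrc_cell, hp m n α]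
  simp

theorem IsStrict.mapCell_hc {X Y : Model z T C} {p : X ⟶ Y} (hp : IsStrict p) {m n : ℕ}
    (s : Cell (T.ob m) (T.ob n)) :
    hc (X.mapCell s) (one (powMap n (Hom.base p))) =
      hc (one (powMap m (Hom.base p))) (Y.mapCell s) := by
  obtain ⟨h, h', e⟩ := Hom.cell_nat p s
  refine Eq.trans ?_ (e.symm.trans ?_)
  · exact ((ovc_congr z _ (hp m n _) rfl).trans (one_ovc z _ _)).symm
  · exact (ovc_congr z _ rfl (hp m n _)).trans (ovc_one z _ _)

theorem IsStrict.cell_comp {X Y Z : Model z T C} (f : X ⟶ Y) {p : Y ⟶ Z} (hp : IsStrict p)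
    {m n : ℕ} (α : T.ob m ⟶ T.ob n) :
    Hom.cell (f ≫ p) α = hc (Hom.cell f α) (one (powMap n (Hom.base p))) := by
  refine (ovc_congr z _ (?_ : _ = one (powMap m (Hom.base f) ≫ osrc z (Hom.cell p α))) rfl).trans
    (one_ovc z _ _)
  rw [one_comp, ← hp m n α]

section

variable {k : ℕ} {P X Z : Model z T C} {π : Fin k → (P ⟶ X)}

/-- The factorisation of a cone through a cone of strict homomorphisms. -/
noncomputable def liftHom (hb : IsPower fun i => Hom.base (π i)) (hs : ∀ i, IsStrict (π i))
    (f : Fin k → (Z ⟶ X)) : Z ⟶ P :=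
  have src_eq : ∀ {m n : ℕ} (α : T.ob m ⟶ T.ob n),
      osrc z ((hb.powMap n).liftCell fun i => Hom.cell (f i) α) =
        powMap m (hb.lift fun i => Hom.base (f i)) ≫ P.map α := fun {m n} α => by
    rw [IsPower.osrc_liftCell]
    refine (hb.powMap n).hom_ext fun i => ?_
    rw [IsPower.lift_fac, Category.assoc, (hs i).map_comp, ← Category.assoc, ← powMap_comp,
      IsPower.lift_fac, Hom.osrc_cell]
  have tgt_eq : ∀ {m n : ℕ} (α : T.ob m ⟶ T.ob n),
      otgt z ((hb.powMap n).liftCell fun i => Hom.cell (f i) α) =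
        Z.map α ≫ powMap n (hb.lift fun i => Hom.base (f i)) := fun {m n} α => by
    rw [IsPower.otgt_liftCell]
    refine (hb.powMap n).hom_ext fun i => ?_
    rw [IsPower.lift_fac, Category.assoc, ← powMap_comp, IsPower.lift_fac, Hom.otgt_cell]
  { base := hb.lift fun i => Hom.base (f i)
    cell := fun {_ n} α => (hb.powMap n).liftCell fun i => Hom.cell (f i) α
    osrc_cell := src_eq
    otgt_cell := tgt_eq
    isWCell := fun {_ n} α => (hb.powMap n).isWCell z _ fun i => by
      rw [IsPower.liftCell_fac]; exact Hom.isWCell (f i) α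
    cell_inert := fun {_ n} φ => (hb.powMap n).cell_ext fun i => by
      rw [IsPower.liftCell_fac, IsPower.osrc_liftCell, ← one_comp, IsPower.lift_fac]
      exact Hom.cell_inert (f i) φ
    cell_comp := fun {l m n} α β => by
      have h : otgt z (hc ((hb.powMap m).liftCell fun i => Hom.cell (f i) α) (one (P.map β))) =
          osrc z (hc (one (Z.map α)) ((hb.powMap n).liftCell fun i => Hom.cell (f i) β)) := by
        rw [otgt_hc, osrc_hc, tgt_eq, src_eq, otgt_one, osrc_one, Category.assoc]
      refine ⟨h, (hb.powMap n).cell_ext fun i => ?_⟩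
      obtain ⟨h₁, e⟩ := Hom.cell_comp (f i) α β
      rw [IsPower.liftCell_fac, ovc_hc]
      refine e.trans (ovc_congr z _ ?_ ?_)
      · rw [hc_assoc, ← one_comp, (hs i).map_comp, one_comp, ← hc_assoc,
          IsPower.liftCell_fac (hb.powMap m) (fun i => Hom.cell (f i) α)]
      · rw [hc_assoc, IsPower.liftCell_fac (hb.powMap n) (fun i => Hom.cell (f i) β)]
    cell_nat := fun {m n} s => by
      refine ⟨by rw [otgt_hc, otgt_one, otgt_mapCell, src_eq],
        by rw [osrc_hc, osrc_one, osrc_mapCell, tgt_eq], (hb.powMap n).cell_ext fun i => ?_⟩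
      obtain ⟨h₁, h₂, e⟩ := Hom.cell_nat (f i) s
      rw [ovc_hc, ovc_hc]
      refine (ovc_congr z _ ?_ ?_).trans (e.trans (ovc_congr z _ ?_ ?_))
      · rw [hc_assoc, (hs i).mapCell_hc, ← hc_assoc, ← one_comp, ← powMap_comp, IsPower.lift_fac]
      · exact IsPower.liftCell_fac (hb.powMap n) (fun i => Hom.cell (f i) _) i
      · exact (IsPower.liftCell_fac (hb.powMap n) (fun i => Hom.cell (f i) _) i).symm
      · rw [hc_assoc, ← one_comp, ← powMap_comp, IsPower.lift_fac] }

theorem liftHom_fac (hb : IsPower fun i => Hom.base (π i)) (hs : ∀ i, IsStrict (π i))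
    (f : Fin k → (Z ⟶ X)) (i : Fin k) : liftHom hb hs f ≫ π i = f i := by
  refine Hom.ext (IsPower.lift_fac hb (fun i => Hom.base (f i)) i) ?_
  funext m n α
  rw [(hs i).cell_comp]
  exact IsPower.liftCell_fac (hb.powMap n) (fun i => Hom.cell (f i) α) i

theorem strict_hom_ext (hb : IsPower fun i => Hom.base (π i)) (hs : ∀ i, IsStrict (π i))
    {f g : Z ⟶ P} (h : ∀ i, f ≫ π i = g ≫ π i) : f = g := by
  refine Hom.ext (hb.hom_ext fun i => congrArg Hom.base (h i)) ?_
  funext m n α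
  refine (hb.powMap n).cell_ext fun i => ?_
  rw [← (hs i).cell_comp, ← (hs i).cell_comp, h i]

theorem isModif_lift (hb : IsPower fun i => Hom.base (π i)) (hs : ∀ i, IsStrict (π i))
    {f g : Fin k → (Z ⟶ X)} {a : Fin k → Cell Z.base X.base}
    (ha : ∀ i, IsModif (f i) (g i) (a i)) (hf : ∀ i, osrc z (a i) = Hom.base (f i))
    (hg : ∀ i, otgt z (a i) = Hom.base (g i)) :
    IsModif (liftHom hb hs f) (liftHom hb hs g) (hb.liftCell a) := by
  have b₁ : osrc z (hb.liftCell a) = Hom.base (liftHom hb hs f) := by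
    rw [IsPower.osrc_liftCell, funext hf]; rfl
  have b₂ : otgt z (hb.liftCell a) = Hom.base (liftHom hb hs g) := by
    rw [IsPower.otgt_liftCell, funext hg]; rfl
  intro m n α
  refine ⟨by rw [Hom.osrc_cell]; simp [b₂], by rw [Hom.otgt_cell]; simp [b₁],
    (hb.powMap n).cell_ext fun i => ?_⟩
  obtain ⟨h, h', e⟩ := ha i m n α
  rw [ovc_hc, ovc_hc]
  refine (ovc_congr z _ ?_ ?_).trans (e.trans (ovc_congr z _ ?_ ?_))
  · rw [hc_assoc, ← one_comp, (hs i).map_comp, one_comp, ← hc_assoc, ← powCell_one, ← powCell_hc,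
      IsPower.liftCell_fac]
  · rw [← (hs i).cell_comp, liftHom_fac]
  · rw [← (hs i).cell_comp, liftHom_fac]
  · rw [hc_assoc, ← powCell_one, ← powCell_hc, IsPower.liftCell_fac]

/-- A cone of strict homomorphisms whose underlying cone is a power cone is a power cone. -/
theorem isPower_of_strict (hb : IsPower fun i => Hom.base (π i)) (hs : ∀ i, IsStrict (π i)) :
    IsPower π := by
  intro Z
  refine ⟨⟨fun f g h => strict_hom_ext hb hs (congrFun h), fun f =>
    ⟨liftHom hb hs f, funext (liftHom_fac hb hs f)⟩⟩, ⟨fun s t h => ?_, fun s => ?_⟩⟩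
  · refine Modif.ext ?_ ?_ (hb.cell_ext fun i => congrArg Modif.cell (congrFun h i))
    · exact strict_hom_ext hb hs fun i => congrArg Modif.src (congrFun h i)
    · exact strict_hom_ext hb hs fun i => congrArg Modif.tgt (congrFun h i)
  · refine ⟨⟨liftHom hb hs fun i => Modif.src (s i), liftHom hb hs fun i => Modif.tgt (s i),
      hb.liftCell fun i => Modif.cell (s i), ?_, ?_, ?_⟩, funext fun i => ?_⟩
    · refine (IsPower.osrc_liftCell hb .lax _).trans ?_
      exact congrArg hb.lift (funext fun i => Modif.src_cell (s i))
    · refine (IsPower.otgt_liftCell hb .lax _).trans ?_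
      exact congrArg hb.lift (funext fun i => Modif.tgt_cell (s i))
    · cases z
      · exact isModif_lift hb hs (fun i => (s i).isModif) (fun i => (s i).src_cell)
          (fun i => (s i).tgt_cell)
      · exact isModif_lift hb hs (fun i => (s i).isModif) (fun i => (s i).src_cell)
          (fun i => (s i).tgt_cell)
      · exact isModif_lift hb hs (fun i => (s i).isModif) (fun i => (s i).src_cell)
          (fun i => (s i).tgt_cell)
      · exact isModif_lift hb hs (fun i => (s i).isModif) (fun i => (s i).tgt_cell)
          (fun i => (s i).src_cell)
    · exact Modif.ext (liftHom_fac hb hs _ i) (liftHom_fac hb hs _ i)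
        (IsPower.liftCell_fac hb _ i)

end

noncomputable instance : ChosenPowers (Model z T C) where
  pow := power
  proj := powerProj
  isPower X k := isPower_of_strict (π := powerProj X k) (isPower X.base k) fun i m n α => by
    change one _ = _
    rw [Hom.osrc_cell]; rfl

end Model

end


/-! ### Functors preserving powers and their action on models -/

/-- A 2-functor that preserves finite powers: the image of each chosen power cone is a power
cone. -/
structure PowFunctor (C : Type u₁) [TwoCat.{u₁, v₁, w₁} C] [ChosenPowers C]
    (D : Type u₂) [TwoCat.{u₂, v₂, w₂} D] [ChosenPowers D] extends TwoFunctor C D where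
  isPower_map : ∀ (X : C) (n : ℕ), IsPower fun i => map (proj X n i)

namespace TwoFunctor

variable {C : Type u₁} [TwoCat.{u₁, v₁, w₁} C] {D : Type u₂} [TwoCat.{u₂, v₂, w₂} D]

@[simp] theorem osrc_mapCell (F : TwoFunctor C D) (z : Weakness) {X Y : C} (a : Cell X Y) :
    osrc z (F.mapCell a) = F.map (osrc z a) := by
  cases z <;> first | exact F.src_mapCell a | exact F.tgt_mapCell a

@[simp] theorem otgt_mapCell (F : TwoFunctor C D) (z : Weakness) {X Y : C} (a : Cell X Y) :
    otgt z (F.mapCell a) = F.map (otgt z a) := by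
  cases z <;> first | exact F.src_mapCell a | exact F.tgt_mapCell a

theorem mapCell_ovc (F : TwoFunctor C D) (z : Weakness) {X Y : C} (a b : Cell X Y)
    (h : otgt z a = osrc z b) :
    F.mapCell (ovc z a b h) = ovc z (F.mapCell a) (F.mapCell b) (by simp [h]) := by
  cases z
  · exact F.mapCell_vc a b h
  · exact F.mapCell_vc a b h
  · exact F.mapCell_vc a b h
  · exact F.mapCell_vc b a h.symm

theorem isWCell (F : TwoFunctor C D) (z : Weakness) {X Y : C} {a : Cell X Y}
    (h : IsWCell z a) : IsWCell z (F.mapCell a) := by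
  cases z
  · simp only [IsWCell] at h ⊢
    rw [h, F.mapCell_one]; simp
  · obtain ⟨b, h₁, h₂, e₁, e₂⟩ := h
    refine ⟨F.mapCell b, by simp [h₁], by simp [h₂], ?_, ?_⟩
    · rw [← F.mapCell_vc _ _ h₁, e₁, F.mapCell_one, F.src_mapCell]
    · rw [← F.mapCell_vc _ _ h₂, e₂, F.mapCell_one, F.src_mapCell]
  · trivial
  · trivial

end TwoFunctor

namespace PowFunctor

variable {C : Type u₁} [TwoCat.{u₁, v₁, w₁} C] [ChosenPowers C]
  {D : Type u₂} [TwoCat.{u₂, v₂, w₂} D] [ChosenPowers D] (F : PowFunctor C D)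

/-- The comparison `F (X ^ n) ⟶ (F X) ^ n`. -/
noncomputable def compare (X : C) (n : ℕ) : F.obj (pow X n) ⟶ pow (F.obj X) n :=
  (isPower (F.obj X) n).lift fun i => F.map (proj X n i)

/-- The inverse of the comparison. -/
noncomputable def uncompare (X : C) (n : ℕ) : pow (F.obj X) n ⟶ F.obj (pow X n) :=
  (F.isPower_map X n).lift fun i => proj (F.obj X) n i

theorem compare_proj (X : C) (n : ℕ) (i : Fin n) :
    F.compare X n ≫ proj (F.obj X) n i = F.map (proj X n i) := IsPower.lift_fac _ _ _

theorem uncompare_proj (X : C) (n : ℕ) (i : Fin n) :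
    F.uncompare X n ≫ F.map (proj X n i) = proj (F.obj X) n i :=
  IsPower.lift_fac (F.isPower_map X n) _ _

theorem compare_uncompare (X : C) (n : ℕ) : F.compare X n ≫ F.uncompare X n = 𝟙 _ :=
  (F.isPower_map X n).hom_ext fun i => by
    rw [Category.assoc, uncompare_proj, compare_proj, Category.id_comp]

theorem uncompare_compare (X : C) (n : ℕ) : F.uncompare X n ≫ F.compare X n = 𝟙 _ :=
  pow_hom_ext n fun i => by
    rw [Category.assoc, compare_proj, uncompare_proj, Category.id_comp]

/-- The action of `F` on 1-cells between powers. -/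
noncomputable def conj {X Y : C} {m n : ℕ} (f : pow X m ⟶ pow Y n) :
    pow (F.obj X) m ⟶ pow (F.obj Y) n :=
  F.uncompare X m ≫ F.map f ≫ F.compare Y n

/-- The action of `F` on 2-cells between powers. -/
noncomputable def conjCell {X Y : C} {m n : ℕ} (s : Cell (pow X m) (pow Y n)) :
    Cell (pow (F.obj X) m) (pow (F.obj Y) n) :=
  hc (one (F.uncompare X m)) (hc (F.mapCell s) (one (F.compare Y n)))

variable {X Y Z : C} {l m n : ℕ}

theorem conj_comp (f : pow X l ⟶ pow Y m) (g : pow Y m ⟶ pow Z n) :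
    F.conj (f ≫ g) = F.conj f ≫ F.conj g := by
  simp only [conj, Category.assoc, F.map_comp]
  rw [← Category.assoc (F.compare Y m), compare_uncompare, Category.id_comp]

theorem conj_reindex (φ : Fin n → Fin m) : F.conj (reindex X φ) = reindex (F.obj X) φ :=
  pow_hom_ext n fun i => by
    rw [conj, Category.assoc, Category.assoc, compare_proj, ← F.map_comp, reindex_proj,
      uncompare_proj, reindex_proj]

theorem conj_powMap (n : ℕ) (f : X ⟶ Y) : F.conj (powMap n f) = powMap n (F.map f) :=
  pow_hom_ext n fun i => by
    rw [conj, Category.assoc, Category.assoc, compare_proj, ← F.map_comp, powMap_proj,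
      F.map_comp, ← Category.assoc, uncompare_proj, powMap_proj]

@[simp] theorem osrc_conjCell (z : Weakness) (s : Cell (pow X m) (pow Y n)) :
    osrc z (F.conjCell s) = F.conj (osrc z s) := by simp [conjCell, conj]

@[simp] theorem otgt_conjCell (z : Weakness) (s : Cell (pow X m) (pow Y n)) :
    otgt z (F.conjCell s) = F.conj (otgt z s) := by simp [conjCell, conj]

theorem conjCell_one (f : pow X m ⟶ pow Y n) : F.conjCell (one f) = one (F.conj f) := by
  rw [conjCell, conj, one_comp, one_comp, F.mapCell_one]

theorem conjCell_hc (s : Cell (pow X l) (pow Y m)) (t : Cell (pow Y m) (pow Z n)) :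
    F.conjCell (hc s t) = hc (F.conjCell s) (F.conjCell t) := by
  simp only [conjCell, hc_assoc, F.mapCell_hc]
  rw [← hc_assoc (one (F.compare Y m)), ← one_comp, compare_uncompare, id_hc]

theorem conjCell_powCell (n : ℕ) (s : Cell X Y) :
    F.conjCell (powCell n s) = powCell n (F.mapCell s) :=
  pow_cell_ext n fun i => by
    rw [conjCell, hc_assoc, hc_assoc, ← one_comp, compare_proj, ← F.mapCell_one, ← F.mapCell_hc,
      powCell_proj, F.mapCell_hc, F.mapCell_one, ← hc_assoc, ← one_comp, uncompare_proj,
      powCell_proj]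

theorem conjCell_ovc (z : Weakness) (s t : Cell (pow X m) (pow Y n))
    (h : otgt z s = osrc z t) :
    F.conjCell (ovc z s t h) = ovc z (F.conjCell s) (F.conjCell t) (by simp [h]) := by
  have h' : otgt z (F.mapCell s) = osrc z (F.mapCell t) := by simp [h]
  have e : hc (F.mapCell (ovc z s t h)) (one (F.compare Y n)) =
      ovc z (hc (F.mapCell s) (one (F.compare Y n))) (hc (F.mapCell t) (one (F.compare Y n)))
        (by simp [h]) := by
    rw [F.mapCell_ovc, ovc_hc]
  rw [conjCell, e]
  exact hc_ovc z _ _ _ _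

theorem conjCell_of_id {z : Weakness} {s : Cell (pow X m) (pow Y n)} (h : s = one (osrc z s)) :
    F.conjCell s = one (osrc z (F.conjCell s)) := by
  rw [osrc_conjCell, ← conjCell_one, ← h]

theorem isWCell_conjCell (z : Weakness) {s : Cell (pow X m) (pow Y n)} (h : IsWCell z s) :
    IsWCell z (F.conjCell s) :=
  isWCell_hc z (isWCell_one z _) (isWCell_hc z (F.isWCell z h) (isWCell_one z _))

end PowFunctor

namespace Model

section push

variable {z : Weakness} {T : LawvereTwoTheory.{v₃, w₃}}
  {C : Type u₁} [TwoCat.{u₁, v₁, w₁} C] [ChosenPowers C]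
  {D : Type u₂} [TwoCat.{u₂, v₂, w₂} D] [ChosenPowers D] (F : PowFunctor C D)

/-- The image of a model under a functor preserving powers. -/
noncomputable def pushObj (X : Model z T C) : Model z T D where
  base := F.obj X.base
  map α := F.conj (X.map α)
  mapCell s := F.conjCell (X.mapCell s)
  map_inert φ := by rw [X.map_inert, F.conj_reindex]
  map_comp α β := by rw [X.map_comp, F.conj_comp]
  src_mapCell s := (F.osrc_conjCell .lax _).trans (congrArg _ (X.src_mapCell s))
  tgt_mapCell s := (F.otgt_conjCell .lax _).trans (congrArg _ (X.tgt_mapCell s))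
  mapCell_one α := by rw [X.mapCell_one, F.conjCell_one]
  mapCell_vc s t h := by
    rw [X.mapCell_vc]
    exact F.conjCell_ovc .lax _ _ _
  mapCell_hc s t := by rw [X.mapCell_hc, F.conjCell_hc]

/-- The image of a homomorphism under a functor preserving powers. -/
noncomputable def pushHom {X Y : Model z T C} (f : X ⟶ Y) : pushObj F X ⟶ pushObj F Y :=
  { base := F.map (Hom.base f)
    cell := fun α => F.conjCell (Hom.cell f α)
    osrc_cell := fun {m _} α => (F.osrc_conjCell z _).trans (by
      rw [Hom.osrc_cell, F.conj_comp, F.conj_powMap]; rfl)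
    otgt_cell := fun α => (F.otgt_conjCell z _).trans (by
      rw [Hom.otgt_cell, F.conj_comp, F.conj_powMap]; rfl)
    isWCell := fun α => F.isWCell_conjCell z (Hom.isWCell f α)
    cell_inert := fun φ => F.conjCell_of_id (Hom.cell_inert f φ)
    cell_comp := fun α β => by
      obtain ⟨h, e⟩ := Hom.cell_comp f α β
      have e' := congrArg F.conjCell e
      rw [F.conjCell_ovc] at e'
      have a₁ := F.conjCell_hc (Hom.cell f α) (one (Y.map β))
      have a₂ := F.conjCell_hc (one (X.map α)) (Hom.cell f β)
      rw [F.conjCell_one] at a₁ a₂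
      exact ⟨_, e'.trans (ovc_congr z _ a₁ a₂)⟩
    cell_nat := fun {m n} s => by
      obtain ⟨h, h', e⟩ := Hom.cell_nat f s
      have e' := congrArg F.conjCell e
      rw [F.conjCell_ovc, F.conjCell_ovc] at e'
      have a₁ := F.conjCell_hc (one (powMap m (Hom.base f))) (Y.mapCell s)
      have a₂ := F.conjCell_hc (X.mapCell s) (one (powMap n (Hom.base f)))
      rw [F.conjCell_one, F.conj_powMap] at a₁ a₂
      exact ⟨_, _, (ovc_congr z _ a₁ rfl).symm.trans (e'.trans (ovc_congr z _ rfl a₂))⟩ }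

theorem pushHom_comp {X Y Z : Model z T C} (f : X ⟶ Y) (g : Y ⟶ Z) :
    pushHom F (f ≫ g) = pushHom F f ≫ pushHom F g :=
  Hom.ext (F.map_comp _ _) (by
    funext m n α
    have a₁ := F.conjCell_hc (one (powMap m (Hom.base f))) (Hom.cell g α)
    have a₂ := F.conjCell_hc (Hom.cell f α) (one (powMap n (Hom.base g)))
    rw [F.conjCell_one, F.conj_powMap] at a₁ a₂
    exact (F.conjCell_ovc z _ _ _).trans (ovc_congr z _ a₁ a₂))

theorem isModif_push {X Y : Model z T C} {f g : X ⟶ Y} {c : Cell X.base Y.base}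
    (h : IsModif f g c) : IsModif (pushHom F f) (pushHom F g) (F.mapCell c) := by
  intro m n α
  obtain ⟨h, h', e⟩ := h m n α
  have e' := congrArg F.conjCell e
  rw [F.conjCell_ovc, F.conjCell_ovc] at e'
  have a₁ := F.conjCell_hc (powCell m c) (one (Y.map α))
  have a₂ := F.conjCell_hc (one (X.map α)) (powCell n c)
  rw [F.conjCell_one, F.conjCell_powCell] at a₁ a₂
  exact ⟨_, _, (ovc_congr z _ a₁ rfl).symm.trans (e'.trans (ovc_congr z _ rfl a₂))⟩

variable (z T) in
/-- The 2-functor between 2-categories of models induced by a functor preserving powers. -/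
noncomputable def pushTwoFunctor : TwoFunctor (Model z T C) (Model z T D) where
  obj := pushObj F
  map := pushHom F
  map_id X := Hom.ext (F.map_id _) (by funext m n α; exact F.conjCell_one _)
  map_comp := pushHom_comp F
  mapCell a := ⟨pushHom F a.src, pushHom F a.tgt, F.mapCell a.cell,
    (F.src_mapCell _).trans (congrArg _ a.src_cell),
    (F.tgt_mapCell _).trans (congrArg _ a.tgt_cell), by
    cases z <;> exact isModif_push F a.isModif⟩
  src_mapCell _ := rfl
  tgt_mapCell _ := rfl
  mapCell_one _ := Modif.ext rfl rfl (F.mapCell_one _)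
  mapCell_vc _ _ _ := Modif.ext rfl rfl (F.mapCell_vc _ _ _)
  mapCell_hc _ _ := Modif.ext (pushHom_comp F _ _) (pushHom_comp F _ _) (F.mapCell_hc _ _)

variable (z T) in
/-- `pushTwoFunctor` preserves powers. -/
noncomputable def push : PowFunctor (Model z T C) (Model z T D) where
  toTwoFunctor := pushTwoFunctor z T F
  isPower_map X k := isPower_of_strict (π := fun i => pushHom F (proj X k i))
    (F.isPower_map X.base k) fun i m n α => by
      refine F.conjCell_of_id (s := Hom.cell (powerProj X k i) α) ?_
      change one _ = _
      rw [Hom.osrc_cell]; rfl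

variable (z T C) in
/-- The forgetful 2-functor, evaluating a model at `1`. -/
noncomputable def forget : PowFunctor (Model z T C) C where
  obj X := X.base
  map f := Hom.base f
  map_id _ := rfl
  map_comp _ _ := rfl
  mapCell a := Modif.cell a
  src_mapCell a := Modif.src_cell a
  tgt_mapCell a := Modif.tgt_cell a
  mapCell_one _ := rfl
  mapCell_vc _ _ _ := rfl
  mapCell_hc _ _ := rfl
  isPower_map X k := isPower X.base k

end push

end Model

/-- A 2-category with chosen finite powers. -/
structure PowTwoCat where
  carrier : Type u
  [twoCat : TwoCat.{u, v, w} carrier]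
  [powers : ChosenPowers carrier]

attribute [instance] PowTwoCat.twoCat PowTwoCat.powers

/-- A simultaneous section of the two forgetful transformations
`Mod(T, Mod(T, C)) → Mod(T, C)`, natural in the 2-category `C` with chosen powers. -/
@[ext]
structure LiftSection (z : Weakness) (T : LawvereTwoTheory.{v, w}) where
  lift : ∀ C : PowTwoCat.{u, v, w},
    TwoFunctor (Model z T C.carrier) (Model z T (Model z T C.carrier))
  natural : ∀ (C D : PowTwoCat.{u, v, w}) (F : PowFunctor C.carrier D.carrier),
    (lift C).comp (Model.push z T (Model.push z T F)).toTwoFunctor =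
      (Model.push z T F).toTwoFunctor.comp (lift D)
  section_inner : ∀ C : PowTwoCat.{u, v, w},
    (lift C).comp (Model.push z T (Model.forget z T C.carrier)).toTwoFunctor = TwoFunctor.id _
  section_outer : ∀ C : PowTwoCat.{u, v, w},
    (lift C).comp (Model.forget z T (Model z T C.carrier)).toTwoFunctor = TwoFunctor.id _


/-! ### Sketches -/

/-- An enhanced 2-category with a class of cones for tight finite powers: a 2-category with a
class of tight 1-cells that contains identities and is closed under composition, and a class of
discrete cones with tight projections. -/
structure FSketch where
  carrier : Type u
  [twoCat : TwoCat.{u, v, w} carrier]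
  tight : ∀ {X Y : carrier}, (X ⟶ Y) → Prop
  tight_id : ∀ X : carrier, tight (𝟙 X)
  tight_comp : ∀ {X Y Z : carrier} (f : X ⟶ Y) (g : Y ⟶ Z), tight f → tight g → tight (f ≫ g)
  cone : ∀ {n : ℕ} {P X : carrier}, (Fin n → (P ⟶ X)) → Prop
  tight_of_cone : ∀ {n : ℕ} {P X : carrier} (π : Fin n → (P ⟶ X)), cone π → ∀ i, tight (π i)

attribute [instance] FSketch.twoCat

/-- Morphisms of sketches: 2-functors that preserve tight 1-cells and the specified cones. -/
structure SketchHom (A : FSketch.{u₁, v₁, w₁}) (B : FSketch.{u₂, v₂, w₂})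
    extends TwoFunctor A.carrier B.carrier where
  map_tight : ∀ {X Y : A.carrier} (f : X ⟶ Y), A.tight f → B.tight (map f)
  map_cone : ∀ {n : ℕ} {P X : A.carrier} (π : Fin n → (P ⟶ X)), A.cone π →
    B.cone fun i => map (π i)

/-! ### The semi-strict Gray tensor product -/

section gray

/-- Objects of the tensor product: pairs of objects. -/
structure GrayOb (z : Weakness) (A : FSketch.{u₁, v₁, w₁}) (B : FSketch.{u₂, v₂, w₂}) where
  fst : A.carrier
  snd : B.carrier

/-- Formal composites of 1-cells `(f, 1)` and `(1, g)`. -/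
inductive GrayWord (z : Weakness) (A : FSketch.{u₁, v₁, w₁}) (B : FSketch.{u₂, v₂, w₂}) :
    GrayOb z A B → GrayOb z A B → Type (max u₁ u₂ v₁ v₂)
  | id (x : GrayOb z A B) : GrayWord z A B x x
  | comp {x y t : GrayOb z A B} (p : GrayWord z A B x y) (q : GrayWord z A B y t) :
    GrayWord z A B x t
  | left {a a' : A.carrier} (f : a ⟶ a') (b : B.carrier) : GrayWord z A B ⟨a, b⟩ ⟨a', b⟩
  | right (a : A.carrier) {b b' : B.carrier} (g : b ⟶ b') : GrayWord z A B ⟨a, b⟩ ⟨a, b'⟩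

variable {z : Weakness} {A : FSketch.{u₁, v₁, w₁}} {B : FSketch.{u₂, v₂, w₂}}

/-- The condition under which the Gray cell of `f` and `g` is required to be an identity. -/
def GrayStrict (z : Weakness) {A : FSketch.{u₁, v₁, w₁}} {B : FSketch.{u₂, v₂, w₂}}
    {a a' : A.carrier} {b b' : B.carrier} (f : a ⟶ a') (g : b ⟶ b') : Prop :=
  z = .strict ∨ A.tight f ∨ B.tight g

/-- The equations between composites of 1-cells `(f, 1)` and `(1, g)`: those of a category,
functoriality in each variable, and commutation of `(f, 1)` and `(1, g)` if their Gray cell is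
required to be an identity. -/
inductive GrayWordRel : ∀ {x y : GrayOb z A B}, GrayWord z A B x y → GrayWord z A B x y → Prop
  | refl {x y} (p : GrayWord z A B x y) : GrayWordRel p p
  | symm {x y} {p q : GrayWord z A B x y} : GrayWordRel p q → GrayWordRel q p
  | trans {x y} {p q r : GrayWord z A B x y} :
    GrayWordRel p q → GrayWordRel q r → GrayWordRel p r
  | comp_congr {x y t} {p p' : GrayWord z A B x y} {q q' : GrayWord z A B y t} :
    GrayWordRel p p' → GrayWordRel q q' → GrayWordRel (.comp p q) (.comp p' q')
  | id_comp {x y} (p : GrayWord z A B x y) : GrayWordRel (.comp (.id x) p) p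
  | comp_id {x y} (p : GrayWord z A B x y) : GrayWordRel (.comp p (.id y)) p
  | assoc {x y t s} (p : GrayWord z A B x y) (q : GrayWord z A B y t) (r : GrayWord z A B t s) :
    GrayWordRel (.comp (.comp p q) r) (.comp p (.comp q r))
  | left_id (a : A.carrier) (b : B.carrier) : GrayWordRel (.left (𝟙 a) b) (.id ⟨a, b⟩)
  | left_comp {a a' a'' : A.carrier} (f : a ⟶ a') (f' : a' ⟶ a'') (b : B.carrier) :
    GrayWordRel (.left (f ≫ f') b) (.comp (.left f b) (.left f' b))
  | right_id (a : A.carrier) (b : B.carrier) : GrayWordRel (.right a (𝟙 b)) (.id ⟨a, b⟩)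
  | right_comp (a : A.carrier) {b b' b'' : B.carrier} (g : b ⟶ b') (g' : b' ⟶ b'') :
    GrayWordRel (.right a (g ≫ g')) (.comp (.right a g) (.right a g'))
  | swap {a a' : A.carrier} {b b' : B.carrier} (f : a ⟶ a') (g : b ⟶ b') (h : GrayStrict z f g) :
    GrayWordRel (.comp (.right a g) (.left f b')) (.comp (.left f b) (.right a' g))

/-- The 1-cells of the tensor product. -/
def GrayHom (x y : GrayOb z A B) : Type (max u₁ u₂ v₁ v₂) :=
  Quot (GrayWordRel (x := x) (y := y))

instance : Category (GrayOb z A B) where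
  Hom := GrayHom
  id x := Quot.mk _ (.id x)
  comp p q := Quot.map₂ .comp (fun p _ _ h => .comp_congr (.refl p) h)
    (fun _ _ q h => .comp_congr h (.refl q)) p q
  id_comp := by rintro x y ⟨p⟩; exact Quot.sound (.id_comp p)
  comp_id := by rintro x y ⟨p⟩; exact Quot.sound (.comp_id p)
  assoc := by rintro x y t s ⟨p⟩ ⟨q⟩ ⟨r⟩; exact Quot.sound (.assoc p q r)

namespace Gray

variable (z) in
/-- The 1-cell `(f, 1)`. -/
def left {a a' : A.carrier} (f : a ⟶ a') (b : B.carrier) :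
    (⟨a, b⟩ : GrayOb z A B) ⟶ ⟨a', b⟩ := Quot.mk _ (.left f b)

variable (z) in
/-- The 1-cell `(1, g)`. -/
def right (a : A.carrier) {b b' : B.carrier} (g : b ⟶ b') :
    (⟨a, b⟩ : GrayOb z A B) ⟶ ⟨a, b'⟩ := Quot.mk _ (.right a g)

variable (z) in
theorem left_id (a : A.carrier) (b : B.carrier) : left z (𝟙 a) b = 𝟙 (⟨a, b⟩ : GrayOb z A B) :=
  Quot.sound (.left_id a b)

variable (z) in
theorem left_comp {a a' a'' : A.carrier} (f : a ⟶ a') (f' : a' ⟶ a'') (b : B.carrier) :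
    left z (f ≫ f') b = left z f b ≫ left z f' b := Quot.sound (.left_comp f f' b)

variable (z) in
theorem right_id (a : A.carrier) (b : B.carrier) : right z a (𝟙 b) = 𝟙 (⟨a, b⟩ : GrayOb z A B) :=
  Quot.sound (.right_id a b)

variable (z) in
theorem right_comp (a : A.carrier) {b b' b'' : B.carrier} (g : b ⟶ b') (g' : b' ⟶ b'') :
    right z a (g ≫ g') = right z a g ≫ right z a g' := Quot.sound (.right_comp a g g')

theorem swap {a a' : A.carrier} {b b' : B.carrier} {f : a ⟶ a'} {g : b ⟶ b'}
    (h : GrayStrict z f g) : right z a g ≫ left z f b' = left z f b ≫ right z a' g :=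
  Quot.sound (.swap f g h)

/-- Formal composites of 2-cells `(s, 1)`, `(1, s)` and Gray cells. The Gray cell
`sig : (1, g) ≫ (f, 1) ⇒ (f, 1) ≫ (1, g)` is present unless `z` is `colax`, and a cell `sigOp` in
the opposite direction is present if `z` is `colax` or `pseudo`. -/
inductive Pre : ∀ {x y : GrayOb z A B}, (x ⟶ y) → (x ⟶ y) →
    Type (max u₁ u₂ v₁ v₂ w₁ w₂)
  | one {x y : GrayOb z A B} (p : x ⟶ y) : Pre p p
  | left {a a' : A.carrier} (s : Cell a a') (b : B.carrier) :
    Pre (Gray.left z (src s) b) (Gray.left z (tgt s) b)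
  | right (a : A.carrier) {b b' : B.carrier} (s : Cell b b') :
    Pre (Gray.right z a (src s)) (Gray.right z a (tgt s))
  | sig (hz : z ≠ .colax) {a a' : A.carrier} {b b' : B.carrier} (f : a ⟶ a') (g : b ⟶ b') :
    Pre (Gray.right z a g ≫ Gray.left z f b') (Gray.left z f b ≫ Gray.right z a' g)
  | sigOp (hz : z = .colax ∨ z = .pseudo) {a a' : A.carrier} {b b' : B.carrier}
      (f : a ⟶ a') (g : b ⟶ b') :
    Pre (Gray.left z f b ≫ Gray.right z a' g) (Gray.right z a g ≫ Gray.left z f b')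
  | vc {x y : GrayOb z A B} {p q q' r : x ⟶ y} (s : Pre p q) (t : Pre q' r) (h : q = q') :
    Pre p r
  | hc {x y t : GrayOb z A B} {p q : x ⟶ y} {p' q' : y ⟶ t} (s : Pre p q) (s' : Pre p' q') :
    Pre (p ≫ p') (q ≫ q')

/-- The equations between composites of 2-cells: those of a 2-category, functoriality in each
variable, and the axioms for the Gray cells. -/
inductive Rel : ∀ {x y : GrayOb z A B} {p q p' q' : x ⟶ y}, Pre p q → Pre p' q' → Prop
  | refl {x y : GrayOb z A B} {p q : x ⟶ y} (s : Pre p q) : Rel s s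
  | symm {x y : GrayOb z A B} {p q p' q' : x ⟶ y} {s : Pre p q} {s' : Pre p' q'} :
    Rel s s' → Rel s' s
  | trans {x y : GrayOb z A B} {p q p' q' p'' q'' : x ⟶ y} {s : Pre p q} {s' : Pre p' q'}
    {s'' : Pre p'' q''} : Rel s s' → Rel s' s'' → Rel s s''
  | vc_congr {x y : GrayOb z A B} {p₁ q₁ q₂ r₂ p₁' q₁' q₂' r₂' : x ⟶ y} {s : Pre p₁ q₁}
    {t : Pre q₂ r₂} {s' : Pre p₁' q₁'} {t' : Pre q₂' r₂'} (h : q₁ = q₂) (h' : q₁' = q₂') :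
    Rel s s' → Rel t t' → Rel (.vc s t h) (.vc s' t' h')
  | hc_congr {x y t : GrayOb z A B} {p q p' q' : x ⟶ y} {k l k' l' : y ⟶ t} {s : Pre p q}
    {s' : Pre p' q'} {r : Pre k l} {r' : Pre k' l'} :
    Rel s s' → Rel r r' → Rel (.hc s r) (.hc s' r')
  | one_vc {x y : GrayOb z A B} {p q q' : x ⟶ y} (s : Pre q q') (h : p = q) :
    Rel (.vc (.one p) s h) s
  | vc_one {x y : GrayOb z A B} {p q q' : x ⟶ y} (s : Pre p q) (h : q = q') :
    Rel (.vc s (.one q') h) s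
  | vc_assoc {x y : GrayOb z A B} {p₁ q₁ p₂ q₂ p₃ q₃ : x ⟶ y} (s₁ : Pre p₁ q₁) (s₂ : Pre p₂ q₂)
    (s₃ : Pre p₃ q₃) (h : q₁ = p₂) (k : q₂ = p₃) :
    Rel (.vc (.vc s₁ s₂ h) s₃ k) (.vc s₁ (.vc s₂ s₃ k) h)
  | one_comp {x y t : GrayOb z A B} (p : x ⟶ y) (q : y ⟶ t) :
    Rel (.one (p ≫ q)) (.hc (.one p) (.one q))
  | id_hc {x y : GrayOb z A B} {p q : x ⟶ y} (s : Pre p q) : Rel (.hc (.one (𝟙 x)) s) s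
  | hc_id {x y : GrayOb z A B} {p q : x ⟶ y} (s : Pre p q) : Rel (.hc s (.one (𝟙 y))) s
  | hc_assoc {x y t r : GrayOb z A B} {p₁ q₁ : x ⟶ y} {p₂ q₂ : y ⟶ t} {p₃ q₃ : t ⟶ r}
    (s₁ : Pre p₁ q₁) (s₂ : Pre p₂ q₂) (s₃ : Pre p₃ q₃) :
    Rel (.hc (.hc s₁ s₂) s₃) (.hc s₁ (.hc s₂ s₃))
  | interchange {x y t : GrayOb z A B} {p₁ q₁ p₂ q₂ : x ⟶ y} {k₁ l₁ k₂ l₂ : y ⟶ t}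
    (s₁ : Pre p₁ q₁) (s₂ : Pre p₂ q₂) (r₁ : Pre k₁ l₁) (r₂ : Pre k₂ l₂)
    (h : q₁ = p₂) (k : l₁ = k₂) (hk : q₁ ≫ l₁ = p₂ ≫ k₂) :
    Rel (.hc (.vc s₁ s₂ h) (.vc r₁ r₂ k)) (.vc (.hc s₁ r₁) (.hc s₂ r₂) hk)
  | left_one {a a' : A.carrier} (f : a ⟶ a') (b : B.carrier) :
    Rel (.left (TwoCat.one f) b) (.one (Gray.left z f b))
  | left_vc {a a' : A.carrier} (s t : Cell a a') (h : tgt s = src t) (b : B.carrier)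
    (h' : Gray.left z (tgt s) b = Gray.left z (src t) b) :
    Rel (.left (TwoCat.vc s t h) b) (.vc (.left s b) (.left t b) h')
  | left_hc {a a' a'' : A.carrier} (s : Cell a a') (t : Cell a' a'') (b : B.carrier) :
    Rel (.left (TwoCat.hc s t) b) (.hc (Pre.left (z := z) s b) (.left t b))
  | right_one (a : A.carrier) {b b' : B.carrier} (g : b ⟶ b') :
    Rel (.right a (TwoCat.one g)) (.one (Gray.right z a g))
  | right_vc (a : A.carrier) {b b' : B.carrier} (s t : Cell b b') (h : tgt s = src t)
    (h' : Gray.right z a (tgt s) = Gray.right z a (src t)) :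
    Rel (.right a (TwoCat.vc s t h)) (.vc (.right a s) (.right a t) h')
  | right_hc (a : A.carrier) {b b' b'' : B.carrier} (s : Cell b b') (t : Cell b' b'') :
    Rel (.right a (TwoCat.hc s t)) (.hc (Pre.right (z := z) a s) (.right a t))
  | sig_strict (hz : z ≠ .colax) {a a' : A.carrier} {b b' : B.carrier} (f : a ⟶ a')
    (g : b ⟶ b') (h : GrayStrict z f g) :
    Rel (.sig hz f g) (.one (Gray.left z f b ≫ Gray.right z a' g))
  | sig_comp_left (hz : z ≠ .colax) {a a' a'' : A.carrier} {b b' : B.carrier} (f : a ⟶ a')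
    (f' : a' ⟶ a'') (g : b ⟶ b') (h) :
    Rel (.sig hz (f ≫ f') g)
      (.vc (.hc (.sig hz f g) (.one (Gray.left z f' b')))
        (.hc (.one (Gray.left z f b)) (.sig hz f' g)) h)
  | sig_comp_right (hz : z ≠ .colax) {a a' : A.carrier} {b b' b'' : B.carrier} (f : a ⟶ a')
    (g : b ⟶ b') (g' : b' ⟶ b'') (h) :
    Rel (.sig hz f (g ≫ g'))
      (.vc (.hc (.one (Gray.right z a g)) (.sig hz f g'))
        (.hc (.sig hz f g) (.one (Gray.right z a' g'))) h)
  | sig_nat_left (hz : z ≠ .colax) {a a' : A.carrier} {b b' : B.carrier} (s : Cell a a')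
    (g : b ⟶ b') (h h') :
    Rel (.vc (.hc (.one (Gray.right z a g)) (.left s b')) (.sig hz (tgt s) g) h)
      (.vc (.sig hz (src s) g) (.hc (.left s b) (.one (Gray.right z a' g))) h')
  | sig_nat_right (hz : z ≠ .colax) {a a' : A.carrier} {b b' : B.carrier} (f : a ⟶ a')
    (s : Cell b b') (h h') :
    Rel (.vc (.hc (.right a s) (.one (Gray.left z f b'))) (.sig hz f (tgt s)) h)
      (.vc (.sig hz f (src s)) (.hc (.one (Gray.left z f b)) (.right a' s)) h')
  | sigOp_strict (hz : z = .colax ∨ z = .pseudo) {a a' : A.carrier} {b b' : B.carrier}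
    (f : a ⟶ a') (g : b ⟶ b') (h : GrayStrict z f g) :
    Rel (.sigOp hz f g) (.one (Gray.left z f b ≫ Gray.right z a' g))
  | sigOp_comp_left (hz : z = .colax ∨ z = .pseudo) {a a' a'' : A.carrier} {b b' : B.carrier}
    (f : a ⟶ a') (f' : a' ⟶ a'') (g : b ⟶ b') (h) :
    Rel (.sigOp hz (f ≫ f') g)
      (.vc (.hc (.one (Gray.left z f b)) (.sigOp hz f' g))
        (.hc (.sigOp hz f g) (.one (Gray.left z f' b'))) h)
  | sigOp_comp_right (hz : z = .colax ∨ z = .pseudo) {a a' : A.carrier} {b b' b'' : B.carrier}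
    (f : a ⟶ a') (g : b ⟶ b') (g' : b' ⟶ b'') (h) :
    Rel (.sigOp hz f (g ≫ g'))
      (.vc (.hc (.sigOp hz f g) (.one (Gray.right z a' g')))
        (.hc (.one (Gray.right z a g)) (.sigOp hz f g')) h)
  | sigOp_nat_left (hz : z = .colax ∨ z = .pseudo) {a a' : A.carrier} {b b' : B.carrier}
    (s : Cell a a') (g : b ⟶ b') (h h') :
    Rel (.vc (.hc (.left s b) (.one (Gray.right z a' g))) (.sigOp hz (tgt s) g) h)
      (.vc (.sigOp hz (src s) g) (.hc (.one (Gray.right z a g)) (.left s b')) h')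
  | sigOp_nat_right (hz : z = .colax ∨ z = .pseudo) {a a' : A.carrier} {b b' : B.carrier}
    (f : a ⟶ a') (s : Cell b b') (h h') :
    Rel (.vc (.hc (.one (Gray.left z f b)) (.right a' s)) (.sigOp hz f (tgt s)) h)
      (.vc (.sigOp hz f (src s)) (.hc (.right a s) (.one (Gray.left z f b'))) h')
  | sig_sigOp (hz : z ≠ .colax) (hz' : z = .colax ∨ z = .pseudo) {a a' : A.carrier}
    {b b' : B.carrier} (f : a ⟶ a') (g : b ⟶ b') :
    Rel (.vc (.sig hz f g) (.sigOp hz' f g) rfl) (.one (Gray.right z a g ≫ Gray.left z f b'))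
  | sigOp_sig (hz : z ≠ .colax) (hz' : z = .colax ∨ z = .pseudo) {a a' : A.carrier}
    {b b' : B.carrier} (f : a ⟶ a') (g : b ⟶ b') :
    Rel (.vc (.sigOp hz' f g) (.sig hz f g) rfl) (.one (Gray.left z f b ≫ Gray.right z a' g))

theorem Rel.eqs {x y : GrayOb z A B} {p q p' q' : x ⟶ y} {s : Pre p q} {s' : Pre p' q'}
    (h : Rel s s') : p = p' ∧ q = q' := by
  induction h with
  | refl s => exact ⟨rfl, rfl⟩
  | symm _ ih => exact ⟨ih.1.symm, ih.2.symm⟩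
  | trans _ _ ih₁ ih₂ => exact ⟨ih₁.1.trans ih₂.1, ih₁.2.trans ih₂.2⟩
  | vc_congr _ _ _ _ ih₁ ih₂ => exact ⟨ih₁.1, ih₂.2⟩
  | hc_congr _ _ ih₁ ih₂ => exact ⟨by rw [ih₁.1, ih₂.1], by rw [ih₁.2, ih₂.2]⟩
  | one_vc s h => exact ⟨h, rfl⟩
  | vc_one s h => exact ⟨rfl, h.symm⟩
  | vc_assoc => exact ⟨rfl, rfl⟩
  | one_comp => exact ⟨rfl, rfl⟩
  | id_hc => exact ⟨Category.id_comp _, Category.id_comp _⟩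
  | hc_id => exact ⟨Category.comp_id _, Category.comp_id _⟩
  | hc_assoc => exact ⟨Category.assoc _ _ _, Category.assoc _ _ _⟩
  | interchange => exact ⟨rfl, rfl⟩
  | left_one => exact ⟨by rw [src_one], by rw [tgt_one]⟩
  | left_vc => exact ⟨by rw [src_vc], by rw [tgt_vc]⟩
  | left_hc => exact ⟨by rw [src_hc, left_comp], by rw [tgt_hc, left_comp]⟩
  | right_one => exact ⟨by rw [src_one], by rw [tgt_one]⟩
  | right_vc => exact ⟨by rw [src_vc], by rw [tgt_vc]⟩
  | right_hc => exact ⟨by rw [src_hc, right_comp], by rw [tgt_hc, right_comp]⟩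
  | sig_strict hz f g h => exact ⟨swap h, rfl⟩
  | sig_comp_left => exact ⟨by rw [left_comp, Category.assoc], by rw [left_comp, Category.assoc]⟩
  | sig_comp_right => exact ⟨by rw [right_comp, Category.assoc], by rw [right_comp, Category.assoc]⟩
  | sig_nat_left => exact ⟨rfl, rfl⟩
  | sig_nat_right => exact ⟨rfl, rfl⟩
  | sigOp_strict hz f g h => exact ⟨rfl, swap h⟩
  | sigOp_comp_left => exact ⟨by rw [left_comp, Category.assoc], by rw [left_comp, Category.assoc]⟩
  | sigOp_comp_right =>
    exact ⟨by rw [right_comp, Category.assoc], by rw [right_comp, Category.assoc]⟩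
  | sigOp_nat_left => exact ⟨rfl, rfl⟩
  | sigOp_nat_right => exact ⟨rfl, rfl⟩
  | sig_sigOp => exact ⟨rfl, rfl⟩
  | sigOp_sig => exact ⟨rfl, rfl⟩

/-- A formal composite of 2-cells together with its source and target. -/
structure PreCell (x y : GrayOb z A B) where
  src : x ⟶ y
  tgt : x ⟶ y
  pre : Pre src tgt

/-- Formal composites up to the equations. -/
def preSetoid (x y : GrayOb z A B) : Setoid (PreCell x y) where
  r s t := Rel s.pre t.pre
  iseqv := ⟨fun s => .refl s.pre, fun h => .symm h, fun h k => .trans h k⟩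

/-- The 2-cells of the tensor product. -/
def GrayCell (x y : GrayOb z A B) : Type (max u₁ u₂ v₁ v₂ w₁ w₂) :=
  _root_.Quotient (preSetoid x y)

/-- The class of a formal composite. -/
def mk {x y : GrayOb z A B} {p q : x ⟶ y} (s : Pre p q) : GrayCell x y :=
  _root_.Quotient.mk (preSetoid x y) ⟨p, q, s⟩

theorem sound {x y : GrayOb z A B} {p q p' q' : x ⟶ y} {s : Pre p q} {s' : Pre p' q'}
    (h : Rel s s') : mk s = mk s' :=
  _root_.Quotient.sound (s := preSetoid x y) (a := ⟨p, q, s⟩) (b := ⟨p', q', s'⟩) h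

/-- The source of a 2-cell. -/
def GrayCell.src {x y : GrayOb z A B} (s : GrayCell x y) : x ⟶ y :=
  _root_.Quotient.lift (s := preSetoid x y) PreCell.src (fun _ _ h => (Rel.eqs h).1) s

/-- The target of a 2-cell. -/
def GrayCell.tgt {x y : GrayOb z A B} (s : GrayCell x y) : x ⟶ y :=
  _root_.Quotient.lift (s := preSetoid x y) PreCell.tgt (fun _ _ h => (Rel.eqs h).2) s

/-- A formal composite that represents a 2-cell. -/
noncomputable def GrayCell.out {x y : GrayOb z A B} (s : GrayCell x y) : PreCell x y :=
  _root_.Quotient.out (s := preSetoid x y) s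

theorem GrayCell.mk_out {x y : GrayOb z A B} (s : GrayCell x y) : mk s.out.pre = s :=
  _root_.Quotient.out_eq (s := preSetoid x y) s

theorem GrayCell.out_mk {x y : GrayOb z A B} {p q : x ⟶ y} (s : Pre p q) :
    Rel (mk s).out.pre s :=
  _root_.Quotient.exact (s := preSetoid x y) (a := (mk s).out) (b := ⟨p, q, s⟩) (mk_out (mk s))

theorem GrayCell.src_out {x y : GrayOb z A B} (s : GrayCell x y) : s.out.src = s.src :=
  congrArg GrayCell.src s.mk_out

theorem GrayCell.tgt_out {x y : GrayOb z A B} (s : GrayCell x y) : s.out.tgt = s.tgt :=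
  congrArg GrayCell.tgt s.mk_out

/-- Vertical composition. -/
noncomputable def GrayCell.vc {x y : GrayOb z A B} (s t : GrayCell x y) (h : s.tgt = t.src) :
    GrayCell x y :=
  mk (.vc s.out.pre t.out.pre (s.tgt_out.trans (h.trans t.src_out.symm)))

/-- Horizontal composition. -/
noncomputable def GrayCell.hc {x y t : GrayOb z A B} (s : GrayCell x y) (r : GrayCell y t) :
    GrayCell x t :=
  mk (.hc s.out.pre r.out.pre)

theorem GrayCell.vc_mk {x y : GrayOb z A B} {p q p' q' : x ⟶ y} (s : Pre p q) (t : Pre p' q')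
    (h : q = p') : GrayCell.vc (mk s) (mk t) h = mk (.vc s t h) :=
  sound (.vc_congr _ _ (out_mk s) (out_mk t))

theorem GrayCell.vc_congr {x y : GrayOb z A B} {s s' t t' : GrayCell x y} (hs : s = s')
    (ht : t = t') (h : s.tgt = t.src) :
    GrayCell.vc s t h = GrayCell.vc s' t' (by rw [← hs, ← ht, h]) := by
  subst hs ht; rfl

theorem GrayCell.hc_mk {x y t : GrayOb z A B} {p q : x ⟶ y} {p' q' : y ⟶ t} (s : Pre p q)
    (r : Pre p' q') : GrayCell.hc (mk s) (mk r) = mk (.hc s r) :=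
  sound (.hc_congr (out_mk s) (out_mk r))

theorem GrayCell.ind {x y : GrayOb z A B} {P : GrayCell x y → Prop}
    (h : ∀ (p q : x ⟶ y) (s : Pre p q), P (mk s)) (s : GrayCell x y) : P s :=
  _root_.Quotient.ind (s := preSetoid x y) (fun s => h s.src s.tgt s.pre) s

noncomputable instance : TwoCat (GrayOb z A B) where
  Cell := GrayCell
  src := GrayCell.src
  tgt := GrayCell.tgt
  one p := mk (.one p)
  vc := GrayCell.vc
  hc := GrayCell.hc
  src_one _ := rfl
  tgt_one _ := rfl
  src_vc a _ _ := a.src_out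
  tgt_vc _ b _ := b.tgt_out
  src_hc a b := congrArg₂ (· ≫ ·) a.src_out b.src_out
  tgt_hc a b := congrArg₂ (· ≫ ·) a.tgt_out b.tgt_out
  one_vc a := by
    induction a using GrayCell.ind with | h p q s =>
    exact (GrayCell.vc_mk _ _ _).trans (sound (.one_vc s rfl))
  vc_one a := by
    induction a using GrayCell.ind with | h p q s =>
    exact (GrayCell.vc_mk _ _ _).trans (sound (.vc_one s rfl))
  vc_assoc a b c h k := by
    induction a using GrayCell.ind with | h p₁ q₁ s₁ =>
    induction b using GrayCell.ind with | h p₂ q₂ s₂ =>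
    induction c using GrayCell.ind with | h p₃ q₃ s₃ =>
    exact (GrayCell.vc_congr (GrayCell.vc_mk s₁ s₂ h) rfl _).trans ((GrayCell.vc_mk _ _ _).trans
      ((sound (.vc_assoc _ _ _ _ _)).trans ((GrayCell.vc_mk _ _ _).symm.trans
        (GrayCell.vc_congr rfl (GrayCell.vc_mk s₂ s₃ k).symm _))))
  one_comp p q := (sound (.one_comp p q)).trans (GrayCell.hc_mk _ _).symm
  id_hc a := by
    induction a using GrayCell.ind with | h p q s =>
    exact (GrayCell.hc_mk _ _).trans (sound (.id_hc s))
  hc_id a := by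
    induction a using GrayCell.ind with | h p q s =>
    exact (GrayCell.hc_mk _ _).trans (sound (.hc_id s))
  hc_assoc a b c := by
    induction a using GrayCell.ind with | h p₁ q₁ s₁ =>
    induction b using GrayCell.ind with | h p₂ q₂ s₂ =>
    induction c using GrayCell.ind with | h p₃ q₃ s₃ =>
    rw [GrayCell.hc_mk, GrayCell.hc_mk, GrayCell.hc_mk, GrayCell.hc_mk]
    exact sound (.hc_assoc _ _ _)
  interchange a a' b b' h k := by
    induction a using GrayCell.ind with | h p₁ q₁ s₁ =>
    induction a' using GrayCell.ind with | h p₂ q₂ s₂ =>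
    induction b using GrayCell.ind with | h p₃ q₃ s₃ =>
    induction b' using GrayCell.ind with | h p₄ q₄ s₄ =>
    refine (congrArg₂ GrayCell.hc (GrayCell.vc_mk s₁ s₂ h) (GrayCell.vc_mk s₃ s₄ k)).trans
      ((GrayCell.hc_mk _ _).trans ((sound (.interchange _ _ _ _ _ _ ?_)).trans
        ((GrayCell.vc_mk _ _ ?_).symm.trans
          (GrayCell.vc_congr (GrayCell.hc_mk _ _).symm (GrayCell.hc_mk _ _).symm _))))
    all_goals exact congrArg₂ (· ≫ ·) h k

variable (z) in
/-- The 2-cell `(s, 1)`. -/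
def leftCell {a a' : A.carrier} (s : Cell a a') (b : B.carrier) :
    Cell (⟨a, b⟩ : GrayOb z A B) ⟨a', b⟩ := mk (.left s b)

variable (z) in
/-- The 2-cell `(1, s)`. -/
def rightCell (a : A.carrier) {b b' : B.carrier} (s : Cell b b') :
    Cell (⟨a, b⟩ : GrayOb z A B) ⟨a, b'⟩ := mk (.right a s)

/-- The Gray cell of `f` and `g`, from `(1, g) ≫ (f, 1)` to `(f, 1) ≫ (1, g)`, and in the
opposite direction if the weakness is `colax`. -/
def sigma : ∀ (z : Weakness) {a a' : A.carrier} {b b' : B.carrier} (_ : a ⟶ a') (_ : b ⟶ b'),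
    Cell (⟨a, b⟩ : GrayOb z A B) ⟨a', b'⟩
  | .strict, _, _, _, _, f, g => mk (.sig (by simp) f g)
  | .pseudo, _, _, _, _, f, g => mk (.sig (by simp) f g)
  | .lax, _, _, _, _, f, g => mk (.sig (by simp) f g)
  | .colax, _, _, _, _, f, g => mk (.sigOp (by simp) f g)

/-- The tight 1-cells of the tensor product, generated by `(f, 1)` and `(1, g)` for `f` and `g`
tight. -/
inductive Tight : ∀ {x y : GrayOb z A B}, (x ⟶ y) → Prop
  | id (x : GrayOb z A B) : Tight (𝟙 x)
  | comp {x y t : GrayOb z A B} (p : x ⟶ y) (q : y ⟶ t) : Tight p → Tight q → Tight (p ≫ q)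
  | left {a a' : A.carrier} (f : a ⟶ a') (b : B.carrier) (h : A.tight f) :
    Tight (Gray.left z f b)
  | right (a : A.carrier) {b b' : B.carrier} (g : b ⟶ b') (h : B.tight g) :
    Tight (Gray.right z a g)

/-- The cones of the tensor product: the images of the cones of the factors. -/
inductive Cone : ∀ {n : ℕ} {P X : GrayOb z A B}, (Fin n → (P ⟶ X)) → Prop
  | left {n : ℕ} {P X : A.carrier} (π : Fin n → (P ⟶ X)) (b : B.carrier) (h : A.cone π) :
    Cone fun i => Gray.left z (π i) b
  | right (a : A.carrier) {n : ℕ} {P X : B.carrier} (π : Fin n → (P ⟶ X)) (h : B.cone π) :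
    Cone fun i => Gray.right z a (π i)

theorem tight_of_cone {n : ℕ} {P X : GrayOb z A B} {π : Fin n → (P ⟶ X)} (h : Cone π)
    (i : Fin n) : Tight (π i) := by
  cases h with
  | left π b h => exact Tight.left _ _ (A.tight_of_cone π h i)
  | right a π h => exact Tight.right _ _ (B.tight_of_cone π h i)

end Gray

variable (z A B) in
/-- The semi-strict Gray tensor product of sketches. -/
noncomputable def grayTensor : FSketch where
  carrier := GrayOb z A B
  tight := Gray.Tight
  tight_id := Gray.Tight.id
  tight_comp := Gray.Tight.comp
  cone := Gray.Cone
  tight_of_cone _ h i := Gray.tight_of_cone h i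

end gray


namespace SketchHom

variable {z : Weakness} {A : FSketch.{u₁, v₁, w₁}} {B : FSketch.{u₂, v₂, w₂}}
  {D : FSketch.{u₃, v₃, w₃}} (M : SketchHom (grayTensor z A B) D)

/-- The value of a two-variable functor on a pair of objects. -/
def ob (a : A.carrier) (b : B.carrier) : D.carrier := M.obj (GrayOb.mk a b)

/-- The value on `(f, 1)`. -/
def mapLeft {a a' : A.carrier} (f : a ⟶ a') (b : B.carrier) : M.ob a b ⟶ M.ob a' b :=
  M.map (Gray.left z f b)

/-- The value on `(1, g)`. -/
def mapRight (a : A.carrier) {b b' : B.carrier} (g : b ⟶ b') : M.ob a b ⟶ M.ob a b' :=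
  M.map (Gray.right z a g)

/-- The value on `(s, 1)` for a 2-cell `s`. -/
def cellLeft {a a' : A.carrier} (s : Cell a a') (b : B.carrier) : Cell (M.ob a b) (M.ob a' b) :=
  M.mapCell (Gray.leftCell z s b)

/-- The value on `(1, s)` for a 2-cell `s`. -/
def cellRight (a : A.carrier) {b b' : B.carrier} (s : Cell b b') : Cell (M.ob a b) (M.ob a b') :=
  M.mapCell (Gray.rightCell z a s)

/-- The value on the Gray cell of `f` and `g`. -/
def cellSigma {a a' : A.carrier} {b b' : B.carrier} (f : a ⟶ a') (g : b ⟶ b') :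
    Cell (M.ob a b) (M.ob a' b') :=
  M.mapCell (Gray.sigma z f g)

end SketchHom

/-- A tight isomorphism in a sketch. -/
structure TightIso (S : FSketch.{u, v, w}) (x y : S.carrier) where
  hom : x ⟶ y
  inv : y ⟶ x
  hom_inv : hom ≫ inv = 𝟙 x
  inv_hom : inv ≫ hom = 𝟙 y
  tight_hom : S.tight hom
  tight_inv : S.tight inv

/-! ### Commutativities -/

/-- A magmal `z`-commutativity on a sketch: a unital magma structure
`mul : S ⊗ S → S`, `unit : 1 → S` for the semi-strict Gray tensor product, with unitality up to
invertible natural transformations of sketches (2-natural, with tight components). -/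
structure MagmalCommutativity (z : Weakness) (S : FSketch.{u, v, w}) where
  mul : SketchHom (grayTensor z S S) S
  unit : S.carrier
  lam : ∀ x : S.carrier, TightIso S (mul.ob unit x) x
  rho : ∀ x : S.carrier, TightIso S (mul.ob x unit) x
  lam_nat : ∀ {x y : S.carrier} (s : Cell x y),
    hc (mul.cellRight unit s) (one (lam y).hom) = hc (one (lam x).hom) s
  rho_nat : ∀ {x y : S.carrier} (s : Cell x y),
    hc (mul.cellLeft s unit) (one (rho y).hom) = hc (one (rho x).hom) s

/-- A `z`-commutativity on a sketch: a pseudomonoid structure for the semi-strict Gray tensor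
product. The associator is an invertible natural transformation of sketches between the two
functors `S ⊗ S ⊗ S → S`; its naturality is stated for the generating 2-cells of the triple
tensor product, that is, 2-cells in one variable and Gray cells in two variables. -/
structure Commutativity (z : Weakness) (S : FSketch.{u, v, w}) extends
    MagmalCommutativity z S where
  assoc : ∀ x y t : S.carrier, TightIso S (mul.ob (mul.ob x y) t) (mul.ob x (mul.ob y t))
  assoc_nat_one : ∀ {x x' : S.carrier} (s : Cell x x') (y t : S.carrier),
    hc (mul.cellLeft (mul.cellLeft s y) t) (one (assoc x' y t).hom) =
      hc (one (assoc x y t).hom) (mul.cellLeft s (mul.ob y t))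
  assoc_nat_two : ∀ (x : S.carrier) {y y' : S.carrier} (s : Cell y y') (t : S.carrier),
    hc (mul.cellLeft (mul.cellRight x s) t) (one (assoc x y' t).hom) =
      hc (one (assoc x y t).hom) (mul.cellRight x (mul.cellLeft s t))
  assoc_nat_three : ∀ (x y : S.carrier) {t t' : S.carrier} (s : Cell t t'),
    hc (mul.cellRight (mul.ob x y) s) (one (assoc x y t').hom) =
      hc (one (assoc x y t).hom) (mul.cellRight x (mul.cellRight y s))
  assoc_nat_one_two : ∀ {x x' y y' : S.carrier} (f : x ⟶ x') (g : y ⟶ y') (t : S.carrier),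
    hc (mul.cellLeft (mul.cellSigma f g) t) (one (assoc x' y' t).hom) =
      hc (one (assoc x y t).hom) (mul.cellSigma f (mul.mapLeft g t))
  assoc_nat_one_three : ∀ {x x' t t' : S.carrier} (f : x ⟶ x') (y : S.carrier) (h : t ⟶ t'),
    hc (mul.cellSigma (mul.mapLeft f y) h) (one (assoc x' y t').hom) =
      hc (one (assoc x y t).hom) (mul.cellSigma f (mul.mapRight y h))
  assoc_nat_two_three : ∀ (x : S.carrier) {y y' t t' : S.carrier} (g : y ⟶ y') (h : t ⟶ t'),
    hc (mul.cellSigma (mul.mapRight x g) h) (one (assoc x y' t').hom) =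
      hc (one (assoc x y t).hom) (mul.cellRight x (mul.cellSigma g h))
  triangle : ∀ x y : S.carrier,
    (assoc x unit y).hom ≫ mul.mapRight x (lam y).hom = mul.mapLeft (rho x).hom y
  pentagon : ∀ x y t r : S.carrier,
    mul.mapLeft (assoc x y t).hom r ≫ (assoc x (mul.ob y t) r).hom ≫
        mul.mapRight x (assoc y t r).hom =
      (assoc (mul.ob x y) t r).hom ≫ (assoc x y (mul.ob t r)).hom

/-- An isomorphism, over the identity of `S`, between two magmal `z`-commutativities on `S`. -/
structure MagmalIso {z : Weakness} {S : FSketch.{u, v, w}} (M N : MagmalCommutativity z S) where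
  mul : ∀ x y : S.carrier, TightIso S (M.mul.ob x y) (N.mul.ob x y)
  unit : TightIso S M.unit N.unit
  nat_left : ∀ {x x' : S.carrier} (s : Cell x x') (y : S.carrier),
    hc (M.mul.cellLeft s y) (one (mul x' y).hom) = hc (one (mul x y).hom) (N.mul.cellLeft s y)
  nat_right : ∀ (x : S.carrier) {y y' : S.carrier} (s : Cell y y'),
    hc (M.mul.cellRight x s) (one (mul x y').hom) = hc (one (mul x y).hom) (N.mul.cellRight x s)
  nat_sigma : ∀ {x x' y y' : S.carrier} (f : x ⟶ x') (g : y ⟶ y'),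
    hc (M.mul.cellSigma f g) (one (mul x' y').hom) =
      hc (one (mul x y).hom) (N.mul.cellSigma f g)
  lam : ∀ x : S.carrier,
    (M.lam x).hom = (mul M.unit x).hom ≫ N.mul.mapLeft unit.hom x ≫ (N.lam x).hom
  rho : ∀ x : S.carrier,
    (M.rho x).hom = (mul x M.unit).hom ≫ N.mul.mapRight x unit.hom ≫ (N.rho x).hom

/-- An isomorphism, over the identity of `S`, between two `z`-commutativities on `S`. -/
structure CommutativityIso {z : Weakness} {S : FSketch.{u, v, w}} (M N : Commutativity z S)
    extends MagmalIso M.toMagmalCommutativity N.toMagmalCommutativity where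
  assoc : ∀ x y t : S.carrier,
    (M.assoc x y t).hom ≫ (mul x (M.mul.ob y t)).hom ≫ N.mul.mapRight x (mul y t).hom =
      (mul (M.mul.ob x y) t).hom ≫ N.mul.mapLeft (mul x y).hom t ≫ (N.assoc x y t).hom

/-- A symmetry on a `z`-commutativity, for `z` strict or pseudo: it makes the pseudomonoid
symmetric. The symmetry `S ⊗ S → S ⊗ S` exchanges the variables and sends the Gray cell of `f`
and `g` to the inverse of the Gray cell of `g` and `f`. -/
@[ext]
structure Symmetry {z : Weakness} {S : FSketch.{u, v, w}} (M : Commutativity z S) where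
  braid : ∀ x y : S.carrier, M.mul.ob x y ⟶ M.mul.ob y x
  tight_braid : ∀ x y : S.carrier, S.tight (braid x y)
  braid_braid : ∀ x y : S.carrier, braid x y ≫ braid y x = 𝟙 _
  nat_left : ∀ {x x' : S.carrier} (s : Cell x x') (y : S.carrier),
    hc (M.mul.cellLeft s y) (one (braid x' y)) = hc (one (braid x y)) (M.mul.cellRight y s)
  nat_right : ∀ (x : S.carrier) {y y' : S.carrier} (s : Cell y y'),
    hc (M.mul.cellRight x s) (one (braid x y')) = hc (one (braid x y)) (M.mul.cellLeft s x)
  nat_sigma : ∀ {x x' y y' : S.carrier} (f : x ⟶ x') (g : y ⟶ y'),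
    ∃ c, IsInverse (M.mul.cellSigma g f) c ∧
      hc (M.mul.cellSigma f g) (one (braid x' y')) = hc (one (braid x y)) c
  unit : ∀ x : S.carrier, braid M.unit x ≫ (M.rho x).hom = (M.lam x).hom
  hexagon : ∀ x y t : S.carrier,
    (M.assoc x y t).hom ≫ braid x (M.mul.ob y t) ≫ (M.assoc y t x).hom =
      M.mul.mapLeft (braid x y) t ≫ (M.assoc y x t).hom ≫ M.mul.mapRight y (braid x t)

/-! ### The comparison for Lawvere 2-theories -/

/-- The sketch of a Lawvere 2-theory: the tight 1-cells are those in the image of `θ`, and the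
cones are all the cones for tight finite powers (power cones with tight projections, through which
1-cells with tight components factor tightly). -/
def LawvereTwoTheory.sketch (T : LawvereTwoTheory.{v, w}) : FSketch.{0, v, w} where
  carrier := T.Ob
  tight {X Y} f := ∃ φ : Fin (Arity.card Y) → Fin (Arity.card X), T.inert φ = f
  tight_id _ := ⟨fun i => i, T.θ_id _⟩
  tight_comp := by
    rintro X Y Z _ _ ⟨φ, rfl⟩ ⟨ψ, rfl⟩
    exact ⟨fun i => φ (ψ i), T.θ_comp φ ψ⟩
  cone {n P X} π := (∀ i, ∃ φ : Fin (Arity.card X) → Fin (Arity.card P), T.inert φ = π i) ∧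
    IsPower π ∧
    ∀ (Z : T.Ob) (f : Z ⟶ P),
      (∀ i, ∃ φ : Fin (Arity.card X) → Fin (Arity.card Z), T.inert φ = f ≫ π i) →
      ∃ φ : Fin (Arity.card P) → Fin (Arity.card Z), T.inert φ = f
  tight_of_cone _ h := h.1

/-- The magmal commutativity `M` induces the coherent system `σ`: under tight isomorphisms
`m · n ≅ mul (m, n)`, the actions of `mul` on 2-cells in one variable (and hence on 1-cells in one
variable) are `s · n` and `m · s`, and its action on Gray cells is `σ`. -/
def MagmalCommutativity.Induces {z : Weakness} {T : LawvereTwoTheory.{v, w}}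
    (M : MagmalCommutativity z T.sketch) (σ : CoherentSystem z T) : Prop :=
  ∃ φ : ∀ m n : ℕ, TightIso T.sketch (T.ob (m * n)) (M.mul.ob (T.ob m) (T.ob n)),
    (∀ {m m' : ℕ} (s : Cell (T.ob m) (T.ob m')) (n : ℕ),
      hc (one (φ m n).hom) (M.mul.cellLeft s (T.ob n)) =
        hc (T.colCell s n) (one (φ m' n).hom)) ∧
    (∀ (m : ℕ) {n n' : ℕ} (s : Cell (T.ob n) (T.ob n')),
      hc (one (φ m n).hom) (M.mul.cellRight (T.ob m) s) =
        hc (T.rowCell m s) (one (φ m n').hom)) ∧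
    ∀ {m m' n n' : ℕ} (α : T.ob m ⟶ T.ob m') (β : T.ob n ⟶ T.ob n'),
      hc (one (φ m n).hom) (M.mul.cellSigma α β) = hc (σ.σ α β) (one (φ m' n').hom)

/-- The coherent system is symmetric: `σ β α`, conjugated by the transpositions `m · k ≅ k · m`,
is the inverse of `σ α β`. -/
def CoherentSystem.IsSymmetric {z : Weakness} {T : LawvereTwoTheory.{v, w}}
    (σ : CoherentSystem z T) : Prop :=
  ∀ {m n k l : ℕ} (α : T.ob m ⟶ T.ob n) (β : T.ob k ⟶ T.ob l),
    IsInverse (σ.σ α β)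
      (hc (one (T.transpose m k)) (hc (σ.σ β α) (one (T.transpose l n))))

section

variable {C : Type u} [TwoCat.{u, v, w} C] [ChosenPowers C]

/-- The canonical isomorphism `(X ^ k) ^ m ⟶ X ^ (m * k)`. -/
noncomputable def flatten (X : C) (m k : ℕ) : pow (pow X k) m ⟶ pow X (m * k) :=
  (isPower X (m * k)).lift fun t =>
    proj (pow X k) m (finProdFinEquiv.symm t).1 ≫ proj X k (finProdFinEquiv.symm t).2

/-- The canonical isomorphism `X ^ (m * k) ⟶ (X ^ k) ^ m`. -/
noncomputable def unflatten (X : C) (m k : ℕ) : pow X (m * k) ⟶ pow (pow X k) m :=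
  (isPower (pow X k) m).lift fun i => (isPower X k).lift fun j =>
    proj X (m * k) (finProdFinEquiv (i, j))

end

/-- The section `L` is given by the coherent system `σ`: for a model `X` in `C`, with image `Y`
under `L` (so that `Y.base = X`), the operation `Y β` is the `z`-homomorphism of models
`X ^ k ⟶ X ^ l` whose cell at `α` is `X (σ α β)`. -/
def LiftSection.IsGivenBy {z : Weakness} {T : LawvereTwoTheory.{v, w}}
    (L : LiftSection.{u} z T) (σ : CoherentSystem z T) : Prop :=
  ∀ (C : PowTwoCat.{u, v, w}) (X : Model z T C.carrier) {m n k l : ℕ}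
    (α : T.ob m ⟶ T.ob n) (β : T.ob k ⟶ T.ob l),
    Model.Hom.cell (((L.lift C).obj X).map β) α =
      hc (one (flatten ((L.lift C).obj X).base.base m k))
        (hc (((L.lift C).obj X).base.mapCell (σ.σ α β))
          (one (unflatten ((L.lift C).obj X).base.base n l)))

end TwoDim

open TwoDim

universe u v w

/-!
The statement rests on one classification and one rigidity property.

A 2-functor on the semi-strict Gray tensor product is the same as a 2-functor in each of two
variables together with interchange cells (`Bifunctor`): `Bifunctor.desc` evaluates formal
composites, and `TwoFunctor.toBifunctor` restricts to generators. A coherent system `σ` is exactly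
what turns `(m, n) ↦ m · n` into such a functor, with the `σ α β` as interchange cells. All the
coherence isomorphisms of the resulting `CoherentSystem.commutativity` are reindexings of arrays.

Conversely, the only inert 1-cell `1 ⟶ 1` is the identity, so there is at most one inert 1-cell to
`1` from an object inertly isomorphic to `1` (`InertIso.eq_of_inert`). Let `(mul, u)` be a magmal
commutativity. As `mul (-, 1)` preserves tight powers, `1 ≅ mul (u, 1)` is a tight `u`-th power of
`mul (1, 1)`, which forces `mul (1, 1) ≅ 1` (`UnitalBifunctor.nonempty_iso_one`). So `mul (x, y)` is
a power of `1` with projections the entries in row `i` and column `j`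
(`UnitalBifunctor.isInertPower_entry`). The induced isomorphisms `m · n ≅ mul (m, n)` carry the Gray
cells to a coherent system (`MagmalCommutativity.system`), and they are the only ones compatible
with the actions on cells (`UnitalBifunctor.arrIso_unique`). Comparing entries, rigidity also
determines the associator (`Commutativity.assoc_entry`) and the braiding
(`UnitalBifunctor.eq_flip`). Hence commutativities with the same system are isomorphic, with or
without their associators, and the one condition for a symmetry that is not automatic is that the
system is symmetric (`UnitalBifunctor.isSymmetric_iff`).

For sections, a coherent system makes the operation `X β` of a model `X` into a homomorphism
`X ^ k ⟶ X ^ l` with the cell `X (σ α β)` at `α` (`CoherentSystem.liftOp`). Doing so for all `β`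
gives a model in models, 2-functorially in `X` (`CoherentSystem.liftTwoFunctor`). Naturality in the
target holds because the two forgetful 2-functors from models in models to models are jointly
faithful (`Model.twoFunctor_ext_forget`). In the other direction, every model is the image of the
generic model in `T` itself (`Syn.push_generic`), so a section is determined by its value there.
That value is a model in models with both underlying models generic, and the cells of its operations
form a coherent system (`Model.exists_liftObj_eq`).
-/

namespace TwoDim

open TwoCat ChosenPowers

universe u₁ v₁ w₁ u₂ v₂ w₂ u₃ v₃ w₃

/-! ### Pasting of 2-cells -/

section calculus

variable {C : Type u} [TwoCat.{u, v, w} C] {z : Weakness} {W X Y Z V : C}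

attribute [simp] hc_assoc

@[simp] theorem hc_one_one (f : X ⟶ Y) (g : Y ⟶ Z) : hc (one f) (one g) = one (f ≫ g) :=
  (one_comp f g).symm

@[simp] theorem hc_one_hc (f : W ⟶ X) (g : X ⟶ Y) (s : Cell Y Z) :
    hc (one f) (hc (one g) s) = hc (one (f ≫ g)) s := by
  rw [← hc_assoc, hc_one_one]

theorem hc_reassoc {s : Cell X Y} {g : Y ⟶ Z} {f : X ⟶ W} {t : Cell W Z}
    (e : hc s (one g) = hc (one f) t) (k : Z ⟶ V) :
    hc s (one (g ≫ k)) = hc (one f) (hc t (one k)) := by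
  rw [one_comp, ← hc_assoc, e, hc_assoc]

/-- The cell `c` is the pasting of `a` and `b`, in the order prescribed by the weakness. Stating
this as a relation keeps the proof that `a` and `b` are composable out of the terms. -/
def Pastes (z : Weakness) (a b c : Cell X Y) : Prop := ∃ h : otgt z a = osrc z b, ovc z a b h = c

/-- The pastings of `a` with `b` and of `c` with `d` are defined and equal. -/
def PasteEq (z : Weakness) (a b c d : Cell X Y) : Prop := ∃ e, Pastes z a b e ∧ Pastes z c d e

theorem pasteEq_iff {a b c d : Cell X Y} :
    PasteEq z a b c d ↔ ∃ h h', ovc z a b h = ovc z c d h' :=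
  ⟨fun ⟨_, ⟨h, e⟩, ⟨h', e'⟩⟩ => ⟨h, h', e.trans e'.symm⟩,
    fun ⟨h, h', e⟩ => ⟨_, ⟨h, rfl⟩, ⟨h', e.symm⟩⟩⟩

namespace Pastes

variable {a b c d ab bc : Cell X Y}

theorem of_ovc (h : otgt z a = osrc z b) : Pastes z a b (ovc z a b h) := ⟨h, rfl⟩

theorem of_vc (h : tgt a = src b) : Pastes .lax a b (vc a b h) := ⟨h, rfl⟩

theorem match_eq (h : Pastes z a b c) : otgt z a = osrc z b := h.1

theorem osrc_eq (h : Pastes z a b c) : osrc z c = osrc z a := by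
  obtain ⟨h, rfl⟩ := h; simp

theorem otgt_eq (h : Pastes z a b c) : otgt z c = otgt z b := by
  obtain ⟨h, rfl⟩ := h; simp

theorem unique (h : Pastes z a b c) (h' : Pastes z a b d) : c = d := by
  obtain ⟨h, rfl⟩ := h; obtain ⟨_, rfl⟩ := h'; rfl

theorem one_left {f : X ⟶ Y} (h : f = osrc z a) : Pastes z (one f) a a :=
  ⟨by simp [h], one_ovc z _ _⟩

theorem one_right {f : X ⟶ Y} (h : otgt z a = f) : Pastes z a (one f) a :=
  ⟨by simp [h], ovc_one z _ _⟩

theorem assoc_right (h : Pastes z a b ab) (k : Pastes z b c bc) (l : Pastes z ab c d) :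
    Pastes z a bc d := by
  obtain ⟨h, rfl⟩ := h; obtain ⟨k, rfl⟩ := k; obtain ⟨l, rfl⟩ := l
  exact ⟨by simp [h], (ovc_assoc z a b c h k).symm⟩

theorem assoc_left (h : Pastes z a b ab) (k : Pastes z b c bc) (l : Pastes z a bc d) :
    Pastes z ab c d := by
  obtain ⟨h, rfl⟩ := h; obtain ⟨k, rfl⟩ := k; obtain ⟨l, rfl⟩ := l
  exact ⟨by simp [k], ovc_assoc z a b c h k⟩

theorem whiskerLeft (h : Pastes z a b c) (f : W ⟶ X) :
    Pastes z (hc (one f) a) (hc (one f) b) (hc (one f) c) := by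
  obtain ⟨h, rfl⟩ := h
  exact ⟨by simp [h], (hc_ovc z f a b h).symm⟩

theorem whiskerRight (h : Pastes z a b c) (f : Y ⟶ Z) :
    Pastes z (hc a (one f)) (hc b (one f)) (hc c (one f)) := by
  obtain ⟨h, rfl⟩ := h
  exact ⟨by simp [h], (ovc_hc z a b f h).symm⟩

end Pastes

theorem PasteEq.whiskerLeft {a b c d : Cell X Y} (h : PasteEq z a b c d) (f : W ⟶ X) :
    PasteEq z (hc (one f) a) (hc (one f) b) (hc (one f) c) (hc (one f) d) := by
  obtain ⟨e, h, k⟩ := h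
  exact ⟨_, h.whiskerLeft f, k.whiskerLeft f⟩

theorem PasteEq.whiskerRight {a b c d : Cell X Y} (h : PasteEq z a b c d) (f : Y ⟶ Z) :
    PasteEq z (hc a (one f)) (hc b (one f)) (hc c (one f)) (hc d (one f)) := by
  obtain ⟨e, h, k⟩ := h
  exact ⟨_, h.whiskerRight f, k.whiskerRight f⟩

theorem TwoFunctor.pastes {D : Type u₁} [TwoCat.{u₁, v₁, w₁} D] (F : TwoFunctor C D)
    {a b c : Cell X Y} (h : Pastes z a b c) :
    Pastes z (F.mapCell a) (F.mapCell b) (F.mapCell c) := by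
  obtain ⟨h, rfl⟩ := h
  exact ⟨by simp [h], (F.mapCell_ovc z a b h).symm⟩

theorem TwoFunctor.pasteEq {D : Type u₁} [TwoCat.{u₁, v₁, w₁} D] (F : TwoFunctor C D)
    {a b c d : Cell X Y} (h : PasteEq z a b c d) :
    PasteEq z (F.mapCell a) (F.mapCell b) (F.mapCell c) (F.mapCell d) := by
  obtain ⟨e, h, k⟩ := h
  exact ⟨_, F.pastes h, F.pastes k⟩

theorem IsPower.pastes {n : ℕ} {π : Fin n → (Y ⟶ Z)} (hπ : IsPower π) {a b c : Cell X Y}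
    (h : ∀ i, Pastes z (hc a (one (π i))) (hc b (one (π i))) (hc c (one (π i)))) :
    Pastes z a b c := by
  have m : otgt z a = osrc z b := hπ.hom_ext fun i => by simpa using (h i).match_eq
  refine ⟨m, hπ.cell_ext fun i => ?_⟩
  exact ((Pastes.of_ovc m).whiskerRight (π i)).unique (h i)

theorem one_injective {f g : X ⟶ Y} (h : one f = one g) : f = g := by
  rw [← src_one f, h, src_one]

theorem src_eq_osrc (hz : z ≠ .colax) (a : Cell X Y) : src a = osrc z a := by
  cases z <;> first | rfl | exact absurd rfl hz

theorem tgt_eq_otgt (hz : z ≠ .colax) (a : Cell X Y) : tgt a = otgt z a := by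
  cases z <;> first | rfl | exact absurd rfl hz

theorem Pastes.lax (hz : z ≠ .colax) {a b c : Cell X Y} (h : Pastes z a b c) :
    Pastes .lax a b c := by
  cases z <;> first | exact h | exact absurd rfl hz

theorem PasteEq.lax (hz : z ≠ .colax) {a b c d : Cell X Y} (h : PasteEq z a b c d) :
    PasteEq .lax a b c d := by
  obtain ⟨e, h, k⟩ := h
  exact ⟨e, h.lax hz, k.lax hz⟩

theorem IsInverse.pastes {a b : Cell X Y} (h : IsInverse a b) :
    Pastes .lax a b (one (src a)) ∧ Pastes .lax b a (one (src b)) := by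
  obtain ⟨h, k, e, e'⟩ := h
  exact ⟨⟨h, e⟩, ⟨k, e'⟩⟩

theorem IsInverse.of_pastes {a b : Cell X Y} (h : Pastes .lax a b (one (src a)))
    (k : Pastes .lax b a (one (src b))) : IsInverse a b := by
  obtain ⟨h, e⟩ := h; obtain ⟨k, e'⟩ := k
  exact ⟨h, k, e, e'⟩

theorem IsInverse.tgt_eq {a b : Cell X Y} (h : IsInverse a b) : tgt a = src b := h.1

theorem IsInverse.src_eq {a b : Cell X Y} (h : IsInverse a b) : src a = tgt b := h.2.1.symm

theorem IsInverse.whiskerLeft {a b : Cell X Y} (h : IsInverse a b) (f : W ⟶ X) :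
    IsInverse (hc (one f) a) (hc (one f) b) := by
  refine .of_pastes ?_ ?_
  · simpa using h.pastes.1.whiskerLeft f
  · simpa using h.pastes.2.whiskerLeft f

theorem IsInverse.whiskerRight {a b : Cell X Y} (h : IsInverse a b) (f : Y ⟶ Z) :
    IsInverse (hc a (one f)) (hc b (one f)) := by
  refine .of_pastes ?_ ?_
  · simpa using h.pastes.1.whiskerRight f
  · simpa using h.pastes.2.whiskerRight f

/-- Two sides of a commutative square of cells may be replaced by their inverses. -/
theorem IsInverse.pasteEq {a b c d b' c' : Cell X Y} (hb : IsInverse b b') (hc : IsInverse c c')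
    (h : PasteEq .lax a b c d) : PasteEq .lax c' a d b' := by
  obtain ⟨e, h, k⟩ := h
  -- `c' ; a` equals `c' ; (a ; b) ; b' = c' ; (c ; d) ; b' = d ; b'`
  have s : src a = src c := by
    have h₁ := h.osrc_eq; have h₂ := k.osrc_eq
    exact h₁.symm.trans h₂
  have t : tgt d = tgt b := by
    have h₁ := h.otgt_eq; have h₂ := k.otgt_eq
    exact h₂.symm.trans h₁
  have m : tgt c' = src a := hc.src_eq.symm.trans s.symm
  have m' : tgt d = src b' := t.trans hb.tgt_eq
  have n : tgt c = src d := k.match_eq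
  have l : tgt a = src b := h.match_eq
  have ed : Pastes .lax c' e d := by
    refine Pastes.assoc_right hc.pastes.2 k (.one_left ?_)
    exact (hc.tgt_eq.symm.trans n)
  have ea : Pastes .lax e b' a :=
    Pastes.assoc_left h hb.pastes.1 (.one_right l)
  refine ⟨_, .of_vc m, ?_⟩
  exact Pastes.assoc_left ed ea (.of_vc m)

theorem IsInverse.comp {a b c a' b' : Cell X Y} (ha : IsInverse a a') (hb : IsInverse b b')
    (h : Pastes .lax a b c) {c' : Cell X Y} (h' : Pastes .lax b' a' c') : IsInverse c c' := by
  have l : tgt a = src b := h.match_eq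
  refine .of_pastes ?_ ?_
  · have h₁ : Pastes .lax b c' a' :=
      Pastes.assoc_right hb.pastes.1 h' (.one_left (l.symm.trans ha.tgt_eq))
    refine Pastes.assoc_left h h₁ ?_
    rw [show src c = src a from h.osrc_eq]
    exact ha.pastes.1
  · have h₁ : Pastes .lax a' c b :=
      Pastes.assoc_right ha.pastes.2 h (.one_left (ha.tgt_eq.symm.trans l))
    refine Pastes.assoc_left h' h₁ ?_
    rw [show src c' = src b' from h'.osrc_eq]
    exact hb.pastes.2

theorem IsInverse.unique {a b b' : Cell X Y} (h : IsInverse a b) (h' : IsInverse a b') :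
    b = b' := by
  have h₁ : Pastes .lax b (one (src a)) b := .one_right h.src_eq.symm
  have h₂ : Pastes .lax (one (src b)) b' b' := .one_left (h.tgt_eq.symm.trans h'.tgt_eq)
  exact (Pastes.assoc_left h.pastes.2 h'.pastes.1 h₁).unique h₂

theorem Pastes.trans_eq {a b c d : Cell X Y} (h : Pastes z a b c) (e : c = d) : Pastes z a b d :=
  e ▸ h

theorem Pastes.congr {a b c a' b' : Cell X Y} (h : Pastes z a b c) (ha : a = a')
    (hb : b = b') : Pastes z a' b' c := by subst ha hb; exact h

end calculus

/-! ### The universal property of the semi-strict Gray tensor product -/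

/-- A 2-functor in each of two variables, with a `z`-cell filling each interchange square, which
is an identity if one of the two sides lies in the given class of 1-cells: the data classified by
the semi-strict Gray tensor product. -/
structure Bifunctor (z : Weakness) (A : Type u₁) [TwoCat.{u₁, v₁, w₁} A] (B : Type u₂)
    [TwoCat.{u₂, v₂, w₂} B] (D : Type u₃) [TwoCat.{u₃, v₃, w₃} D]
    (tA : ∀ {a a' : A}, (a ⟶ a') → Prop) (tB : ∀ {b b' : B}, (b ⟶ b') → Prop) where
  ob : A → B → D
  mapL : ∀ {a a' : A} (_ : a ⟶ a') (b : B), ob a b ⟶ ob a' b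
  mapR : ∀ (a : A) {b b' : B} (_ : b ⟶ b'), ob a b ⟶ ob a b'
  cellL : ∀ {a a' : A} (_ : Cell a a') (b : B), Cell (ob a b) (ob a' b)
  cellR : ∀ (a : A) {b b' : B} (_ : Cell b b'), Cell (ob a b) (ob a b')
  sigma : ∀ {a a' : A} {b b' : B} (_ : a ⟶ a') (_ : b ⟶ b'), Cell (ob a b) (ob a' b')
  src_cellL : ∀ {a a' : A} (s : Cell a a') (b : B), src (cellL s b) = mapL (src s) b
  tgt_cellL : ∀ {a a' : A} (s : Cell a a') (b : B), tgt (cellL s b) = mapL (tgt s) b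
  src_cellR : ∀ (a : A) {b b' : B} (s : Cell b b'), src (cellR a s) = mapR a (src s)
  tgt_cellR : ∀ (a : A) {b b' : B} (s : Cell b b'), tgt (cellR a s) = mapR a (tgt s)
  mapL_id : ∀ a b, mapL (𝟙 a) b = 𝟙 _
  mapR_id : ∀ a b, mapR a (𝟙 b) = 𝟙 _
  cellL_one : ∀ {a a' : A} (f : a ⟶ a') (b : B), cellL (one f) b = one (mapL f b)
  cellR_one : ∀ (a : A) {b b' : B} (g : b ⟶ b'), cellR a (one g) = one (mapR a g)
  cellL_vc : ∀ {a a' : A} (s t r : Cell a a') (b : B), Pastes .lax s t r →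
    Pastes .lax (cellL s b) (cellL t b) (cellL r b)
  cellR_vc : ∀ (a : A) {b b' : B} (s t r : Cell b b'), Pastes .lax s t r →
    Pastes .lax (cellR a s) (cellR a t) (cellR a r)
  cellL_hc : ∀ {a a' a'' : A} (s : Cell a a') (t : Cell a' a'') (b : B),
    cellL (hc s t) b = hc (cellL s b) (cellL t b)
  cellR_hc : ∀ (a : A) {b b' b'' : B} (s : Cell b b') (t : Cell b' b''),
    cellR a (hc s t) = hc (cellR a s) (cellR a t)
  osrc_sigma : ∀ {a a' : A} {b b' : B} (f : a ⟶ a') (g : b ⟶ b'),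
    osrc z (sigma f g) = mapR a g ≫ mapL f b'
  otgt_sigma : ∀ {a a' : A} {b b' : B} (f : a ⟶ a') (g : b ⟶ b'),
    otgt z (sigma f g) = mapL f b ≫ mapR a' g
  isWCell : ∀ {a a' : A} {b b' : B} (f : a ⟶ a') (g : b ⟶ b'), IsWCell z (sigma f g)
  sigma_strict : ∀ {a a' : A} {b b' : B} (f : a ⟶ a') (g : b ⟶ b'), tA f ∨ tB g →
    sigma f g = one (mapL f b ≫ mapR a' g)
  sigma_comp_left : ∀ {a a' a'' : A} {b b' : B} (f : a ⟶ a') (f' : a' ⟶ a'') (g : b ⟶ b'),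
    Pastes z (hc (sigma f g) (one (mapL f' b'))) (hc (one (mapL f b)) (sigma f' g))
      (sigma (f ≫ f') g)
  sigma_comp_right : ∀ {a a' : A} {b b' b'' : B} (f : a ⟶ a') (g : b ⟶ b') (g' : b' ⟶ b''),
    Pastes z (hc (one (mapR a g)) (sigma f g')) (hc (sigma f g) (one (mapR a' g')))
      (sigma f (g ≫ g'))
  sigma_nat_left : ∀ {a a' : A} {b b' : B} (s : Cell a a') (g : b ⟶ b'),
    PasteEq z (hc (one (mapR a g)) (cellL s b')) (sigma (otgt z s) g)
      (sigma (osrc z s) g) (hc (cellL s b) (one (mapR a' g)))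
  sigma_nat_right : ∀ {a a' : A} {b b' : B} (f : a ⟶ a') (s : Cell b b'),
    PasteEq z (hc (cellR a s) (one (mapL f b'))) (sigma f (otgt z s))
      (sigma f (osrc z s)) (hc (one (mapL f b)) (cellR a' s))

namespace Bifunctor

section

variable {z : Weakness} {A : Type u₁} [TwoCat.{u₁, v₁, w₁} A] {B : Type u₂}
  [TwoCat.{u₂, v₂, w₂} B] {D : Type u₃} [TwoCat.{u₃, v₃, w₃} D]
  {tA : ∀ {a a' : A}, (a ⟶ a') → Prop} {tB : ∀ {b b' : B}, (b ⟶ b') → Prop}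
  (F : Bifunctor z A B D tA tB)

theorem mapL_comp {a a' a'' : A} (f : a ⟶ a') (f' : a' ⟶ a'') (b : B) :
    F.mapL (f ≫ f') b = F.mapL f b ≫ F.mapL f' b :=
  one_injective (by rw [← F.cellL_one, one_comp, one_comp, F.cellL_hc, F.cellL_one, F.cellL_one])

theorem mapR_comp (a : A) {b b' b'' : B} (g : b ⟶ b') (g' : b' ⟶ b'') :
    F.mapR a (g ≫ g') = F.mapR a g ≫ F.mapR a g' :=
  one_injective (by rw [← F.cellR_one, one_comp, one_comp, F.cellR_hc, F.cellR_one, F.cellR_one])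

theorem swap {a a' : A} {b b' : B} (f : a ⟶ a') (g : b ⟶ b') (h : tA f ∨ tB g) :
    F.mapR a g ≫ F.mapL f b' = F.mapL f b ≫ F.mapR a' g := by
  rw [← F.osrc_sigma, F.sigma_strict f g h, osrc_one]

/-- The interchange cell is an identity for `z` strict, too. -/
theorem sigma_eq_one {a a' : A} {b b' : B} (f : a ⟶ a') (g : b ⟶ b')
    (h : z = .strict ∨ tA f ∨ tB g) : F.sigma f g = one (F.mapL f b ≫ F.mapR a' g) := by
  rcases h with rfl | h
  · have e : F.sigma f g = one (src (F.sigma f g)) := F.isWCell f g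
    rw [← F.otgt_sigma, e, otgt_one]
  · exact F.sigma_strict f g h

theorem swap' {a a' : A} {b b' : B} (f : a ⟶ a') (g : b ⟶ b')
    (h : z = .strict ∨ tA f ∨ tB g) :
    F.mapR a g ≫ F.mapL f b' = F.mapL f b ≫ F.mapR a' g := by
  rw [← F.osrc_sigma, F.sigma_eq_one f g h, osrc_one]

theorem exists_sigmaOp {a a' : A} {b b' : B} (f : a ⟶ a') (g : b ⟶ b') :
    ∃ c : Cell (F.ob a b) (F.ob a' b'), (z = .colax → c = F.sigma f g) ∧
      (z = .pseudo → IsInverse (F.sigma f g) c) := by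
  have h := F.isWCell f g
  cases z
  · exact ⟨F.sigma f g, by simp, by simp⟩
  · obtain ⟨c, hc⟩ := h
    exact ⟨c, by simp, fun _ => hc⟩
  · exact ⟨F.sigma f g, by simp, by simp⟩
  · exact ⟨F.sigma f g, by simp, by simp⟩

/-- The image of the Gray cell `sigOp`: the interchange cell if `z` is `colax`, and its inverse
if `z` is `pseudo`. -/
noncomputable def sigmaOp {a a' : A} {b b' : B} (f : a ⟶ a') (g : b ⟶ b') :
    Cell (F.ob a b) (F.ob a' b') := (F.exists_sigmaOp f g).choose

theorem sigmaOp_inverse (hz : z = .pseudo) {a a' : A} {b b' : B} (f : a ⟶ a') (g : b ⟶ b') :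
    IsInverse (F.sigma f g) (F.sigmaOp f g) := (F.exists_sigmaOp f g).choose_spec.2 hz

theorem src_sigma (hz : z ≠ .colax) {a a' : A} {b b' : B} (f : a ⟶ a') (g : b ⟶ b') :
    src (F.sigma f g) = F.mapR a g ≫ F.mapL f b' := by rw [src_eq_osrc hz, F.osrc_sigma]

theorem tgt_sigma (hz : z ≠ .colax) {a a' : A} {b b' : B} (f : a ⟶ a') (g : b ⟶ b') :
    tgt (F.sigma f g) = F.mapL f b ≫ F.mapR a' g := by rw [tgt_eq_otgt hz, F.otgt_sigma]

end

section colax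

variable {A : Type u₁} [TwoCat.{u₁, v₁, w₁} A] {B : Type u₂}
  [TwoCat.{u₂, v₂, w₂} B] {D : Type u₃} [TwoCat.{u₃, v₃, w₃} D]
  {tA : ∀ {a a' : A}, (a ⟶ a') → Prop} {tB : ∀ {b b' : B}, (b ⟶ b') → Prop}

theorem sigmaOp_colax (F : Bifunctor .colax A B D tA tB) {a a' : A} {b b' : B} (f : a ⟶ a')
    (g : b ⟶ b') : F.sigmaOp f g = F.sigma f g := (F.exists_sigmaOp f g).choose_spec.1 rfl

theorem Pastes.of_colax {X Y : D} {a b c : Cell X Y} (h : Pastes .colax a b c) :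
    Pastes .lax b a c := ⟨h.1.symm, h.2⟩

theorem PasteEq.of_colax {X Y : D} {a b c d : Cell X Y} (h : PasteEq .colax a b c d) :
    PasteEq .lax d c b a := by
  obtain ⟨e, h, k⟩ := h
  exact ⟨e, Pastes.of_colax k, Pastes.of_colax h⟩

end colax

section sigmaOp

variable {z : Weakness} {A : Type u₁} [TwoCat.{u₁, v₁, w₁} A] {B : Type u₂}
  [TwoCat.{u₂, v₂, w₂} B] {D : Type u₃} [TwoCat.{u₃, v₃, w₃} D]
  {tA : ∀ {a a' : A}, (a ⟶ a') → Prop} {tB : ∀ {b b' : B}, (b ⟶ b') → Prop}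
  (F : Bifunctor z A B D tA tB) (hz : z = .colax ∨ z = .pseudo)

include hz

theorem src_sigmaOp {a a' : A} {b b' : B} (f : a ⟶ a') (g : b ⟶ b') :
    src (F.sigmaOp f g) = F.mapL f b ≫ F.mapR a' g := by
  rcases hz with rfl | rfl
  · rw [F.sigmaOp_colax]; exact F.otgt_sigma f g
  · rw [← (F.sigmaOp_inverse rfl f g).tgt_eq]; exact F.otgt_sigma f g

theorem tgt_sigmaOp {a a' : A} {b b' : B} (f : a ⟶ a') (g : b ⟶ b') :
    tgt (F.sigmaOp f g) = F.mapR a g ≫ F.mapL f b' := by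
  rcases hz with rfl | rfl
  · rw [F.sigmaOp_colax]; exact F.osrc_sigma f g
  · rw [← (F.sigmaOp_inverse rfl f g).src_eq]; exact F.osrc_sigma f g

theorem sigmaOp_eq_one {a a' : A} {b b' : B} (f : a ⟶ a') (g : b ⟶ b') (h : tA f ∨ tB g) :
    F.sigmaOp f g = one (F.mapL f b ≫ F.mapR a' g) := by
  rcases hz with rfl | rfl
  · rw [F.sigmaOp_colax, F.sigma_strict f g h]
  · have k := F.sigmaOp_inverse rfl f g
    rw [F.sigma_strict f g h] at k
    refine k.unique (.of_pastes ?_ ?_) <;>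
      · rw [src_one]; exact .one_left (osrc_one _ _).symm

theorem sigmaOp_comp_left {a a' a'' : A} {b b' : B} (f : a ⟶ a') (f' : a' ⟶ a'') (g : b ⟶ b') :
    Pastes .lax (hc (one (F.mapL f b)) (F.sigmaOp f' g))
      (hc (F.sigmaOp f g) (one (F.mapL f' b'))) (F.sigmaOp (f ≫ f') g) := by
  rcases hz with rfl | rfl
  · simp only [F.sigmaOp_colax]; exact Pastes.of_colax (F.sigma_comp_left f f' g)
  · have h := (F.sigma_comp_left f f' g).lax (by simp)
    have h' : tgt (hc (one (F.mapL f b)) (F.sigmaOp f' g)) =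
        src (hc (F.sigmaOp f g) (one (F.mapL f' b'))) := by
      have := h.match_eq
      simp only [tgt_hc, src_hc, tgt_one, src_one]
      rw [← (F.sigmaOp_inverse rfl f g).tgt_eq, ← (F.sigmaOp_inverse rfl f' g).src_eq]
      simpa [otgt, osrc, pick] using this.symm
    have k := IsInverse.comp ((F.sigmaOp_inverse rfl f g).whiskerRight (F.mapL f' b'))
      ((F.sigmaOp_inverse rfl f' g).whiskerLeft (F.mapL f b)) h (.of_vc h')
    rw [(F.sigmaOp_inverse rfl (f ≫ f') g).unique k]
    exact .of_vc h'

theorem sigmaOp_comp_right {a a' : A} {b b' b'' : B} (f : a ⟶ a') (g : b ⟶ b') (g' : b' ⟶ b'') :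
    Pastes .lax (hc (F.sigmaOp f g) (one (F.mapR a' g')))
      (hc (one (F.mapR a g)) (F.sigmaOp f g')) (F.sigmaOp f (g ≫ g')) := by
  rcases hz with rfl | rfl
  · simp only [F.sigmaOp_colax]; exact Pastes.of_colax (F.sigma_comp_right f g g')
  · have h := (F.sigma_comp_right f g g').lax (by simp)
    have h' : tgt (hc (F.sigmaOp f g) (one (F.mapR a' g'))) =
        src (hc (one (F.mapR a g)) (F.sigmaOp f g')) := by
      have := h.match_eq
      simp only [tgt_hc, src_hc, tgt_one, src_one]
      rw [← (F.sigmaOp_inverse rfl f g').tgt_eq, ← (F.sigmaOp_inverse rfl f g).src_eq]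
      simpa [otgt, osrc, pick] using this.symm
    have k := IsInverse.comp ((F.sigmaOp_inverse rfl f g').whiskerLeft (F.mapR a g))
      ((F.sigmaOp_inverse rfl f g).whiskerRight (F.mapR a' g')) h (.of_vc h')
    rw [(F.sigmaOp_inverse rfl f (g ≫ g')).unique k]
    exact .of_vc h'

theorem sigmaOp_nat_left {a a' : A} {b b' : B} (s : Cell a a') (g : b ⟶ b') :
    PasteEq .lax (hc (F.cellL s b) (one (F.mapR a' g))) (F.sigmaOp (tgt s) g)
      (F.sigmaOp (src s) g) (hc (one (F.mapR a g)) (F.cellL s b')) := by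
  have h := F.sigma_nat_left s g
  rcases hz with rfl | rfl
  · simp only [F.sigmaOp_colax] at *; exact PasteEq.of_colax h
  · obtain ⟨e, k₁, k₂⟩ := (F.sigmaOp_inverse rfl (tgt s) g).pasteEq
      (F.sigmaOp_inverse rfl (src s) g) (h.lax (by simp))
    exact ⟨e, k₂, k₁⟩

theorem sigmaOp_nat_right {a a' : A} {b b' : B} (f : a ⟶ a') (s : Cell b b') :
    PasteEq .lax (hc (one (F.mapL f b)) (F.cellR a' s)) (F.sigmaOp f (tgt s))
      (F.sigmaOp f (src s)) (hc (F.cellR a s) (one (F.mapL f b'))) := by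
  have h := F.sigma_nat_right f s
  rcases hz with rfl | rfl
  · simp only [F.sigmaOp_colax] at *; exact PasteEq.of_colax h
  · obtain ⟨e, k₁, k₂⟩ := (F.sigmaOp_inverse rfl f (tgt s)).pasteEq
      (F.sigmaOp_inverse rfl f (src s)) (h.lax (by simp))
    exact ⟨e, k₂, k₁⟩

end sigmaOp

section desc

variable {z : Weakness} {A : FSketch.{u₁, v₁, w₁}} {B : FSketch.{u₂, v₂, w₂}} {D : Type u₃}
  [TwoCat.{u₃, v₃, w₃} D] (F : Bifunctor z A.carrier B.carrier D A.tight B.tight)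

/-- The value on a formal composite of 1-cells. -/
def evalWord {x y : GrayOb z A B} :
    GrayWord z A B x y → (F.ob x.fst x.snd ⟶ F.ob y.fst y.snd)
  | .id _ => 𝟙 _
  | .comp p q => evalWord p ≫ evalWord q
  | .left f b => F.mapL f b
  | .right a g => F.mapR a g

theorem evalWord_rel {x y : GrayOb z A B} {p q : GrayWord z A B x y} (h : GrayWordRel p q) :
    F.evalWord p = F.evalWord q := by
  induction h with
  | refl => rfl
  | symm _ ih => exact ih.symm
  | trans _ _ ih₁ ih₂ => exact ih₁.trans ih₂
  | comp_congr _ _ ih₁ ih₂ => simp only [evalWord, ih₁, ih₂]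
  | id_comp p => exact Category.id_comp _
  | comp_id p => exact Category.comp_id _
  | assoc p q r => exact Category.assoc _ _ _
  | left_id a b => exact F.mapL_id a b
  | left_comp f f' b => exact F.mapL_comp f f' b
  | right_id a b => exact F.mapR_id a b
  | right_comp a g g' => exact F.mapR_comp a g g'
  | swap f g h => exact F.swap' f g h

/-- The value on a 1-cell of the tensor product. -/
def evalHom {x y : GrayOb z A B} (p : x ⟶ y) : F.ob x.fst x.snd ⟶ F.ob y.fst y.snd :=
  Quot.lift F.evalWord (fun _ _ h => F.evalWord_rel h) p

theorem evalHom_comp {x y t : GrayOb z A B} (p : x ⟶ y) (q : y ⟶ t) :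
    F.evalHom (p ≫ q) = F.evalHom p ≫ F.evalHom q := by
  obtain ⟨p⟩ := p; obtain ⟨q⟩ := q; rfl

/-- The value on a formal composite of 2-cells. -/
noncomputable def evalPre {x y : GrayOb z A B} {p q : x ⟶ y} : Gray.Pre p q →
    {c : Cell (F.ob x.fst x.snd) (F.ob y.fst y.snd) //
      src c = F.evalHom p ∧ tgt c = F.evalHom q}
  | .one p => ⟨one (F.evalHom p), src_one _, tgt_one _⟩
  | .left s b => ⟨F.cellL s b, F.src_cellL s b, F.tgt_cellL s b⟩
  | .right a s => ⟨F.cellR a s, F.src_cellR a s, F.tgt_cellR a s⟩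
  | .sig hz f g => ⟨F.sigma f g, F.src_sigma hz f g,
      F.tgt_sigma hz f g⟩
  | .sigOp hz f g => ⟨F.sigmaOp f g, F.src_sigmaOp hz f g,
      F.tgt_sigmaOp hz f g⟩
  | .vc s t h => ⟨vc (evalPre s).1 (evalPre t).1
      ((evalPre s).2.2.trans ((congrArg F.evalHom h).trans (evalPre t).2.1.symm)),
      (src_vc _ _ _).trans (evalPre s).2.1, (tgt_vc _ _ _).trans (evalPre t).2.2⟩
  | .hc s t => ⟨hc (evalPre s).1 (evalPre t).1,
      by rw [src_hc, (evalPre s).2.1, (evalPre t).2.1, F.evalHom_comp],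
      by rw [tgt_hc, (evalPre s).2.2, (evalPre t).2.2, F.evalHom_comp]⟩

theorem pastes_evalPre {x y : GrayOb z A B} {p q q' r : x ⟶ y} (s : Gray.Pre p q)
    (t : Gray.Pre q' r) (h : q = q') :
    Pastes .lax (F.evalPre s).1 (F.evalPre t).1 (F.evalPre (.vc s t h)).1 := ⟨_, rfl⟩

theorem evalPre_rel {x y : GrayOb z A B} {p q p' q' : x ⟶ y} {s : Gray.Pre p q}
    {t : Gray.Pre p' q'} (h : Gray.Rel s t) : (F.evalPre s).1 = (F.evalPre t).1 := by
  induction h with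
  | refl => rfl
  | symm _ ih => exact ih.symm
  | trans _ _ ih₁ ih₂ => exact ih₁.trans ih₂
  | vc_congr h h' _ _ ih₁ ih₂ =>
    refine (F.pastes_evalPre _ _ h).unique ?_
    rw [ih₁, ih₂]
    exact F.pastes_evalPre _ _ h'
  | hc_congr _ _ ih₁ ih₂ => simp only [evalPre, ih₁, ih₂]
  | one_vc s h =>
    exact (F.pastes_evalPre _ _ h).unique (.one_left
      ((congrArg F.evalHom h).trans (F.evalPre s).2.1.symm))
  | vc_one s h =>
    exact (F.pastes_evalPre _ _ h).unique (.one_right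
      ((F.evalPre s).2.2.trans (congrArg F.evalHom h)))
  | vc_assoc s₁ s₂ s₃ h k =>
    exact (Pastes.assoc_right (F.pastes_evalPre s₁ s₂ h) (F.pastes_evalPre s₂ s₃ k)
      (F.pastes_evalPre _ _ k)).unique (F.pastes_evalPre _ _ h)
  | one_comp p q => simp only [evalPre, evalHom_comp, one_comp]
  | id_hc s => exact id_hc _
  | hc_id s => exact hc_id _
  | hc_assoc s₁ s₂ s₃ => exact hc_assoc _ _ _
  | interchange s₁ s₂ r₁ r₂ h k hk => exact interchange _ _ _ _ _ _
  | left_one f b => exact F.cellL_one f b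
  | left_vc s t h b h' =>
    refine Pastes.unique ?_ (F.pastes_evalPre _ _ h')
    exact (F.cellL_vc s t _ b (.of_vc h))
  | left_hc s t b => exact F.cellL_hc s t b
  | right_one a g => exact F.cellR_one a g
  | right_vc a s t h h' =>
    refine Pastes.unique ?_ (F.pastes_evalPre _ _ h')
    exact (F.cellR_vc a s t _ (.of_vc h))
  | right_hc a s t => exact F.cellR_hc a s t
  | sig_strict hz f g h => exact F.sigma_eq_one f g h
  | sig_comp_left hz f f' g h =>
    refine Pastes.unique ?_ (F.pastes_evalPre _ _ h)
    exact ((F.sigma_comp_left f f' g).lax hz)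
  | sig_comp_right hz f g g' h =>
    refine Pastes.unique ?_ (F.pastes_evalPre _ _ h)
    exact ((F.sigma_comp_right f g g').lax hz)
  | sig_nat_left hz s g h h' =>
    obtain ⟨e, k, k'⟩ := (F.sigma_nat_left s g).lax hz
    rw [← tgt_eq_otgt hz] at k
    rw [← src_eq_osrc hz] at k'
    refine Eq.trans (b := e) (Pastes.unique (F.pastes_evalPre _ _ h) ?_)
      (Pastes.unique ?_ (F.pastes_evalPre _ _ h'))
    · exact k
    · exact k'
  | sig_nat_right hz f s h h' =>
    obtain ⟨e, k, k'⟩ := (F.sigma_nat_right f s).lax hz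
    rw [← tgt_eq_otgt hz] at k
    rw [← src_eq_osrc hz] at k'
    refine Eq.trans (b := e) (Pastes.unique (F.pastes_evalPre _ _ h) ?_)
      (Pastes.unique ?_ (F.pastes_evalPre _ _ h'))
    · exact k
    · exact k'
  | sigOp_strict hz f g h =>
    rcases h with rfl | h
    · simp at hz
    · exact F.sigmaOp_eq_one hz f g h
  | sigOp_comp_left hz f f' g h =>
    refine Pastes.unique ?_ (F.pastes_evalPre _ _ h)
    exact (F.sigmaOp_comp_left hz f f' g)
  | sigOp_comp_right hz f g g' h =>
    refine Pastes.unique ?_ (F.pastes_evalPre _ _ h)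
    exact (F.sigmaOp_comp_right hz f g g')
  | sigOp_nat_left hz s g h h' =>
    obtain ⟨e, k, k'⟩ := F.sigmaOp_nat_left hz s g
    refine Eq.trans (b := e) (Pastes.unique (F.pastes_evalPre _ _ h) ?_)
      (Pastes.unique ?_ (F.pastes_evalPre _ _ h'))
    · exact k
    · exact k'
  | sigOp_nat_right hz f s h h' =>
    obtain ⟨e, k, k'⟩ := F.sigmaOp_nat_right hz f s
    refine Eq.trans (b := e) (Pastes.unique (F.pastes_evalPre _ _ h) ?_)
      (Pastes.unique ?_ (F.pastes_evalPre _ _ h'))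
    · exact k
    · exact k'
  | sig_sigOp hz hz' f g =>
    have := (F.sigmaOp_inverse (hz'.resolve_left hz) f g).pastes.1
    refine (F.pastes_evalPre _ _ rfl).unique (this.trans_eq ?_)
    exact congrArg one (F.src_sigma hz f g)
  | sigOp_sig hz hz' f g =>
    have := (F.sigmaOp_inverse (hz'.resolve_left hz) f g).pastes.2
    refine (F.pastes_evalPre _ _ rfl).unique (this.trans_eq ?_)
    exact congrArg one (F.src_sigmaOp hz' f g)

/-- The value on a 2-cell of the tensor product. -/
noncomputable def evalCell {x y : GrayOb z A B} (s : Cell x y) :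
    Cell (F.ob x.fst x.snd) (F.ob y.fst y.snd) :=
  _root_.Quotient.lift (s := Gray.preSetoid x y) (fun s => (F.evalPre s.pre).1)
    (fun _ _ h => F.evalPre_rel h) s

/-- The 2-functor on the semi-strict Gray tensor product that corresponds to a functor of two
variables. -/
noncomputable def desc : TwoFunctor (GrayOb z A B) D where
  obj x := F.ob x.fst x.snd
  map := F.evalHom
  map_id _ := rfl
  map_comp := F.evalHom_comp
  mapCell := F.evalCell
  src_mapCell s := by
    induction s using Gray.GrayCell.ind with | h p q s => exact (F.evalPre s).2.1
  tgt_mapCell s := by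
    induction s using Gray.GrayCell.ind with | h p q s => exact (F.evalPre s).2.2
  mapCell_one _ := rfl
  mapCell_vc s t h := by
    induction s using Gray.GrayCell.ind with | h p q s =>
    induction t using Gray.GrayCell.ind with | h p' q' t =>
    exact congrArg F.evalCell (Gray.GrayCell.vc_mk s t h)
  mapCell_hc s t := by
    induction s using Gray.GrayCell.ind with | h p q s =>
    induction t using Gray.GrayCell.ind with | h p' q' t =>
    exact congrArg F.evalCell (Gray.GrayCell.hc_mk s t)

theorem desc_sigma {a a' : A.carrier} {b b' : B.carrier} (f : a ⟶ a') (g : b ⟶ b') :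
    F.desc.mapCell (Gray.sigma z f g) = F.sigma f g := by
  cases z
  · rfl
  · rfl
  · rfl
  · exact F.sigmaOp_colax f g

end desc

end Bifunctor

/-! ### 2-functors on the Gray tensor product as functors of two variables -/

section calculus

variable {C : Type u} [TwoCat.{u, v, w} C] {z : Weakness} {X Y : C}

theorem Pastes.of_lax (hz : z ≠ .colax) {a b c : Cell X Y} (h : Pastes .lax a b c) :
    Pastes z a b c := by
  cases z <;> first | exact h | exact absurd rfl hz

theorem Pastes.colax_of_lax {a b c : Cell X Y} (h : Pastes .lax b a c) :
    Pastes .colax a b c := ⟨h.1.symm, h.2⟩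

theorem IsInverse.isInvertible {a b : Cell X Y} (h : IsInverse a b) : IsInvertible a := ⟨b, h⟩

end calculus

namespace Gray

variable {z : Weakness} {A : FSketch.{u₁, v₁, w₁}} {B : FSketch.{u₂, v₂, w₂}}

theorem pastes_mk {x y : GrayOb z A B} {p q q' r : x ⟶ y} (s : Pre p q) (t : Pre q' r)
    (h : q = q') : Pastes .lax (C := GrayOb z A B) (mk s) (mk t) (mk (.vc s t h)) :=
  ⟨h, GrayCell.vc_mk s t h⟩

theorem hc_mk {x y t : GrayOb z A B} {p q : x ⟶ y} {p' q' : y ⟶ t} (s : Pre p q)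
    (r : Pre p' q') : hc (C := GrayOb z A B) (mk s) (mk r) = mk (.hc s r) := GrayCell.hc_mk s r

theorem one_eq_mk {x y : GrayOb z A B} (p : x ⟶ y) : one p = mk (.one p) := rfl

theorem sigma_of_ne (hz : z ≠ .colax) {a a' : A.carrier} {b b' : B.carrier} (f : a ⟶ a')
    (g : b ⟶ b') : sigma z f g = mk (.sig hz f g) := by
  cases z <;> first | rfl | exact absurd rfl hz

variable {a a' a'' : A.carrier} {b b' b'' : B.carrier}

theorem osrc_sigma (f : a ⟶ a') (g : b ⟶ b') :
    osrc z (sigma z f g) = right z a g ≫ left z f b' := by cases z <;> rfl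

theorem otgt_sigma (f : a ⟶ a') (g : b ⟶ b') :
    otgt z (sigma z f g) = left z f b ≫ right z a' g := by cases z <;> rfl

theorem isWCell_sigma (f : a ⟶ a') (g : b ⟶ b') : IsWCell z (sigma z f g) := by
  cases z
  · refine (sound (.sig_strict (by simp) f g (.inl rfl))).trans ?_
    exact congrArg (fun p => mk (.one p)) (swap (.inl rfl)).symm
  · refine IsInverse.isInvertible (b := mk (.sigOp (by simp) f g)) (.of_pastes ?_ ?_)
    · exact (pastes_mk _ _ rfl).trans_eq (sound (.sig_sigOp (by simp) (by simp) f g))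
    · exact (pastes_mk _ _ rfl).trans_eq (sound (.sigOp_sig (by simp) (by simp) f g))
  · trivial
  · trivial

theorem sigma_strict (f : a ⟶ a') (g : b ⟶ b') (h : A.tight f ∨ B.tight g) :
    sigma z f g = one (left z f b ≫ right z a' g) := by
  by_cases hz : z = .colax
  · subst hz; exact sound (.sigOp_strict (by simp) f g (.inr h))
  · rw [sigma_of_ne hz]; exact sound (.sig_strict hz f g (.inr h))

theorem sigma_comp_left (f : a ⟶ a') (f' : a' ⟶ a'') (g : b ⟶ b') :
    Pastes z (hc (sigma z f g) (one (left z f' b'))) (hc (one (left z f b)) (sigma z f' g))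
      (sigma z (f ≫ f') g) := by
  by_cases hz : z = .colax
  · subst hz
    refine .colax_of_lax ?_
    simp only [sigma, one_eq_mk, hc_mk]
    exact (pastes_mk _ _ (Category.assoc _ _ _).symm).trans_eq
      (sound (.sigOp_comp_left (by simp) f f' g _)).symm
  · refine .of_lax hz ?_
    simp only [sigma_of_ne hz, one_eq_mk, hc_mk]
    exact (pastes_mk _ _ (Category.assoc _ _ _)).trans_eq
      (sound (.sig_comp_left hz f f' g _)).symm

theorem sigma_comp_right (f : a ⟶ a') (g : b ⟶ b') (g' : b' ⟶ b'') :
    Pastes z (hc (one (right z a g)) (sigma z f g')) (hc (sigma z f g) (one (right z a' g')))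
      (sigma z f (g ≫ g')) := by
  by_cases hz : z = .colax
  · subst hz
    refine .colax_of_lax ?_
    simp only [sigma, one_eq_mk, hc_mk]
    exact (pastes_mk _ _ (Category.assoc _ _ _)).trans_eq
      (sound (.sigOp_comp_right (by simp) f g g' _)).symm
  · refine .of_lax hz ?_
    simp only [sigma_of_ne hz, one_eq_mk, hc_mk]
    exact (pastes_mk _ _ (Category.assoc _ _ _).symm).trans_eq
      (sound (.sig_comp_right hz f g g' _)).symm

theorem sigma_nat_left (s : Cell a a') (g : b ⟶ b') :
    PasteEq z (hc (one (right z a g)) (leftCell z s b')) (sigma z (otgt z s) g)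
      (sigma z (osrc z s) g) (hc (leftCell z s b) (one (right z a' g))) := by
  by_cases hz : z = .colax
  · subst hz
    refine ⟨mk (.vc (.sigOp (.inl rfl) (src s) g) (.hc (.one (right _ a g)) (.left s b')) rfl),
      .colax_of_lax ?_, .colax_of_lax ?_⟩
    rotate_left
    · simp only [osrc, pick, sigma, leftCell, one_eq_mk, hc_mk]
      exact (pastes_mk _ _ rfl).trans_eq (sound (.sigOp_nat_left (.inl rfl) s g rfl rfl))
    · simp only [otgt, pick, sigma, leftCell, one_eq_mk, hc_mk]
      exact pastes_mk _ _ rfl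
  · refine ⟨mk (.vc (.sig hz (src s) g) (.hc (.left s b) (.one (right _ a' g))) rfl),
      .of_lax hz ?_, .of_lax hz ?_⟩
    rotate_left
    · rw [← src_eq_osrc hz]
      simp only [sigma_of_ne hz, leftCell, one_eq_mk, hc_mk]
      exact pastes_mk _ _ rfl
    · rw [← tgt_eq_otgt hz]
      simp only [sigma_of_ne hz, leftCell, one_eq_mk, hc_mk]
      exact (pastes_mk _ _ rfl).trans_eq (sound (.sig_nat_left hz s g rfl rfl))

theorem sigma_nat_right (f : a ⟶ a') (s : Cell b b') :
    PasteEq z (hc (rightCell z a s) (one (left z f b'))) (sigma z f (otgt z s))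
      (sigma z f (osrc z s)) (hc (one (left z f b)) (rightCell z a' s)) := by
  by_cases hz : z = .colax
  · subst hz
    refine ⟨mk (.vc (.sigOp (.inl rfl) f (src s)) (.hc (.right a s) (.one (left _ f b'))) rfl),
      .colax_of_lax ?_, .colax_of_lax ?_⟩
    rotate_left
    · simp only [osrc, pick, sigma, rightCell, one_eq_mk, hc_mk]
      exact (pastes_mk _ _ rfl).trans_eq (sound (.sigOp_nat_right (.inl rfl) f s rfl rfl))
    · simp only [otgt, pick, sigma, rightCell, one_eq_mk, hc_mk]
      exact pastes_mk _ _ rfl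
  · refine ⟨mk (.vc (.sig hz f (src s)) (.hc (.one (left _ f b)) (.right a' s)) rfl),
      .of_lax hz ?_, .of_lax hz ?_⟩
    rotate_left
    · rw [← src_eq_osrc hz]
      simp only [sigma_of_ne hz, rightCell, one_eq_mk, hc_mk]
      exact pastes_mk _ _ rfl
    · rw [← tgt_eq_otgt hz]
      simp only [sigma_of_ne hz, rightCell, one_eq_mk, hc_mk]
      exact (pastes_mk _ _ rfl).trans_eq (sound (.sig_nat_right hz f s rfl rfl))

end Gray

/-- The functor of two variables that corresponds to a 2-functor on the semi-strict Gray tensor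
product. -/
def TwoFunctor.toBifunctor {z : Weakness} {A : FSketch.{u₁, v₁, w₁}} {B : FSketch.{u₂, v₂, w₂}}
    {D : Type u₃} [TwoCat.{u₃, v₃, w₃} D] (F : TwoFunctor (GrayOb z A B) D) :
    Bifunctor z A.carrier B.carrier D A.tight B.tight where
  ob a b := F.obj ⟨a, b⟩
  mapL f b := F.map (Gray.left z f b)
  mapR a _ _ g := F.map (Gray.right z a g)
  cellL s b := F.mapCell (Gray.leftCell z s b)
  cellR a _ _ s := F.mapCell (Gray.rightCell z a s)
  sigma f g := F.mapCell (Gray.sigma z f g)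
  src_cellL s b := F.src_mapCell _
  tgt_cellL s b := F.tgt_mapCell _
  src_cellR a _ _ s := F.src_mapCell _
  tgt_cellR a _ _ s := F.tgt_mapCell _
  mapL_id a b := by rw [Gray.left_id, F.map_id]
  mapR_id a b := by rw [Gray.right_id, F.map_id]
  cellL_one f b := (congrArg F.mapCell (Gray.sound (.left_one f b))).trans (F.mapCell_one _)
  cellR_one a _ _ g := (congrArg F.mapCell (Gray.sound (.right_one a g))).trans (F.mapCell_one _)
  cellL_vc s t r b h := F.pastes (by
    obtain ⟨h, rfl⟩ := h
    exact (Gray.pastes_mk _ _ _).trans_eq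
      (Gray.sound (.left_vc s t h b (congrArg (Gray.left z · b) h))).symm)
  cellR_vc a _ _ s t r h := F.pastes (by
    obtain ⟨h, rfl⟩ := h
    exact (Gray.pastes_mk _ _ _).trans_eq
      (Gray.sound (.right_vc a s t h (congrArg (Gray.right z a ·) h))).symm)
  cellL_hc s t b := by
    rw [← F.mapCell_hc]
    exact congrArg F.mapCell ((Gray.sound (.left_hc s t b)).trans (Gray.hc_mk _ _).symm)
  cellR_hc a _ _ _ s t := by
    rw [← F.mapCell_hc]
    exact congrArg F.mapCell ((Gray.sound (.right_hc a s t)).trans (Gray.hc_mk _ _).symm)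
  osrc_sigma f g := by rw [F.osrc_mapCell, Gray.osrc_sigma, F.map_comp]
  otgt_sigma f g := by rw [F.otgt_mapCell, Gray.otgt_sigma, F.map_comp]
  isWCell f g := F.isWCell z (Gray.isWCell_sigma f g)
  sigma_strict f g h := by rw [Gray.sigma_strict f g h, F.mapCell_one, F.map_comp]
  sigma_comp_left f f' g := by
    simpa only [F.mapCell_hc, F.mapCell_one] using F.pastes (Gray.sigma_comp_left f f' g)
  sigma_comp_right f g g' := by
    simpa only [F.mapCell_hc, F.mapCell_one] using F.pastes (Gray.sigma_comp_right f g g')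
  sigma_nat_left s g := by
    simpa only [F.mapCell_hc, F.mapCell_one] using F.pasteEq (Gray.sigma_nat_left s g)
  sigma_nat_right f s := by
    simpa only [F.mapCell_hc, F.mapCell_one] using F.pasteEq (Gray.sigma_nat_right f s)

/-! ### Iterated powers in a Lawvere 2-theory -/

section power

variable {C : Type u} [TwoCat.{u, v, w} C] {m k : ℕ} {P Q X Y : C}

/-- Powers of powers are powers. -/
theorem IsPower.comp {π : Fin m → (P ⟶ Q)} {ρ : Fin k → (Q ⟶ X)} (hπ : IsPower π)
    (hρ : IsPower ρ) : IsPower fun t : Fin (m * k) =>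
      π (finProdFinEquiv.symm t).1 ≫ ρ (finProdFinEquiv.symm t).2 := by
  intro Z
  refine ⟨⟨fun f g h => ?_, fun f => ?_⟩, ⟨fun s t h => ?_, fun s => ?_⟩⟩
  · refine hπ.hom_ext fun i => hρ.hom_ext fun j => ?_
    have := congrFun h (finProdFinEquiv (i, j))
    simpa only [Equiv.symm_apply_apply, Category.assoc] using this
  · refine ⟨hπ.lift fun i => hρ.lift fun j => f (finProdFinEquiv (i, j)), funext fun t => ?_⟩
    obtain ⟨⟨i, j⟩, rfl⟩ := finProdFinEquiv.surjective t
    simp only [Equiv.symm_apply_apply]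
    rw [← Category.assoc, IsPower.lift_fac, IsPower.lift_fac]
  · refine hπ.cell_ext fun i => hρ.cell_ext fun j => ?_
    have := congrFun h (finProdFinEquiv (i, j))
    simpa only [Equiv.symm_apply_apply, hc_assoc, hc_one_one] using this
  · refine ⟨hπ.liftCell fun i => hρ.liftCell fun j => s (finProdFinEquiv (i, j)),
      funext fun t => ?_⟩
    obtain ⟨⟨i, j⟩, rfl⟩ := finProdFinEquiv.surjective t
    simp only [Equiv.symm_apply_apply]
    rw [one_comp, ← hc_assoc, IsPower.liftCell_fac, IsPower.liftCell_fac]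

/-- The first factor of a composite power cone is a power cone. -/
theorem IsPower.of_comp {π : Fin m → (P ⟶ Q)} {ρ : Fin k → (Q ⟶ X)} (hρ : IsPower ρ)
    (h : IsPower fun t : Fin (m * k) =>
      π (finProdFinEquiv.symm t).1 ≫ ρ (finProdFinEquiv.symm t).2) : IsPower π := by
  intro Z
  refine ⟨⟨fun f g e => ?_, fun f => ?_⟩, ⟨fun s t e => ?_, fun s => ?_⟩⟩
  · refine h.hom_ext fun t => ?_
    rw [← Category.assoc, ← Category.assoc]
    exact congrArg (· ≫ _) (congrFun e _)
  · refine ⟨h.lift fun t => f (finProdFinEquiv.symm t).1 ≫ ρ (finProdFinEquiv.symm t).2,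
      funext fun i => hρ.hom_ext fun j => ?_⟩
    have := h.lift_fac (fun t => f (finProdFinEquiv.symm t).1 ≫ ρ (finProdFinEquiv.symm t).2)
      (finProdFinEquiv (i, j))
    simpa only [Equiv.symm_apply_apply, Category.assoc] using this
  · refine h.cell_ext fun t => ?_
    rw [one_comp, ← hc_assoc, ← hc_assoc]
    exact congrArg (hc · _) (congrFun e _)
  · refine ⟨h.liftCell fun t =>
      hc (s (finProdFinEquiv.symm t).1) (one (ρ (finProdFinEquiv.symm t).2)),
      funext fun i => hρ.cell_ext fun j => ?_⟩
    have := h.liftCell_fac (fun t =>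
      hc (s (finProdFinEquiv.symm t).1) (one (ρ (finProdFinEquiv.symm t).2)))
      (finProdFinEquiv (i, j))
    simpa only [Equiv.symm_apply_apply, hc_assoc, hc_one_one] using this

theorem IsPower.comp_iso {π : Fin m → (P ⟶ X)} (hπ : IsPower π) {f : X ⟶ Y} {g : Y ⟶ X}
    (hfg : f ≫ g = 𝟙 X) (hgf : g ≫ f = 𝟙 Y) : IsPower fun i => π i ≫ f := by
  intro Z
  refine ⟨⟨fun a b h => ?_, fun a => ?_⟩, ⟨fun s t h => ?_, fun s => ?_⟩⟩
  · refine hπ.hom_ext fun i => ?_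
    have := congrArg (· ≫ g) (congrFun h i)
    simpa [hfg] using this
  · refine ⟨hπ.lift fun i => a i ≫ g, funext fun i => ?_⟩
    simp only []
    rw [← Category.assoc, IsPower.lift_fac, Category.assoc, hgf, Category.comp_id]
  · refine hπ.cell_ext fun i => ?_
    have := congrArg (hc · (one g)) (congrFun h i)
    simpa [hfg] using this
  · refine ⟨hπ.liftCell fun i => hc (s i) (one g), funext fun i => ?_⟩
    simp only []
    rw [one_comp, ← hc_assoc, IsPower.liftCell_fac, hc_assoc, hc_one_one, hgf, hc_id]

theorem IsPower.iso_comp {π : Fin m → (P ⟶ X)} (hπ : IsPower π) {f : Q ⟶ P} {g : P ⟶ Q}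
    (hfg : f ≫ g = 𝟙 Q) (hgf : g ≫ f = 𝟙 P) : IsPower fun i => f ≫ π i := by
  intro Z
  refine ⟨⟨fun a b h => ?_, fun a => ?_⟩, ⟨fun s t h => ?_, fun s => ?_⟩⟩
  · have := congrArg (· ≫ g) (hπ.hom_ext (f := a ≫ f) (g := b ≫ f) fun i => by
      simpa using congrFun h i)
    simpa [hfg] using this
  · refine ⟨hπ.lift a ≫ g, funext fun i => ?_⟩
    simp only [Category.assoc]
    rw [← Category.assoc g, hgf, Category.id_comp, IsPower.lift_fac]
  · have := congrArg (hc · (one g)) (hπ.cell_ext (s := hc s (one f)) (t := hc t (one f))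
      fun i => by simpa using congrFun h i)
    simpa [hfg] using this
  · refine ⟨hc (hπ.liftCell s) (one g), funext fun i => ?_⟩
    simp only [hc_assoc, hc_one_one]
    rw [← Category.assoc g, hgf, Category.id_comp, IsPower.liftCell_fac]

end power

namespace LawvereTwoTheory

variable {T : LawvereTwoTheory.{v, w}}

variable (T) in
theorem inert_id (n : ℕ) : T.inert (fun i : Fin n => i) = 𝟙 _ := T.θ_id n

@[simp] theorem inert_comp {l m n : ℕ} (φ : Fin m → Fin l) (ψ : Fin n → Fin m) :
    T.inert φ ≫ T.inert ψ = T.inert fun i => φ (ψ i) := (T.θ_comp φ ψ).symm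

@[simp] theorem inert_pr {m n : ℕ} (φ : Fin n → Fin m) (i : Fin n) :
    T.inert φ ≫ T.pr n i = T.pr m (φ i) := inert_comp _ _

theorem row_pr (m k : ℕ) (i : Fin m) (j : Fin k) :
    T.row m k i ≫ T.pr k j = T.pr (m * k) (finProdFinEquiv (i, j)) := inert_comp _ _

theorem col_pr (m k : ℕ) (i : Fin m) (j : Fin k) :
    T.col m k j ≫ T.pr m i = T.pr (m * k) (finProdFinEquiv (i, j)) := inert_comp _ _

variable (T) in
theorem isPower_row (m k : ℕ) : IsPower (T.row m k) := by
  refine IsPower.of_comp (T.isPower_pr k) ?_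
  simpa only [row_pr, Prod.mk.eta, Equiv.apply_symm_apply] using T.isPower_pr (m * k)

variable (T) in
theorem isPower_reindex {m n : ℕ} (e : Fin n ≃ Fin m) {P X : T.Ob} {π : Fin m → (P ⟶ X)}
    (h : IsPower π) : IsPower fun i => π (e i) := by
  intro Z
  refine ⟨⟨fun f g k => h.hom_ext fun i => ?_, fun f => ⟨h.lift fun i => f (e.symm i), ?_⟩⟩,
    ⟨fun s t k => h.cell_ext fun i => ?_, fun s => ⟨h.liftCell fun i => s (e.symm i), ?_⟩⟩⟩
  · simpa using congrFun k (e.symm i)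
  · funext i; simp [IsPower.lift_fac]
  · simpa using congrFun k (e.symm i)
  · funext i; simp [IsPower.liftCell_fac]

variable (T) in
theorem isPower_col (m k : ℕ) : IsPower (T.col m k) := by
  refine IsPower.of_comp (T.isPower_pr m) ?_
  simp only [col_pr]
  refine T.isPower_reindex ((finProdFinEquiv.symm.trans (Equiv.prodComm _ _)).trans
    finProdFinEquiv) (π := fun t => T.pr (m * k) t) (T.isPower_pr (m * k))

section rows

variable {m n k l r : ℕ}

theorem row_hom_ext {Z : T.Ob} {f g : Z ⟶ T.ob (m * k)}
    (h : ∀ i, f ≫ T.row m k i = g ≫ T.row m k i) : f = g := (T.isPower_row m k).hom_ext h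

theorem row_cell_ext {Z : T.Ob} {s t : Cell Z (T.ob (m * k))}
    (h : ∀ i, hc s (one (T.row m k i)) = hc t (one (T.row m k i))) : s = t :=
  (T.isPower_row m k).cell_ext h

theorem col_hom_ext {Z : T.Ob} {f g : Z ⟶ T.ob (m * k)}
    (h : ∀ j, f ≫ T.col m k j = g ≫ T.col m k j) : f = g := (T.isPower_col m k).hom_ext h

theorem col_cell_ext {Z : T.Ob} {s t : Cell Z (T.ob (m * k))}
    (h : ∀ j, hc s (one (T.col m k j)) = hc t (one (T.col m k j))) : s = t :=
  (T.isPower_col m k).cell_ext h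

@[simp] theorem rowMap_row (α : T.ob k ⟶ T.ob l) (i : Fin m) :
    T.rowMap m α ≫ T.row m l i = T.row m k i ≫ α := by
  refine (T.isPower_pr l).hom_ext fun j => ?_
  rw [Category.assoc, row_pr, rowMap, IsPower.lift_fac]
  simp only [Equiv.symm_apply_apply, Category.assoc]

@[simp] theorem colMap_col (α : T.ob m ⟶ T.ob n) (j : Fin k) :
    T.colMap α k ≫ T.col n k j = T.col m k j ≫ α := by
  refine (T.isPower_pr n).hom_ext fun i => ?_
  rw [Category.assoc, col_pr, colMap, IsPower.lift_fac]
  simp only [Equiv.symm_apply_apply, Category.assoc]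

@[simp] theorem rowCell_row (s : Cell (T.ob k) (T.ob l)) (i : Fin m) :
    hc (T.rowCell m s) (one (T.row m l i)) = hc (one (T.row m k i)) s := by
  refine (T.isPower_pr l).cell_ext fun j => ?_
  rw [hc_assoc, hc_one_one, row_pr, rowCell, IsPower.liftCell_fac]
  simp only [Equiv.symm_apply_apply, hc_assoc]

@[simp] theorem colCell_col (s : Cell (T.ob m) (T.ob n)) (j : Fin k) :
    hc (T.colCell s k) (one (T.col n k j)) = hc (one (T.col m k j)) s := by
  refine (T.isPower_pr n).cell_ext fun i => ?_
  rw [hc_assoc, hc_one_one, col_pr, colCell, IsPower.liftCell_fac]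
  simp only [Equiv.symm_apply_apply, hc_assoc]

theorem rowMap_id (m k : ℕ) : T.rowMap m (𝟙 (T.ob k)) = 𝟙 _ := row_hom_ext fun i => by simp

theorem colMap_id (m k : ℕ) : T.colMap (𝟙 (T.ob m)) k = 𝟙 _ := col_hom_ext fun i => by simp

@[simp] theorem osrc_rowCell (z : Weakness) (s : Cell (T.ob k) (T.ob l)) :
    osrc z (T.rowCell m s) = T.rowMap m (osrc z s) :=
  row_hom_ext fun i => by
    simpa only [osrc_hc, osrc_one, rowMap_row] using congrArg (osrc z) (rowCell_row s i)

@[simp] theorem otgt_rowCell (z : Weakness) (s : Cell (T.ob k) (T.ob l)) :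
    otgt z (T.rowCell m s) = T.rowMap m (otgt z s) :=
  row_hom_ext fun i => by
    simpa only [otgt_hc, otgt_one, rowMap_row] using congrArg (otgt z) (rowCell_row s i)

@[simp] theorem osrc_colCell (z : Weakness) (s : Cell (T.ob m) (T.ob n)) :
    osrc z (T.colCell s k) = T.colMap (osrc z s) k :=
  col_hom_ext fun i => by
    simpa only [osrc_hc, osrc_one, colMap_col] using congrArg (osrc z) (colCell_col s i)

@[simp] theorem otgt_colCell (z : Weakness) (s : Cell (T.ob m) (T.ob n)) :
    otgt z (T.colCell s k) = T.colMap (otgt z s) k :=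
  col_hom_ext fun i => by
    simpa only [otgt_hc, otgt_one, colMap_col] using congrArg (otgt z) (colCell_col s i)

theorem rowCell_one (α : T.ob k ⟶ T.ob l) : T.rowCell m (one α) = one (T.rowMap m α) :=
  row_cell_ext fun i => by simp

theorem colCell_one (α : T.ob m ⟶ T.ob n) : T.colCell (one α) k = one (T.colMap α k) :=
  col_cell_ext fun i => by simp

theorem rowCell_hc (s : Cell (T.ob k) (T.ob l)) (t : Cell (T.ob l) (T.ob r)) :
    T.rowCell m (hc s t) = hc (T.rowCell m s) (T.rowCell m t) :=
  row_cell_ext fun i => by rw [rowCell_row, hc_assoc, rowCell_row, ← hc_assoc, ← hc_assoc,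
    rowCell_row]

theorem colCell_hc (s : Cell (T.ob m) (T.ob n)) (t : Cell (T.ob n) (T.ob r)) :
    T.colCell (hc s t) k = hc (T.colCell s k) (T.colCell t k) :=
  col_cell_ext fun i => by rw [colCell_col, hc_assoc, colCell_col, ← hc_assoc, ← hc_assoc,
    colCell_col]

theorem pastes_rowCell {z : Weakness} {s t r : Cell (T.ob k) (T.ob l)} (h : Pastes z s t r) :
    Pastes z (T.rowCell m s) (T.rowCell m t) (T.rowCell m r) :=
  (T.isPower_row m l).pastes fun i => by simpa only [rowCell_row] using h.whiskerLeft _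

theorem pastes_colCell {z : Weakness} {s t r : Cell (T.ob m) (T.ob n)} (h : Pastes z s t r) :
    Pastes z (T.colCell s k) (T.colCell t k) (T.colCell r k) :=
  (T.isPower_col n k).pastes fun i => by simpa only [colCell_col] using h.whiskerLeft _

theorem rowMap_inert (m : ℕ) (φ : Fin l → Fin k) : T.rowMap m (T.inert φ) =
    T.inert fun t => finProdFinEquiv ((finProdFinEquiv.symm t).1, φ (finProdFinEquiv.symm t).2) :=
  row_hom_ext fun i => by
    rw [rowMap_row, row, row, inert_comp, inert_comp]
    simp only [Equiv.symm_apply_apply]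

theorem colMap_inert (φ : Fin n → Fin m) (k : ℕ) : T.colMap (T.inert φ) k =
    T.inert fun t => finProdFinEquiv (φ (finProdFinEquiv.symm t).1, (finProdFinEquiv.symm t).2) :=
  col_hom_ext fun i => by
    rw [colMap_col, col, col, inert_comp, inert_comp]
    simp only [Equiv.symm_apply_apply]

theorem isPower_rowMap {p : ℕ} {π : Fin p → (T.ob l ⟶ T.ob k)} (h : IsPower π) :
    IsPower fun i => T.rowMap m (π i) := by
  intro Z
  refine ⟨⟨fun f g e => ?_, fun f => ?_⟩, ⟨fun s t e => ?_, fun s => ?_⟩⟩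
  · refine row_hom_ext fun j => h.hom_ext fun i => ?_
    simpa using congrArg (· ≫ T.row m k j) (congrFun e i)
  · refine ⟨(T.isPower_row m l).lift fun j => h.lift fun i => f i ≫ T.row m k j,
      funext fun i => row_hom_ext fun j => ?_⟩
    rw [Category.assoc, rowMap_row, ← Category.assoc, IsPower.lift_fac, IsPower.lift_fac]
  · refine row_cell_ext fun j => h.cell_ext fun i => ?_
    simpa using congrArg (hc · (one (T.row m k j))) (congrFun e i)
  · refine ⟨(T.isPower_row m l).liftCell fun j => h.liftCell fun i =>
      hc (s i) (one (T.row m k j)), funext fun i => row_cell_ext fun j => ?_⟩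
    rw [hc_assoc, hc_one_one, rowMap_row, one_comp, ← hc_assoc, IsPower.liftCell_fac,
      IsPower.liftCell_fac]

theorem isPower_colMap {p : ℕ} {π : Fin p → (T.ob m ⟶ T.ob n)} (h : IsPower π) :
    IsPower fun i => T.colMap (π i) k := by
  intro Z
  refine ⟨⟨fun f g e => ?_, fun f => ?_⟩, ⟨fun s t e => ?_, fun s => ?_⟩⟩
  · refine col_hom_ext fun j => h.hom_ext fun i => ?_
    simpa using congrArg (· ≫ T.col n k j) (congrFun e i)
  · refine ⟨(T.isPower_col m k).lift fun j => h.lift fun i => f i ≫ T.col n k j,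
      funext fun i => col_hom_ext fun j => ?_⟩
    rw [Category.assoc, colMap_col, ← Category.assoc, IsPower.lift_fac, IsPower.lift_fac]
  · refine col_cell_ext fun j => h.cell_ext fun i => ?_
    simpa using congrArg (hc · (one (T.col n k j))) (congrFun e i)
  · refine ⟨(T.isPower_col m k).liftCell fun j => h.liftCell fun i =>
      hc (s i) (one (T.col n k j)), funext fun i => col_cell_ext fun j => ?_⟩
    rw [hc_assoc, hc_one_one, colMap_col, one_comp, ← hc_assoc, IsPower.liftCell_fac,
      IsPower.liftCell_fac]

end rows

/-- The inert 1-cells: those in the image of `θ`. -/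
def IsInert {X Y : T.Ob} (f : X ⟶ Y) : Prop :=
  ∃ φ : Fin (Arity.card Y) → Fin (Arity.card X), T.inert φ = f

theorem isInert_inert {m n : ℕ} (φ : Fin n → Fin m) : IsInert (T.inert φ) := ⟨φ, rfl⟩

theorem isInert_row (m k : ℕ) (i : Fin m) : IsInert (T.row m k i) := ⟨_, rfl⟩

theorem isInert_col (m k : ℕ) (j : Fin k) : IsInert (T.col m k j) := ⟨_, rfl⟩

theorem isInert_id (X : T.Ob) : IsInert (𝟙 X) := ⟨fun i => i, T.θ_id _⟩

theorem IsInert.comp {X Y Z : T.Ob} {f : X ⟶ Y} {g : Y ⟶ Z} (hf : IsInert f) (hg : IsInert g) :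
    IsInert (f ≫ g) := by
  obtain ⟨φ, rfl⟩ := hf; obtain ⟨ψ, rfl⟩ := hg
  exact ⟨_, T.θ_comp φ ψ⟩

/-- A 1-cell is inert as soon as its components are. -/
theorem isInert_of_pr {X : T.Ob} {n : ℕ} {f : X ⟶ T.ob n} (h : ∀ i, IsInert (f ≫ T.pr n i)) :
    IsInert f := by
  choose φ hφ using h
  refine ⟨fun i => φ i (0 : Fin 1), (T.isPower_pr n).hom_ext fun i => ?_⟩
  refine Eq.trans ?_ (hφ i)
  refine (inert_pr (m := Arity.card X) _ i).trans ?_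
  refine congrArg T.inert (funext fun j => ?_)
  exact congrArg (φ i) (Subsingleton.elim (α := Fin 1) _ _)

theorem IsInert.rowMap {m k l : ℕ} {f : T.ob k ⟶ T.ob l} (h : IsInert f) :
    IsInert (T.rowMap m f) := by
  obtain ⟨φ, rfl⟩ := h
  exact ⟨_, (rowMap_inert m φ).symm⟩

theorem IsInert.colMap {m n k : ℕ} {f : T.ob m ⟶ T.ob n} (h : IsInert f) :
    IsInert (T.colMap f k) := by
  obtain ⟨φ, rfl⟩ := h
  exact ⟨_, (colMap_inert φ k).symm⟩

/-- The cones for tight powers: power cones of inert 1-cells, through which 1-cells with inert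
components factor by inert ones. -/
def IsInertPower {n : ℕ} {P X : T.Ob} (π : Fin n → (P ⟶ X)) : Prop :=
  (∀ i, IsInert (π i)) ∧ IsPower π ∧
    ∀ (Z : T.Ob) (f : Z ⟶ P), (∀ i, IsInert (f ≫ π i)) → IsInert f

variable (T) in
theorem isInertPower_pr (n : ℕ) : IsInertPower (T.pr n) :=
  ⟨fun _ => isInert_inert _, T.isPower_pr n, fun _ _ h => isInert_of_pr h⟩

theorem IsInertPower.rowMap {m k l p : ℕ} {π : Fin p → (T.ob k ⟶ T.ob l)}
    (h : IsInertPower π) : IsInertPower fun i => T.rowMap m (π i) := by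
  refine ⟨fun i => (h.1 i).rowMap, isPower_rowMap h.2.1, fun Z f hf => ?_⟩
  have hr : ∀ i, IsInert (f ≫ T.row m k i) := fun i => h.2.2 _ _ fun j => by
    have := (hf j).comp (isInert_inert (T := T) fun t => finProdFinEquiv (i, t))
    change IsInert (_ ≫ T.row m l i) at this
    simpa using this
  refine isInert_of_pr fun t => ?_
  obtain ⟨⟨i, j⟩, rfl⟩ := finProdFinEquiv.surjective t
  rw [← row_pr, ← Category.assoc]
  exact (hr i).comp (isInert_inert _)

theorem IsInertPower.colMap {m n k p : ℕ} {π : Fin p → (T.ob m ⟶ T.ob n)}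
    (h : IsInertPower π) : IsInertPower fun i => T.colMap (π i) k := by
  refine ⟨fun i => (h.1 i).colMap, isPower_colMap h.2.1, fun Z f hf => ?_⟩
  have hr : ∀ j, IsInert (f ≫ T.col m k j) := fun j => h.2.2 _ _ fun i => by
    have := (hf i).comp (isInert_inert (T := T) fun t => finProdFinEquiv (t, j))
    change IsInert (_ ≫ T.col n k j) at this
    simpa using this
  refine isInert_of_pr fun t => ?_
  obtain ⟨⟨i, j⟩, rfl⟩ := finProdFinEquiv.surjective t
  rw [← col_pr, ← Category.assoc]
  exact (hr j).comp (isInert_inert _)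

end LawvereTwoTheory

open LawvereTwoTheory

/-! ### The commutativity of a coherent system -/

namespace CoherentSystem

variable {z : Weakness} {T : LawvereTwoTheory.{v, w}} (σ : CoherentSystem z T) {m n k l r : ℕ}

attribute [simp] CoherentSystem.osrc_σ CoherentSystem.otgt_σ

theorem pastes_right (α : T.ob m ⟶ T.ob n) (β : T.ob k ⟶ T.ob l) (γ : T.ob l ⟶ T.ob r) :
    Pastes z (hc (one (T.rowMap m β)) (σ.σ α γ)) (hc (σ.σ α β) (one (T.rowMap n γ)))
      (σ.σ α (β ≫ γ)) := by
  obtain ⟨h, e⟩ := σ.comp_right α β γ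
  exact ⟨h, e.symm⟩

theorem pastes_left (α : T.ob m ⟶ T.ob n) (γ : T.ob n ⟶ T.ob r) (β : T.ob k ⟶ T.ob l) :
    Pastes z (hc (σ.σ α β) (one (T.colMap γ l))) (hc (one (T.colMap α k)) (σ.σ γ β))
      (σ.σ (α ≫ γ) β) := by
  obtain ⟨h, e⟩ := σ.comp_left α γ β
  exact ⟨h, e.symm⟩

theorem of_inert (α : T.ob m ⟶ T.ob n) (β : T.ob k ⟶ T.ob l) (h : IsInert α ∨ IsInert β) :
    σ.σ α β = one (T.colMap α k ≫ T.rowMap n β) := by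
  have e : σ.σ α β = one (osrc z (σ.σ α β)) := by
    rcases h with ⟨φ, rfl⟩ | ⟨φ, rfl⟩
    · exact σ.inert_left φ β
    · exact σ.inert_right α φ
  rw [← σ.otgt_σ, e, otgt_one]

theorem inert_comp_right (α : T.ob m ⟶ T.ob n) {f : T.ob k ⟶ T.ob l} (hf : IsInert f)
    (γ : T.ob l ⟶ T.ob r) : σ.σ α (f ≫ γ) = hc (one (T.rowMap m f)) (σ.σ α γ) := by
  have h := σ.pastes_right α f γ
  rw [σ.of_inert α f (.inr hf), hc_one_one] at h
  exact h.unique (.one_right (by simpa using h.match_eq))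

theorem comp_inert_right (α : T.ob m ⟶ T.ob n) (β : T.ob k ⟶ T.ob l) {f : T.ob l ⟶ T.ob r}
    (hf : IsInert f) : σ.σ α (β ≫ f) = hc (σ.σ α β) (one (T.rowMap n f)) := by
  have h := σ.pastes_right α β f
  rw [σ.of_inert α f (.inr hf), hc_one_one] at h
  exact h.unique (.one_left (by simp))

theorem inert_comp_left {f : T.ob m ⟶ T.ob n} (hf : IsInert f) (γ : T.ob n ⟶ T.ob r)
    (β : T.ob k ⟶ T.ob l) : σ.σ (f ≫ γ) β = hc (one (T.colMap f k)) (σ.σ γ β) := by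
  have h := σ.pastes_left f γ β
  rw [σ.of_inert f β (.inl hf), hc_one_one] at h
  exact h.unique (.one_left (by simp))

theorem comp_inert_left (α : T.ob m ⟶ T.ob n) {f : T.ob n ⟶ T.ob r} (hf : IsInert f)
    (β : T.ob k ⟶ T.ob l) : σ.σ (α ≫ f) β = hc (σ.σ α β) (one (T.colMap f l)) := by
  have h := σ.pastes_left α f β
  rw [σ.of_inert f β (.inl hf), hc_one_one] at h
  exact h.unique (.one_right (by simpa using h.match_eq))

/-- The functor of two variables `(m, n) ↦ m · n` with interchange cells `σ`. -/
noncomputable def bifunctor : Bifunctor z T.Ob T.Ob T.Ob IsInert IsInert where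
  ob x y := T.ob (Arity.card x * Arity.card y)
  mapL {x x'} f y := T.colMap (m := Arity.card x) (n := Arity.card x') f (Arity.card y)
  mapR x {y y'} g := T.rowMap (Arity.card x) (k := Arity.card y) (l := Arity.card y') g
  cellL {x x'} s y := T.colCell (m := Arity.card x) (n := Arity.card x') s (Arity.card y)
  cellR x {y y'} s := T.rowCell (Arity.card x) (k := Arity.card y) (l := Arity.card y') s
  sigma {x x' y y'} f g := σ.σ (m := Arity.card x) (n := Arity.card x') (k := Arity.card y)
    (l := Arity.card y') f g
  src_cellL s _ := osrc_colCell .lax s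
  tgt_cellL s _ := otgt_colCell .lax s
  src_cellR _ _ _ s := osrc_rowCell .lax s
  tgt_cellR _ _ _ s := otgt_rowCell .lax s
  mapL_id _ _ := colMap_id _ _
  mapR_id _ _ := rowMap_id _ _
  cellL_one f _ := colCell_one f
  cellR_one _ _ _ g := rowCell_one g
  cellL_vc _ _ _ _ h := pastes_colCell h
  cellR_vc _ _ _ _ _ _ h := pastes_rowCell h
  cellL_hc s t _ := colCell_hc s t
  cellR_hc _ _ _ _ s t := rowCell_hc s t
  osrc_sigma _ _ := σ.osrc_σ _ _
  otgt_sigma _ _ := σ.otgt_σ _ _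
  isWCell _ _ := σ.isWCell _ _
  sigma_strict _ _ h := σ.of_inert _ _ h
  sigma_comp_left _ _ _ := σ.pastes_left _ _ _
  sigma_comp_right _ _ _ := σ.pastes_right _ _ _
  sigma_nat_left s g := pasteEq_iff.2 (σ.nat_left s g)
  sigma_nat_right f s := pasteEq_iff.2 (σ.nat_right f s)

/-- The multiplication `(m, n) ↦ m · n` with Gray cells sent to `σ`. -/
noncomputable def mul : SketchHom (grayTensor z T.sketch T.sketch) T.sketch where
  toTwoFunctor := Bifunctor.desc (A := T.sketch) (B := T.sketch) σ.bifunctor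
  map_tight f h := by
    induction h with
    | id x => exact isInert_id _
    | comp p q _ _ hp hq =>
      exact Eq.subst (motive := fun f => IsInert (T := T) f) (Bifunctor.evalHom_comp
        (A := T.sketch) (B := T.sketch) σ.bifunctor p q).symm (IsInert.comp hp hq)
    | left f b h => exact IsInert.colMap h
    | right a g h => exact IsInert.rowMap h
  map_cone π h := by
    cases h with
    | left π b h => exact IsInertPower.colMap h
    | right a π h => exact IsInertPower.rowMap h

end CoherentSystem

namespace LawvereTwoTheory

variable {T : LawvereTwoTheory.{v, w}}

variable (T) in
/-- The inert isomorphism induced by a bijection. -/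
def inertIso {m n : ℕ} (e : Fin n ≃ Fin m) : TightIso T.sketch (T.ob m) (T.ob n) where
  hom := T.inert e
  inv := T.inert e.symm
  hom_inv := (inert_comp _ _).trans
    ((congrArg T.inert (funext fun i => by simp)).trans (T.inert_id _))
  inv_hom := (inert_comp _ _).trans
    ((congrArg T.inert (funext fun i => by simp)).trans (T.inert_id _))
  tight_hom := isInert_inert _
  tight_inv := isInert_inert _

/-- The bijection underlying `1 · n ≅ n`. -/
def lamEquiv (n : ℕ) : Fin n ≃ Fin (1 * n) where
  toFun i := finProdFinEquiv (0, i)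
  invFun t := (finProdFinEquiv.symm t).2
  left_inv i := by simp only [Equiv.symm_apply_apply]
  right_inv t := by
    obtain ⟨⟨i, j⟩, rfl⟩ := finProdFinEquiv.surjective t
    simp only [Equiv.symm_apply_apply, Subsingleton.elim i 0]

/-- The bijection underlying `n · 1 ≅ n`. -/
def rhoEquiv (n : ℕ) : Fin n ≃ Fin (n * 1) where
  toFun i := finProdFinEquiv (i, 0)
  invFun t := (finProdFinEquiv.symm t).1
  left_inv i := by simp only [Equiv.symm_apply_apply]
  right_inv t := by
    obtain ⟨⟨i, j⟩, rfl⟩ := finProdFinEquiv.surjective t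
    simp only [Equiv.symm_apply_apply, Subsingleton.elim j 0]

/-- The bijection underlying `(m · n) · k ≅ m · (n · k)`. -/
def assocEquiv (m n k : ℕ) : Fin (m * (n * k)) ≃ Fin (m * n * k) :=
  (finProdFinEquiv.symm.trans (Equiv.prodCongr (Equiv.refl _) finProdFinEquiv.symm)).trans
    ((Equiv.prodAssoc _ _ _).symm.trans
      ((Equiv.prodCongr finProdFinEquiv (Equiv.refl _)).trans finProdFinEquiv))

theorem assocEquiv_apply {m n k : ℕ} (i : Fin m) (j : Fin n) (t : Fin k) :
    assocEquiv m n k (finProdFinEquiv (i, finProdFinEquiv (j, t))) =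
      finProdFinEquiv (finProdFinEquiv (i, j), t) := by
  simp only [assocEquiv, Equiv.trans_apply, Equiv.symm_apply_apply, Equiv.prodCongr_apply,
    Prod.map_apply, Equiv.refl_apply, Equiv.prodAssoc_symm_apply]

variable (T) in
/-- The inert 1-cell `(m · n) · k ⟶ m · (n · k)`. -/
def assocMap (m n k : ℕ) : T.ob (m * n * k) ⟶ T.ob (m * (n * k)) := T.inert (assocEquiv m n k)

theorem assocMap_col {m n k : ℕ} (j : Fin n) (t : Fin k) :
    T.assocMap m n k ≫ T.col m (n * k) (finProdFinEquiv (j, t)) =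
      T.col (m * n) k t ≫ T.col m n j := by
  rw [assocMap, col, col, col, inert_comp, inert_comp]
  simp only [assocEquiv_apply]

theorem assocMap_row {m n k : ℕ} (i : Fin m) :
    T.assocMap m n k ≫ T.row m (n * k) i = T.colMap (T.row m n i) k := by
  rw [assocMap, row, row, colMap_inert, inert_comp]
  refine congrArg T.inert (funext fun t => ?_)
  obtain ⟨⟨j, t⟩, rfl⟩ := finProdFinEquiv.surjective t
  simp only [assocEquiv_apply, Equiv.symm_apply_apply]

theorem assocMap_rowMap_col {m n k : ℕ} (t : Fin k) :
    T.assocMap m n k ≫ T.rowMap m (T.col n k t) = T.col (m * n) k t := by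
  rw [assocMap, col, col, rowMap_inert, inert_comp]
  refine congrArg T.inert (funext fun u => ?_)
  obtain ⟨⟨i, j⟩, rfl⟩ := finProdFinEquiv.surjective u
  simp only [assocEquiv_apply, Equiv.symm_apply_apply]

theorem assocMap_rowMap_row {m n k : ℕ} (j : Fin n) :
    T.assocMap m n k ≫ T.rowMap m (T.row n k j) = T.colMap (T.col m n j) k := by
  rw [assocMap, row, col, rowMap_inert, colMap_inert, inert_comp]
  refine congrArg T.inert (funext fun u => ?_)
  obtain ⟨⟨i, t⟩, rfl⟩ := finProdFinEquiv.surjective u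
  simp only [assocEquiv_apply, Equiv.symm_apply_apply]

end LawvereTwoTheory

namespace CoherentSystem

variable {z : Weakness} {T : LawvereTwoTheory.{v, w}} (σ : CoherentSystem z T)

/-- The magmal commutativity with `mul (m, n) = m · n`, unit `1` and Gray cells `σ`. -/
noncomputable def magmal : MagmalCommutativity z T.sketch where
  mul := σ.mul
  unit := T.ob 1
  lam x := T.inertIso (lamEquiv (Arity.card x))
  rho x := T.inertIso (rhoEquiv (Arity.card x))
  lam_nat s := rowCell_row (m := 1) s (0 : Fin 1)
  rho_nat s := colCell_col (k := 1) s (0 : Fin 1)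

theorem assoc_cell_one {m m' : ℕ} (s : Cell (T.ob m) (T.ob m')) (n k : ℕ) :
    hc (T.colCell (T.colCell s n) k) (one (T.assocMap m' n k)) =
      hc (one (T.assocMap m n k)) (T.colCell s (n * k)) := by
  refine col_cell_ext fun u => ?_
  obtain ⟨⟨j, t⟩, rfl⟩ := finProdFinEquiv.surjective u
  simp only [hc_assoc, hc_one_one, assocMap_col, colCell_col, hc_one_hc]
  rw [one_comp, ← hc_assoc, colCell_col, hc_assoc, colCell_col, hc_one_hc]

theorem assoc_cell_two {n n' : ℕ} (m : ℕ) (s : Cell (T.ob n) (T.ob n')) (k : ℕ) :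
    hc (T.colCell (T.rowCell m s) k) (one (T.assocMap m n' k)) =
      hc (one (T.assocMap m n k)) (T.rowCell m (T.colCell s k)) := by
  refine row_cell_ext fun i => col_cell_ext fun t => ?_
  have e : ∀ r, T.colMap (T.row m r i) k ≫ T.col r k t = T.col (m * r) k t ≫ T.row m r i :=
    fun r => colMap_col _ _
  simp only [hc_assoc, hc_one_one, assocMap_row, e]
  rw [one_comp, ← hc_assoc, colCell_col, hc_assoc, rowCell_row, one_comp, hc_one_hc,
    ← hc_assoc (T.rowCell m _), rowCell_row, hc_assoc, colCell_col, hc_one_hc, hc_one_hc,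
    assocMap_row, e]

theorem assoc_cell_three {k k' : ℕ} (m n : ℕ) (s : Cell (T.ob k) (T.ob k')) :
    hc (T.rowCell (m * n) s) (one (T.assocMap m n k')) =
      hc (one (T.assocMap m n k)) (T.rowCell m (T.rowCell n s)) := by
  refine row_cell_ext fun i => row_cell_ext fun j => ?_
  have e : ∀ r, T.assocMap m n r ≫ T.row m (n * r) i ≫ T.row n r j =
      T.row (m * n) r (finProdFinEquiv (i, j)) := fun r => by
    rw [assocMap, row, row, row, inert_comp, inert_comp]
    simp only [assocEquiv_apply]
  simp only [hc_assoc, hc_one_one, Category.assoc, e]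
  rw [rowCell_row]
  rw [one_comp (T.row m _ i), ← hc_assoc (T.rowCell m _), rowCell_row, hc_assoc, rowCell_row,
    hc_one_hc, hc_one_hc, Category.assoc, e]

section

variable {m m' n n' k k' : ℕ}

theorem assoc_σ_one_two (f : T.ob m ⟶ T.ob m') (g : T.ob n ⟶ T.ob n') (k : ℕ) :
    hc (T.colCell (σ.σ f g) k) (one (T.assocMap m' n' k)) =
      hc (one (T.assocMap m n k)) (σ.σ f (T.colMap g k)) := by
  refine (isPower_rowMap (m := m') (T.isPower_col n' k)).cell_ext fun t => ?_
  simp only [hc_assoc, hc_one_one, assocMap_rowMap_col, colCell_col]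
  rw [← σ.comp_inert_right f _ (isInert_col n' k t), colMap_col,
    σ.inert_comp_right f (isInert_col n k t), hc_one_hc,
    assocMap_rowMap_col]

theorem assoc_σ_one_three (f : T.ob m ⟶ T.ob m') (n : ℕ) (h : T.ob k ⟶ T.ob k') :
    hc (σ.σ (T.colMap f n) h) (one (T.assocMap m' n k')) =
      hc (one (T.assocMap m n k)) (σ.σ f (T.rowMap n h)) := by
  refine (isPower_rowMap (m := m') (T.isPower_row n k')).cell_ext fun j => ?_
  simp only [hc_assoc, hc_one_one, assocMap_rowMap_row]
  rw [← σ.comp_inert_right f _ (isInert_row n k' j), rowMap_row,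
    σ.inert_comp_right f (isInert_row n k j), hc_one_hc,
    assocMap_rowMap_row, ← σ.comp_inert_left _ (isInert_col m' n j),
    colMap_col, σ.inert_comp_left (isInert_col m n j)]

theorem assoc_σ_two_three (m : ℕ) (g : T.ob n ⟶ T.ob n') (h : T.ob k ⟶ T.ob k') :
    hc (σ.σ (T.rowMap m g) h) (one (T.assocMap m n' k')) =
      hc (one (T.assocMap m n k)) (T.rowCell m (σ.σ g h)) := by
  refine row_cell_ext fun i => ?_
  simp only [hc_assoc, hc_one_one, assocMap_row, rowCell_row, hc_one_hc]
  rw [← σ.comp_inert_left _ (isInert_row m n' i),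
    rowMap_row, σ.inert_comp_left (isInert_row m n i)]

end

/-- The commutativity with `mul (m, n) = m · n`, unit `1` and Gray cells `σ`. -/
noncomputable def commutativity : Commutativity z T.sketch where
  toMagmalCommutativity := σ.magmal
  assoc x y t := T.inertIso (assocEquiv (Arity.card x) (Arity.card y) (Arity.card t))
  assoc_nat_one s y t := assoc_cell_one s (Arity.card y) (Arity.card t)
  assoc_nat_two x _ _ s t := assoc_cell_two (Arity.card x) s (Arity.card t)
  assoc_nat_three x y _ _ s := assoc_cell_three (Arity.card x) (Arity.card y) s
  assoc_nat_one_two f g t := by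
    refine Eq.trans ?_ ((σ.assoc_σ_one_two f g (Arity.card t)).trans ?_)
    · exact congrArg (fun c => hc (T.colCell c (Arity.card t)) (one (T.assocMap _ _ _)))
        (Bifunctor.desc_sigma (A := T.sketch) (B := T.sketch) σ.bifunctor f g)
    · exact congrArg (hc (one (T.assocMap _ _ _)))
        (Bifunctor.desc_sigma (A := T.sketch) (B := T.sketch) σ.bifunctor _ _).symm
  assoc_nat_one_three f y h := by
    refine Eq.trans ?_ ((σ.assoc_σ_one_three f (Arity.card y) h).trans ?_)
    · exact congrArg (hc · (one (T.assocMap _ _ _)))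
        (Bifunctor.desc_sigma (A := T.sketch) (B := T.sketch) σ.bifunctor _ _)
    · exact congrArg (hc (one (T.assocMap _ _ _)))
        (Bifunctor.desc_sigma (A := T.sketch) (B := T.sketch) σ.bifunctor _ _).symm
  assoc_nat_two_three x _ _ _ _ g h := by
    refine Eq.trans ?_ ((σ.assoc_σ_two_three (Arity.card x) g h).trans ?_)
    · exact congrArg (hc · (one (T.assocMap _ _ _)))
        (Bifunctor.desc_sigma (A := T.sketch) (B := T.sketch) σ.bifunctor _ _)
    · exact congrArg (fun c => hc (one (T.assocMap _ _ _)) (T.rowCell (Arity.card x) c))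
        (Bifunctor.desc_sigma (A := T.sketch) (B := T.sketch) σ.bifunctor g h).symm
  triangle x y := by
    change T.assocMap (Arity.card x) 1 (Arity.card y) ≫ T.rowMap (Arity.card x) (T.row 1 _ 0) =
      T.colMap (T.col _ 1 0) (Arity.card y)
    exact assocMap_rowMap_row 0
  pentagon x y t r := by
    change T.colMap (T.assocMap (Arity.card x) (Arity.card y) (Arity.card t)) (Arity.card r) ≫
      T.assocMap _ _ _ ≫ T.rowMap (Arity.card x) (T.assocMap _ _ _) =
      T.assocMap _ _ _ ≫ T.assocMap _ _ _
    simp only [assocMap, colMap_inert, rowMap_inert, inert_comp]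
    refine congrArg T.inert (funext fun u => ?_)
    obtain ⟨⟨i, u⟩, rfl⟩ := finProdFinEquiv.surjective u
    obtain ⟨⟨j, u⟩, rfl⟩ := finProdFinEquiv.surjective u
    obtain ⟨⟨k, u⟩, rfl⟩ := finProdFinEquiv.surjective u
    simp only [assocEquiv_apply, Equiv.symm_apply_apply]

end CoherentSystem

/-! ### Inert isomorphisms -/

namespace LawvereTwoTheory

variable {T : LawvereTwoTheory.{v, w}}

/-- An isomorphism that is inert together with its inverse. -/
structure InertIso (x y : T.Ob) where
  hom : x ⟶ y
  inv : y ⟶ x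
  hom_inv : hom ≫ inv = 𝟙 x
  inv_hom : inv ≫ hom = 𝟙 y
  inert_hom : IsInert hom
  inert_inv : IsInert inv

namespace InertIso

attribute [simp] hom_inv inv_hom

variable {x y t s : T.Ob}

@[simp] theorem hom_inv_assoc (e : InertIso x y) (f : x ⟶ t) : e.hom ≫ e.inv ≫ f = f := by
  rw [← Category.assoc, e.hom_inv, Category.id_comp]

@[simp] theorem inv_hom_assoc (e : InertIso x y) (f : y ⟶ t) : e.inv ≫ e.hom ≫ f = f := by
  rw [← Category.assoc, e.inv_hom, Category.id_comp]

/-- The identity. -/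
def refl (x : T.Ob) : InertIso x x :=
  ⟨𝟙 x, 𝟙 x, Category.id_comp _, Category.id_comp _, isInert_id x, isInert_id x⟩

/-- The inverse isomorphism. -/
def symm (e : InertIso x y) : InertIso y x :=
  ⟨e.inv, e.hom, e.inv_hom, e.hom_inv, e.inert_inv, e.inert_hom⟩

/-- The composite of two isomorphisms. -/
def trans (e : InertIso x y) (e' : InertIso y t) : InertIso x t :=
  ⟨e.hom ≫ e'.hom, e'.inv ≫ e.inv, by simp, by simp, e.inert_hom.comp e'.inert_hom,
    e'.inert_inv.comp e.inert_inv⟩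

end InertIso

/-- The tight isomorphism of sketches given by an inert isomorphism. -/
def InertIso.toTightIso {x y : T.Ob} (e : InertIso x y) :
    TightIso T.sketch x y :=
  ⟨e.hom, e.inv, e.hom_inv, e.inv_hom, e.inert_hom, e.inert_inv⟩

/-- The inert isomorphism given by a tight isomorphism of sketches. -/
def InertIso.ofTightIso {x y : T.Ob} (e : TightIso T.sketch x y) : InertIso (T := T) x y :=
  ⟨e.hom, e.inv, e.hom_inv, e.inv_hom, e.tight_hom, e.tight_inv⟩

theorem IsInert.eq_id {f : T.ob 1 ⟶ T.ob 1} (h : IsInert f) : f = 𝟙 _ := by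
  obtain ⟨φ, rfl⟩ := h
  exact (congrArg T.inert (funext fun i => Subsingleton.elim (α := Fin 1) _ _)).trans
    (T.inert_id 1)

/-- Inert 1-cells from an object isomorphic to `1` to `1` are unique. This rigidity is the source
of all the coherence laws. -/
theorem InertIso.eq_of_inert {x : T.Ob} (e : InertIso x (T.ob 1)) {f g : x ⟶ T.ob 1}
    (hf : IsInert f) (hg : IsInert g) : f = g := by
  rw [← e.hom_inv_assoc f, ← e.hom_inv_assoc g, (e.inert_inv.comp hf).eq_id,
    (e.inert_inv.comp hg).eq_id]

/-- The `i`-th projection from `x` to `1`. -/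
def coord (x : T.Ob) (i : Fin (Arity.card x)) : x ⟶ T.ob 1 := T.pr (Arity.card x) i

theorem isInert_coord (x : T.Ob) (i : Fin (Arity.card x)) : IsInert (coord x i) :=
  isInert_inert (T := T) fun _ : Fin 1 => i

theorem isInertPower_coord (x : T.Ob) : IsInertPower (coord x) :=
  T.isInertPower_pr (Arity.card x)

/-- The only coordinate of `1`. -/
def single (T : LawvereTwoTheory.{v, w}) : Fin (Arity.card (T.ob 1)) := (0 : Fin 1)

theorem coord_one (i : Fin (Arity.card (T.ob 1))) : coord (T.ob 1) i = 𝟙 _ :=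
  (isInert_coord _ _).eq_id

theorem coord_hom_ext {z x : T.Ob} {f g : z ⟶ x} (h : ∀ i, f ≫ coord x i = g ≫ coord x i) :
    f = g := (isInertPower_coord x).2.1.hom_ext h

namespace IsInertPower

variable {m k : ℕ} {P P' Q X Y : T.Ob}

theorem comp {π : Fin m → (P ⟶ Q)} {ρ : Fin k → (Q ⟶ X)} (hπ : IsInertPower π)
    (hρ : IsInertPower ρ) : IsInertPower fun t : Fin (m * k) =>
      π (finProdFinEquiv.symm t).1 ≫ ρ (finProdFinEquiv.symm t).2 := by
  refine ⟨fun t => (hπ.1 _).comp (hρ.1 _), hπ.2.1.comp hρ.2.1, fun Z f hf =>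
    hπ.2.2 _ _ fun i => hρ.2.2 _ _ fun j => ?_⟩
  simpa only [Equiv.symm_apply_apply, Category.assoc] using hf (finProdFinEquiv (i, j))

theorem comp_iso {π : Fin m → (P ⟶ X)} (hπ : IsInertPower π) (e : InertIso X Y) :
    IsInertPower fun i => π i ≫ e.hom := by
  refine ⟨fun i => (hπ.1 i).comp e.inert_hom, hπ.2.1.comp_iso e.hom_inv e.inv_hom,
    fun Z f hf => hπ.2.2 _ _ fun i => ?_⟩
  simpa using (hf i).comp e.inert_inv

theorem iso_comp {π : Fin m → (P ⟶ X)} (hπ : IsInertPower π) (e : InertIso Q P) :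
    IsInertPower fun i => e.hom ≫ π i := by
  refine ⟨fun i => e.inert_hom.comp (hπ.1 i), hπ.2.1.iso_comp e.hom_inv e.inv_hom,
    fun Z f hf => ?_⟩
  have : IsInert (f ≫ e.hom) := hπ.2.2 _ _ fun i => by simpa using hf i
  simpa using this.comp e.inert_inv

theorem isInert_lift {π : Fin m → (P ⟶ X)} (hπ : IsInertPower π) {f : Fin m → (Q ⟶ X)}
    (h : ∀ i, IsInert (f i)) : IsInert (hπ.2.1.lift f) :=
  hπ.2.2 _ _ fun i => by rw [IsPower.lift_fac]; exact h i

/-- The comparison of two cones for the same tight power. -/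
noncomputable def iso {π : Fin m → (P ⟶ X)} {π' : Fin m → (P' ⟶ X)} (h : IsInertPower π)
    (h' : IsInertPower π') : InertIso P P' where
  hom := h'.2.1.lift π
  inv := h.2.1.lift π'
  hom_inv := h.2.1.hom_ext fun i => by simp [IsPower.lift_fac]
  inv_hom := h'.2.1.hom_ext fun i => by simp [IsPower.lift_fac]
  inert_hom := h'.isInert_lift h.1
  inert_inv := h.isInert_lift h'.1

theorem iso_hom {π : Fin m → (P ⟶ X)} {π' : Fin m → (P' ⟶ X)} (h : IsInertPower π)
    (h' : IsInertPower π') (i : Fin m) : (h.iso h').hom ≫ π' i = π i :=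
  IsPower.lift_fac h'.2.1 _ _

end IsInertPower

end LawvereTwoTheory

/-! ### Rigidity of magmal commutativities -/

/-- The data of a magmal commutativity on a Lawvere 2-theory, in terms of the values of the
multiplication on 1-cells and 2-cells in each variable and on Gray cells. -/
structure UnitalBifunctor (z : Weakness) (T : LawvereTwoTheory.{v, w}) extends
    Bifunctor z T.Ob T.Ob T.Ob IsInert IsInert where
  inertL : ∀ {x x' : T.Ob} {f : x ⟶ x'} (y : T.Ob), IsInert f → IsInert (mapL f y)
  inertR : ∀ (x : T.Ob) {y y' : T.Ob} {g : y ⟶ y'}, IsInert g → IsInert (mapR x g)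
  powerL : ∀ {n : ℕ} {x x' : T.Ob} {π : Fin n → (x ⟶ x')} (y : T.Ob), IsInertPower π →
    IsInertPower fun i => mapL (π i) y
  powerR : ∀ {n : ℕ} (x : T.Ob) {y y' : T.Ob} {π : Fin n → (y ⟶ y')}, IsInertPower π →
    IsInertPower fun i => mapR x (π i)
  unit : T.Ob
  lam : ∀ x, InertIso (ob unit x) x
  rho : ∀ x, InertIso (ob x unit) x
  lam_nat : ∀ {x y : T.Ob} (s : Cell x y),
    hc (cellR unit s) (one (lam y).hom) = hc (one (lam x).hom) s
  rho_nat : ∀ {x y : T.Ob} (s : Cell x y),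
    hc (cellL s unit) (one (rho y).hom) = hc (one (rho x).hom) s

namespace UnitalBifunctor

variable {z : Weakness} {T : LawvereTwoTheory.{v, w}} (F : UnitalBifunctor z T)

/-- Since `1 ≅ mul (u, 1)` is a tight `u`-th power of `mul (1, 1)`, the latter is isomorphic
to `1`. -/
theorem nonempty_iso_one : Nonempty (InertIso (F.ob (T.ob 1) (T.ob 1)) (T.ob 1)) := by
  have h : IsInertPower fun i => (F.lam (T.ob 1)).inv ≫ F.mapL (coord F.unit i) (T.ob 1) :=
    (F.powerL (T.ob 1) (isInertPower_coord F.unit)).iso_comp (F.lam (T.ob 1)).symm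
  rcases Nat.eq_zero_or_pos (Arity.card F.unit) with h0 | h0
  · -- an empty power receives an inert 1-cell from `0`, but there is none from `0` to `1`
    obtain ⟨φ, -⟩ := h.2.2 (T.ob 0) (h.2.1.lift fun i => (Fin.cast h0 i).elim0)
      fun i => (Fin.cast h0 i).elim0
    exact (φ (0 : Fin 1)).elim0
  · -- the diagonal of the power is a section of each projection, and a retraction too, because the
    -- only inert 1-cell from `1` to `1` is the identity
    set c := F.ob (T.ob 1) (T.ob 1)
    refine ⟨⟨h.2.1.lift fun _ => 𝟙 _, _, h.2.1.lift_fac (fun _ => 𝟙 _) ⟨0, h0⟩, ?_,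
      h.isInert_lift fun _ => isInert_id _, h.1 _⟩⟩
    exact ((h.1 _).comp (h.isInert_lift fun _ => isInert_id _)).eq_id

/-- The isomorphism `mul (1, 1) ≅ 1`. -/
noncomputable def oneIso : InertIso (F.ob (T.ob 1) (T.ob 1)) (T.ob 1) := F.nonempty_iso_one.some

/-- The isomorphism of the unit with `1`. -/
noncomputable def unitIso : InertIso F.unit (T.ob 1) :=
  ((isInertPower_coord F.unit).iso
    ((F.powerL (T.ob 1) (isInertPower_coord F.unit)).comp_iso F.oneIso)).trans (F.lam (T.ob 1))

section

variable {x x' y y' : T.Ob}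

theorem cellL_mapR (s : Cell x x') {g : y ⟶ y'} (hg : IsInert g) :
    hc (F.cellL s y) (one (F.mapR x' g)) = hc (one (F.mapR x g)) (F.cellL s y') := by
  obtain ⟨e, h, k⟩ := F.sigma_nat_left s g
  rw [F.sigma_strict _ _ (.inr hg)] at h k
  have h' := h.unique (.one_right (h.match_eq.trans (osrc_one _ _)))
  have k' := k.unique (.one_left ((otgt_one _ _).symm.trans k.match_eq))
  exact k'.symm.trans h'

theorem cellR_mapL {f : x ⟶ x'} (hf : IsInert f) (s : Cell y y') :
    hc (F.cellR x s) (one (F.mapL f y')) = hc (one (F.mapL f y)) (F.cellR x' s) := by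
  obtain ⟨e, h, k⟩ := F.sigma_nat_right f s
  rw [F.sigma_strict _ _ (.inl hf)] at h k
  have h' := h.unique (.one_right (h.match_eq.trans (osrc_one _ _)))
  have k' := k.unique (.one_left ((otgt_one _ _).symm.trans k.match_eq))
  exact h'.symm.trans k'

/-- The `j`-th column `mul (x, y) ⟶ x`. -/
noncomputable def col (x y : T.Ob) (j : Fin (Arity.card y)) : F.ob x y ⟶ x :=
  F.mapR x (coord y j ≫ F.unitIso.inv) ≫ (F.rho x).hom

/-- The `i`-th row `mul (x, y) ⟶ y`. -/
noncomputable def row (x y : T.Ob) (i : Fin (Arity.card x)) : F.ob x y ⟶ y :=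
  F.mapL (coord x i ≫ F.unitIso.inv) y ≫ (F.lam y).hom

theorem isInert_coord_unit (y : T.Ob) (j : Fin (Arity.card y)) :
    IsInert (coord y j ≫ F.unitIso.inv) := (isInert_coord y j).comp F.unitIso.inert_inv

theorem isInert_col (x y : T.Ob) (j : Fin (Arity.card y)) : IsInert (F.col x y j) :=
  (F.inertR x (F.isInert_coord_unit y j)).comp (F.rho x).inert_hom

theorem isInert_row (x y : T.Ob) (i : Fin (Arity.card x)) : IsInert (F.row x y i) :=
  (F.inertL y (F.isInert_coord_unit x i)).comp (F.lam y).inert_hom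

theorem cellL_col (s : Cell x x') (y : T.Ob) (j : Fin (Arity.card y)) :
    hc (F.cellL s y) (one (F.col x' y j)) = hc (one (F.col x y j)) s := by
  rw [UnitalBifunctor.col, hc_reassoc (F.cellL_mapR s (F.isInert_coord_unit y j)), F.rho_nat,
    hc_one_hc, UnitalBifunctor.col]

theorem cellR_row (x : T.Ob) (s : Cell y y') (i : Fin (Arity.card x)) :
    hc (F.cellR x s) (one (F.row x y' i)) = hc (one (F.row x y i)) s := by
  rw [UnitalBifunctor.row, hc_reassoc (F.cellR_mapL (F.isInert_coord_unit x i) s), F.lam_nat,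
    hc_one_hc, UnitalBifunctor.row]

theorem mapL_col (f : x ⟶ x') (y : T.Ob) (j : Fin (Arity.card y)) :
    F.mapL f y ≫ F.col x' y j = F.col x y j ≫ f :=
  one_injective (by simpa [F.cellL_one] using F.cellL_col (one f) y j)

theorem mapL_col_assoc {t : T.Ob} (f : x ⟶ x') (y : T.Ob) (j : Fin (Arity.card y)) (g : x' ⟶ t) :
    F.mapL f y ≫ F.col x' y j ≫ g = F.col x y j ≫ f ≫ g := by
  rw [← Category.assoc, mapL_col, Category.assoc]

theorem mapR_row (x : T.Ob) (g : y ⟶ y') (i : Fin (Arity.card x)) :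
    F.mapR x g ≫ F.row x y' i = F.row x y i ≫ g :=
  one_injective (by simpa [F.cellR_one] using F.cellR_row x (one g) i)

theorem mapR_row_assoc {t : T.Ob} (x : T.Ob) (f : y ⟶ y') (i : Fin (Arity.card x)) (g : y' ⟶ t) :
    F.mapR x f ≫ F.row x y' i ≫ g = F.row x y i ≫ f ≫ g := by
  rw [← Category.assoc, mapR_row, Category.assoc]

theorem mapR_coord_col (x y : T.Ob) (j : Fin (Arity.card y)) :
    F.mapR x (coord y j) ≫ F.col x (T.ob 1) T.single = F.col x y j := by
  rw [UnitalBifunctor.col, ← Category.assoc, ← F.mapR_comp, ← Category.assoc, coord_one,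
    Category.comp_id, UnitalBifunctor.col]

theorem mapL_coord_row (x y : T.Ob) (i : Fin (Arity.card x)) :
    F.mapL (coord x i) y ≫ F.row (T.ob 1) y T.single = F.row x y i := by
  rw [UnitalBifunctor.row, ← Category.assoc, ← F.mapL_comp, ← Category.assoc, coord_one,
    Category.comp_id, UnitalBifunctor.row]

/-- The projection of `mul (x, y)` to the entry in row `i` and column `j`. -/
noncomputable def entry (x y : T.Ob) (i : Fin (Arity.card x)) (j : Fin (Arity.card y)) :
    F.ob x y ⟶ T.ob 1 := F.mapL (coord x i) y ≫ F.mapR (T.ob 1) (coord y j) ≫ F.oneIso.hom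

theorem col_coord (x y : T.Ob) (i : Fin (Arity.card x)) (j : Fin (Arity.card y)) :
    F.col x y j ≫ coord x i = F.entry x y i j := by
  rw [← mapL_col, UnitalBifunctor.entry, ← mapR_coord_col]
  refine congrArg (F.mapL _ _ ≫ F.mapR _ _ ≫ ·) ?_
  exact F.oneIso.eq_of_inert (F.isInert_col _ _ _) F.oneIso.inert_hom

theorem row_coord (x y : T.Ob) (i : Fin (Arity.card x)) (j : Fin (Arity.card y)) :
    F.row x y i ≫ coord y j = F.entry x y i j := by
  rw [← mapR_row, UnitalBifunctor.entry, ← mapL_coord_row, ← Category.assoc,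
    F.swap _ _ (.inl (isInert_coord x i)), Category.assoc]
  refine congrArg (F.mapL _ _ ≫ F.mapR _ _ ≫ ·) ?_
  exact F.oneIso.eq_of_inert (F.isInert_row _ _ _) F.oneIso.inert_hom

theorem isInertPower_entry (x y : T.Ob) :
    IsInertPower fun t : Fin (Arity.card x * Arity.card y) =>
      F.entry x y (finProdFinEquiv.symm t).1 (finProdFinEquiv.symm t).2 := by
  have := ((F.powerL y (isInertPower_coord x)).comp
    (F.powerR (T.ob 1) (isInertPower_coord y))).comp_iso F.oneIso
  simp only [Category.assoc] at this
  exact this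

theorem entry_hom_ext {t : T.Ob} {f g : t ⟶ F.ob x y}
    (h : ∀ i j, f ≫ F.entry x y i j = g ≫ F.entry x y i j) : f = g :=
  (F.isInertPower_entry x y).2.1.hom_ext fun _ => h _ _

theorem isPower_row (x y : T.Ob) : IsPower (F.row x y) := by
  refine IsPower.of_comp (isInertPower_coord y).2.1 ?_
  simpa only [row_coord] using (F.isInertPower_entry x y).2.1

theorem row_hom_ext {t : T.Ob} {f g : t ⟶ F.ob x y}
    (h : ∀ i, f ≫ F.row x y i = g ≫ F.row x y i) : f = g := (F.isPower_row x y).hom_ext h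

theorem row_cell_ext {t : T.Ob} {r s : Cell t (F.ob x y)}
    (h : ∀ i, hc r (one (F.row x y i)) = hc s (one (F.row x y i))) : r = s :=
  (F.isPower_row x y).cell_ext h

theorem isPower_col (x y : T.Ob) : IsPower (F.col x y) := by
  refine IsPower.of_comp (isInertPower_coord x).2.1 ?_
  simp only [col_coord]
  have := T.isPower_reindex ((finProdFinEquiv.symm.trans (Equiv.prodComm _ _)).trans
    finProdFinEquiv) (π := fun t => F.entry x y (finProdFinEquiv.symm t).1
      (finProdFinEquiv.symm t).2) (F.isInertPower_entry x y).2.1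
  simpa only [Equiv.trans_apply, Equiv.symm_apply_apply, Equiv.prodComm_apply, Prod.fst_swap,
    Prod.snd_swap] using this

theorem col_cell_ext {t : T.Ob} {r s : Cell t (F.ob x y)}
    (h : ∀ j, hc r (one (F.col x y j)) = hc s (one (F.col x y j))) : r = s :=
  (F.isPower_col x y).cell_ext h

/-- The unit isomorphism in terms of the only row of `mul (1, y)`. -/
theorem lam_eq (y : T.Ob) :
    (F.lam y).hom = F.mapL F.unitIso.hom y ≫ F.row (T.ob 1) y T.single := by
  rw [UnitalBifunctor.row, coord_one, Category.id_comp, ← Category.assoc, ← F.mapL_comp,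
    F.unitIso.hom_inv, F.mapL_id, Category.id_comp]

/-- The unit isomorphism in terms of the only column of `mul (x, 1)`. -/
theorem rho_eq (x : T.Ob) :
    (F.rho x).hom = F.mapR x F.unitIso.hom ≫ F.col x (T.ob 1) T.single := by
  rw [UnitalBifunctor.col, coord_one, Category.id_comp, ← Category.assoc, ← F.mapR_comp,
    F.unitIso.hom_inv, F.mapR_id, Category.id_comp]

end

/-! ### The coherent system of a magmal commutativity -/

section

variable {m n k l r : ℕ}

/-- The isomorphism `m · n ≅ mul (m, n)`. -/
noncomputable def arrIso (m n : ℕ) : InertIso (T.ob (m * n)) (F.ob (T.ob m) (T.ob n)) :=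
  (T.isInertPower_pr (m * n)).iso (F.isInertPower_entry (T.ob m) (T.ob n))

theorem arrIso_entry (i : Fin (Arity.card (T.ob m))) (j : Fin (Arity.card (T.ob n))) :
    (F.arrIso m n).hom ≫ F.entry (T.ob m) (T.ob n) i j = T.pr (m * n) (finProdFinEquiv (i, j)) := by
  have h := (T.isInertPower_pr (m * n)).iso_hom (F.isInertPower_entry (T.ob m) (T.ob n))
    (finProdFinEquiv (i, j))
  exact (congrArg (fun p : Fin (Arity.card (T.ob m)) × Fin (Arity.card (T.ob n)) =>
    (F.arrIso m n).hom ≫ F.entry (T.ob m) (T.ob n) p.1 p.2)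
    (finProdFinEquiv.symm_apply_apply (i, j)).symm).trans h

theorem arrIso_col (j : Fin (Arity.card (T.ob n))) :
    (F.arrIso m n).hom ≫ F.col (T.ob m) (T.ob n) j = T.col m n j :=
  coord_hom_ext fun i => by
    rw [Category.assoc, col_coord, arrIso_entry]
    exact (col_pr m n i j).symm

theorem arrIso_row (i : Fin (Arity.card (T.ob m))) :
    (F.arrIso m n).hom ≫ F.row (T.ob m) (T.ob n) i = T.row m n i :=
  coord_hom_ext fun j => by
    rw [Category.assoc, row_coord, arrIso_entry]
    exact (row_pr m n i j).symm

theorem arrIso_cellL (s : Cell (T.ob m) (T.ob n)) (k : ℕ) :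
    hc (one (F.arrIso m k).hom) (F.cellL s (T.ob k)) =
      hc (T.colCell s k) (one (F.arrIso n k).hom) :=
  F.col_cell_ext fun j => by
    rw [hc_assoc, cellL_col, hc_one_hc, arrIso_col, hc_assoc, hc_one_one, arrIso_col]
    exact (colCell_col s j).symm

theorem arrIso_cellR (m : ℕ) (s : Cell (T.ob k) (T.ob l)) :
    hc (one (F.arrIso m k).hom) (F.cellR (T.ob m) s) =
      hc (T.rowCell m s) (one (F.arrIso m l).hom) :=
  F.row_cell_ext fun i => by
    rw [hc_assoc, cellR_row, hc_one_hc, arrIso_row, hc_assoc, hc_one_one, arrIso_row]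
    exact (rowCell_row s i).symm

theorem arrIso_mapL (f : T.ob m ⟶ T.ob n) (k : ℕ) :
    (F.arrIso m k).hom ≫ F.mapL f (T.ob k) = T.colMap f k ≫ (F.arrIso n k).hom :=
  one_injective (by simpa [F.cellL_one, colCell_one] using F.arrIso_cellL (one f) k)

theorem arrIso_mapR (m : ℕ) (f : T.ob k ⟶ T.ob l) :
    (F.arrIso m k).hom ≫ F.mapR (T.ob m) f = T.rowMap m f ≫ (F.arrIso m l).hom :=
  one_injective (by simpa [F.cellR_one, rowCell_one] using F.arrIso_cellR m (one f))

/-- The interchange cell of `α` and `β`, as a cell between arrays. -/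
noncomputable def arrSigma (α : T.ob m ⟶ T.ob n) (β : T.ob k ⟶ T.ob l) :
    Cell (T.ob (m * k)) (T.ob (n * l)) :=
  hc (one (F.arrIso m k).hom) (hc (F.sigma α β) (one (F.arrIso n l).inv))

theorem arrIso_sigma (α : T.ob m ⟶ T.ob n) (β : T.ob k ⟶ T.ob l) :
    hc (one (F.arrIso m k).hom) (F.sigma α β) =
      hc (F.arrSigma α β) (one (F.arrIso n l).hom) := by
  rw [arrSigma, hc_assoc, hc_assoc, hc_one_one, (F.arrIso n l).inv_hom, hc_id]

theorem whisker_mapR (α : T.ob m ⟶ T.ob n) (β : T.ob k ⟶ T.ob l) (γ : T.ob l ⟶ T.ob r) :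
    hc (one (F.arrIso m k).hom) (hc (hc (one (F.mapR (T.ob m) β)) (F.sigma α γ))
      (one (F.arrIso n r).inv)) = hc (one (T.rowMap m β)) (F.arrSigma α γ) := by
  rw [hc_assoc, hc_one_hc, arrIso_mapR, arrSigma, hc_one_hc]

theorem whisker_mapL (α : T.ob m ⟶ T.ob n) (γ : T.ob n ⟶ T.ob r) (β : T.ob k ⟶ T.ob l) :
    hc (one (F.arrIso m k).hom) (hc (hc (one (F.mapL α (T.ob k))) (F.sigma γ β))
      (one (F.arrIso r l).inv)) = hc (one (T.colMap α k)) (F.arrSigma γ β) := by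
  rw [hc_assoc, hc_one_hc, arrIso_mapL, arrSigma, hc_one_hc]

theorem mapR_arrIso_inv (m : ℕ) (f : T.ob k ⟶ T.ob l) :
    F.mapR (T.ob m) f ≫ (F.arrIso m l).inv = (F.arrIso m k).inv ≫ T.rowMap m f := by
  rw [← (F.arrIso m k).inv_hom_assoc (_ ≫ _), ← Category.assoc (F.arrIso m k).hom, arrIso_mapR,
    Category.assoc, (F.arrIso m l).hom_inv, Category.comp_id]

theorem mapL_arrIso_inv (f : T.ob m ⟶ T.ob n) (k : ℕ) :
    F.mapL f (T.ob k) ≫ (F.arrIso n k).inv = (F.arrIso m k).inv ≫ T.colMap f k := by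
  rw [← (F.arrIso m k).inv_hom_assoc (_ ≫ _), ← Category.assoc (F.arrIso m k).hom, arrIso_mapL,
    Category.assoc, (F.arrIso n k).hom_inv, Category.comp_id]

theorem whisker_sigma_mapR (α : T.ob m ⟶ T.ob n) (β : T.ob k ⟶ T.ob l) (γ : T.ob l ⟶ T.ob r) :
    hc (one (F.arrIso m k).hom) (hc (hc (F.sigma α β) (one (F.mapR (T.ob n) γ)))
      (one (F.arrIso n r).inv)) = hc (F.arrSigma α β) (one (T.rowMap n γ)) := by
  rw [hc_assoc, hc_one_one, mapR_arrIso_inv, arrSigma, hc_assoc, hc_assoc, hc_one_one]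

theorem whisker_sigma_mapL (α : T.ob m ⟶ T.ob n) (γ : T.ob n ⟶ T.ob r) (β : T.ob k ⟶ T.ob l) :
    hc (one (F.arrIso m k).hom) (hc (hc (F.sigma α β) (one (F.mapL γ (T.ob l))))
      (one (F.arrIso r l).inv)) = hc (F.arrSigma α β) (one (T.colMap γ l)) := by
  rw [hc_assoc, hc_one_one, mapL_arrIso_inv, arrSigma, hc_assoc, hc_assoc, hc_one_one]

theorem osrc_arrSigma (α : T.ob m ⟶ T.ob n) (β : T.ob k ⟶ T.ob l) :
    osrc z (F.arrSigma α β) = T.rowMap m β ≫ T.colMap α l := by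
  simp only [arrSigma, osrc_hc, osrc_one, F.osrc_sigma, Category.assoc, mapL_arrIso_inv]
  rw [← Category.assoc, arrIso_mapR, Category.assoc, InertIso.hom_inv_assoc]

theorem otgt_arrSigma (α : T.ob m ⟶ T.ob n) (β : T.ob k ⟶ T.ob l) :
    otgt z (F.arrSigma α β) = T.colMap α k ≫ T.rowMap n β := by
  simp only [arrSigma, otgt_hc, otgt_one, F.otgt_sigma, Category.assoc, mapR_arrIso_inv]
  rw [← Category.assoc, arrIso_mapL, Category.assoc, InertIso.hom_inv_assoc]

theorem arrSigma_of_inert (α : T.ob m ⟶ T.ob n) (β : T.ob k ⟶ T.ob l)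
    (h : IsInert α ∨ IsInert β) : F.arrSigma α β = one (osrc z (F.arrSigma α β)) := by
  rw [arrSigma, F.sigma_strict _ _ h, hc_one_one, hc_one_one, osrc_one]

/-- The coherent system of a magmal commutativity. -/
noncomputable def system : CoherentSystem z T where
  σ := F.arrSigma
  osrc_σ := F.osrc_arrSigma
  otgt_σ := F.otgt_arrSigma
  isWCell α β := isWCell_hc z (isWCell_one z _) (isWCell_hc z (F.isWCell α β) (isWCell_one z _))
  inert_left φ β := F.arrSigma_of_inert _ _ (.inl (isInert_inert φ))
  inert_right α φ := F.arrSigma_of_inert _ _ (.inr (isInert_inert φ))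
  comp_right {m n k l r} α β γ := by
    have := ((F.sigma_comp_right α β γ).whiskerRight (F.arrIso n r).inv).whiskerLeft
      (F.arrIso m k).hom
    rw [whisker_mapR, whisker_sigma_mapR] at this
    exact ⟨this.1, this.2.symm⟩
  comp_left {m n r k l} α γ β := by
    have := ((F.sigma_comp_left α γ β).whiskerRight (F.arrIso r l).inv).whiskerLeft
      (F.arrIso m k).hom
    rw [whisker_mapL, whisker_sigma_mapL] at this
    exact ⟨this.1, this.2.symm⟩
  nat_right {m n k l} α s := by
    have := ((F.sigma_nat_right α s).whiskerRight (F.arrIso n l).inv).whiskerLeft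
      (F.arrIso m k).hom
    have e₁ : hc (one (F.arrIso m k).hom) (hc (hc (F.cellR (T.ob m) s)
        (one (F.mapL α (T.ob l)))) (one (F.arrIso n l).inv)) =
        hc (T.rowCell m s) (one (T.colMap α l)) := by
      rw [hc_assoc, hc_one_one, mapL_arrIso_inv, ← hc_assoc, arrIso_cellR, hc_assoc, hc_one_one,
        InertIso.hom_inv_assoc]
    have e₂ : hc (one (F.arrIso m k).hom) (hc (hc (one (F.mapL α (T.ob k)))
        (F.cellR (T.ob n) s)) (one (F.arrIso n l).inv)) =
        hc (one (T.colMap α k)) (T.rowCell n s) := by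
      rw [hc_assoc, hc_one_hc, arrIso_mapL, ← hc_one_hc, ← hc_assoc (one (F.arrIso n k).hom),
        arrIso_cellR, hc_assoc, hc_one_one, InertIso.hom_inv, hc_id]
    rw [e₁, e₂] at this
    exact pasteEq_iff.1 this
  nat_left {m n k l} s β := by
    have := ((F.sigma_nat_left s β).whiskerRight (F.arrIso n l).inv).whiskerLeft
      (F.arrIso m k).hom
    have e₁ : hc (one (F.arrIso m k).hom) (hc (hc (one (F.mapR (T.ob m) β))
        (F.cellL s (T.ob l))) (one (F.arrIso n l).inv)) =
        hc (one (T.rowMap m β)) (T.colCell s l) := by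
      rw [hc_assoc, hc_one_hc, arrIso_mapR, ← hc_one_hc, ← hc_assoc (one (F.arrIso m l).hom),
        arrIso_cellL, hc_assoc, hc_one_one, InertIso.hom_inv, hc_id]
    have e₂ : hc (one (F.arrIso m k).hom) (hc (hc (F.cellL s (T.ob k))
        (one (F.mapR (T.ob n) β))) (one (F.arrIso n l).inv)) =
        hc (T.colCell s k) (one (T.rowMap n β)) := by
      rw [hc_assoc, hc_one_one, mapR_arrIso_inv, ← hc_assoc, arrIso_cellL, hc_assoc, hc_one_one,
        InertIso.hom_inv_assoc]
    rw [e₁, e₂] at this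
    exact pasteEq_iff.1 this

end

end UnitalBifunctor

namespace LawvereTwoTheory

variable {T : LawvereTwoTheory.{v, w}}

theorem InertIso.hc_cancel {x y t : T.Ob} (e : InertIso x y) {a b : Cell y t}
    (h : hc (one e.hom) a = hc (one e.hom) b) : a = b := by
  have := congrArg (hc (one e.inv)) h
  simpa only [hc_one_hc, e.inv_hom, id_hc] using this

theorem InertIso.cancel_hc {x y t : T.Ob} (e : InertIso x y) {a b : Cell t x}
    (h : hc a (one e.hom) = hc b (one e.hom)) : a = b := by
  have := congrArg (hc · (one e.inv)) h
  simpa only [hc_assoc, hc_one_one, e.hom_inv, hc_id] using this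

theorem InertIso.isInverse_iff {x x' y y' : T.Ob} (e : InertIso x y) (e' : InertIso y' x')
    {a b : Cell y y'} :
    IsInverse (hc (one e.hom) (hc a (one e'.hom))) (hc (one e.hom) (hc b (one e'.hom))) ↔
      IsInverse a b := by
  refine ⟨fun h => ?_, fun h => (h.whiskerRight _).whiskerLeft _⟩
  have := (h.whiskerRight e'.inv).whiskerLeft e.inv
  simpa only [hc_assoc, hc_one_hc, hc_one_one, e.inv_hom, e'.hom_inv, id_hc, hc_id] using this

theorem IsInertPower.reindex {m n : ℕ} (e : Fin n ≃ Fin m) {P X : T.Ob} {π : Fin m → (P ⟶ X)}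
    (h : IsInertPower π) : IsInertPower fun i => π (e i) :=
  ⟨fun i => h.1 _, T.isPower_reindex e h.2.1, fun Z f hf => h.2.2 Z f fun i => by
    have := hf (e.symm i)
    simp only [e.apply_symm_apply] at this
    exact this⟩

end LawvereTwoTheory

namespace UnitalBifunctor

variable {z : Weakness} {T : LawvereTwoTheory.{v, w}} (F G : UnitalBifunctor z T)

/-- The functor `mul (-, y)` on inert isomorphisms. -/
def isoL {x x' : T.Ob} (e : InertIso x x') (y : T.Ob) : InertIso (F.ob x y) (F.ob x' y) where
  hom := F.mapL e.hom y
  inv := F.mapL e.inv y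
  hom_inv := by rw [← F.mapL_comp, e.hom_inv, F.mapL_id]
  inv_hom := by rw [← F.mapL_comp, e.inv_hom, F.mapL_id]
  inert_hom := F.inertL y e.inert_hom
  inert_inv := F.inertL y e.inert_inv

/-- There is only one way to identify the values of the functor with arrays, compatibly with the
actions on 2-cells in each variable. -/
theorem arrIso_unique
    (φ : ∀ m n : ℕ, T.ob (m * n) ⟶ F.ob (T.ob m) (T.ob n)) (hφ : ∀ m n, IsInert (φ m n))
    (hL : ∀ {m m' : ℕ} (f : T.ob m ⟶ T.ob m') (n : ℕ),
      φ m n ≫ F.mapL f (T.ob n) = T.colMap f n ≫ φ m' n)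
    (hR : ∀ (m : ℕ) {n n' : ℕ} (f : T.ob n ⟶ T.ob n'),
      φ m n ≫ F.mapR (T.ob m) f = T.rowMap m f ≫ φ m n') (m n : ℕ) :
    φ m n = (F.arrIso m n).hom := by
  refine F.entry_hom_ext fun i j => ?_
  -- compatibility with 1-cells reduces the claim to `m = n = 1`, where rigidity applies
  have e : φ 1 1 ≫ F.oneIso.hom = (F.arrIso 1 1).hom ≫ F.oneIso.hom :=
    ((F.arrIso 1 1).trans F.oneIso).eq_of_inert ((hφ 1 1).comp F.oneIso.inert_hom)
      ((F.arrIso 1 1).trans F.oneIso).inert_hom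
  have h₁ := hL (coord (T.ob m) i) n
  have h₂ := hR 1 (coord (T.ob n) j)
  have h₃ := F.arrIso_mapL (coord (T.ob m) i) n
  have h₄ := F.arrIso_mapR 1 (coord (T.ob n) j)
  rw [UnitalBifunctor.entry]
  exact calc
    _ = (φ m n ≫ F.mapL (coord (T.ob m) i) (T.ob n)) ≫ F.mapR _ (coord (T.ob n) j) ≫
        F.oneIso.hom := (Category.assoc _ _ _).symm
    _ = T.colMap (coord (T.ob m) i) n ≫ (φ 1 n ≫ F.mapR _ (coord (T.ob n) j)) ≫
        F.oneIso.hom := by rw [h₁, Category.assoc, Category.assoc]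
    _ = T.colMap (coord (T.ob m) i) n ≫ T.rowMap 1 (coord (T.ob n) j) ≫ φ 1 1 ≫
        F.oneIso.hom := by rw [h₂, Category.assoc]
    _ = T.colMap (coord (T.ob m) i) n ≫ ((F.arrIso 1 n).hom ≫ F.mapR _ (coord (T.ob n) j)) ≫
        F.oneIso.hom := by rw [e, h₄, Category.assoc]
    _ = ((F.arrIso m n).hom ≫ F.mapL (coord (T.ob m) i) (T.ob n)) ≫
        F.mapR _ (coord (T.ob n) j) ≫ F.oneIso.hom := by
      rw [h₃, Category.assoc, Category.assoc]
    _ = _ := Category.assoc _ _ _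

/-! ### The comparison of two magmal commutativities -/

section

variable {x x' y y' : T.Ob}

/-- The comparison isomorphism of the values of two functors, defined by entries. -/
noncomputable def compare (x y : T.Ob) : InertIso (F.ob x y) (G.ob x y) :=
  (F.isInertPower_entry x y).iso (G.isInertPower_entry x y)

theorem compare_entry (i : Fin (Arity.card x)) (j : Fin (Arity.card y)) :
    (F.compare G x y).hom ≫ G.entry x y i j = F.entry x y i j := by
  have := (F.isInertPower_entry x y).iso_hom (G.isInertPower_entry x y) (finProdFinEquiv (i, j))
  simp only [Equiv.symm_apply_apply] at this
  exact this

theorem compare_row (i : Fin (Arity.card x)) :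
    (F.compare G x y).hom ≫ G.row x y i = F.row x y i :=
  coord_hom_ext fun j => by rw [Category.assoc, row_coord, row_coord, compare_entry]

theorem compare_row_assoc {t : T.Ob} (i : Fin (Arity.card x)) (g : y ⟶ t) :
    (F.compare G x y).hom ≫ G.row x y i ≫ g = F.row x y i ≫ g := by
  rw [← Category.assoc, compare_row]

theorem compare_col (j : Fin (Arity.card y)) :
    (F.compare G x y).hom ≫ G.col x y j = F.col x y j :=
  coord_hom_ext fun i => by rw [Category.assoc, col_coord, col_coord, compare_entry]

theorem compare_col_assoc {t : T.Ob} (i : Fin (Arity.card y)) (g : x ⟶ t) :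
    (F.compare G x y).hom ≫ G.col x y i ≫ g = F.col x y i ≫ g := by
  rw [← Category.assoc, compare_col]

theorem compare_cellL (s : Cell x x') (y : T.Ob) :
    hc (F.cellL s y) (one (F.compare G x' y).hom) =
      hc (one (F.compare G x y).hom) (G.cellL s y) :=
  G.col_cell_ext fun j => by
    rw [hc_assoc, hc_one_one, compare_col, cellL_col, hc_assoc, cellL_col, hc_one_hc, compare_col]

theorem compare_cellR (x : T.Ob) (s : Cell y y') :
    hc (F.cellR x s) (one (F.compare G x y').hom) =
      hc (one (F.compare G x y).hom) (G.cellR x s) :=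
  G.row_cell_ext fun j => by
    rw [hc_assoc, hc_one_one, compare_row, cellR_row, hc_assoc, cellR_row, hc_one_hc, compare_row]

theorem compare_mapL (f : x ⟶ x') (y : T.Ob) :
    (F.compare G x y).hom ≫ G.mapL f y = F.mapL f y ≫ (F.compare G x' y).hom :=
  one_injective (by simpa [F.cellL_one, G.cellL_one] using (F.compare_cellL G (one f) y).symm)

theorem compare_mapR (x : T.Ob) (f : y ⟶ y') :
    (F.compare G x y).hom ≫ G.mapR x f = F.mapR x f ≫ (F.compare G x y').hom :=
  one_injective (by simpa [F.cellR_one, G.cellR_one] using (F.compare_cellR G x (one f)).symm)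

theorem arrIso_compare (m n : ℕ) :
    (F.arrIso m n).hom ≫ (F.compare G (T.ob m) (T.ob n)).hom = (G.arrIso m n).hom :=
  G.entry_hom_ext fun i j => by rw [Category.assoc, compare_entry, arrIso_entry, arrIso_entry]

theorem compare_sigma (h : F.system = G.system) (f : x ⟶ x') (g : y ⟶ y') :
    hc (F.sigma f g) (one (F.compare G x' y').hom) =
      hc (one (F.compare G x y).hom) (G.sigma f g) := by
  refine (F.arrIso (Arity.card x) (Arity.card y)).hc_cancel ?_
  have e : F.arrSigma (m := Arity.card x) (n := Arity.card x') (k := Arity.card y)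
      (l := Arity.card y') f g = G.arrSigma f g := congrArg (fun σ : CoherentSystem z T =>
    σ.σ (m := Arity.card x) (n := Arity.card x') (k := Arity.card y) (l := Arity.card y') f g) h
  refine (hc_assoc _ _ _).symm.trans ((congrArg (hc · _) (F.arrIso_sigma f g)).trans ?_)
  refine (hc_assoc _ _ _).trans ((congrArg (hc _) (hc_one_one _ _)).trans ?_)
  refine (congrArg₂ (fun a b => hc a (one b)) e (F.arrIso_compare G _ _)).trans ?_
  refine (G.arrIso_sigma f g).symm.trans (Eq.trans ?_ (hc_one_hc _ _ _).symm)
  exact congrArg (fun b => hc (one b) _) (F.arrIso_compare G _ _).symm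

/-- The comparison isomorphism of the units. -/
noncomputable def compareUnit : InertIso F.unit G.unit := F.unitIso.trans G.unitIso.symm

theorem lam_compare (x : T.Ob) : (F.lam x).hom =
    (F.compare G F.unit x).hom ≫ G.mapL (F.compareUnit G).hom x ≫ (G.lam x).hom := by
  rw [G.lam_eq, ← Category.assoc (G.mapL _ _), ← G.mapL_comp, ← Category.assoc, compare_mapL,
    Category.assoc, compare_row, F.lam_eq]
  refine congrArg (F.mapL · x ≫ _) ?_
  exact ((Category.assoc _ _ _).trans ((congrArg (F.unitIso.hom ≫ ·) G.unitIso.inv_hom).trans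
    (Category.comp_id _))).symm

theorem rho_compare (x : T.Ob) : (F.rho x).hom =
    (F.compare G x F.unit).hom ≫ G.mapR x (F.compareUnit G).hom ≫ (G.rho x).hom := by
  rw [G.rho_eq, ← Category.assoc (G.mapR _ _), ← G.mapR_comp, ← Category.assoc, compare_mapR,
    Category.assoc, compare_col, F.rho_eq]
  refine congrArg (F.mapR x · ≫ _) ?_
  exact ((Category.assoc _ _ _).trans ((congrArg (F.unitIso.hom ≫ ·) G.unitIso.inv_hom).trans
    (Category.comp_id _))).symm

end

/-! ### The exchange of rows and columns -/

section

variable {x x' y y' : T.Ob}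

/-- The isomorphism `mul (x, y) ≅ mul (y, x)` that exchanges rows and columns. -/
noncomputable def flip (x y : T.Ob) : InertIso (F.ob x y) (F.ob y x) :=
  ((F.isInertPower_entry x y).reindex ((finProdFinEquiv.symm.trans (Equiv.prodComm _ _)).trans
    finProdFinEquiv)).iso (F.isInertPower_entry y x)

theorem flip_entry (j : Fin (Arity.card y)) (i : Fin (Arity.card x)) :
    (F.flip x y).hom ≫ F.entry y x j i = F.entry x y i j := by
  refine (congrArg (fun p : Fin (Arity.card y) × Fin (Arity.card x) =>
    (F.flip x y).hom ≫ F.entry y x p.1 p.2) (finProdFinEquiv.symm_apply_apply (j, i)).symm).trans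
    ((((F.isInertPower_entry x y).reindex ((finProdFinEquiv.symm.trans
    (Equiv.prodComm _ _)).trans finProdFinEquiv)).iso_hom (F.isInertPower_entry y x)
    (finProdFinEquiv (j, i))).trans ?_)
  simp only [Equiv.symm_apply_apply, Equiv.trans_apply, Equiv.prodComm_apply, Prod.fst_swap,
    Prod.snd_swap]

theorem flip_row (j : Fin (Arity.card y)) : (F.flip x y).hom ≫ F.row y x j = F.col x y j :=
  coord_hom_ext fun i => by rw [Category.assoc, row_coord, col_coord, flip_entry]

theorem flip_col (i : Fin (Arity.card x)) : (F.flip x y).hom ≫ F.col y x i = F.row x y i :=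
  coord_hom_ext fun j => by rw [Category.assoc, row_coord, col_coord, flip_entry]

theorem flip_col_assoc {t : T.Ob} (i : Fin (Arity.card x)) (g : y ⟶ t) :
    (F.flip x y).hom ≫ F.col y x i ≫ g = F.row x y i ≫ g := by
  rw [← Category.assoc, flip_col]

theorem flip_flip (x y : T.Ob) : (F.flip x y).hom ≫ (F.flip y x).hom = 𝟙 _ :=
  F.entry_hom_ext fun i j => by rw [Category.assoc, flip_entry, flip_entry, Category.id_comp]

theorem flip_cellL (s : Cell x x') (y : T.Ob) :
    hc (F.cellL s y) (one (F.flip x' y).hom) = hc (one (F.flip x y).hom) (F.cellR y s) :=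
  F.row_cell_ext fun j => by
    rw [hc_assoc, hc_one_one, flip_row, cellL_col, hc_assoc, cellR_row, hc_one_hc, flip_row]

theorem flip_cellR (x : T.Ob) (s : Cell y y') :
    hc (F.cellR x s) (one (F.flip x y').hom) = hc (one (F.flip x y).hom) (F.cellL s x) :=
  F.col_cell_ext fun j => by
    rw [hc_assoc, hc_one_one, flip_col, cellR_row, hc_assoc, cellL_col, hc_one_hc, flip_col]

theorem flip_mapR (f : x ⟶ x') (y : T.Ob) :
    (F.flip x y).hom ≫ F.mapR y f = F.mapL f y ≫ (F.flip x' y).hom :=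
  one_injective (by simpa [F.cellL_one, F.cellR_one] using (F.flip_cellL (one f) y).symm)

theorem flip_unit (x : T.Ob) : (F.flip F.unit x).hom ≫ (F.rho x).hom = (F.lam x).hom := by
  rw [rho_eq, ← Category.assoc, flip_mapR, Category.assoc, flip_col, ← lam_eq]

/-- Rigidity forces the shape of a braiding. -/
theorem eq_flip (b : ∀ x y : T.Ob, F.ob x y ⟶ F.ob y x) (hb : ∀ x y, IsInert (b x y))
    (hL : ∀ {x x' : T.Ob} (f : x ⟶ x') (y : T.Ob), F.mapL f y ≫ b x' y = b x y ≫ F.mapR y f)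
    (hR : ∀ (x : T.Ob) {y y' : T.Ob} (f : y ⟶ y'), F.mapR x f ≫ b x y' = b x y ≫ F.mapL f x)
    (x y : T.Ob) : b x y = (F.flip x y).hom := by
  refine F.entry_hom_ext fun j i => ?_
  rw [flip_entry, UnitalBifunctor.entry, ← Category.assoc, ← hR, Category.assoc, ← Category.assoc
    (b _ _), ← hL, UnitalBifunctor.entry, Category.assoc, ← Category.assoc (F.mapR _ _),
    F.swap _ _ (.inl (isInert_coord x i)), Category.assoc]
  refine congrArg (F.mapL _ _ ≫ F.mapR _ _ ≫ ·) ?_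
  exact F.oneIso.eq_of_inert ((hb _ _).comp F.oneIso.inert_hom) F.oneIso.inert_hom

theorem arrIso_flip (m n : ℕ) :
    (F.arrIso m n).hom ≫ (F.flip (T.ob m) (T.ob n)).hom =
      T.transpose m n ≫ (F.arrIso n m).hom :=
  F.entry_hom_ext fun j i => by
    rw [Category.assoc, flip_entry, arrIso_entry, Category.assoc, arrIso_entry, transpose,
      inert_pr]
    exact congrArg (T.pr _) (by simp only [Equiv.symm_apply_apply])

theorem flip_arrIso_inv (m n : ℕ) :
    (F.flip (T.ob m) (T.ob n)).hom ≫ (F.arrIso n m).inv =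
      (F.arrIso m n).inv ≫ T.transpose m n := by
  rw [← (F.arrIso m n).inv_hom_assoc (_ ≫ _), ← Category.assoc (F.arrIso m n).hom, arrIso_flip,
    Category.assoc, (F.arrIso n m).hom_inv, Category.comp_id]

theorem isInverse_sigma_iff {m n k l : ℕ} (α : T.ob m ⟶ T.ob n) (β : T.ob k ⟶ T.ob l) :
    IsInverse (F.arrSigma α β)
        (hc (one (T.transpose m k)) (hc (F.arrSigma β α) (one (T.transpose l n)))) ↔
      IsInverse (F.sigma α β)
        (hc (one (F.flip (T.ob m) (T.ob k)).hom)
          (hc (F.sigma β α) (one (F.flip (T.ob l) (T.ob n)).hom))) := by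
  rw [← InertIso.isInverse_iff (F.arrIso m k) (F.arrIso n l).symm]
  refine iff_of_eq (congrArg (IsInverse _) ?_)
  simp only [arrSigma, hc_assoc, hc_one_one, hc_one_hc, InertIso.symm]
  rw [← arrIso_flip, flip_arrIso_inv]

/-- The system is symmetric if and only if the exchange of rows and columns sends Gray cells to
inverses of Gray cells. -/
theorem isSymmetric_iff : F.system.IsSymmetric ↔
    ∀ {x x' y y' : T.Ob} (f : x ⟶ x') (g : y ⟶ y'), ∃ c, IsInverse (F.sigma g f) c ∧
      hc (F.sigma f g) (one (F.flip x' y').hom) = hc (one (F.flip x y).hom) c := by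
  constructor
  · intro h x x' y y' f g
    have := (F.isInverse_sigma_iff (m := Arity.card y) (n := Arity.card y') (k := Arity.card x)
      (l := Arity.card x') g f).1 (h _ _)
    refine ⟨_, this, Eq.symm ?_⟩
    exact (hc_one_hc _ _ _).trans ((congrArg (fun b => hc (one b) _) (F.flip_flip x y)).trans
      (id_hc _))
  · intro h m n k l α β
    refine (F.isInverse_sigma_iff α β).2 ?_
    obtain ⟨c, hc₁, hc₂⟩ := h β α
    rwa [hc₂, hc_one_hc, flip_flip, id_hc]

end

end UnitalBifunctor

/-! ### Classification of commutativities -/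

namespace MagmalCommutativity

variable {z : Weakness} {T : LawvereTwoTheory.{v, w}} (M N : MagmalCommutativity z T.sketch)

/-- The data of a magmal commutativity as a functor of two variables. -/
def unital : UnitalBifunctor z T where
  toBifunctor := M.mul.toTwoFunctor.toBifunctor
  inertL _ h := M.mul.map_tight _ (Gray.Tight.left _ _ h)
  inertR _ _ _ _ h := M.mul.map_tight _ (Gray.Tight.right _ _ h)
  powerL _ h := M.mul.map_cone _ (Gray.Cone.left _ _ h)
  powerR _ _ _ _ h := M.mul.map_cone _ (Gray.Cone.right _ _ h)
  unit := M.unit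
  lam x := .ofTightIso (M.lam x)
  rho x := .ofTightIso (M.rho x)
  lam_nat s := M.lam_nat s
  rho_nat s := M.rho_nat s

/-- The coherent system of a magmal commutativity. -/
noncomputable def system : CoherentSystem z T := M.unital.system

theorem induces_system : M.Induces M.system :=
  ⟨fun m n => (M.unital.arrIso m n).toTightIso, fun s n => M.unital.arrIso_cellL s n,
    fun m _ _ s => M.unital.arrIso_cellR m s, fun α β => M.unital.arrIso_sigma α β⟩

/-- The isomorphisms `m · n ≅ mul (m, n)` are forced by their compatibility with the actions on
1-cells (`arrIso_unique`), so a magmal commutativity induces only one coherent system. -/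
theorem Induces.system_eq {M : MagmalCommutativity z T.sketch} {σ : CoherentSystem z T}
    (h : M.Induces σ) : M.system = σ := by
  obtain ⟨φ, hL, hR, hσ⟩ := h
  have e : ∀ m n, (φ m n).hom = (M.unital.arrIso m n).hom :=
    M.unital.arrIso_unique (fun m n => (φ m n).hom) (fun m n => (φ m n).tight_hom)
      (fun f n => one_injective (by
        have := hL (one f) n
        rw [colCell_one] at this
        refine Eq.trans ?_ (this.trans (hc_one_one _ _))
        exact (hc_one_one _ _).symm.trans (congrArg (hc _) (M.unital.cellL_one f _).symm)))
      (fun m _ _ f => one_injective (by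
        have := hR m (one f)
        rw [rowCell_one] at this
        refine Eq.trans ?_ (this.trans (hc_one_one _ _))
        exact (hc_one_one _ _).symm.trans (congrArg (hc _) (M.unital.cellR_one _ f).symm)))
  refine CoherentSystem.ext ?_
  funext m n k l α β
  have h₁ := hσ α β
  rw [e, e] at h₁
  have h₂ := (M.unital.arrIso_sigma α β).symm.trans h₁
  exact (M.unital.arrIso n l).cancel_hc h₂

theorem induces_magmal (σ : CoherentSystem z T) : σ.magmal.Induces σ := by
  refine ⟨fun m n => (InertIso.refl (T.ob (m * n))).toTightIso, fun s n => ?_, fun m _ _ s => ?_,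
    fun α β => ?_⟩
  · exact (id_hc _).trans (hc_id _).symm
  · exact (id_hc _).trans (hc_id _).symm
  · exact ((id_hc _).trans (Bifunctor.desc_sigma (A := T.sketch) (B := T.sketch) σ.bifunctor
      α β)).trans (hc_id _).symm

theorem system_surjective : Function.Surjective (system (z := z) (T := T)) := fun σ =>
  ⟨σ.magmal, Induces.system_eq (induces_magmal σ)⟩

end MagmalCommutativity

namespace MagmalCommutativity

variable {z : Weakness} {T : LawvereTwoTheory.{v, w}} {M N : MagmalCommutativity z T.sketch}

/-- An isomorphism `M ≅ N` transports the identification of `M` with arrays to one of `N`, so the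
system of `M` is also induced by `N`. -/
theorem system_eq_of_iso (e : MagmalIso M N) : M.system = N.system := by
  refine (Induces.system_eq ⟨fun m n => ((M.unital.arrIso m n).trans
    (.ofTightIso (e.mul (T.ob m) (T.ob n)))).toTightIso, fun s n => ?_, fun m _ _ s => ?_,
    fun α β => ?_⟩).symm
  · refine (congrArg (hc · _) (one_comp _ _)).trans ((hc_assoc _ _ _).trans ?_)
    refine (congrArg (hc _) (e.nat_left s (T.ob n)).symm).trans ((hc_assoc _ _ _).symm.trans ?_)
    refine (congrArg (hc · _) (M.unital.arrIso_cellL s n)).trans ((hc_assoc _ _ _).trans ?_)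
    exact congrArg (hc _) (hc_one_one _ _)
  · refine (congrArg (hc · _) (one_comp _ _)).trans ((hc_assoc _ _ _).trans ?_)
    refine (congrArg (hc _) (e.nat_right (T.ob m) s).symm).trans ((hc_assoc _ _ _).symm.trans ?_)
    refine (congrArg (hc · _) (M.unital.arrIso_cellR m s)).trans ((hc_assoc _ _ _).trans ?_)
    exact congrArg (hc _) (hc_one_one _ _)
  · refine (congrArg (hc · _) (one_comp _ _)).trans ((hc_assoc _ _ _).trans ?_)
    refine (congrArg (hc _) (e.nat_sigma α β).symm).trans ((hc_assoc _ _ _).symm.trans ?_)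
    refine (congrArg (hc · _) (M.unital.arrIso_sigma α β)).trans ((hc_assoc _ _ _).trans ?_)
    exact congrArg (hc _) (hc_one_one _ _)

/-- Magmal commutativities with the same coherent system are isomorphic: both multiplications are
identified with arrays, and the comparison preserves the Gray cells because the systems agree. -/
noncomputable def isoOfSystemEq (h : M.system = N.system) : MagmalIso M N where
  mul x y := (M.unital.compare N.unital x y).toTightIso
  unit := (M.unital.compareUnit N.unital).toTightIso
  nat_left s y := M.unital.compare_cellL N.unital s y
  nat_right x _ _ s := M.unital.compare_cellR N.unital x s
  nat_sigma f g := M.unital.compare_sigma N.unital h f g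
  lam x := M.unital.lam_compare N.unital x
  rho x := M.unital.rho_compare N.unital x

end MagmalCommutativity

namespace Commutativity

variable {z : Weakness} {T : LawvereTwoTheory.{v, w}} (M N : Commutativity z T.sketch)

/-- The data of a commutativity, without the associator, as a functor of two variables. -/
abbrev unital : UnitalBifunctor z T := M.toMagmalCommutativity.unital

/-- The associator as an inert 1-cell. -/
def assocHom (x y t : T.Ob) :
    M.unital.ob (M.unital.ob x y) t ⟶ M.unital.ob x (M.unital.ob y t) := (M.assoc x y t).hom

section

variable {x x' y y' t t' : T.Ob}

theorem assoc_mapL (f : x ⟶ x') (y t : T.Ob) :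
    M.assocHom x y t ≫ M.unital.mapL f (M.unital.ob y t) =
      M.unital.mapL (M.unital.mapL f y) t ≫ M.assocHom x' y t := by
  refine one_injective ?_
  have := M.assoc_nat_one (one f) y t
  have e₁ : M.mul.cellLeft (M.mul.cellLeft (one f) y) t =
      one (M.unital.mapL (M.unital.mapL f y) t) :=
    (congrArg (M.mul.cellLeft · t) (M.unital.cellL_one f y)).trans (M.unital.cellL_one _ t)
  rw [e₁] at this
  refine Eq.trans ?_ (this.symm.trans (hc_one_one _ _))
  exact (hc_one_one _ _).symm.trans (congrArg (hc _) (M.unital.cellL_one _ _).symm)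

theorem assoc_mapR_mapL (x : T.Ob) (f : y ⟶ y') (t : T.Ob) :
    M.assocHom x y t ≫ M.unital.mapR x (M.unital.mapL f t) =
      M.unital.mapL (M.unital.mapR x f) t ≫ M.assocHom x y' t := by
  refine one_injective ?_
  have := M.assoc_nat_two x (one f) t
  have e₁ : M.mul.cellLeft (M.mul.cellRight x (one f)) t =
      one (M.unital.mapL (M.unital.mapR x f) t) :=
    (congrArg (M.mul.cellLeft · t) (M.unital.cellR_one x f)).trans (M.unital.cellL_one _ t)
  have e₂ : M.mul.cellRight x (M.mul.cellLeft (one f) t) =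
      one (M.unital.mapR x (M.unital.mapL f t)) :=
    (congrArg (M.mul.cellRight x) (M.unital.cellL_one f t)).trans (M.unital.cellR_one x _)
  rw [e₁, e₂] at this
  exact (hc_one_one _ _).symm.trans (this.symm.trans (hc_one_one _ _))

theorem assoc_mapR (x y : T.Ob) (f : t ⟶ t') :
    M.assocHom x y t ≫ M.unital.mapR x (M.unital.mapR y f) =
      M.unital.mapR (M.unital.ob x y) f ≫ M.assocHom x y t' := by
  refine one_injective ?_
  have := M.assoc_nat_three x y (one f)
  have e₁ : M.mul.cellRight (M.mul.ob x y) (one f) = one (M.unital.mapR (M.unital.ob x y) f) :=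
    M.unital.cellR_one _ f
  have e₂ : M.mul.cellRight x (M.mul.cellRight y (one f)) =
      one (M.unital.mapR x (M.unital.mapR y f)) :=
    (congrArg (M.mul.cellRight x) (M.unital.cellR_one y f)).trans (M.unital.cellR_one x _)
  rw [e₁, e₂] at this
  exact (hc_one_one _ _).symm.trans (this.symm.trans (hc_one_one _ _))

/-- Rigidity forces the shape of the associator. -/
theorem assoc_entry (x y t : T.Ob) (i : Fin (Arity.card x)) (j : Fin (Arity.card y))
    (k : Fin (Arity.card t)) :
    M.assocHom x y t ≫ M.unital.row x (M.unital.ob y t) i ≫ M.unital.entry y t j k =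
      M.unital.col (M.unital.ob x y) t k ≫ M.unital.entry x y i j := by
  -- both sides factor through the projection to the `(i, j, k)`-th copy of
  -- `mul (mul (1, 1), 1) ≅ 1`, from which there is only one inert 1-cell to `1`
  set F := M.unital
  have hr : F.row x (F.ob y t) i ≫ F.entry y t j k = F.mapL (coord x i) (F.ob y t) ≫
      F.mapR _ (F.mapL (coord y j) t) ≫ F.mapR _ (F.mapR _ (coord t k)) ≫
      F.row (T.ob 1) _ T.single ≫ F.oneIso.hom := by
    rw [← F.mapL_coord_row, UnitalBifunctor.entry, Category.assoc, ← F.mapR_row_assoc,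
      ← F.mapR_row_assoc]
  have hl : F.col (F.ob x y) t k ≫ F.entry x y i j = F.mapL (F.mapL (coord x i) y) t ≫
      F.mapL (F.mapR _ (coord y j)) t ≫ F.mapR _ (coord t k) ≫
      F.col _ (T.ob 1) T.single ≫ F.oneIso.hom := by
    rw [UnitalBifunctor.entry, ← F.mapL_col_assoc, ← F.mapL_col_assoc, ← F.mapR_coord_col,
      Category.assoc]
  rw [hr, hl, ← Category.assoc, assoc_mapL, Category.assoc, ← Category.assoc (M.assocHom _ _ _),
    assoc_mapR_mapL, Category.assoc, ← Category.assoc (M.assocHom _ _ _), assoc_mapR,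
    Category.assoc]
  refine congrArg (F.mapL _ _ ≫ F.mapL _ _ ≫ F.mapR _ _ ≫ ·) ?_
  refine ((F.isoL F.oneIso (T.ob 1)).trans F.oneIso).eq_of_inert ?_ ?_
  · exact IsInert.comp (M.assoc _ _ _).tight_hom ((F.isInert_row _ _ _).comp F.oneIso.inert_hom)
  · exact (F.isInert_col _ _ _).comp F.oneIso.inert_hom

theorem row_entry_hom_ext {r : T.Ob} {f g : r ⟶ M.unital.ob x (M.unital.ob y t)}
    (h : ∀ i j k, f ≫ M.unital.row x (M.unital.ob y t) i ≫ M.unital.entry y t j k =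
      g ≫ M.unital.row x (M.unital.ob y t) i ≫ M.unital.entry y t j k) : f = g :=
  M.unital.row_hom_ext fun i => M.unital.entry_hom_ext fun j k => by
    rw [Category.assoc, Category.assoc, h]

theorem compare_assoc (x y t : T.Ob) :
    M.assocHom x y t ≫ (M.unital.compare N.unital x (M.unital.ob y t)).hom ≫
        N.unital.mapR x (M.unital.compare N.unital y t).hom =
      (M.unital.compare N.unital (M.unital.ob x y) t).hom ≫
        N.unital.mapL (M.unital.compare N.unital x y).hom t ≫ N.assocHom x y t := by
  refine N.row_entry_hom_ext fun i j k => ?_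
  simp only [Category.assoc]
  rw [N.unital.mapR_row_assoc, UnitalBifunctor.compare_entry, UnitalBifunctor.compare_row_assoc,
    assoc_entry, assoc_entry, N.unital.mapL_col_assoc, UnitalBifunctor.compare_entry,
    UnitalBifunctor.compare_col_assoc]

theorem flip_hexagon (x y t : T.Ob) :
    M.assocHom x y t ≫ (M.unital.flip x (M.unital.ob y t)).hom ≫ M.assocHom y t x =
      M.unital.mapL (M.unital.flip x y).hom t ≫ M.assocHom y x t ≫
        M.unital.mapR y (M.unital.flip x t).hom := by
  refine M.row_entry_hom_ext fun j k i => ?_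
  simp only [Category.assoc]
  rw [assoc_entry, M.unital.flip_col_assoc, assoc_entry, M.unital.mapR_row_assoc,
    M.unital.flip_entry, assoc_entry, M.unital.mapL_col_assoc, M.unital.flip_entry]

end

/-- Commutativities with the same coherent system are isomorphic: the associators impose no further
condition, since both have the shape forced by rigidity. -/
noncomputable def isoOfSystemEq
    (h : M.toMagmalCommutativity.system = N.toMagmalCommutativity.system) :
    CommutativityIso M N where
  toMagmalIso := MagmalCommutativity.isoOfSystemEq h
  assoc x y t := M.compare_assoc N x y t

theorem Symmetry.braid_eq {M : Commutativity z T.sketch} (S : Symmetry M) (x y : T.Ob) :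
    S.braid x y = (M.unital.flip x y).hom :=
  M.unital.eq_flip S.braid S.tight_braid
    (fun f y => one_injective (by
      refine Eq.trans ?_ ((S.nat_left (one f) y).trans ?_)
      · exact (hc_one_one _ _).symm.trans (congrArg (hc · _) (M.unital.cellL_one f y).symm)
      · exact (congrArg (hc _) (M.unital.cellR_one y f)).trans (hc_one_one _ _)))
    (fun x _ _ f => one_injective (by
      refine Eq.trans ?_ ((S.nat_right x (one f)).trans ?_)
      · exact (hc_one_one _ _).symm.trans (congrArg (hc · _) (M.unital.cellR_one x f).symm)
      · exact (congrArg (hc _) (M.unital.cellL_one f x)).trans (hc_one_one _ _))) x y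

/-- The components of a symmetry are forced to exchange rows and columns. -/
theorem subsingleton_symmetry : Subsingleton (Symmetry M) :=
  ⟨fun S S' => Symmetry.ext (funext fun x => funext fun y =>
    (Symmetry.braid_eq S x y).trans (Symmetry.braid_eq S' x y).symm)⟩

/-- The exchange of rows and columns satisfies every axiom of a symmetry except the one on Gray
cells, which says that the system is symmetric. -/
theorem nonempty_symmetry_iff :
    Nonempty (Symmetry M) ↔ M.toMagmalCommutativity.system.IsSymmetric := by
  refine Iff.trans ?_ M.unital.isSymmetric_iff.symm
  constructor
  · rintro ⟨S⟩ x x' y y' f g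
    have := S.nat_sigma f g
    rw [Symmetry.braid_eq, Symmetry.braid_eq] at this
    exact this
  · intro h
    exact ⟨{
      braid := fun x y => (M.unital.flip x y).hom
      tight_braid := fun x y => (M.unital.flip x y).inert_hom
      braid_braid := fun x y => M.unital.flip_flip x y
      nat_left := fun s y => M.unital.flip_cellL s y
      nat_right := fun x _ _ s => M.unital.flip_cellR x s
      nat_sigma := fun f g => h f g
      unit := fun x => M.unital.flip_unit x
      hexagon := fun x y t => M.flip_hexagon x y t }⟩

end Commutativity

/-! ### Iterated powers as arrays -/

section flatten

variable {C : Type u} [TwoCat.{u, v, w} C] [ChosenPowers C] {X Y : C} {m n k l r : ℕ}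

theorem flatten_proj (X : C) (i : Fin m) (j : Fin k) :
    flatten X m k ≫ proj X (m * k) (finProdFinEquiv (i, j)) =
      proj (pow X k) m i ≫ proj X k j := by
  rw [flatten, IsPower.lift_fac]
  simp only [Equiv.symm_apply_apply]

theorem unflatten_proj (X : C) (i : Fin m) (j : Fin k) :
    unflatten X m k ≫ proj (pow X k) m i ≫ proj X k j =
      proj X (m * k) (finProdFinEquiv (i, j)) := by
  rw [unflatten, ← Category.assoc, IsPower.lift_fac, IsPower.lift_fac]

theorem array_hom_ext {Z : C} {f g : Z ⟶ pow X (m * k)}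
    (h : ∀ i j, f ≫ proj X (m * k) (finProdFinEquiv (i, j)) =
      g ≫ proj X (m * k) (finProdFinEquiv (i, j))) : f = g :=
  pow_hom_ext _ fun t => by
    obtain ⟨⟨i, j⟩, rfl⟩ := finProdFinEquiv.surjective t
    exact h i j

theorem pow_pow_hom_ext {Z : C} {f g : Z ⟶ pow (pow X k) m}
    (h : ∀ i j, f ≫ proj (pow X k) m i ≫ proj X k j = g ≫ proj (pow X k) m i ≫ proj X k j) :
    f = g :=
  pow_hom_ext _ fun i => pow_hom_ext _ fun j => by
    rw [Category.assoc, Category.assoc, h]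

theorem flatten_unflatten (X : C) (m k : ℕ) : flatten X m k ≫ unflatten X m k = 𝟙 _ :=
  pow_pow_hom_ext fun i j => by rw [Category.assoc, unflatten_proj, flatten_proj, Category.id_comp]

theorem unflatten_flatten (X : C) (m k : ℕ) : unflatten X m k ≫ flatten X m k = 𝟙 _ :=
  array_hom_ext fun i j => by rw [Category.assoc, flatten_proj, unflatten_proj, Category.id_comp]

/-- The projection of an array to a row. -/
noncomputable def powRow (X : C) (m k : ℕ) (i : Fin m) : pow X (m * k) ⟶ pow X k :=
  reindex X fun j => finProdFinEquiv (i, j)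

/-- The projection of an array to a column. -/
noncomputable def powCol (X : C) (m k : ℕ) (j : Fin k) : pow X (m * k) ⟶ pow X m :=
  reindex X fun i => finProdFinEquiv (i, j)

theorem flatten_row (X : C) (i : Fin m) : flatten X m k ≫ powRow X m k i = proj (pow X k) m i :=
  pow_hom_ext _ fun j => by rw [powRow, Category.assoc, reindex_proj, flatten_proj]

theorem flatten_col (X : C) (j : Fin k) : flatten X m k ≫ powCol X m k j = powMap m (proj X k j) :=
  pow_hom_ext _ fun i => by rw [powCol, Category.assoc, reindex_proj, flatten_proj, powMap_proj]

theorem isPower_powRow (X : C) (m k : ℕ) : IsPower (powRow X m k) := by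
  have := (isPower (pow X k) m).iso_comp (unflatten_flatten X m k) (flatten_unflatten X m k)
  have e : ∀ i, unflatten X m k ≫ proj (pow X k) m i = powRow X m k i := fun i => by
    rw [← flatten_row, ← Category.assoc, unflatten_flatten, Category.id_comp]
  simpa only [e] using this

theorem isPower_powCol (X : C) (m k : ℕ) : IsPower (powCol X m k) := by
  have := (IsPower.powMap m (isPower X k)).iso_comp (unflatten_flatten X m k)
    (flatten_unflatten X m k)
  have e : ∀ j, unflatten X m k ≫ powMap m (proj X k j) = powCol X m k j := fun i => by
    rw [← flatten_col, ← Category.assoc, unflatten_flatten, Category.id_comp]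
  simpa only [e] using this

theorem powCell_flatten (s : Cell X Y) (m k : ℕ) :
    hc (powCell m (powCell k s)) (one (flatten Y m k)) =
      hc (one (flatten X m k)) (powCell (m * k) s) :=
  pow_cell_ext _ fun t => by
    obtain ⟨⟨i, j⟩, rfl⟩ := finProdFinEquiv.surjective t
    rw [hc_assoc, hc_one_one, flatten_proj, hc_assoc, powCell_proj, hc_one_hc, flatten_proj,
      one_comp, ← hc_assoc, powCell_proj, hc_assoc, powCell_proj, hc_one_hc]

theorem powMap_flatten (f : X ⟶ Y) (m k : ℕ) :
    powMap m (powMap k f) ≫ flatten Y m k = flatten X m k ≫ powMap (m * k) f :=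
  one_injective (by simpa only [powCell_one, hc_one_one] using powCell_flatten (one f) m k)

/-- A cell between arrays as a cell between iterated powers. -/
noncomputable def fold (s : Cell (pow X (m * k)) (pow Y (n * l))) :
    Cell (pow (pow X k) m) (pow (pow Y l) n) :=
  hc (one (flatten X m k)) (hc s (one (unflatten Y n l)))

theorem fold_flatten (s : Cell (pow X (m * k)) (pow Y (n * l))) :
    hc (fold s) (one (flatten Y n l)) = hc (one (flatten X m k)) s := by
  rw [fold, hc_assoc, hc_assoc, hc_one_one, unflatten_flatten, hc_id]

theorem eq_fold {s : Cell (pow X (m * k)) (pow Y (n * l))}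
    {t : Cell (pow (pow X k) m) (pow (pow Y l) n)}
    (h : hc t (one (flatten Y n l)) = hc (one (flatten X m k)) s) : t = fold s := by
  rw [fold, ← hc_assoc, ← h, hc_assoc, hc_one_one, flatten_unflatten, hc_id]

theorem fold_injective {s t : Cell (pow X (m * k)) (pow Y (n * l))} (h : fold s = fold t) :
    s = t := by
  have := congrArg (fun c => hc (one (unflatten X m k)) (hc c (one (flatten Y n l)))) h
  simpa only [fold_flatten, hc_one_hc, unflatten_flatten, id_hc] using this

theorem exists_fold (t : Cell (pow (pow X k) m) (pow (pow Y l) n)) :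
    ∃ s : Cell (pow X (m * k)) (pow Y (n * l)), t = fold s :=
  ⟨hc (one (unflatten X m k)) (hc t (one (flatten Y n l))), eq_fold (by
    rw [hc_one_hc, flatten_unflatten, id_hc])⟩

theorem pastes_fold {z : Weakness} {a b c : Cell (pow X (m * k)) (pow Y (n * l))} :
    Pastes z (fold a) (fold b) (fold c) ↔ Pastes z a b c := by
  refine ⟨fun h => ?_, fun h => (h.whiskerRight _).whiskerLeft _⟩
  simpa only [fold_flatten, hc_one_hc, unflatten_flatten, id_hc] using
    (h.whiskerRight (flatten Y n l)).whiskerLeft (unflatten X m k)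

theorem pasteEq_fold {z : Weakness} {a b c d : Cell (pow X (m * k)) (pow Y (n * l))} :
    PasteEq z (fold a) (fold b) (fold c) (fold d) ↔ PasteEq z a b c d := by
  refine ⟨fun h => ?_, fun h => (h.whiskerRight _).whiskerLeft _⟩
  simpa only [fold_flatten, hc_one_hc, unflatten_flatten, id_hc] using
    (h.whiskerRight (flatten Y n l)).whiskerLeft (unflatten X m k)

theorem isWCell_fold {z : Weakness} {a : Cell (pow X (m * k)) (pow Y (n * l))} :
    IsWCell z (fold a) ↔ IsWCell z a := by
  refine ⟨fun h => ?_, fun h =>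
    isWCell_hc z (isWCell_one z _) (isWCell_hc z h (isWCell_one z _))⟩
  have := isWCell_hc z (isWCell_one z (unflatten X m k))
    (isWCell_hc z h (isWCell_one z (flatten Y n l)))
  simpa only [fold_flatten, hc_one_hc, unflatten_flatten, id_hc] using this

theorem fold_one (f : pow X (m * k) ⟶ pow Y (n * l)) :
    fold (one f) = one (flatten X m k ≫ f ≫ unflatten Y n l) := by
  rw [fold, hc_one_one, hc_one_one]

theorem osrc_fold (z : Weakness) (s : Cell (pow X (m * k)) (pow Y (n * l))) :
    osrc z (fold s) = flatten X m k ≫ osrc z s ≫ unflatten Y n l := by simp [fold]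

theorem otgt_fold (z : Weakness) (s : Cell (pow X (m * k)) (pow Y (n * l))) :
    otgt z (fold s) = flatten X m k ≫ otgt z s ≫ unflatten Y n l := by simp [fold]

end flatten

/-! ### Models and homomorphisms on arrays -/

section models

variable {z : Weakness} {T : LawvereTwoTheory.{v₁, w₁}} {C : Type u} [TwoCat.{u, v, w} C]
  [ChosenPowers C]

namespace Model

variable {m n k l r : ℕ} {X Y Z : Model z T C}

/-- A model as a 2-functor on the Lawvere 2-theory. -/
noncomputable def toTwoFunctor (X : Model z T C) : TwoFunctor T.Ob C where
  obj x := pow X.base (Arity.card x)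
  map {x y} f := X.map (m := Arity.card x) (n := Arity.card y) f
  map_id x := by
    have h : X.map (T.inert fun i : Fin (Arity.card x) => i) = _ := X.map_inert _
    refine Eq.trans (congrArg X.map (T.inert_id (Arity.card x)).symm) (h.trans ?_)
    exact pow_hom_ext _ fun i => by rw [reindex_proj, Category.id_comp]
  map_comp f g := X.map_comp _ _
  mapCell {x y} s := X.mapCell (m := Arity.card x) (n := Arity.card y) s
  src_mapCell s := X.src_mapCell _
  tgt_mapCell s := X.tgt_mapCell _
  mapCell_one f := X.mapCell_one _
  mapCell_vc s t h := X.mapCell_vc _ _ h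
  mapCell_hc s t := X.mapCell_hc _ _

theorem pastes_mapCell (X : Model z T C) {z' : Weakness} {a b c : Cell (T.ob m) (T.ob n)}
    (h : Pastes z' a b c) : Pastes z' (X.mapCell a) (X.mapCell b) (X.mapCell c) :=
  X.toTwoFunctor.pastes h

theorem pasteEq_mapCell (X : Model z T C) {z' : Weakness} {a b c d : Cell (T.ob m) (T.ob n)}
    (h : PasteEq z' a b c d) :
    PasteEq z' (X.mapCell a) (X.mapCell b) (X.mapCell c) (X.mapCell d) :=
  X.toTwoFunctor.pasteEq h

theorem isWCell_mapCell (X : Model z T C) {z' : Weakness} {a : Cell (T.ob m) (T.ob n)}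
    (h : IsWCell z' a) : IsWCell z' (X.mapCell a) := X.toTwoFunctor.isWCell z' h

theorem map_row (X : Model z T C) (i : Fin m) : X.map (T.row m k i) = powRow X.base m k i :=
  X.map_inert _

theorem map_col (X : Model z T C) (j : Fin k) : X.map (T.col m k j) = powCol X.base m k j :=
  X.map_inert _

/-- The operation `α` on the `k`-th power of a model. -/
noncomputable def powerMap (X : Model z T C) (k : ℕ) (α : T.ob m ⟶ T.ob n) :
    pow (pow X.base k) m ⟶ pow (pow X.base k) n := (X.power k).map α

/-- The 2-cell `s` on the `k`-th power of a model. -/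
noncomputable def powerCell (X : Model z T C) (k : ℕ) (s : Cell (T.ob m) (T.ob n)) :
    Cell (pow (pow X.base k) m) (pow (pow X.base k) n) := (X.power k).mapCell s

theorem powerCell_one (X : Model z T C) (k : ℕ) (α : T.ob m ⟶ T.ob n) :
    X.powerCell k (one α) = one (X.powerMap k α) := (X.power k).mapCell_one α

theorem powerCell_proj (X : Model z T C) (s : Cell (T.ob m) (T.ob n)) (j : Fin k) :
    hc (X.powerCell k s) (one (powMap n (proj X.base k j))) =
      hc (one (powMap m (proj X.base k j))) (X.mapCell s) :=
  IsPower.liftCell_fac ((isPower X.base k).powMap n) _ j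

theorem mapCell_rowCell (X : Model z T C) (m : ℕ) (s : Cell (T.ob k) (T.ob l)) :
    hc (powCell m (X.mapCell s)) (one (flatten X.base m l)) =
      hc (one (flatten X.base m k)) (X.mapCell (T.rowCell m s)) :=
  (isPower_powRow X.base m l).cell_ext fun i => by
    rw [hc_assoc, hc_one_one, flatten_row, powCell_proj, hc_assoc, ← X.map_row, ← X.mapCell_one,
      ← X.mapCell_hc, rowCell_row, X.mapCell_hc, X.mapCell_one, X.map_row, hc_one_hc, flatten_row]

theorem mapCell_colCell (X : Model z T C) (s : Cell (T.ob m) (T.ob n)) (k : ℕ) :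
    hc (X.powerCell k s) (one (flatten X.base n k)) =
      hc (one (flatten X.base m k)) (X.mapCell (T.colCell s k)) :=
  (isPower_powCol X.base n k).cell_ext fun j => by
    rw [hc_assoc, hc_one_one, flatten_col, powerCell_proj, hc_assoc, ← X.map_col, ← X.mapCell_one,
      ← X.mapCell_hc, colCell_col, X.mapCell_hc, X.mapCell_one, X.map_col, hc_one_hc, flatten_col]

theorem map_rowMap (X : Model z T C) (m : ℕ) (β : T.ob k ⟶ T.ob l) :
    powMap m (X.map β) ≫ flatten X.base m l = flatten X.base m k ≫ X.map (T.rowMap m β) :=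
  one_injective (by
    simpa only [X.mapCell_one, powCell_one, rowCell_one, hc_one_one] using
      X.mapCell_rowCell m (one β))

theorem map_colMap (X : Model z T C) (α : T.ob m ⟶ T.ob n) (k : ℕ) :
    X.powerMap k α ≫ flatten X.base n k = flatten X.base m k ≫ X.map (T.colMap α k) :=
  one_injective (by
    simpa only [mapCell_one, powerCell_one, colCell_one, hc_one_one] using
      X.mapCell_colCell (one α) k)

theorem map_rowMap_unflatten (X : Model z T C) (m : ℕ) (β : T.ob k ⟶ T.ob l) :
    unflatten X.base m k ≫ powMap m (X.map β) = X.map (T.rowMap m β) ≫ unflatten X.base m l := by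
  rw [← Category.comp_id (powMap m _), ← flatten_unflatten, ← Category.assoc (powMap m _),
    map_rowMap, ← Category.assoc, ← Category.assoc, unflatten_flatten, Category.id_comp]

theorem map_colMap_unflatten (X : Model z T C) (α : T.ob m ⟶ T.ob n) (k : ℕ) :
    unflatten X.base m k ≫ X.powerMap k α = X.map (T.colMap α k) ≫ unflatten X.base n k := by
  rw [← Category.comp_id (powerMap _ _ _), ← flatten_unflatten, ← Category.assoc (powerMap _ _ _),
    map_colMap, ← Category.assoc, ← Category.assoc, unflatten_flatten, Category.id_comp]

end Model

end models

/-! ### Homomorphisms and modifications on arrays -/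

section

variable {z : Weakness} {T : LawvereTwoTheory.{v₁, w₁}} {C : Type u} [TwoCat.{u, v, w} C]
  [ChosenPowers C]

namespace Model

section whisker

variable {m n k l r : ℕ} {X Y : Model z T C} {A : C}

theorem rowMap_hc_fold (X : Model z T C) (m : ℕ) (β : T.ob k ⟶ T.ob l)
    (s : Cell (pow X.base (m * l)) (pow A (n * r))) :
    hc (one (powMap m (X.map β))) (fold s) = fold (hc (one (X.map (T.rowMap m β))) s) :=
  eq_fold (by rw [hc_assoc, fold_flatten, hc_one_hc, map_rowMap, hc_one_hc])

theorem fold_hc_rowMap (X : Model z T C) (n : ℕ) (β : T.ob k ⟶ T.ob l)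
    (s : Cell (pow A (m * r)) (pow X.base (n * k))) :
    hc (fold s) (one (powMap n (X.map β))) = fold (hc s (one (X.map (T.rowMap n β)))) :=
  eq_fold (by rw [hc_assoc, hc_one_one, map_rowMap, one_comp, ← hc_assoc, fold_flatten, hc_assoc])

theorem colMap_hc_fold (X : Model z T C) (α : T.ob m ⟶ T.ob n) (k : ℕ)
    (s : Cell (pow X.base (n * k)) (pow A (r * l))) :
    hc (one (X.powerMap k α)) (fold s) = fold (hc (one (X.map (T.colMap α k))) s) :=
  eq_fold (by rw [hc_assoc, fold_flatten, hc_one_hc, map_colMap, hc_one_hc])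

theorem fold_hc_colMap (X : Model z T C) (α : T.ob m ⟶ T.ob n) (k : ℕ)
    (s : Cell (pow A (r * l)) (pow X.base (m * k))) :
    hc (fold s) (one (X.powerMap k α)) = fold (hc s (one (X.map (T.colMap α k)))) :=
  eq_fold (by rw [hc_assoc, hc_one_one, map_colMap, one_comp, ← hc_assoc, fold_flatten, hc_assoc])

theorem powCell_eq_fold (X : Model z T C) (m : ℕ) (s : Cell (T.ob k) (T.ob l)) :
    powCell m (X.mapCell s) = fold (X.mapCell (T.rowCell m s)) := eq_fold (X.mapCell_rowCell m s)

theorem powerCell_eq_fold (X : Model z T C) (s : Cell (T.ob m) (T.ob n)) (k : ℕ) :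
    X.powerCell k s = fold (X.mapCell (T.colCell s k)) := eq_fold (X.mapCell_colCell s k)

theorem osrc_fold_mapCell (X : Model z T C) {α : T.ob m ⟶ T.ob n} {β : T.ob k ⟶ T.ob l}
    {s : Cell (T.ob (m * k)) (T.ob (n * l))} :
    osrc z (fold (X.mapCell s)) = powMap m (X.map β) ≫ X.powerMap l α ↔
      X.map (osrc z s) = X.map (T.rowMap m β ≫ T.colMap α l) := by
  have e : powMap m (X.map β) ≫ X.powerMap l α =
      flatten X.base m k ≫ X.map (T.rowMap m β ≫ T.colMap α l) ≫ unflatten X.base n l := by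
    rw [X.map_comp, Category.assoc, ← map_colMap_unflatten, ← Category.assoc (X.map _),
      ← map_rowMap_unflatten, Category.assoc, ← Category.assoc (flatten _ _ _), flatten_unflatten,
      Category.id_comp]
  rw [osrc_fold, osrc_mapCell, e]
  refine ⟨fun h => ?_, fun h => by rw [h]⟩
  exact one_injective (fold_injective (by rw [fold_one, fold_one, h]))

theorem otgt_fold_mapCell (X : Model z T C) {α : T.ob m ⟶ T.ob n} {β : T.ob k ⟶ T.ob l}
    {s : Cell (T.ob (m * k)) (T.ob (n * l))} :
    otgt z (fold (X.mapCell s)) = X.powerMap k α ≫ powMap n (X.map β) ↔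
      X.map (otgt z s) = X.map (T.colMap α k ≫ T.rowMap n β) := by
  have e : X.powerMap k α ≫ powMap n (X.map β) =
      flatten X.base m k ≫ X.map (T.colMap α k ≫ T.rowMap n β) ≫ unflatten X.base n l := by
    rw [X.map_comp, Category.assoc, ← map_rowMap_unflatten, ← Category.assoc (X.map _),
      ← map_colMap_unflatten, Category.assoc, ← Category.assoc (flatten _ _ _), flatten_unflatten,
      Category.id_comp]
  rw [otgt_fold, otgt_mapCell, e]
  refine ⟨fun h => ?_, fun h => by rw [h]⟩
  exact one_injective (fold_injective (by rw [fold_one, fold_one, h]))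

end whisker

section hom

variable {m n k l r : ℕ} {X Y Z : Model z T C} (f : X ⟶ Y)

theorem Hom.pastes_cell (α : T.ob m ⟶ T.ob n) (β : T.ob n ⟶ T.ob r) :
    Pastes z (hc (Hom.cell f α) (one (Y.map β))) (hc (one (X.map α)) (Hom.cell f β))
      (Hom.cell f (α ≫ β)) := by
  obtain ⟨h, e⟩ := Hom.cell_comp f α β
  exact ⟨h, e.symm⟩

theorem Hom.pasteEq_cell (s : Cell (T.ob m) (T.ob n)) :
    PasteEq z (hc (one (powMap m (Hom.base f))) (Y.mapCell s)) (Hom.cell f (otgt z s))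
      (Hom.cell f (osrc z s)) (hc (X.mapCell s) (one (powMap n (Hom.base f)))) :=
  pasteEq_iff.2 (Hom.cell_nat f s)

theorem Hom.cell_comp_inert (α : T.ob m ⟶ T.ob n) (φ : Fin r → Fin n) :
    Hom.cell f (α ≫ T.inert φ) = hc (Hom.cell f α) (one (Y.map (T.inert φ))) := by
  have h := Hom.pastes_cell f α (T.inert φ)
  rw [Hom.cell_inert, hc_one_one] at h
  exact h.unique (.one_right (by simp))

theorem Hom.cell_inert_comp (φ : Fin n → Fin m) (β : T.ob n ⟶ T.ob r) :
    Hom.cell f (T.inert φ ≫ β) = hc (one (X.map (T.inert φ))) (Hom.cell f β) := by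
  have h := Hom.pastes_cell f (T.inert φ) β
  rw [Hom.cell_inert, hc_one_one] at h
  exact h.unique (.one_left (by simpa using h.match_eq))

theorem powCell_cell_eq_fold (m : ℕ) (β : T.ob k ⟶ T.ob l) :
    powCell m (Hom.cell f β) = fold (Hom.cell f (T.rowMap m β)) :=
  eq_fold ((isPower_powRow Y.base m l).cell_ext fun i => by
    rw [hc_assoc, hc_one_one, flatten_row, powCell_proj, hc_assoc, ← Y.map_row,
      LawvereTwoTheory.row, ← Hom.cell_comp_inert, ← LawvereTwoTheory.row, rowMap_row,
      LawvereTwoTheory.row, Hom.cell_inert_comp, ← LawvereTwoTheory.row, X.map_row,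
      hc_one_hc, flatten_row])

/-- The `k`-th power of a homomorphism. -/
noncomputable def powHom (k : ℕ) : X.power k ⟶ Y.power k := powMap (C := Model z T C) k f

theorem powHom_proj (j : Fin k) : powHom f k ≫ Y.powerProj k j = X.powerProj k j ≫ f :=
  powMap_proj (C := Model z T C) k f j

theorem base_powHom (k : ℕ) : Hom.base (powHom f k) = powMap k (Hom.base f) :=
  pow_hom_ext _ fun j => (congrArg Hom.base (powHom_proj f j)).trans (powMap_proj _ _ _).symm

theorem isStrict_powerProj (X : Model z T C) (k : ℕ) (j : Fin k) : IsStrict (X.powerProj k j) :=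
  fun m n α => by
    change one _ = _
    rw [Hom.osrc_cell]; rfl

theorem IsStrict.comp_cell {p : X ⟶ Y} (hp : IsStrict p) (g : Y ⟶ Z) (α : T.ob m ⟶ T.ob n) :
    Hom.cell (p ≫ g) α = hc (one (powMap m (Hom.base p))) (Hom.cell g α) := by
  have h : Pastes z (hc (one (powMap m (Hom.base p))) (Hom.cell g α))
      (hc (Hom.cell p α) (one (powMap n (Hom.base g)))) (Hom.cell (p ≫ g) α) := .of_ovc _
  rw [hp m n α, hc_one_one] at h
  exact h.unique (.one_right (by simp))

theorem IsStrict.comp {p : X ⟶ Y} (hp : IsStrict p) {q : Y ⟶ Z} (hq : IsStrict q) :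
    IsStrict (p ≫ q) := fun m n α => by
  rw [hp.comp_cell, hq, hc_one_one, osrc_one]

theorem IsStrict.ext {p q : X ⟶ Y} (hp : IsStrict p) (hq : IsStrict q)
    (h : Hom.base p = Hom.base q) : p = q :=
  Hom.ext h (by
    funext m n α
    exact (hp m n α).trans ((congrArg one (by rw [Hom.osrc_cell, Hom.osrc_cell, h])).trans
      (hq m n α).symm))

theorem powHom_cell_eq_fold (α : T.ob m ⟶ T.ob n) (k : ℕ) :
    Hom.cell (powHom f k) α = fold (Hom.cell f (T.colMap α k)) := by
  refine eq_fold ((isPower_powCol Y.base n k).cell_ext fun j => ?_)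
  have h : hc (Hom.cell (powHom f k) α) (one (powMap n (proj Y.base k j))) =
      hc (one (powMap m (proj X.base k j))) (Hom.cell f α) := by
    refine ((isStrict_powerProj Y k j).cell_comp (powHom f k) α).symm.trans ?_
    rw [powHom_proj]
    exact (isStrict_powerProj X k j).comp_cell f α
  refine (hc_assoc _ _ _).trans ((congrArg (hc _) ((hc_one_one _ _).trans
    (congrArg one (flatten_col _ j)))).trans (h.trans ?_))
  rw [hc_assoc, ← Y.map_col, LawvereTwoTheory.col, ← Hom.cell_comp_inert, ← LawvereTwoTheory.col,
    colMap_col, LawvereTwoTheory.col, Hom.cell_inert_comp, ← LawvereTwoTheory.col, X.map_col,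
    hc_one_hc, flatten_col]

end hom

section modif

variable {X Y : Model z T C}

/-- The modification with a given underlying cell, from `f` to `g` in the sense of the
weakness. -/
def mkModif (f g : X ⟶ Y) (c : Cell X.base Y.base) (hf : osrc z c = Hom.base f)
    (hg : otgt z c = Hom.base g) (h : IsModif f g c) : Cell X Y :=
  Modif.mk (pick z f g) (pick z g f) c
    (by cases z; exacts [hf, hf, hf, hg]) (by cases z; exacts [hg, hg, hg, hf])
    (by cases z <;> exact h)

section

variable {f g : X ⟶ Y} {c : Cell X.base Y.base} (hf : osrc z c = Hom.base f)
    (hg : otgt z c = Hom.base g) (h : IsModif f g c)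

theorem osrc_mkModif : osrc z (mkModif f g c hf hg h) = f := by cases z <;> rfl

theorem otgt_mkModif : otgt z (mkModif f g c hf hg h) = g := by cases z <;> rfl

end

theorem base_osrc (z' : Weakness) (a : Cell X Y) : Hom.base (osrc z' a) = osrc z' (Modif.cell a) :=
  ((forget z T C).toTwoFunctor.osrc_mapCell z' a).symm

theorem isModif_cell (a : Cell X Y) : IsModif (osrc z a) (otgt z a) (Modif.cell a) := by
  have := Modif.isModif a
  cases z <;> exact this

theorem modif_ext {a b : Cell X Y} (h₁ : osrc z a = osrc z b) (h₂ : otgt z a = otgt z b)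
    (h : Modif.cell a = Modif.cell b) : a = b := by
  cases z
  · exact Modif.ext h₁ h₂ h
  · exact Modif.ext h₁ h₂ h
  · exact Modif.ext h₁ h₂ h
  · exact Modif.ext h₂ h₁ h

theorem pastes_of_cell {a b c : Cell X Y} (h₁ : osrc z a = osrc z c) (h₂ : otgt z a = osrc z b)
    (h₃ : otgt z b = otgt z c) (h : Pastes z (Modif.cell a) (Modif.cell b) (Modif.cell c)) :
    Pastes z a b c := by
  refine ⟨h₂, modif_ext (by rw [osrc_ovc, h₁]) (by rw [otgt_ovc, h₃]) ?_⟩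
  exact ((forget z T C).toTwoFunctor.pastes (Pastes.of_ovc h₂)).unique h

theorem pasteEq_of_cell {a b c d : Cell X Y} (h₁ : osrc z a = osrc z c) (h₂ : otgt z a = osrc z b)
    (h₃ : otgt z c = osrc z d) (h₄ : otgt z b = otgt z d)
    (h : PasteEq z (Modif.cell a) (Modif.cell b) (Modif.cell c) (Modif.cell d)) :
    PasteEq z a b c d := by
  obtain ⟨e, h, h'⟩ := h
  refine ⟨_, .of_ovc h₂, ?_⟩
  refine pastes_of_cell (by rw [osrc_ovc, h₁]) h₃ (by rw [otgt_ovc, h₄]) (h'.trans_eq ?_)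
  exact h.unique ((forget z T C).toTwoFunctor.pastes (Pastes.of_ovc h₂))

theorem isStrict_of_strict {X Y : Model .strict T C} (f : X ⟶ Y) : IsStrict f :=
  fun _ _ α => Hom.isWCell f α

/-- A modification is a `z`-cell as soon as its underlying cell is one. -/
theorem isWCell_of_cell (a : Cell X Y) (h : IsWCell z (Modif.cell a)) : IsWCell z a := by
  cases z
  · have e : Modif.src a = Modif.tgt a := (isStrict_of_strict _).ext (isStrict_of_strict _) (by
      rw [← Modif.src_cell, ← Modif.tgt_cell, h, src_one, tgt_one])
    refine Modif.ext rfl e.symm (h.trans (congrArg one (Modif.src_cell a)))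
  · obtain ⟨b, hb⟩ := h
    have hb : IsInverse (Modif.cell a) b := hb
    have sb : src b = Hom.base (Modif.tgt a) := hb.tgt_eq.symm.trans (Modif.tgt_cell a)
    have tb : tgt b = Hom.base (Modif.src a) := hb.src_eq.symm.trans (Modif.src_cell a)
    have ib : IsModif (Modif.tgt a) (Modif.src a) b := fun m n α => by
      obtain ⟨h₁, h₂, e⟩ := Modif.isModif a m n α
      have hp : ∀ r, IsInverse (powCell r (Modif.cell a)) (powCell r b) := fun r => by
        obtain ⟨k, k', e₁, e₂⟩ := hb
        refine ⟨?_, ?_, ?_, ?_⟩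
        · exact (otgt_powCell r .lax _).trans ((congrArg (powMap r) k).trans
            (osrc_powCell r .lax _).symm)
        · exact (otgt_powCell r .lax _).trans ((congrArg (powMap r) k').trans
            (osrc_powCell r .lax _).symm)
        · refine (powCell_ovc r .lax _ _ k).symm.trans ((congrArg (powCell r) e₁).trans ?_)
          exact (powCell_one r _).trans (congrArg one (osrc_powCell r .lax _).symm)
        · refine (powCell_ovc r .lax _ _ k').symm.trans ((congrArg (powCell r) e₂).trans ?_)
          exact (powCell_one r _).trans (congrArg one (osrc_powCell r .lax _).symm)
      have k : PasteEq .lax (Hom.cell (Modif.src a) α)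
          (hc (one (X.map α)) (powCell n (Modif.cell a)))
          (hc (powCell m (Modif.cell a)) (one (Y.map α))) (Hom.cell (Modif.tgt a) α) :=
        ⟨_, ⟨h₂, rfl⟩, ⟨h₁, e⟩⟩
      exact pasteEq_iff.1 (((hp n).whiskerLeft _).pasteEq ((hp m).whiskerRight _) k)
    refine ⟨⟨Modif.tgt a, Modif.src a, b, sb, tb, ib⟩, rfl, rfl, Modif.ext rfl rfl ?_,
      Modif.ext rfl rfl ?_⟩
    · exact hb.2.2.1.trans (congrArg one (Modif.src_cell a))
    · exact hb.2.2.2.trans (congrArg one sb)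
  · trivial
  · trivial

end modif

end Model

end

open Model

/-! ### The section of a coherent system -/

section

variable {z : Weakness} {T : LawvereTwoTheory.{v₁, w₁}} {C : Type u} [TwoCat.{u, v, w} C]
  [ChosenPowers C]

theorem Model.fold_mapCell_of_id (X : Model z T C) {m n k l : ℕ}
    {s : Cell (T.ob (m * k)) (T.ob (n * l))} (h : s = one (osrc z s)) :
    fold (X.mapCell s) = one (osrc z (fold (X.mapCell s))) := by
  rw [h, X.mapCell_one, fold_one, osrc_one]

theorem powMap_hc_fold {A B D : C} {m n k l : ℕ} (f : A ⟶ B)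
    (s : Cell (pow B (m * k)) (pow D (n * l))) :
    hc (one (powMap m (powMap k f))) (fold s) = fold (hc (one (powMap (m * k) f)) s) :=
  eq_fold (by rw [hc_assoc, fold_flatten, hc_one_hc, powMap_flatten, hc_one_hc])

theorem fold_hc_powMap {A B D : C} {m n k l : ℕ} (f : A ⟶ B)
    (s : Cell (pow D (m * k)) (pow A (n * l))) :
    hc (fold s) (one (powMap n (powMap l f))) = fold (hc s (one (powMap (n * l) f))) :=
  eq_fold (by rw [hc_assoc, hc_one_one, powMap_flatten, one_comp, ← hc_assoc, fold_flatten,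
    hc_assoc])

namespace CoherentSystem

variable (σ : CoherentSystem z T) {m n k l r : ℕ}

/-- The operation `β` of a model, as a homomorphism from the `k`-th to the `l`-th power of the
model. -/
noncomputable def liftOp (X : Model z T C) (β : T.ob k ⟶ T.ob l) : X.power k ⟶ X.power l :=
  { base := X.map β
    cell := fun α => fold (X.mapCell (σ.σ α β))
    osrc_cell := fun α => X.osrc_fold_mapCell.2 (congrArg X.map (σ.osrc_σ α β))
    otgt_cell := fun α => X.otgt_fold_mapCell.2 (congrArg X.map (σ.otgt_σ α β))
    isWCell := fun α => isWCell_fold.2 (X.isWCell_mapCell (σ.isWCell α β))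
    cell_inert := fun φ => X.fold_mapCell_of_id (σ.inert_left φ β)
    cell_comp := fun α γ => by
      have h := pastes_fold.2 (X.pastes_mapCell (σ.pastes_left α γ β))
      rw [X.mapCell_hc, X.mapCell_hc, X.mapCell_one, X.mapCell_one, ← fold_hc_colMap,
        ← colMap_hc_fold] at h
      obtain ⟨h, e⟩ := h
      exact ⟨h, e.symm⟩
    cell_nat := fun s => by
      have h := pasteEq_fold.2 (X.pasteEq_mapCell (pasteEq_iff.2 (σ.nat_left s β)))
      rw [X.mapCell_hc, X.mapCell_hc, X.mapCell_one, X.mapCell_one, ← fold_hc_rowMap,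
        ← rowMap_hc_fold, ← powerCell_eq_fold, ← powerCell_eq_fold] at h
      exact pasteEq_iff.1 h }

theorem isModif_liftOp (X : Model z T C) (s : Cell (T.ob k) (T.ob l)) :
    IsModif (σ.liftOp X (osrc z s)) (σ.liftOp X (otgt z s)) (X.mapCell s) := fun m n α => by
  have h := pasteEq_fold.2 (X.pasteEq_mapCell (pasteEq_iff.2 (σ.nat_right α s)))
  rw [X.mapCell_hc, X.mapCell_hc, X.mapCell_one, X.mapCell_one, ← fold_hc_colMap,
    ← colMap_hc_fold, ← powCell_eq_fold, ← powCell_eq_fold] at h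
  exact pasteEq_iff.1 h

theorem liftOp_comp (X : Model z T C) (β : T.ob k ⟶ T.ob l) (γ : T.ob l ⟶ T.ob r) :
    σ.liftOp X (β ≫ γ) = σ.liftOp X β ≫ σ.liftOp X γ :=
  Hom.ext (X.map_comp β γ) (by
    funext m n α
    have h := pastes_fold.2 (X.pastes_mapCell (σ.pastes_right α β γ))
    rw [X.mapCell_hc, X.mapCell_hc, X.mapCell_one, X.mapCell_one, ← fold_hc_rowMap,
      ← rowMap_hc_fold] at h
    exact h.unique (.of_ovc _))

theorem isStrict_liftOp_inert (X : Model z T C) (φ : Fin l → Fin k) :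
    IsStrict (σ.liftOp X (T.inert φ)) :=
  fun _ _ α => X.fold_mapCell_of_id (σ.inert_right α φ)

/-- The homomorphism `X ^ m ⟶ X ^ n` of models induced by a function. -/
noncomputable def _root_.TwoDim.Model.reindexHom (X : Model z T C) (φ : Fin n → Fin m) :
    X.power m ⟶ X.power n := reindex (C := Model z T C) X φ

theorem _root_.TwoDim.Model.reindexHom_proj (X : Model z T C) (φ : Fin n → Fin m) (i : Fin n) :
    X.reindexHom φ ≫ X.powerProj n i = X.powerProj m (φ i) :=
  reindex_proj (C := Model z T C) φ i

theorem liftOp_inert (X : Model z T C) (φ : Fin l → Fin k) :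
    σ.liftOp X (T.inert φ) = X.reindexHom φ :=
  pow_hom_ext (C := Model z T C) (X := X) l fun i => by
    refine Eq.trans ?_ (X.reindexHom_proj φ i).symm
    refine ((σ.isStrict_liftOp_inert X φ).comp (isStrict_powerProj X l i)).ext
      (isStrict_powerProj X k _) ?_
    exact (congrArg (· ≫ proj X.base l i) (X.map_inert φ)).trans (reindex_proj _ _)

/-- A 2-cell of the theory, as a modification. -/
noncomputable def liftCell (X : Model z T C) (s : Cell (T.ob k) (T.ob l)) :
    Cell (X.power k) (X.power l) :=
  mkModif (X := X.power k) (Y := X.power l) (σ.liftOp X (osrc z s)) (σ.liftOp X (otgt z s))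
    (X.mapCell s) (X.osrc_mapCell z s) (X.otgt_mapCell z s) (σ.isModif_liftOp X s)

theorem osrc_liftCell (X : Model z T C) (s : Cell (T.ob k) (T.ob l)) :
    osrc z (σ.liftCell X s) = σ.liftOp X (osrc z s) := osrc_mkModif _ _ _

theorem otgt_liftCell (X : Model z T C) (s : Cell (T.ob k) (T.ob l)) :
    otgt z (σ.liftCell X s) = σ.liftOp X (otgt z s) := otgt_mkModif _ _ _

theorem liftCell_one (X : Model z T C) (β : T.ob k ⟶ T.ob l) :
    σ.liftCell X (one β) = one (σ.liftOp X β) :=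
  modif_ext (by rw [osrc_liftCell, osrc_one, osrc_one])
    (by rw [otgt_liftCell, otgt_one, otgt_one]) (X.mapCell_one β)

theorem liftCell_hc (X : Model z T C) (s : Cell (T.ob k) (T.ob l)) (t : Cell (T.ob l) (T.ob r)) :
    σ.liftCell X (hc s t) = hc (σ.liftCell X s) (σ.liftCell X t) :=
  modif_ext
    (by rw [osrc_liftCell, osrc_hc, osrc_hc, osrc_liftCell, osrc_liftCell, liftOp_comp])
    (by rw [otgt_liftCell, otgt_hc, otgt_hc, otgt_liftCell, otgt_liftCell, liftOp_comp])
    (X.mapCell_hc s t)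

theorem src_liftCell (X : Model z T C) (s : Cell (T.ob k) (T.ob l)) :
    src (σ.liftCell X s) = σ.liftOp X (src s) := by cases z <;> rfl

theorem tgt_liftCell (X : Model z T C) (s : Cell (T.ob k) (T.ob l)) :
    tgt (σ.liftCell X s) = σ.liftOp X (tgt s) := by cases z <;> rfl

/-- The value of the section at a model. -/
noncomputable def liftObj (X : Model z T C) : Model z T (Model z T C) where
  base := X
  map β := σ.liftOp X β
  mapCell s := σ.liftCell X s
  map_inert φ := σ.liftOp_inert X φ
  map_comp β γ := σ.liftOp_comp X β γ
  src_mapCell s := σ.src_liftCell X s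
  tgt_mapCell s := σ.tgt_liftCell X s
  mapCell_one β := σ.liftCell_one X β
  mapCell_vc s t h := by
    refine Modif.ext ?_ ?_ (X.mapCell_vc s t h)
    · refine (σ.src_liftCell X _).trans (Eq.trans ?_ (σ.src_liftCell X s).symm)
      rw [src_vc]
    · refine (σ.tgt_liftCell X _).trans (Eq.trans ?_ (σ.tgt_liftCell X t).symm)
      rw [tgt_vc]
  mapCell_hc s t := σ.liftCell_hc X s t

section

variable {X Y Z : Model z T C} (f : X ⟶ Y)

/-- The cells of a homomorphism are modifications. -/
theorem isModif_liftCell (β : T.ob k ⟶ T.ob l) :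
    IsModif (powHom f k ≫ σ.liftOp Y β) (σ.liftOp X β ≫ powHom f l) (Hom.cell f β) :=
  fun m n α => by
    obtain ⟨e, h, h'⟩ := Hom.pasteEq_cell f (σ.σ α β)
    rw [σ.osrc_σ] at h'
    rw [σ.otgt_σ] at h
    have p₁ := pastes_fold.2 (Hom.pastes_cell f (T.rowMap m β) (T.colMap α l))
    have p₂ := pastes_fold.2 (Hom.pastes_cell f (T.colMap α k) (T.rowMap n β))
    have q₁ : Pastes z (fold (hc (one (powMap (m * k) (Hom.base f))) (Y.mapCell (σ.σ α β))))
        (fold (hc (Hom.cell f (T.colMap α k)) (one (Y.map (T.rowMap n β)))))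
        (Hom.cell (powHom f k ≫ σ.liftOp Y β) α) :=
      (Pastes.of_ovc _ : Pastes z (hc (one (powMap m (Hom.base (powHom f k))))
        (Hom.cell (σ.liftOp Y β) α)) _ _).congr
        ((congrArg (fun b => hc (one (powMap m b)) _) (base_powHom f k)).trans
          (powMap_hc_fold _ _))
        ((congrArg (hc · _) (powHom_cell_eq_fold f α k)).trans (Y.fold_hc_rowMap n β _))
    have q₂ : Pastes z (fold (hc (one (X.map (T.rowMap m β))) (Hom.cell f (T.colMap α l))))
        (fold (hc (X.mapCell (σ.σ α β)) (one (powMap (n * l) (Hom.base f)))))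
        (Hom.cell (σ.liftOp X β ≫ powHom f l) α) :=
      (Pastes.of_ovc _ : Pastes z (hc (one (powMap m (X.map β))) (Hom.cell (powHom f l) α))
        _ _).congr ((congrArg (hc _) (powHom_cell_eq_fold f α l)).trans
          (X.rowMap_hc_fold m β _))
        ((congrArg (fun b => hc _ (one (powMap n b))) (base_powHom f l)).trans
          (fold_hc_powMap _ _))
    have r₁ : hc (powCell m (Hom.cell f β)) (one (Y.powerMap l α)) = _ :=
      (congrArg (hc · _) (powCell_cell_eq_fold f m β)).trans (Y.fold_hc_colMap α l _)
    have r₂ : hc (one (X.powerMap k α)) (powCell n (Hom.cell f β)) = _ :=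
      (congrArg (hc _) (powCell_cell_eq_fold f n β)).trans (X.colMap_hc_fold α k _)
    exact pasteEq_iff.1 ⟨fold e,
      (p₁.assoc_right q₂ (pastes_fold.2 h')).congr r₁.symm rfl,
      (q₁.assoc_left p₂ (pastes_fold.2 h)).congr rfl r₂.symm⟩

/-- The cell of a homomorphism at `β`, as a modification. -/
noncomputable def liftHomCell (β : T.ob k ⟶ T.ob l) : Cell (X.power k) (Y.power l) :=
  mkModif (powHom f k ≫ σ.liftOp Y β) (σ.liftOp X β ≫ powHom f l) (Hom.cell f β)
    ((Hom.osrc_cell f β).trans (congrArg (· ≫ Y.map β) (base_powHom f k)).symm)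
    ((Hom.otgt_cell f β).trans (congrArg (X.map β ≫ ·) (base_powHom f l)).symm)
    (σ.isModif_liftCell f β)

theorem osrc_liftHomCell (β : T.ob k ⟶ T.ob l) :
    osrc z (σ.liftHomCell f β) = powHom f k ≫ σ.liftOp Y β := osrc_mkModif _ _ _

theorem otgt_liftHomCell (β : T.ob k ⟶ T.ob l) :
    otgt z (σ.liftHomCell f β) = σ.liftOp X β ≫ powHom f l := otgt_mkModif _ _ _

theorem powHom_reindexHom (φ : Fin l → Fin k) :
    powHom f k ≫ Y.reindexHom φ = X.reindexHom φ ≫ powHom f l :=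
  powMap_reindex (C := Model z T C) f φ

/-- The value of the section at a homomorphism. -/
noncomputable def liftHom (f : X ⟶ Y) : σ.liftObj X ⟶ σ.liftObj Y :=
  { base := f
    cell := fun β => σ.liftHomCell f β
    osrc_cell := fun β => σ.osrc_liftHomCell f β
    otgt_cell := fun β => σ.otgt_liftHomCell f β
    isWCell := fun β => isWCell_of_cell _ (Hom.isWCell f β)
    cell_inert := fun φ => modif_ext (osrc_one z _).symm
      (by
        refine Eq.trans (σ.otgt_liftHomCell f _) (Eq.trans ?_ (otgt_one z _).symm)
        refine Eq.trans ?_ (σ.osrc_liftHomCell f _).symm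
        rw [liftOp_inert, liftOp_inert, powHom_reindexHom])
      ((Hom.cell_inert f φ).trans (congrArg one (base_osrc z (σ.liftHomCell f (T.inert φ))).symm))
    cell_comp := fun {k l r} β γ => by
      have h : Pastes z (hc (σ.liftHomCell f β) (one (σ.liftOp Y γ)))
          (hc (one (σ.liftOp X β)) (σ.liftHomCell f γ)) (σ.liftHomCell f (β ≫ γ)) := by
        refine pastes_of_cell ?_ ?_ ?_ (Hom.pastes_cell f β γ)
        · rw [osrc_hc, osrc_liftHomCell, osrc_liftHomCell, osrc_one, Category.assoc, liftOp_comp]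
        · rw [otgt_hc, otgt_liftHomCell, osrc_hc, osrc_liftHomCell, osrc_one, otgt_one,
            Category.assoc]
        · rw [otgt_hc, otgt_liftHomCell, otgt_liftHomCell, otgt_one, liftOp_comp, Category.assoc]
      obtain ⟨h, e⟩ := h
      exact ⟨h, e.symm⟩
    cell_nat := fun {k l} s => by
      refine pasteEq_iff.1 (?_ : PasteEq z (hc (one (powHom f k)) (σ.liftCell Y s))
        (σ.liftHomCell f (otgt z s)) (σ.liftHomCell f (osrc z s))
        (hc (σ.liftCell X s) (one (powHom f l))))
      refine pasteEq_of_cell ?_ ?_ ?_ ?_ ?_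
      · rw [osrc_hc, osrc_one, osrc_liftCell, osrc_liftHomCell]
      · rw [otgt_hc, otgt_one, otgt_liftCell, osrc_liftHomCell]
      · rw [osrc_hc, osrc_one, osrc_liftCell, otgt_liftHomCell]
      · rw [otgt_hc, otgt_one, otgt_liftCell, otgt_liftHomCell]
      · have h := Hom.pasteEq_cell f s
        rw [← base_powHom, ← base_powHom] at h
        exact h }

theorem forget_powCell {a : Cell X Y} (k : ℕ) :
    Modif.cell (powCell (C := Model z T C) k a) = powCell k (Modif.cell a) :=
  pow_cell_ext _ fun i =>
    (congrArg Modif.cell (powCell_proj (C := Model z T C) k a i)).trans (powCell_proj _ _ _).symm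

theorem isModif_lift (a : Cell X Y) :
    IsModif (σ.liftHom (osrc z a)) (σ.liftHom (otgt z a)) a := fun k l β => by
  refine pasteEq_iff.1 (?_ : PasteEq z (hc (powCell (C := Model z T C) k a) (one (σ.liftOp Y β)))
    (σ.liftHomCell (otgt z a) β) (σ.liftHomCell (osrc z a) β)
    (hc (one (σ.liftOp X β)) (powCell (C := Model z T C) l a)))
  refine pasteEq_of_cell ?_ ?_ ?_ ?_ ?_
  · rw [osrc_hc, osrc_one, osrc_powCell, osrc_liftHomCell]; rfl
  · rw [otgt_hc, otgt_one, otgt_powCell, osrc_liftHomCell]; rfl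
  · rw [osrc_hc, osrc_one, osrc_powCell, otgt_liftHomCell]; rfl
  · rw [otgt_hc, otgt_one, otgt_powCell, otgt_liftHomCell]; rfl
  · have h := pasteEq_iff.2 (isModif_cell a k l β)
    rw [← forget_powCell, ← forget_powCell] at h
    exact h

end

end CoherentSystem

end

/-! ### Equality of 2-functors into models -/

namespace TwoFunctor

section

variable {C : Type u₁} [TwoCat.{u₁, v₁, w₁} C] {D : Type u₂} [TwoCat.{u₂, v₂, w₂} D]
  {F G : TwoFunctor C D}

theorem hext (h : ∀ X, F.obj X = G.obj X)
    (h₁ : ∀ {X Y : C} (f : X ⟶ Y), HEq (F.map f) (G.map f))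
    (h₂ : ∀ {X Y : C} (a : Cell X Y), HEq (F.mapCell a) (G.mapCell a)) : F = G := by
  obtain ⟨F, Fc, _, _, _, _, _⟩ := F
  obtain ⟨G, Gc, _, _, _, _, _⟩ := G
  obtain rfl : F = G := CategoryTheory.Functor.hext h fun _ _ => h₁
  obtain rfl : @Fc = @Gc := by
    funext X Y a
    exact eq_of_heq (h₂ a)
  rfl

theorem map_heq (h : F = G) {X Y : C} (f : X ⟶ Y) : HEq (F.map f) (G.map f) := by
  subst h; rfl

theorem mapCell_heq (h : F = G) {X Y : C} (a : Cell X Y) : HEq (F.mapCell a) (G.mapCell a) := by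
  subst h; rfl

theorem obj_eq (h : F = G) (X : C) : F.obj X = G.obj X := by
  subst h; rfl

end

end TwoFunctor

namespace Model

section

variable {z : Weakness} {T : LawvereTwoTheory.{v₁, w₁}} {C : Type u} [TwoCat.{u, v, w} C]
  [ChosenPowers C]

theorem hom_heq {X X' Y Y' : Model z T C} (hX : X = X') (hY : Y = Y') {f : X ⟶ Y} {f' : X' ⟶ Y'}
    (hb : HEq (Hom.base f) (Hom.base f'))
    (hc : ∀ {m n : ℕ} (α : T.ob m ⟶ T.ob n), HEq (Hom.cell f α) (Hom.cell f' α)) : HEq f f' := by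
  subst hX hY
  refine heq_of_eq (Hom.ext (eq_of_heq hb) ?_)
  funext m n α
  exact eq_of_heq (hc α)

theorem modif_heq {X X' Y Y' : Model z T C} (hX : X = X') (hY : Y = Y') {a : Cell X Y}
    {a' : Cell X' Y'} (hs : HEq (src a) (src a')) (ht : HEq (tgt a) (tgt a'))
    (hc : HEq (Modif.cell a) (Modif.cell a')) : HEq a a' := by
  subst hX hY
  exact heq_of_eq (Modif.ext (eq_of_heq hs) (eq_of_heq ht) (eq_of_heq hc))

theorem forget_compare (X : Model z T C) (n : ℕ) : (forget z T C).compare X n = 𝟙 _ :=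
  pow_hom_ext n fun i =>
    ((forget z T C).compare_proj X n i).trans (Category.id_comp (proj X.base n i)).symm

theorem forget_uncompare (X : Model z T C) (n : ℕ) : (forget z T C).uncompare X n = 𝟙 _ :=
  pow_hom_ext n fun i =>
    ((forget z T C).uncompare_proj X n i).trans (Category.id_comp (proj X.base n i)).symm

variable {m n k l : ℕ}

theorem forget_conj {X Y : Model z T C} (f : pow X m ⟶ pow Y n) :
    (forget z T C).conj f = Hom.base f := by
  rw [PowFunctor.conj, forget_compare, forget_uncompare]
  exact (Category.id_comp _).trans (Category.comp_id (Hom.base f))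

theorem forget_conjCell {X Y : Model z T C} (s : Cell (pow X m) (pow Y n)) :
    (forget z T C).conjCell s = Modif.cell s := by
  rw [PowFunctor.conjCell, forget_compare, forget_uncompare]
  exact (id_hc _).trans (hc_id (Modif.cell s))

/-- Homomorphisms of models in models are determined by their two underlying homomorphisms: the
first determines the 1-cell, and the second determines the structure cells. -/
theorem hom_ext_forget {A B : Model z T (Model z T C)} {f g : A ⟶ B} (h : Hom.base f = Hom.base g)
    (h' : pushHom (forget z T C) f = pushHom (forget z T C) g) : f = g := by
  refine Hom.ext h ?_
  funext m n α
  refine modif_ext ((Hom.osrc_cell f α).trans (Eq.trans ?_ (Hom.osrc_cell g α).symm))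
    ((Hom.otgt_cell f α).trans (Eq.trans ?_ (Hom.otgt_cell g α).symm)) ?_
  · rw [h]
  · rw [h]
  · have := congrArg (fun p => Hom.cell p α) h'
    exact (forget_conjCell _).symm.trans (this.trans (forget_conjCell _))

/-- The two forgetful 2-functors from models in models to models are jointly faithful. -/
theorem twoFunctor_ext_forget {E : Type u₂} [TwoCat.{u₂, v₂, w₂} E]
    {K K' : TwoFunctor E (Model z T (Model z T C))} (h : ∀ X, K.obj X = K'.obj X)
    (h₁ : K.comp (forget z T (Model z T C)).toTwoFunctor =
      K'.comp (forget z T (Model z T C)).toTwoFunctor)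
    (h₂ : K.comp (push z T (forget z T C)).toTwoFunctor =
      K'.comp (push z T (forget z T C)).toTwoFunctor) : K = K' := by
  have aux : ∀ {A A' B B' : Model z T (Model z T C)} {f : A ⟶ B} {f' : A' ⟶ B'}, A = A' → B = B' →
      HEq (Hom.base f) (Hom.base f') →
      HEq (pushHom (forget z T C) f) (pushHom (forget z T C) f') → HEq f f' := by
    rintro A _ B _ f f' rfl rfl hb hp
    exact heq_of_eq (hom_ext_forget (eq_of_heq hb) (eq_of_heq hp))
  have map : ∀ {X Y : E} (f : X ⟶ Y), HEq (K.map f) (K'.map f) := fun f =>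
    aux (h _) (h _) (TwoFunctor.map_heq h₁ f) (TwoFunctor.map_heq h₂ f)
  refine TwoFunctor.hext h map fun a => modif_heq (h _) (h _) ?_ ?_ (TwoFunctor.mapCell_heq h₁ a)
  · rw [K.src_mapCell, K'.src_mapCell]; exact map _
  · rw [K.tgt_mapCell, K'.tgt_mapCell]; exact map _

end

section push

variable {z : Weakness} {T : LawvereTwoTheory.{v₃, w₃}}
  {C : Type u₁} [TwoCat.{u₁, v₁, w₁} C] [ChosenPowers C]
  {D : Type u₂} [TwoCat.{u₂, v₂, w₂} D] [ChosenPowers D] (F : PowFunctor C D)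
  {m n k l : ℕ}

theorem isStrict_of_comp {k : ℕ} {P X Z : Model z T C} {π : Fin k → (P ⟶ X)}
    (hb : IsPower fun i => Hom.base (π i)) (hs : ∀ i, IsStrict (π i)) {p : Z ⟶ P}
    (h : ∀ i, IsStrict (p ≫ π i)) : IsStrict p := fun m n α =>
  (hb.powMap n).cell_ext fun i => by
    rw [← (hs i).cell_comp, h i m n α, (hs i).cell_comp, osrc_hc, one_comp, osrc_one]

theorem isStrict_pushHom {X Y : Model z T C} {p : X ⟶ Y} (hp : IsStrict p) :
    IsStrict (pushHom F p) := fun m n α => F.conjCell_of_id (hp m n α)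

theorem base_push_compare (X : Model z T C) (k : ℕ) :
    Hom.base ((push z T F).compare X k) = F.compare X.base k :=
  pow_hom_ext k fun i =>
    (congrArg Hom.base ((push z T F).compare_proj X k i)).trans (F.compare_proj X.base k i).symm

theorem base_push_uncompare (X : Model z T C) (k : ℕ) :
    Hom.base ((push z T F).uncompare X k) = F.uncompare X.base k :=
  (F.isPower_map X.base k).hom_ext fun i =>
    (congrArg Hom.base ((push z T F).uncompare_proj X k i)).trans
      (F.uncompare_proj X.base k i).symm

theorem isStrict_push_compare (X : Model z T C) (k : ℕ) : IsStrict ((push z T F).compare X k) :=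
  isStrict_of_comp (π := (pushObj F X).powerProj k) (isPower (F.obj X.base) k)
    (isStrict_powerProj _ k) fun i => by
      have h := (push z T F).compare_proj X k i
      have h' : IsStrict (pushHom F (X.powerProj k i)) :=
        isStrict_pushHom F (isStrict_powerProj X k i)
      exact h ▸ h'

theorem isStrict_push_uncompare (X : Model z T C) (k : ℕ) :
    IsStrict ((push z T F).uncompare X k) :=
  isStrict_of_comp (π := fun i => pushHom F (X.powerProj k i)) (F.isPower_map X.base k)
    (fun i => isStrict_pushHom F (isStrict_powerProj X k i)) fun i => by
      have h := (push z T F).uncompare_proj X k i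
      exact h ▸ isStrict_powerProj (pushObj F X) k i

theorem base_push_conj {X Y : Model z T C} (f : pow X k ⟶ pow Y l) :
    Hom.base ((push z T F).conj f) = F.conj (Hom.base f) := by
  refine (?_ : _ = Hom.base ((push z T F).uncompare X k) ≫ F.map (Hom.base f) ≫
    Hom.base ((push z T F).compare Y l)).trans ?_
  · rfl
  · rw [base_push_compare, base_push_uncompare]; rfl

theorem cell_push_conjCell {X Y : Model z T C} (s : Cell (pow X k) (pow Y l)) :
    Modif.cell ((push z T F).conjCell s) = F.conjCell (Modif.cell s) := by
  refine (?_ : _ = hc (one (Hom.base ((push z T F).uncompare X k))) (hc (F.mapCell (Modif.cell s))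
    (one (Hom.base ((push z T F).compare Y l))))).trans ?_
  · rfl
  · rw [base_push_compare, base_push_uncompare]; rfl

/-- Pushing models in models forward along `F` and forgetting the inner structure commute. -/
theorem push_push_comp_push_forget :
    (push z T (push z T F)).toTwoFunctor.comp (push z T (forget z T D)).toTwoFunctor =
      (push z T (forget z T C)).toTwoFunctor.comp (push z T F).toTwoFunctor := by
  have hconj : ∀ {X Y : Model z T C} {m n : ℕ} (f : pow X m ⟶ pow Y n),
      (forget z T D).conj ((push z T F).conj f) = F.conj ((forget z T C).conj f) := fun f =>
    (forget_conj _).trans ((base_push_conj F f).trans (congrArg F.conj (forget_conj f).symm))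
  have hcell : ∀ {X Y : Model z T C} {m n : ℕ} (s : Cell (pow X m) (pow Y n)),
      (forget z T D).conjCell ((push z T F).conjCell s) = F.conjCell ((forget z T C).conjCell s) :=
    fun s => (forget_conjCell _).trans
      ((cell_push_conjCell F s).trans (congrArg F.conjCell (forget_conjCell s).symm))
  have obj : ∀ A : Model z T (Model z T C),
      pushObj (forget z T D) (pushObj (push z T F) A) = pushObj F (pushObj (forget z T C) A) :=
    fun A => Model.ext rfl (heq_of_eq (by funext m n α; exact hconj _))
      (heq_of_eq (by funext m n s; exact hcell _))
  have map : ∀ {A B : Model z T (Model z T C)} (f : A ⟶ B),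
      HEq (pushHom (forget z T D) (pushHom (push z T F) f))
        (pushHom F (pushHom (forget z T C) f)) :=
    fun f => hom_heq (obj _) (obj _) HEq.rfl fun α => heq_of_eq (hcell _)
  exact TwoFunctor.hext obj map fun a => modif_heq (obj _) (obj _) (map _) (map _) HEq.rfl

end push

end Model

namespace PowFunctor

section

variable {C : Type u₁} [TwoCat.{u₁, v₁, w₁} C] [ChosenPowers C]
  {D : Type u₂} [TwoCat.{u₂, v₂, w₂} D] [ChosenPowers D] (F : PowFunctor C D)
  {m n k l : ℕ}

theorem compare_flatten (X : C) (n l : ℕ) :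
    F.compare (pow X l) n ≫ powMap n (F.compare X l) ≫ flatten (F.obj X) n l =
      F.map (flatten X n l) ≫ F.compare X (n * l) :=
  array_hom_ext fun i j => by
    rw [Category.assoc, Category.assoc, flatten_proj, powMap_proj_comp, compare_proj,
      ← Category.assoc, compare_proj, ← F.map_comp, Category.assoc, compare_proj, ← F.map_comp,
      flatten_proj]

theorem uncompare_flatten (X : C) (m k : ℕ) :
    powMap m (F.uncompare X k) ≫ F.uncompare (pow X k) m ≫ F.map (flatten X m k) =
      flatten (F.obj X) m k ≫ F.uncompare X (m * k) :=
  (F.isPower_map X (m * k)).hom_ext fun t => by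
    obtain ⟨⟨i, j⟩, rfl⟩ := finProdFinEquiv.surjective t
    rw [Category.assoc, Category.assoc, Category.assoc, uncompare_proj, ← F.map_comp, flatten_proj,
      flatten_proj, F.map_comp, ← Category.assoc (F.uncompare _ _), uncompare_proj,
      powMap_proj_comp, uncompare_proj]

theorem conjCell_fold {X Y : C} (s : Cell (pow X (m * k)) (pow Y (n * l))) :
    hc (one (powMap m (F.uncompare X k))) (hc (F.conjCell (fold s))
      (one (powMap n (F.compare Y l)))) = fold (F.conjCell s) :=
  eq_fold (by
    rw [conjCell, conjCell]
    simp only [hc_assoc]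
    rw [hc_one_one, hc_one_one, compare_flatten, one_comp, ← hc_assoc (F.mapCell _),
      ← F.mapCell_one, ← F.mapCell_hc, fold_flatten, F.mapCell_hc, F.mapCell_one, hc_assoc,
      hc_one_hc, hc_one_hc, Category.assoc, uncompare_flatten, hc_one_hc])

end

end PowFunctor

namespace CoherentSystem

section

variable {z : Weakness} {T : LawvereTwoTheory.{v₃, w₃}}
  {C : Type u₁} [TwoCat.{u₁, v₁, w₁} C] [ChosenPowers C]
  {D : Type u₂} [TwoCat.{u₂, v₂, w₂} D] [ChosenPowers D] (σ : CoherentSystem z T)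

theorem push_liftOp (F : PowFunctor C D) (X : Model z T C) {k l : ℕ} (β : T.ob k ⟶ T.ob l) :
    (push z T F).conj (X := X) (Y := X) (m := k) (n := l) (σ.liftOp X β) =
      σ.liftOp (pushObj F X) β := by
  refine Hom.ext (base_push_conj F (X := X) (Y := X) (k := k) (l := l) (σ.liftOp X β)) ?_
  funext m n α
  refine ((isStrict_push_uncompare F X k).comp_cell _ α).trans ?_
  refine (congrArg (hc _) ((isStrict_push_compare F X l).cell_comp _ α)).trans ?_
  rw [base_push_compare, base_push_uncompare]
  exact F.conjCell_fold _

theorem push_liftObj (F : PowFunctor C D) (X : Model z T C) :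
    pushObj (push z T F) (σ.liftObj X) = σ.liftObj (pushObj F X) :=
  Model.ext rfl (heq_of_eq (by funext k l β; exact σ.push_liftOp F X β)) (heq_of_eq (by
    funext k l s
    refine modif_ext ?_ ?_ (cell_push_conjCell F (X := X) (Y := X) (k := k) (l := l)
      (σ.liftCell X s))
    · exact ((push z T F).osrc_conjCell z _).trans ((congrArg _ (σ.osrc_liftCell X s)).trans
        ((σ.push_liftOp F X _).trans (σ.osrc_liftCell _ s).symm))
    · exact ((push z T F).otgt_conjCell z _).trans ((congrArg _ (σ.otgt_liftCell X s)).trans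
        ((σ.push_liftOp F X _).trans (σ.otgt_liftCell _ s).symm))))

theorem liftHom_comp {X Y Z : Model z T C} (f : X ⟶ Y) (g : Y ⟶ Z) :
    σ.liftHom (f ≫ g) = σ.liftHom f ≫ σ.liftHom g :=
  hom_ext_forget rfl (Hom.ext rfl (by
    funext m n α
    refine (forget_conjCell (X := X) (Y := Z) (m := m) (n := n) _).trans
      (Eq.trans ?_ (forget_conjCell (X := X) (Y := Z) (m := m) (n := n) _).symm)
    have h : Pastes z (hc (one (powHom f m)) (σ.liftHomCell g α))
        (hc (σ.liftHomCell f α) (one (powHom g n))) (Hom.cell (σ.liftHom f ≫ σ.liftHom g) α) :=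
      .of_ovc _
    have h' : Pastes z (hc (one (Hom.base (powHom f m))) (Hom.cell g α))
        (hc (Hom.cell f α) (one (Hom.base (powHom g n)))) _ := (forget z T C).toTwoFunctor.pastes h
    rw [base_powHom, base_powHom] at h'
    exact (Pastes.of_ovc _ : Pastes z _ _ (Hom.cell (f ≫ g) α)).unique h'))

theorem liftHom_id (X : Model z T C) : σ.liftHom (𝟙 X) = 𝟙 (σ.liftObj X) :=
  hom_ext_forget rfl (Hom.ext rfl (by
    funext m n α
    exact (forget_conjCell (X := X) (Y := X) (m := m) (n := n) _).trans
      (forget_conjCell (X := X) (Y := X) (m := m) (n := n) _).symm))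

variable (C) in
/-- The 2-functor from models to models in models given by a coherent system. -/
noncomputable def liftTwoFunctor : TwoFunctor (Model z T C) (Model z T (Model z T C)) where
  obj X := σ.liftObj X
  map f := σ.liftHom f
  map_id X := σ.liftHom_id X
  map_comp f g := σ.liftHom_comp f g
  mapCell a := ⟨σ.liftHom (src a), σ.liftHom (tgt a), a, rfl, rfl, by
    have h := σ.isModif_lift a
    cases z <;> exact h⟩
  src_mapCell _ := rfl
  tgt_mapCell _ := rfl
  mapCell_one _ := rfl
  mapCell_vc _ _ _ := rfl
  mapCell_hc _ _ := Modif.ext (σ.liftHom_comp _ _) (σ.liftHom_comp _ _) rfl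

variable (C) in
theorem liftTwoFunctor_comp_forget :
    (σ.liftTwoFunctor C).comp (forget z T (Model z T C)).toTwoFunctor = TwoFunctor.id _ := rfl

variable (C) in
theorem liftTwoFunctor_comp_push_forget :
    (σ.liftTwoFunctor C).comp (push z T (forget z T C)).toTwoFunctor = TwoFunctor.id _ := by
  have obj : ∀ X : Model z T C, pushObj (forget z T C) (σ.liftObj X) = X := fun X =>
    Model.ext rfl
      (heq_of_eq (by
        funext m n α
        exact forget_conj (X := X) (Y := X) (m := m) (n := n) (σ.liftOp X α)))
      (heq_of_eq (by
        funext m n s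
        exact forget_conjCell (X := X) (Y := X) (m := m) (n := n) (σ.liftCell X s)))
  have map : ∀ {X Y : Model z T C} (f : X ⟶ Y),
      HEq (pushHom (forget z T C) (σ.liftHom f)) f := fun {X Y} f =>
    hom_heq (obj X) (obj Y) HEq.rfl fun {m n} α =>
      heq_of_eq (forget_conjCell (X := X) (Y := Y) (m := m) (n := n) (σ.liftHomCell f α))
  exact TwoFunctor.hext obj map fun a => modif_heq (obj _) (obj _) (map _) (map _) HEq.rfl

/-- Naturality in the target. On objects it is `push_liftObj`; on 1-cells and 2-cells it follows
from that of the two forgetful 2-functors, as these are jointly faithful. -/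
theorem liftTwoFunctor_natural (F : PowFunctor C D) :
    (σ.liftTwoFunctor C).comp (push z T (push z T F)).toTwoFunctor =
      (push z T F).toTwoFunctor.comp (σ.liftTwoFunctor D) := by
  refine twoFunctor_ext_forget (σ.push_liftObj F) rfl ?_
  refine (congrArg ((σ.liftTwoFunctor C).comp ·) (push_push_comp_push_forget F)).trans ?_
  refine (congrArg (TwoFunctor.comp · (push z T F).toTwoFunctor)
    (σ.liftTwoFunctor_comp_push_forget C)).trans ?_
  exact (congrArg ((push z T F).toTwoFunctor.comp ·) (σ.liftTwoFunctor_comp_push_forget D)).symm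

end

/-- The simultaneous section given by a coherent system. -/
noncomputable def toLiftSection {z : Weakness} {T : LawvereTwoTheory.{v, w}}
    (σ : CoherentSystem z T) : LiftSection.{u, v, w} z T where
  lift C := σ.liftTwoFunctor C.carrier
  natural _ _ F := σ.liftTwoFunctor_natural F
  section_inner C := σ.liftTwoFunctor_comp_push_forget C.carrier
  section_outer C := σ.liftTwoFunctor_comp_forget C.carrier

theorem toLiftSection_isGivenBy {z : Weakness} {T : LawvereTwoTheory.{v, w}}
    (σ : CoherentSystem z T) : (toLiftSection.{u} σ).IsGivenBy σ := fun _ _ _ _ _ _ _ _ => rfl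

end CoherentSystem

/-- A simultaneous section is determined by its values on objects. -/
theorem LiftSection.ext_obj {z : Weakness} {T : LawvereTwoTheory.{v, w}}
    {L L' : LiftSection.{u, v, w} z T}
    (h : ∀ (C : PowTwoCat.{u, v, w}) (X : Model z T C.carrier),
      (L.lift C).obj X = (L'.lift C).obj X) : L = L' :=
  LiftSection.ext (funext fun C => twoFunctor_ext_forget (h C)
    ((L.section_outer C).trans (L'.section_outer C).symm)
    ((L.section_inner C).trans (L'.section_inner C).symm))

/-! ### Coherent systems from models in models -/

namespace Model

section

variable {z : Weakness} {T : LawvereTwoTheory.{v₁, w₁}} {C : Type u} [TwoCat.{u, v, w} C]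
  [ChosenPowers C] {m n k l : ℕ}

theorem map_heq {X X' : Model z T C} (h : X = X') (α : T.ob m ⟶ T.ob n) :
    HEq (X.map α) (X'.map α) := by
  subst h; rfl

theorem mapCell_heq {X X' : Model z T C} (h : X = X') (s : Cell (T.ob m) (T.ob n)) :
    HEq (X.mapCell s) (X'.mapCell s) := by
  subst h; rfl

/-- A model that is bijective on 2-cells between any two arities, hence also on 1-cells. -/
def IsFull (X : Model z T C) : Prop :=
  ∀ m n : ℕ, Function.Bijective (X.mapCell : Cell (T.ob m) (T.ob n) → _)

namespace IsFull

variable {X : Model z T C} (hX : X.IsFull)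
include hX

theorem map_injective {α β : T.ob m ⟶ T.ob n} (h : X.map α = X.map β) : α = β :=
  one_injective ((hX m n).1 (by rw [X.mapCell_one, X.mapCell_one, h]))

theorem pastes {z' : Weakness} {a b c : Cell (T.ob m) (T.ob n)}
    (h : Pastes z' (X.mapCell a) (X.mapCell b) (X.mapCell c)) : Pastes z' a b c := by
  have e : otgt z' a = osrc z' b := hX.map_injective (by
    rw [← X.otgt_mapCell, ← X.osrc_mapCell, h.match_eq])
  exact ⟨e, (hX m n).1 ((X.pastes_mapCell (.of_ovc e)).unique h)⟩

theorem pasteEq {z' : Weakness} {a b c d : Cell (T.ob m) (T.ob n)}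
    (h : PasteEq z' (X.mapCell a) (X.mapCell b) (X.mapCell c) (X.mapCell d)) :
    PasteEq z' a b c d := by
  obtain ⟨e, h, h'⟩ := h
  obtain ⟨e, rfl⟩ := (hX m n).2 e
  exact ⟨e, hX.pastes h, hX.pastes h'⟩

theorem eq_one {z' : Weakness} {s : Cell (T.ob m) (T.ob n)}
    (h : X.mapCell s = one (osrc z' (X.mapCell s))) : s = one (osrc z' s) :=
  (hX m n).1 (by rw [X.mapCell_one, ← X.osrc_mapCell, ← h])

theorem isWCell {z' : Weakness} {s : Cell (T.ob m) (T.ob n)} (h : IsWCell z' (X.mapCell s)) :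
    IsWCell z' s := by
  cases z'
  · exact hX.eq_one (z' := .strict) h
  · obtain ⟨b, h₁, h₂, e₁, e₂⟩ := h
    obtain ⟨b, rfl⟩ := (hX m n).2 b
    have k₁ : tgt s = src b := hX.map_injective (by rw [← X.tgt_mapCell, ← X.src_mapCell, h₁])
    have k₂ : tgt b = src s := hX.map_injective (by rw [← X.tgt_mapCell, ← X.src_mapCell, h₂])
    refine ⟨b, k₁, k₂, (hX m n).1 ?_, (hX m n).1 ?_⟩
    · rw [X.mapCell_vc, e₁, X.mapCell_one, X.src_mapCell]
    · rw [X.mapCell_vc, e₂, X.mapCell_one, X.src_mapCell]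
  · trivial
  · trivial

end IsFull

theorem eq_one_of_fold {z' : Weakness} {X Y : C} {s : Cell (pow X (m * k)) (pow Y (n * l))}
    (h : fold s = one (osrc z' (fold s))) : s = one (osrc z' s) :=
  fold_injective (by rw [fold_one, ← osrc_fold, ← h])

theorem isStrict_reindexHom (X : Model z T C) (φ : Fin n → Fin m) : IsStrict (X.reindexHom φ) :=
  isStrict_of_comp (π := X.powerProj n) (isPower X.base n) (isStrict_powerProj X n) fun i => by
    rw [reindexHom_proj]; exact isStrict_powerProj X m _

section

variable (Y : Model z T (Model z T C))

/-- The operation `β` of a model in models, as a homomorphism of models. -/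
noncomputable def opHom (β : T.ob k ⟶ T.ob l) : Y.base.power k ⟶ Y.base.power l := Y.map β

/-- The action of a model in models on a 2-cell. -/
noncomputable def opCell (s : Cell (T.ob k) (T.ob l)) :
    Cell (Y.base.power k) (Y.base.power l) := Y.mapCell s

theorem opHom_comp {r : ℕ} (β : T.ob k ⟶ T.ob l) (γ : T.ob l ⟶ T.ob r) :
    Y.opHom (β ≫ γ) = Y.opHom β ≫ Y.opHom γ := Y.map_comp β γ

theorem opHom_inert (φ : Fin l → Fin k) : Y.opHom (T.inert φ) = Y.base.reindexHom φ :=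
  Y.map_inert φ

theorem osrc_opCell (s : Cell (T.ob k) (T.ob l)) : osrc z (Y.opCell s) = Y.opHom (osrc z s) :=
  Y.osrc_mapCell z s

theorem otgt_opCell (s : Cell (T.ob k) (T.ob l)) : otgt z (Y.opCell s) = Y.opHom (otgt z s) :=
  Y.otgt_mapCell z s

/-- The operation `α` in the inner variable and `β` in the outer variable. -/
noncomputable def opInterchange (α : T.ob m ⟶ T.ob n) (β : T.ob k ⟶ T.ob l) :
    Cell (pow (pow Y.base.base k) m) (pow (pow Y.base.base l) n) := Hom.cell (Y.opHom β) α

end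

/-- A model in models whose inner and outer models agree and are full is given by a coherent
system. -/
theorem exists_liftObj_eq (Y : Model z T (Model z T C)) (hY : Y.base.IsFull)
    (h : pushObj (forget z T C) Y = Y.base) : ∃ σ : CoherentSystem z T, Y = σ.liftObj Y.base := by
  have hm : ∀ {k l : ℕ} (β : T.ob k ⟶ T.ob l), Hom.base (Y.opHom β) = Y.base.map β :=
    fun {k l} β => (forget_conj (X := Y.base) (Y := Y.base) (m := k) (n := l) _).symm.trans
      (eq_of_heq (map_heq h β))
  have hs : ∀ {k l : ℕ} (s : Cell (T.ob k) (T.ob l)), Modif.cell (Y.opCell s) = Y.base.mapCell s :=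
    fun {k l} s => (forget_conjCell (X := Y.base) (Y := Y.base) (m := k) (n := l) _).symm.trans
      (eq_of_heq (mapCell_heq h s))
  have ex : ∀ {m n k l : ℕ} (α : T.ob m ⟶ T.ob n) (β : T.ob k ⟶ T.ob l),
      ∃ s : Cell (T.ob (m * k)) (T.ob (n * l)), Y.opInterchange α β = fold (Y.base.mapCell s) :=
    fun α β => by
      obtain ⟨t, e⟩ := exists_fold (Y.opInterchange α β)
      obtain ⟨s, rfl⟩ := (hY _ _).2 t
      exact ⟨s, e⟩
  choose σ hσ using @ex
  have comp : ∀ {A B D : Model z T C} (f : A ⟶ B) (g : B ⟶ D) {m n : ℕ} (α : T.ob m ⟶ T.ob n),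
      Pastes z (hc (one (powMap m (Hom.base f))) (Hom.cell g α))
        (hc (Hom.cell f α) (one (powMap n (Hom.base g)))) (Hom.cell (f ≫ g) α) :=
    fun _ _ _ _ _ => .of_ovc _
  obtain ⟨S, hS⟩ : ∃ S : CoherentSystem z T, ∀ {m n k l : ℕ} (α : T.ob m ⟶ T.ob n)
      (β : T.ob k ⟶ T.ob l), S.σ α β = σ α β := by
    refine ⟨{
     σ := fun α β => σ α β
     osrc_σ := fun {m n k l} α β => hY.map_injective (Y.base.osrc_fold_mapCell.1 ?_)
     otgt_σ := fun {m n k l} α β => hY.map_injective (Y.base.otgt_fold_mapCell.1 ?_)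
     isWCell := fun {m n k l} α β => hY.isWCell (isWCell_fold.1 ?_)
     inert_left := fun {m n k l} φ β => hY.eq_one (eq_one_of_fold ?_)
     inert_right := fun {m n k l} α φ => hY.eq_one (eq_one_of_fold ?_)
     comp_right := fun {m n k l r} α β γ => ?_
     comp_left := fun {m n r k l} α γ β => ?_
     nat_right := fun {m n k l} α s => pasteEq_iff.1 (hY.pasteEq (pasteEq_fold.1 ?_))
     nat_left := fun {m n k l} s β => pasteEq_iff.1 (hY.pasteEq (pasteEq_fold.1 ?_)) },
      fun α β => rfl⟩
    · rw [← hσ, ← hm]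
      exact Hom.osrc_cell (Y.opHom β) α
    · rw [← hσ, ← hm]
      exact Hom.otgt_cell (Y.opHom β) α
    · rw [← hσ]
      exact Hom.isWCell (Y.opHom β) α
    · rw [← hσ]
      exact Hom.cell_inert (Y.opHom β) φ
    · rw [← hσ, opInterchange, opHom_inert]
      exact isStrict_reindexHom Y.base φ m n α
    · have p := comp (Y.opHom β) (Y.opHom γ) α
      rw [← opHom_comp, hm, hm] at p
      have p : Pastes z (hc (one (powMap m (Y.base.map β))) (Y.opInterchange α γ))
          (hc (Y.opInterchange α β) (one (powMap n (Y.base.map γ))))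
          (Y.opInterchange α (β ≫ γ)) := p
      rw [hσ, hσ, hσ, rowMap_hc_fold, fold_hc_rowMap, ← mapCell_one, ← mapCell_one, ← mapCell_hc,
        ← mapCell_hc] at p
      obtain ⟨e, p⟩ := hY.pastes (pastes_fold.1 p)
      exact ⟨e, p.symm⟩
    · have p : Pastes z (hc (Y.opInterchange α β) (one (Y.base.powerMap l γ)))
          (hc (one (Y.base.powerMap k α)) (Y.opInterchange γ β)) (Y.opInterchange (α ≫ γ) β) :=
        Hom.pastes_cell (Y.opHom β) α γ
      rw [hσ, hσ, hσ, fold_hc_colMap, colMap_hc_fold, ← mapCell_one, ← mapCell_one, ← mapCell_hc,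
        ← mapCell_hc] at p
      obtain ⟨e, p⟩ := hY.pastes (pastes_fold.1 p)
      exact ⟨e, p.symm⟩
    · have p := pasteEq_iff.2 (isModif_cell (Y.opCell s) m n α)
      rw [hs, osrc_opCell, otgt_opCell] at p
      have p : PasteEq z (hc (powCell m (Y.base.mapCell s)) (one (Y.base.powerMap l α)))
          (Y.opInterchange α (otgt z s)) (Y.opInterchange α (osrc z s))
          (hc (one (Y.base.powerMap k α)) (powCell n (Y.base.mapCell s))) := p
      rw [hσ, hσ, powCell_eq_fold, powCell_eq_fold, fold_hc_colMap, colMap_hc_fold, ← mapCell_one,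
        ← mapCell_one, ← mapCell_hc, ← mapCell_hc] at p
      exact p
    · have p := Hom.pasteEq_cell (Y.opHom β) s
      rw [hm] at p
      have p : PasteEq z (hc (one (powMap m (Y.base.map β))) (Y.base.powerCell l s))
          (Y.opInterchange (otgt z s) β) (Y.opInterchange (osrc z s) β)
          (hc (Y.base.powerCell k s) (one (powMap n (Y.base.map β)))) := p
      rw [hσ, hσ, powerCell_eq_fold, powerCell_eq_fold, rowMap_hc_fold, fold_hc_rowMap,
        ← mapCell_one, ← mapCell_one, ← mapCell_hc, ← mapCell_hc] at p
      exact p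
  have hmap : ∀ {k l : ℕ} (β : T.ob k ⟶ T.ob l), Y.opHom β = S.liftOp Y.base β :=
    fun β => Hom.ext (hm β) (by
      funext m n α
      refine (hσ α β).trans ?_
      rw [← hS]; rfl)
  refine ⟨S, Model.ext rfl (heq_of_eq ?_) (heq_of_eq ?_)⟩
  · funext k l β
    exact hmap β
  · funext k l s
    refine modif_ext ?_ ?_ (hs s)
    · exact (Y.osrc_opCell s).trans ((hmap _).trans (S.osrc_liftCell _ s).symm)
    · exact (Y.otgt_opCell s).trans ((hmap _).trans (S.otgt_liftCell _ s).symm)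

end

end Model

/-! ### The generic model -/

/-- The theory `T` as a 2-category of arities in an arbitrary universe. -/
structure Syn (T : LawvereTwoTheory.{v, w}) : Type u where
  card : ℕ

namespace Syn

variable (T : LawvereTwoTheory.{v, w})

instance : TwoCat.{u, v, w} (Syn.{u} T) where
  Hom x y := T.ob x.card ⟶ T.ob y.card
  id x := 𝟙 (T.ob x.card)
  comp f g := f ≫ g
  id_comp f := Category.id_comp (X := T.ob _) (Y := T.ob _) f
  comp_id f := Category.comp_id (X := T.ob _) (Y := T.ob _) f
  assoc f g h := Category.assoc (W := T.ob _) (X := T.ob _) (Y := T.ob _) (Z := T.ob _) f g h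
  Cell x y := Cell (T.ob x.card) (T.ob y.card)
  src a := TwoCat.src (C := T.Ob) a
  tgt a := TwoCat.tgt (C := T.Ob) a
  one f := TwoCat.one (C := T.Ob) f
  vc a b h := TwoCat.vc (C := T.Ob) a b h
  hc a b := TwoCat.hc (C := T.Ob) a b
  src_one f := TwoCat.src_one (C := T.Ob) f
  tgt_one f := TwoCat.tgt_one (C := T.Ob) f
  src_vc a b h := TwoCat.src_vc (C := T.Ob) a b h
  tgt_vc a b h := TwoCat.tgt_vc (C := T.Ob) a b h
  src_hc a b := TwoCat.src_hc (C := T.Ob) a b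
  tgt_hc a b := TwoCat.tgt_hc (C := T.Ob) a b
  one_vc a := TwoCat.one_vc (C := T.Ob) a
  vc_one a := TwoCat.vc_one (C := T.Ob) a
  vc_assoc a b c h k := TwoCat.vc_assoc (C := T.Ob) a b c h k
  one_comp f g := TwoCat.one_comp (C := T.Ob) f g
  id_hc a := TwoCat.id_hc (C := T.Ob) a
  hc_id a := TwoCat.hc_id (C := T.Ob) a
  hc_assoc a b c := TwoCat.hc_assoc (C := T.Ob) a b c
  interchange a a' b b' h k := TwoCat.interchange (C := T.Ob) a a' b b' h k

/-- The arity of the `n`-th power of the arity `c`; the case `c = 1` is kept apart so that the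
`n`-th power of `1` is `n` on the nose. -/
def powCard : ℕ → ℕ → ℕ
  | 0, n => n * 0
  | 1, n => n
  | c + 2, n => n * (c + 2)

/-- The projections of the powers of an arity: to the rows, or to the entries if it is `1`. -/
def powProj : ∀ c n : ℕ, Fin n → (T.ob (powCard c n) ⟶ T.ob c)
  | 0, n, i => T.row n 0 i
  | 1, n, i => T.pr n i
  | c + 2, n, i => T.row n (c + 2) i

theorem isPower_powProj : ∀ c n : ℕ, IsPower (powProj T c n)
  | 0, n => T.isPower_row n 0
  | 1, n => T.isPower_pr n
  | c + 2, n => T.isPower_row n (c + 2)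

instance : ChosenPowers (Syn.{u} T) where
  pow x n := ⟨powCard x.card n⟩
  proj x n i := powProj T x.card n i
  isPower x n Z := isPower_powProj T x.card n (T.ob Z.card)

/-- The generic model of `T`: the arity `1`, with powers the arities `n`. -/
def generic (z : Weakness) : Model z T (Syn.{u} T) where
  base := ⟨1⟩
  map α := α
  mapCell s := s
  map_inert {m n} φ := pow_hom_ext (C := Syn.{u} T) (X := ⟨1⟩) n fun i => by
    refine Eq.trans ?_ (reindex_proj (C := Syn.{u} T) (X := ⟨1⟩) φ i).symm
    exact inert_pr φ i
  map_comp _ _ := rfl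
  src_mapCell _ := rfl
  tgt_mapCell _ := rfl
  mapCell_one _ := rfl
  mapCell_vc _ _ _ := rfl
  mapCell_hc _ _ := rfl

theorem isFull_generic (z : Weakness) : (generic.{u} T z).IsFull :=
  fun _ _ => Function.bijective_id

end Syn

/-! ### The 2-functor classifying a model -/

namespace Syn

section

variable {z : Weakness} {T : LawvereTwoTheory.{v₁, w₁}} {C : Type u} [TwoCat.{u, v, w} C]
  [ChosenPowers C] (X : Model z T C)

/-- The value at the arity `c` of the 2-functor classifying a model: the `c`-th power, except that
the value at `1` is the model itself. -/
def evalObj : ℕ → C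
  | 0 => pow X.base 0
  | 1 => X.base
  | c + 2 => pow X.base (c + 2)

/-- The canonical isomorphism from `evalObj` to the chosen power. -/
noncomputable def toPow : ∀ c : ℕ, evalObj X c ⟶ pow X.base c
  | 0 => 𝟙 _
  | 1 => (isPower X.base 1).lift fun _ => 𝟙 _
  | _ + 2 => 𝟙 _

/-- The inverse of `toPow`. -/
def ofPow : ∀ c : ℕ, pow X.base c ⟶ evalObj X c
  | 0 => 𝟙 _
  | 1 => proj X.base 1 0
  | _ + 2 => 𝟙 _

theorem toPow_ofPow : ∀ c : ℕ, toPow X c ≫ ofPow X c = 𝟙 _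
  | 0 => Category.id_comp _
  | 1 => IsPower.lift_fac (isPower X.base 1) _ 0
  | _ + 2 => Category.id_comp _

theorem ofPow_toPow : ∀ c : ℕ, ofPow X c ≫ toPow X c = 𝟙 _
  | 0 => Category.id_comp _
  | 1 => pow_hom_ext 1 fun i => by
    obtain rfl := Subsingleton.elim i 0
    rw [Category.assoc, Category.id_comp]
    exact (congrArg (proj X.base 1 0 ≫ ·)
      (IsPower.lift_fac (isPower X.base 1) (fun _ => 𝟙 X.base) 0)).trans (Category.comp_id _)
  | _ + 2 => Category.id_comp _

/-- The action on 2-cells of the 2-functor classifying a model. -/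
noncomputable def evalCell {c d : ℕ} (s : Cell (T.ob c) (T.ob d)) :
    Cell (evalObj X c) (evalObj X d) :=
  hc (one (toPow X c)) (hc (X.mapCell s) (one (ofPow X d)))

/-- The action on 1-cells of the 2-functor classifying a model. -/
noncomputable def evalMap {c d : ℕ} (f : T.ob c ⟶ T.ob d) : evalObj X c ⟶ evalObj X d :=
  toPow X c ≫ X.map f ≫ ofPow X d

theorem evalMap_pr (n : ℕ) (i : Fin n) :
    evalMap X (T.pr n i) = toPow X n ≫ proj X.base n i := by
  refine congrArg (toPow X n ≫ ·) ?_
  refine (congrArg (· ≫ ofPow X 1) (X.map_inert fun _ : Fin 1 => i)).trans ?_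
  exact reindex_proj _ _

theorem evalMap_row (n c : ℕ) (i : Fin n) :
    evalMap X (T.row n c i) = toPow X (n * c) ≫ powRow X.base n c i ≫ ofPow X c := by
  rw [evalMap, X.map_row]

theorem isPower_evalMap_row (n c : ℕ) : IsPower fun i => evalMap X (T.row n c i) := by
  have h := ((isPower_powRow X.base n c).comp_iso (ofPow_toPow X c) (toPow_ofPow X c)).iso_comp
    (toPow_ofPow X (n * c)) (ofPow_toPow X (n * c))
  simpa only [← evalMap_row] using h

theorem isPower_evalMap_powProj :
    ∀ c n : ℕ, IsPower fun i => evalMap X (powProj T c n i)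
  | 0, n => isPower_evalMap_row X n 0
  | 1, n => by
    have h := (isPower X.base n).iso_comp (toPow_ofPow X n) (ofPow_toPow X n)
    simp only [← evalMap_pr] at h
    exact h
  | c + 2, n => isPower_evalMap_row X n (c + 2)

theorem evalMap_comp {b c d : ℕ} (f : T.ob b ⟶ T.ob c) (g : T.ob c ⟶ T.ob d) :
    evalMap X (f ≫ g) = evalMap X f ≫ evalMap X g := by
  simp only [evalMap, X.map_comp, Category.assoc]
  rw [← Category.assoc (ofPow X c), ofPow_toPow, Category.id_comp]

/-- The 2-functor classifying a model. -/
noncomputable def eval : PowFunctor (Syn.{u} T) C where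
  obj x := evalObj X x.card
  map f := evalMap X f
  map_id x := by
    have h : X.map (𝟙 (T.ob x.card)) = 𝟙 _ := X.toTwoFunctor.map_id (T.ob x.card)
    exact (congrArg (toPow X _ ≫ · ≫ ofPow X _) h).trans
      ((congrArg _ (Category.id_comp _)).trans (toPow_ofPow X _))
  map_comp f g := evalMap_comp X f g
  mapCell s := evalCell X s
  src_mapCell s := by
    refine (src_hc _ _).trans ?_
    rw [src_one, src_hc, src_one, X.src_mapCell]; rfl
  tgt_mapCell s := by
    refine (tgt_hc _ _).trans ?_
    rw [tgt_one, tgt_hc, tgt_one, X.tgt_mapCell]; rfl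
  mapCell_one f := by
    refine (congrArg (fun s => hc _ (hc s _)) (X.mapCell_one f)).trans ?_
    rw [hc_one_one, hc_one_one]; rfl
  mapCell_vc s t h := by
    have p := ((X.pastes_mapCell (z' := .lax) ⟨h, rfl⟩).whiskerRight (ofPow X _)).whiskerLeft
      (toPow X _)
    exact p.2.symm
  mapCell_hc {x y t} a b := by
    refine (congrArg (fun s => hc _ (hc s _)) (X.mapCell_hc a b)).trans ?_
    refine Eq.trans ?_ (hc_assoc (one (toPow X x.card)) _ (evalCell X b)).symm
    refine congrArg (hc _) ?_
    rw [evalCell, hc_assoc, hc_assoc, hc_one_hc, ofPow_toPow, id_hc]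
  isPower_map x n := isPower_evalMap_powProj X x.card n

/-- The inverse comparison of `eval X` at the arity `1`. -/
noncomputable def evalUncompare (n : ℕ) : pow X.base n ⟶ evalObj X n :=
  (eval X).uncompare (⟨1⟩ : Syn.{u} T) n

/-- The comparison of `eval X` at the arity `1`. -/
noncomputable def evalCompare (n : ℕ) : evalObj X n ⟶ pow X.base n :=
  (eval X).compare (⟨1⟩ : Syn.{u} T) n

theorem evalCompare_eq (n : ℕ) : evalCompare X n = toPow X n :=
  pow_hom_ext n fun i => ((eval X).compare_proj (⟨1⟩ : Syn.{u} T) n i).trans (evalMap_pr X n i)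

theorem evalUncompare_eq (n : ℕ) : evalUncompare X n = ofPow X n := by
  have h : evalUncompare X n ≫ evalCompare X n = 𝟙 _ :=
    (eval X).uncompare_compare (⟨1⟩ : Syn.{u} T) n
  rw [evalCompare_eq] at h
  rw [← Category.comp_id (evalUncompare X n), ← toPow_ofPow, ← Category.assoc, h, Category.id_comp]

/-- Every model is the image of the generic model under the 2-functor that classifies it. -/
theorem push_generic : pushObj (eval X) (generic.{u} T z) = X := by
  refine Model.ext rfl (heq_of_eq ?_) (heq_of_eq ?_)
  · funext m n α
    have h : evalUncompare X m ≫ evalMap X α ≫ evalCompare X n = X.map α := by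
      rw [evalUncompare_eq, evalCompare_eq, evalMap, Category.assoc, Category.assoc, ofPow_toPow,
        Category.comp_id, ← Category.assoc, ofPow_toPow, Category.id_comp]
    exact h
  · funext m n s
    have h : hc (one (evalUncompare X m)) (hc (evalCell X s) (one (evalCompare X n))) =
        X.mapCell s := by
      rw [evalUncompare_eq, evalCompare_eq, evalCell, hc_assoc, hc_assoc, hc_one_one, ofPow_toPow,
        hc_id, hc_one_hc, ofPow_toPow, id_hc]
    exact h

end

end Syn

/-! ### Simultaneous sections -/

section

variable {z : Weakness} {T : LawvereTwoTheory.{v, w}}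

/-- A simultaneous section is determined by its value at the generic model. -/
theorem LiftSection.obj_eq (L : LiftSection.{u, v, w} z T) (C : PowTwoCat.{u, v, w})
    (X : Model z T C.carrier) :
    (L.lift C).obj X = pushObj (push z T (Syn.eval X))
      ((L.lift ⟨Syn.{u} T⟩).obj (Syn.generic.{u} T z)) := by
  have h := TwoFunctor.obj_eq (L.natural ⟨Syn.{u} T⟩ C (Syn.eval X)) (Syn.generic.{u} T z)
  exact (congrArg (L.lift C).obj (Syn.push_generic X)).symm.trans h.symm

/-- The value of a section at the generic model is a model in models whose two underlying models are
both the generic one. As the generic model is full, it comes from a coherent system, and naturality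
transports this to all models. -/
theorem CoherentSystem.toLiftSection_surjective :
    Function.Surjective (toLiftSection.{u} : CoherentSystem z T → LiftSection.{u, v, w} z T) := by
  intro L
  have h₁ : ((L.lift ⟨Syn.{u} T⟩).obj (Syn.generic.{u} T z)).base = Syn.generic.{u} T z :=
    TwoFunctor.obj_eq (L.section_outer ⟨Syn.{u} T⟩) _
  have h₂ : pushObj (forget z T (Syn.{u} T)) ((L.lift ⟨Syn.{u} T⟩).obj (Syn.generic.{u} T z)) =
      Syn.generic.{u} T z := TwoFunctor.obj_eq (L.section_inner ⟨Syn.{u} T⟩) _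
  obtain ⟨σ, hσ⟩ := exists_liftObj_eq _ (h₁.symm ▸ Syn.isFull_generic.{u} T z :
    IsFull (Model.base ((L.lift ⟨Syn.{u} T⟩).obj (Syn.generic.{u} T z)))) (h₂.trans h₁.symm)
  refine ⟨σ, LiftSection.ext_obj fun C X => ?_⟩
  rw [LiftSection.obj_eq, LiftSection.obj_eq L, hσ, h₁]
  rfl

/-- The generic model is full, so the system can be read off from the value of its section there. -/
theorem CoherentSystem.toLiftSection_injective :
    Function.Injective (toLiftSection.{u} : CoherentSystem z T → LiftSection.{u, v, w} z T) := by
  intro σ τ h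
  have h' : σ.liftObj (Syn.generic.{u} T z) = τ.liftObj (Syn.generic.{u} T z) :=
    congrArg (fun L => (LiftSection.lift L ⟨Syn.{u} T⟩).obj (Syn.generic.{u} T z)) h
  refine CoherentSystem.ext ?_
  funext m n k l α β
  have e : σ.liftOp (Syn.generic.{u} T z) β = τ.liftOp (Syn.generic.{u} T z) β :=
    eq_of_heq (map_heq h' β)
  have e' := congrArg (fun f => Hom.cell f α) e
  exact (Syn.isFull_generic.{u} T z _ _).1 (fold_injective e')

/-- Coherent systems are the same as simultaneous sections. -/
noncomputable def CoherentSystem.equivLiftSection :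
    CoherentSystem z T ≃ LiftSection.{u, v, w} z T :=
  Equiv.ofBijective toLiftSection.{u}
    ⟨CoherentSystem.toLiftSection_injective, CoherentSystem.toLiftSection_surjective⟩

end

end TwoDim

theorem mainTheorem3 (z : Weakness) (T : LawvereTwoTheory.{v, w}) :
    ∃ (Φ : MagmalCommutativity z T.sketch → CoherentSystem z T)
      (Ψ : CoherentSystem z T ≃ LiftSection.{u, v, w} z T),
      -- magmal commutativities, up to isomorphism, are the same as coherent systems
      (∀ M : MagmalCommutativity z T.sketch, M.Induces (Φ M)) ∧
      Function.Surjective Φ ∧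
      (∀ M N : MagmalCommutativity z T.sketch, Φ M = Φ N ↔ Nonempty (MagmalIso M N)) ∧
      -- commutativities, up to isomorphism, are the same as coherent systems
      (∀ σ : CoherentSystem z T, ∃ M : Commutativity z T.sketch,
        Φ M.toMagmalCommutativity = σ ∧ M.unit = T.ob 1 ∧
          ∀ m n : ℕ, M.mul.ob (T.ob m) (T.ob n) = T.ob (m * n)) ∧
      (∀ M N : Commutativity z T.sketch,
        Φ M.toMagmalCommutativity = Φ N.toMagmalCommutativity ↔
          Nonempty (CommutativityIso M N)) ∧
      -- symmetric commutativities
      (z = .strict ∨ z = .pseudo → ∀ M : Commutativity z T.sketch,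
        Subsingleton (Symmetry M) ∧
          (Nonempty (Symmetry M) ↔ (Φ M.toMagmalCommutativity).IsSymmetric)) ∧
      -- the bijection with simultaneous sections
      ∀ σ : CoherentSystem z T, (Ψ σ).IsGivenBy σ := by
  refine ⟨MagmalCommutativity.system, CoherentSystem.equivLiftSection, fun M => M.induces_system,
    MagmalCommutativity.system_surjective, fun M N => ⟨fun h =>
      ⟨MagmalCommutativity.isoOfSystemEq h⟩, fun ⟨e⟩ => MagmalCommutativity.system_eq_of_iso e⟩,
    fun σ => ⟨σ.commutativity, (MagmalCommutativity.induces_magmal σ).system_eq, rfl,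
      fun _ _ => rfl⟩,
    fun M N => ⟨fun h => ⟨Commutativity.isoOfSystemEq M N h⟩, fun ⟨e⟩ =>
      MagmalCommutativity.system_eq_of_iso e.toMagmalIso⟩,
    fun _ M => ⟨M.subsingleton_symmetry, M.nonempty_symmetry_iff⟩,
    fun σ => σ.toLiftSection_isGivenBy⟩
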